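/- Conventions. Let $X=(X_k)$ be a random vector of dimension $n\ge 2$ on a probability space $(\Omega,\mathbb P)$. For $\theta\in\mathbb S^{n-1}$ let $F_\theta(x)=\mathbb P\{\sum_k\theta_kX_k\le x\}$, let $\Phi$ be the standard normal distribution function, and put $\rho(F_\theta,\Phi)=\sup_x|F_\theta(x)-\Phi(x)|$, $\omega(F_\theta,\Phi)=\big(\int_{-\infty}^{\infty}(F_\theta(x)-\Phi(x))^2dx\big)^{1/2}$. $\mathbb E_\theta$ is the integral over $\mathbb S^{n-1}$ with respect to the normalized Lebesgue measure. Consider the bounds $$(A)\quad \frac{c_0}{n}\le \mathbb E_\theta\,\omega^2(F_\theta,\Phi)\le\frac{c_1}{n},$$ $$(B)\quad \frac{c_0}{(\log n)^{15/4}\sqrt n}\le \mathbb E_\theta\,\omega(F_\theta,\Phi)\le\frac{c_1}{\sqrt n},$$ $$(C)\quad \frac{c_0}{(\log n)^{4}\sqrt n}\le \mathbb E_\theta\,\rho(F_\theta,\Phi)\le\big(\mathbb E_\theta\,\rho^2(F_\theta,\Phi)\big)^{1/2}\le\frac{c_1\log n}{\sqrt n}.$$ **1.** There are absolute constants $c_0,c_1>0$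 such that (A), (B), (C) hold for each of the following systems, for all admissible dimensions $n\ge2$: - the trigonometric system ($n$ even) $X_{2k-1}(t)=\sqrt2\cos(kt)$, $X_{2k}(t)=\sqrt2\sin(kt)$, $1\le k\le n/2$, on $(-\pi,\pi)$ with the normalized Lebesgue measure; - the cosine system $X_k(t)=\sqrt2\cos(kt)$, $1\le k\le n$, on $(0,\pi)$ with the normalized Lebesgue measure; - the normalized Chebyshev polynomials $X_k(t)=\sqrt2\cos(k\arccos t)$, $1\le k\le n$, on $(-1,1)$ with the measure $\frac{dt}{\pi\sqrt{1-t^2}}$; - the Walsh system $X_\tau(t)=\prod_{k\in\tau}t_k$, $\emptyset\ne\tau\subset\{1,\dots,d\}$, on $\{-1,1\}^d$ with the normalized counting measure, where $d\ge2$ and $n=2^d-1$; - the random vector $X$ in $\mathbb R^n$ that takes each of the values $\sqrt n\,e_1,\dots,\sqrt n\,e_n$ with probability $1/n$, where $e_1,\dots,e_n$ is the canonical basis (so $F_\theta$ is the empirical distribution function of $\sqrt n\,\theta_1,\dots,\sqrt n\,\theta_n$). **2.** Let $\Psi:\mathbb R\to\mathbb R$ be 1-periodic with $\int_0^1\Psi\,dx=0$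 and $\int_0^1\Psi^2\,dx=1$, and let $X_k(t,s)=\Psi(kt+s)$, $1\le k\le n$, on $(0,1)\times(0,1)$ with the Lebesgue measure. (a) If $\Psi$ is Lipschitz, then (A), (B), (C) hold for all $n\ge2$ with constants $c_0,c_1>0$ depending on $\Psi$ only. (b) If $\Psi$ is only measurable with $\int_0^1\Psi^4\,dx\le M<\infty$, then the upper bounds in (A), (B), (C) hold for all $n\ge2$ with a constant $c_1>0$ depending on $M$ only. In all these cases $(F_\theta-\Phi)^2$ is integrable on $\mathbb R$ for every $\theta \in \mathbb S^{n-1}$, and $\omega(F_\theta,\Phi)$ and $\rho(F_\theta,\Phi)$ are square integrable over $\mathbb S^{n-1}$. **3.** For the last system in 1, $$\mathbb E_\theta\,\omega^2(F_\theta,\Phi)=\frac{7/8}{n\sqrt\pi}+O\Big(\frac1{n^2}\Big),\qquad n\ge2,$$ that is, the difference of the two sides is at most $C/n^2$ in absolute value with an absolute constant $C$. -/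

import Mathlib

open MeasureTheory ProbabilityTheory Set

namespace RandCLT

noncomputable section

/-- The normalized Lebesgue (surface) measure on the unit sphere of `ℝ^ι`. The average `E_θ` is
the integral with respect to this measure. -/
def sphereMeasure (ι : Type*) [Fintype ι] :
    Measure (Metric.sphere (0 : EuclideanSpace ℝ ι) 1) :=
  ((volume : Measure (EuclideanSpace ℝ ι)).toSphere univ)⁻¹ •
    (volume : Measure (EuclideanSpace ℝ ι)).toSphere

/-- The average `E_θ g(θ)` over the unit sphere. -/
def sphereMean {ι : Type*} [Fintype ι]
    (g : Metric.sphere (0 : EuclideanSpace ℝ ι) 1 → ℝ) : ℝ :=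
  ∫ θ, g θ ∂(sphereMeasure ι)

/-- The standard normal distribution function. -/
def Phi (x : ℝ) : ℝ := cdf (gaussianReal 0 1) x

section Distances

variable {Ω ι : Type*} [MeasurableSpace Ω] [Fintype ι]

/-- The weighted sum `S_θ = ∑ θ_k X_k`. -/
def weightedSum (X : ι → Ω → ℝ) (θ : EuclideanSpace ℝ ι) (w : Ω) : ℝ := ∑ k, θ k * X k w

/-- The distribution function `F_θ(x) = P{S_θ ≤ x}`. -/
def distFun (P : Measure Ω) (X : ι → Ω → ℝ) (θ : EuclideanSpace ℝ ι) (x : ℝ) : ℝ :=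
  P.real {w | weightedSum X θ w ≤ x}

/-- The Kolmogorov distance `ρ(F_θ, Φ)`. -/
def rho (P : Measure Ω) (X : ι → Ω → ℝ) (θ : EuclideanSpace ℝ ι) : ℝ :=
  ⨆ x : ℝ, |distFun P X θ x - Phi x|

/-- The `L²`-distance `ω(F_θ, Φ)`. -/
def omega (P : Measure Ω) (X : ι → Ω → ℝ) (θ : EuclideanSpace ℝ ι) : ℝ :=
  Real.sqrt (∫ x : ℝ, (distFun P X θ x - Phi x) ^ 2)

/-- All integrals in the bounds below are genuine: `(F_θ - Φ)²` is integrable on the line for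
every `θ`, and `ω(F_θ, Φ)`, `ρ(F_θ, Φ)` are measurable and square integrable in `θ`. -/
structure WellDefined (P : Measure Ω) (X : ι → Ω → ℝ) : Prop where
  integrable_sq : ∀ θ : Metric.sphere (0 : EuclideanSpace ℝ ι) 1,
    Integrable (fun x : ℝ => (distFun P X θ x - Phi x) ^ 2)
  memLp_omega : MemLp (fun θ : Metric.sphere (0 : EuclideanSpace ℝ ι) 1 => omega P X θ) 2
    (sphereMeasure ι)
  memLp_rho : MemLp (fun θ : Metric.sphere (0 : EuclideanSpace ℝ ι) 1 => rho P X θ) 2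
    (sphereMeasure ι)

/-- The lower bounds with constant `c`; here `n` is the dimension of the random vector. -/
structure LowerBounds (P : Measure Ω) (X : ι → Ω → ℝ) (c : ℝ) : Prop where
  mean_omega_sq : c / (Fintype.card ι : ℝ) ≤ sphereMean (ι := ι) (fun θ => omega P X θ ^ 2)
  mean_omega : c / (Real.log (Fintype.card ι : ℝ) ^ (15 / 4 : ℝ) * Real.sqrt (Fintype.card ι : ℝ)) ≤
    sphereMean (ι := ι) (fun θ => omega P X θ)
  mean_rho : c / (Real.log (Fintype.card ι : ℝ) ^ 4 * Real.sqrt (Fintype.card ι : ℝ)) ≤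
    sphereMean (ι := ι) (fun θ => rho P X θ)

/-- The upper bounds with constant `c`; here `n` is the dimension of the random vector. -/
structure UpperBounds (P : Measure Ω) (X : ι → Ω → ℝ) (c : ℝ) : Prop where
  mean_omega_sq : sphereMean (ι := ι) (fun θ => omega P X θ ^ 2) ≤ c / (Fintype.card ι : ℝ)
  mean_omega : sphereMean (ι := ι) (fun θ => omega P X θ) ≤ c / Real.sqrt (Fintype.card ι : ℝ)
  mean_rho_le : sphereMean (ι := ι) (fun θ => rho P X θ) ≤
    Real.sqrt (sphereMean (ι := ι) (fun θ => rho P X θ ^ 2))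
  sqrt_mean_rho_sq : Real.sqrt (sphereMean (ι := ι) (fun θ => rho P X θ ^ 2)) ≤
    c * Real.log (Fintype.card ι : ℝ) / Real.sqrt (Fintype.card ι : ℝ)

/-- The two-sided bounds with constants `c₀` and `c₁`. -/
structure TwoSidedBounds (P : Measure Ω) (X : ι → Ω → ℝ) (c₀ c₁ : ℝ) : Prop where
  wellDefined : WellDefined P X
  lower : LowerBounds P X c₀
  upper : UpperBounds P X c₁

end Distances

/-- The normalized Lebesgue measure on `(-π, π)`. -/
def trigMeasure : Measure ℝ := cond volume (Ioo (-Real.pi) Real.pi)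

/-- The trigonometric system. The index `j : Fin n` stands for the component number `j + 1`, so
that `j = 2k - 2` gives `√2 cos(kt)` and `j = 2k - 1` gives `√2 sin(kt)`. -/
def trigSystem (n : ℕ) (j : Fin n) (t : ℝ) : ℝ :=
  if Even (j : ℕ) then Real.sqrt 2 * Real.cos ((((j : ℕ) / 2 + 1 : ℕ) : ℝ) * t)
  else Real.sqrt 2 * Real.sin ((((j : ℕ) / 2 + 1 : ℕ) : ℝ) * t)

/-- The normalized Lebesgue measure on `(0, π)`. -/
def cosMeasure : Measure ℝ := cond volume (Ioo 0 Real.pi)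

/-- The cosine system `√2 cos(kt)`, `k = j + 1 = 1, …, n`. -/
def cosSystem (n : ℕ) (j : Fin n) (t : ℝ) : ℝ :=
  Real.sqrt 2 * Real.cos ((((j : ℕ) + 1 : ℕ) : ℝ) * t)

/-- The measure with density `1 / (π √(1 - t²))` on `(-1, 1)`. -/
def chebMeasure : Measure ℝ :=
  (volume.restrict (Ioo (-1 : ℝ) 1)).withDensity
    (fun t => ENNReal.ofReal (1 / (Real.pi * Real.sqrt (1 - t ^ 2))))

/-- The normalized Chebyshev polynomials `√2 cos(k arccos t)`, `k = j + 1 = 1, …, n`. -/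
def chebSystem (n : ℕ) (j : Fin n) (t : ℝ) : ℝ :=
  Real.sqrt 2 * Real.cos ((((j : ℕ) + 1 : ℕ) : ℝ) * Real.arccos t)

/-- The Lebesgue measure on the square `(0, 1) × (0, 1)`. -/
def squareMeasure : Measure (ℝ × ℝ) := volume.restrict (Ioo (0 : ℝ) 1 ×ˢ Ioo (0 : ℝ) 1)

/-- The system `Ψ(kt + s)`, `k = j + 1 = 1, …, n`. -/
def psiSystem (Ψ : ℝ → ℝ) (n : ℕ) (j : Fin n) (p : ℝ × ℝ) : ℝ :=
  Ψ ((((j : ℕ) + 1 : ℕ) : ℝ) * p.1 + p.2)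

/-- The normalized counting measure on the discrete cube `{-1, 1}^d`. -/
def cubeMeasure (d : ℕ) : Measure (Fin d → ℤˣ) := uniformOn univ

/-- The Walsh system `∏_{k ∈ τ} t_k`, indexed by the nonempty `τ ⊆ {1, …, d}`. -/
def walshSystem (d : ℕ) (τ : {τ : Finset (Fin d) // τ ≠ ∅}) (t : Fin d → ℤˣ) : ℝ :=
  ∏ k ∈ τ.1, (((t k : ℤˣ) : ℤ) : ℝ)

/-- The uniform distribution on the `n` indices. -/
def indexMeasure (n : ℕ) : Measure (Fin n) := uniformOn univ

/-- The random vector that takes the value `√n e_i` at the index `i`; its `k`-th coordinate. -/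
def empiricalSystem (n : ℕ) (k : Fin n) (i : Fin n) : ℝ :=
  if k = i then Real.sqrt n else 0

end

end RandCLT

/-! Put X/√n for X and let Q be its law. Orthonormality of the system makes Q isotropic, and a bound
of order n for the variance of ∑ X_k² makes |y|² equal to 1 up to an L²-error of order n^(-1/2);
this is `IsoLaw`. The uniform direction θ is traded for a standard Gaussian vector g = rθ with r
independent of θ (`map_smul_sphere_prod_radial`). Since r²/n has mean 1 and variance 2/n, the trade
costs only the change of the distances when a law is rescaled by r/√n. For Gaussian g, averages over
directions of functions of ⟨g, y⟩ are explicit.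

Upper bounds. By the energy identity (`integral_cdf_sub_sq`), ω² is a combination of mean distances;
averaged over g these become means of √(|x|²+1) and |x-y|, whose leading terms cancel, leaving
O(1/n). For ρ, a Gaussian smoothing inequality bounds the distance by the deviation of
characteristic functions (`kolDist_le_integral_charFun`). The mean square of that deviation is at
most of order min(1,t²)/n, again because the zeroth order terms cancel and the first order terms
have a small mean. Smoothing at scale n^(-1/2) and one use of Cauchy–Schwarz cost a factor log n.

Lower bounds. The distances dominate the deviation of any smooth statistic. The statistic is the
mean, under the marginal, of `testFun`, a combination of two Gaussian bumps. Its value 5 at N(0,1)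
is stationary under a change of variance, so the fluctuations of |y| and r enter only quadratically.
The covariance of the bumps in the directions u and w is a power series in ⟨u,w⟩² whose terms are
positive semidefinite kernels. Hence the second moment of the statistic is at least the square of
its mean plus a multiple of the fourth order term, which is comparable to `overlap`, the mean of
⟨x,y⟩⁴ (`exists_integral_testMean_sq_ge`). Isotropy makes the statistic Lipschitz in g with constant
O(n^(-1/2)), and the rotation of a Gaussian pair turns this into a fourth moment bound of order
n^(-2) (`integral_testMean_sub_pow_four_le`). Second and fourth moments together bound the first
absolute moment below by c/√n. This gives lower bounds for ω and ρ of order n^(-1/2), which imply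
the ones with logarithms. Small dimensions are handled by the boundedness of the support.

It remains to see that the overlap is at least c/n. Pairs of points in a strip of measure about 1/n
around the diagonal have nearly equal vectors, hence a large scalar product (`overlap_ge_of_strip`).
For the systems on an interval the strip has width of order 1/n, for the finite systems it is the
diagonal, and for Ψ(kt+s) it is thin only in t. Without a strip the upper bounds survive, which is
the case of a merely measurable Ψ.

The asymptotics for the empirical measure come from the energy identity alone. The mean of |√n θ_i -
√n θ_j| is explicit up to the mean radius. The mean of |√n θ_i - Z| is an integral of the Laplace
transform of nθ_i², which is computed up to O(n^(-2)) by expanding Gaussian integrals in the radial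
deviation. -/

namespace RandCLT

/-! ### Differences of distribution functions: Fubini, energy identity, Fourier transform. -/

/-- The distribution function of the point mass at `a`. -/
noncomputable def step (a x : ℝ) : ℝ := if a ≤ x then 1 else 0

lemma measurable_step : Measurable (fun p : ℝ × ℝ => step p.1 p.2) :=
  Measurable.ite (measurableSet_le measurable_fst measurable_snd) measurable_const measurable_const

lemma step_mem (a x : ℝ) : step a x = 0 ∨ step a x = 1 := by
  unfold step; split_ifs <;> simp

lemma step_eq_indicator (x : ℝ) : (fun a => step a x) = (Iic x).indicator 1 := by
  ext a; simp [step, indicator_apply]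

lemma integrable_step (μ : Measure ℝ) [IsProbabilityMeasure μ] (x : ℝ) :
    Integrable (fun a => step a x) μ := by
  rw [step_eq_indicator]
  exact (integrable_const (1 : ℝ)).indicator measurableSet_Iic

lemma integral_step (μ : Measure ℝ) [IsProbabilityMeasure μ] (x : ℝ) :
    ∫ a, step a x ∂μ = cdf μ x := by
  rw [step_eq_indicator, integral_indicator_one measurableSet_Iic, cdf_eq_real]

lemma step_sub_step_of_le {a b : ℝ} (h : a ≤ b) :
    (fun y => step a y - step b y) = (Ico a b).indicator 1 := by
  ext y
  by_cases h1 : a ≤ y <;> by_cases h2 : b ≤ y <;> simp [step, indicator_apply, h1, h2]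
  linarith

/-- The difference of two steps is the indicator of the interval between the jumps, signed exactly
as an oriented integral. -/
lemma integral_step_sub_smul {V : Type*} [NormedAddCommGroup V] [NormedSpace ℝ V]
    (φ : ℝ → V) (a b : ℝ) :
    ∫ y, (step a y - step b y) • φ y = ∫ y in a..b, φ y := by
  have key : ∀ a b : ℝ, a ≤ b → ∫ y, (step a y - step b y) • φ y = ∫ y in a..b, φ y := by
    intro a b h
    rw [intervalIntegral.integral_of_le h, ← integral_Ico_eq_integral_Ioc,
      ← integral_indicator measurableSet_Ico]
    congr 1
    ext y
    rw [show step a y - step b y = (Ico a b).indicator 1 y from congrFun (step_sub_step_of_le h) y]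
    by_cases hy : y ∈ Ico a b <;> simp [hy]
  rcases le_total a b with h | h
  · exact key a b h
  · rw [intervalIntegral.integral_symm, ← key b a h, ← integral_neg]
    congr 1; ext y; rw [← neg_smul]; congr 1; ring

lemma abs_step_sub (a b : ℝ) :
    (fun y => |step a y - step b y|) = (Ico (min a b) (max a b)).indicator 1 := by
  rcases le_total a b with h | h
  · ext y
    rw [show step a y - step b y = (Ico a b).indicator 1 y from congrFun (step_sub_step_of_le h) y,
      min_eq_left h, max_eq_right h]
    simp only [indicator_apply]; split_ifs <;> simp
  · ext y
    rw [abs_sub_comm, show step b y - step a y = (Ico b a).indicator 1 y from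
      congrFun (step_sub_step_of_le h) y, min_eq_right h, max_eq_left h]
    simp only [indicator_apply]; split_ifs <;> simp

lemma integrable_abs_step_sub (a b : ℝ) : Integrable (fun y => |step a y - step b y|) := by
  rw [abs_step_sub]
  refine (integrable_indicator_iff measurableSet_Ico).2 ?_
  exact integrableOn_const (C := (1 : ℝ)) (by simp) (by simp)

lemma measurable_step_sub (a b : ℝ) : Measurable (fun y => step a y - step b y) :=
  (measurable_step.comp (measurable_const.prodMk measurable_id)).sub
    (measurable_step.comp (measurable_const.prodMk measurable_id))

lemma integral_abs_step_sub (a b : ℝ) : ∫ y, |step a y - step b y| = |a - b| := by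
  rw [abs_step_sub, integral_indicator_one measurableSet_Ico, Real.volume_real_Ico_of_le min_le_max,
    max_sub_min_eq_abs']

section Pair

variable (μ ν : Measure ℝ) [IsProbabilityMeasure μ] [IsProbabilityMeasure ν]

lemma integrable_sub_prod {μ ν : Measure ℝ} [IsProbabilityMeasure μ] [IsProbabilityMeasure ν]
    (hμ : Integrable id μ) (hν : Integrable id ν) :
    Integrable (fun p : ℝ × ℝ => p.1 - p.2) (μ.prod ν) :=
  (hμ.comp_fst ν).sub (hν.comp_snd μ)

/-- A distribution function is not integrable on the line, but a difference of two steps has total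
mass |a - b|. First moments are therefore enough for Tonelli, and the interchanges for differences
of distribution functions rest on this. -/
lemma integrable_step_sub_prod {μ ν : Measure ℝ} [IsProbabilityMeasure μ] [IsProbabilityMeasure ν]
    (hμ : Integrable id μ) (hν : Integrable id ν) :
    Integrable (fun q : (ℝ × ℝ) × ℝ => step q.1.1 q.2 - step q.1.2 q.2)
      ((μ.prod ν).prod volume) := by
  have hm : Measurable (fun q : (ℝ × ℝ) × ℝ => step q.1.1 q.2 - step q.1.2 q.2) :=
    (measurable_step.comp (by fun_prop : Measurable fun q : (ℝ × ℝ) × ℝ => (q.1.1, q.2))).sub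
      (measurable_step.comp (by fun_prop : Measurable fun q : (ℝ × ℝ) × ℝ => (q.1.2, q.2)))
  rw [integrable_prod_iff hm.aestronglyMeasurable]
  refine ⟨Filter.Eventually.of_forall fun p => ?_, ?_⟩
  · exact (integrable_norm_iff (measurable_step_sub p.1 p.2).aestronglyMeasurable).1
      (integrable_abs_step_sub p.1 p.2)
  · simp only [Real.norm_eq_abs, integral_abs_step_sub]
    exact (integrable_sub_prod hμ hν).abs

lemma integral_step_sub_prod (y : ℝ) :
    ∫ p : ℝ × ℝ, (step p.1 y - step p.2 y) ∂(μ.prod ν) = cdf μ y - cdf ν y := by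
  rw [integral_sub ((integrable_step μ y).comp_fst ν) ((integrable_step ν y).comp_snd μ),
    integral_fun_fst (fun a => step a y), integral_fun_snd (fun a => step a y)]
  simp [integral_step]

lemma integrable_cdf_sub {μ ν : Measure ℝ} [IsProbabilityMeasure μ] [IsProbabilityMeasure ν]
    (hμ : Integrable id μ) (hν : Integrable id ν) :
    Integrable (fun y => cdf μ y - cdf ν y) := by
  refine (integrable_step_sub_prod hμ hν).integral_prod_right.congr ?_
  exact Filter.Eventually.of_forall fun y => integral_step_sub_prod μ ν y

/-- Integration of a bounded function against the difference of two distribution functions. -/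
lemma integral_cdf_sub_smul {V : Type*} [NormedAddCommGroup V] [NormedSpace ℝ V] [CompleteSpace V]
    {μ ν : Measure ℝ} [IsProbabilityMeasure μ] [IsProbabilityMeasure ν]
    (hμ : Integrable id μ) (hν : Integrable id ν) {φ : ℝ → V} (hφ : StronglyMeasurable φ)
    {C : ℝ} (hC : ∀ y, ‖φ y‖ ≤ C) :
    ∫ y, (cdf μ y - cdf ν y) • φ y = ∫ p : ℝ × ℝ, (∫ y in p.1..p.2, φ y) ∂(μ.prod ν) := by
  have hi : Integrable (fun q : (ℝ × ℝ) × ℝ => (step q.1.1 q.2 - step q.1.2 q.2) • φ q.2)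
      ((μ.prod ν).prod volume) := by
    refine (integrable_step_sub_prod hμ hν).smul_bdd C ?_ ?_
    · exact (hφ.comp_measurable measurable_snd).aestronglyMeasurable
    · exact Filter.Eventually.of_forall fun q => hC _
  have := integral_integral_swap (f := fun (p : ℝ × ℝ) (y : ℝ) => (step p.1 y - step p.2 y) • φ y) hi
  simp only [integral_step_sub_smul] at this
  rw [this]
  congr 1
  ext y
  rw [integral_smul_const, integral_step_sub_prod]

/-- The mean distance of two independent variables with laws `μ` and `ν`. -/
noncomputable def meanDist (μ ν : Measure ℝ) : ℝ := ∫ p : ℝ × ℝ, |p.1 - p.2| ∂(μ.prod ν)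

lemma integral_abs_step_sub_prod (y : ℝ) :
    ∫ p : ℝ × ℝ, |step p.1 y - step p.2 y| ∂(μ.prod ν) =
      cdf μ y + cdf ν y - 2 * (cdf μ y * cdf ν y) := by
  have h : ∀ p : ℝ × ℝ, |step p.1 y - step p.2 y| =
      step p.1 y + step p.2 y - 2 * (step p.1 y * step p.2 y) := by
    intro p
    rcases step_mem p.1 y with h | h <;> rcases step_mem p.2 y with h' | h' <;>
      simp [h, h'] <;> norm_num
  simp_rw [h]
  have i1 := (integrable_step μ y).comp_fst ν
  have i2 := (integrable_step ν y).comp_snd μ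
  have i3 := (integrable_step μ y).mul_prod (integrable_step ν y)
  have i12 : Integrable (fun p : ℝ × ℝ => step p.1 y + step p.2 y) (μ.prod ν) := i1.add i2
  rw [integral_sub i12 (i3.const_mul 2), integral_add i1 i2, integral_const_mul,
    integral_prod_mul (fun a => step a y) (fun a => step a y), integral_fun_fst (fun a => step a y),
    integral_fun_snd (fun a => step a y)]
  simp [integral_step]

/-- The function |1_{a ≤ y} - 1_{b ≤ y}| integrates in y to |a - b|, and its mean over an
independent pair is F + G - 2FG. -/
lemma integrable_meanDist {μ ν : Measure ℝ} [IsProbabilityMeasure μ] [IsProbabilityMeasure ν]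
    (hμ : Integrable id μ) (hν : Integrable id ν) :
    Integrable (fun y => cdf μ y + cdf ν y - 2 * (cdf μ y * cdf ν y)) ∧
    ∫ y, (cdf μ y + cdf ν y - 2 * (cdf μ y * cdf ν y)) = meanDist μ ν := by
  have hi := (integrable_step_sub_prod hμ hν).norm
  simp only [Real.norm_eq_abs] at hi
  have h1 := hi.integral_prod_right
  have h2 := integral_integral_swap
    (f := fun (p : ℝ × ℝ) (y : ℝ) => |step p.1 y - step p.2 y|) hi
  simp only [integral_abs_step_sub_prod, integral_abs_step_sub] at h1 h2
  exact ⟨h1, h2.symm⟩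

/-- The energy identity for the `L²` distance of two distribution functions. -/
lemma integral_cdf_sub_sq {μ ν : Measure ℝ} [IsProbabilityMeasure μ] [IsProbabilityMeasure ν]
    (hμ : Integrable id μ) (hν : Integrable id ν) :
    Integrable (fun y => (cdf μ y - cdf ν y) ^ 2) ∧
    ∫ y, (cdf μ y - cdf ν y) ^ 2 =
      meanDist μ ν - meanDist μ μ / 2 - meanDist ν ν / 2 := by
  obtain ⟨a1, a2⟩ := integrable_meanDist hμ hν
  obtain ⟨b1, b2⟩ := integrable_meanDist hμ hμ
  obtain ⟨c1, c2⟩ := integrable_meanDist hν hν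
  -- Polarization: (F-G)² is F + G - 2FG minus F - F² minus G - G², and each of the three is
  -- integrable by itself.
  have h : (fun y => (cdf μ y - cdf ν y) ^ 2) = fun y =>
      (cdf μ y + cdf ν y - 2 * (cdf μ y * cdf ν y)) -
      (cdf μ y + cdf μ y - 2 * (cdf μ y * cdf μ y)) / 2 -
      (cdf ν y + cdf ν y - 2 * (cdf ν y * cdf ν y)) / 2 := by
    ext y; ring
  refine ⟨?_, ?_⟩
  · rw [h]; exact (a1.sub (b1.div_const 2)).sub (c1.div_const 2)
  · have ab : Integrable (fun y => (cdf μ y + cdf ν y - 2 * (cdf μ y * cdf ν y)) -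
      (cdf μ y + cdf μ y - 2 * (cdf μ y * cdf μ y)) / 2) := a1.sub (b1.div_const 2)
    rw [h, integral_sub ab (c1.div_const 2),
      integral_sub a1 (b1.div_const 2), integral_div, integral_div, a2, b2, c2]

/-- The Fourier transform of the difference of two distribution functions. -/
lemma norm_integral_cdf_sub_mul_cexp {μ ν : Measure ℝ} [IsProbabilityMeasure μ]
    [IsProbabilityMeasure ν] (hμ : Integrable id μ) (hν : Integrable id ν) {t : ℝ} (ht : t ≠ 0) :
    ‖∫ y, (cdf μ y - cdf ν y) • Complex.exp (t * y * Complex.I)‖ =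
      ‖charFun μ t - charFun ν t‖ / |t| := by
  have hc : ∀ y : ℝ, ‖Complex.exp (t * y * Complex.I)‖ ≤ 1 := fun y => by
    rw [← Complex.ofReal_mul, Complex.norm_exp_ofReal_mul_I]
  -- After Fubini the exponential is integrated over an interval with random endpoints, which
  -- produces the difference of the characteristic functions divided by it.
  rw [integral_cdf_sub_smul hμ hν (Continuous.stronglyMeasurable (by fun_prop)) hc]
  have h1 : ∀ p : ℝ × ℝ, ∫ y in p.1..p.2, Complex.exp (t * y * Complex.I) =
      (Complex.exp (t * p.2 * Complex.I) - Complex.exp (t * p.1 * Complex.I)) / (t * Complex.I) := by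
    intro p
    have hne : (t * Complex.I : ℂ) ≠ 0 := by simp [ht]
    have := integral_exp_mul_complex (a := p.1) (b := p.2) hne
    simp only [show ∀ y : ℂ, t * Complex.I * y = t * y * Complex.I from fun y => by ring] at this
    exact this
  simp_rw [h1]
  have i : ∀ (κ : Measure ℝ) [IsProbabilityMeasure κ],
      Integrable (fun y : ℝ => Complex.exp (t * y * Complex.I)) κ := fun κ _ =>
    Integrable.of_bound (Continuous.aestronglyMeasurable (by fun_prop)) 1
      (Filter.Eventually.of_forall hc)
  rw [integral_div, integral_sub ((i ν).comp_snd μ) ((i μ).comp_fst ν),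
    integral_fun_fst (fun y : ℝ => Complex.exp (t * y * Complex.I)),
    integral_fun_snd (fun y : ℝ => Complex.exp (t * y * Complex.I))]
  simp [charFun_apply_real, norm_sub_rev]

end Pair

/-! ### Cauchy–Schwarz and the standard normal law. -/

/-- The Cauchy–Schwarz inequality for integrals. -/
lemma integral_mul_sq_le {α : Type*} [MeasurableSpace α] {μ : Measure α} {f g : α → ℝ}
    (hf : MemLp f 2 μ) (hg : MemLp g 2 μ) :
    (∫ a, f a * g a ∂μ) ^ 2 ≤ (∫ a, f a ^ 2 ∂μ) * ∫ a, g a ^ 2 ∂μ := by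
  have hff := hf.integrable_sq
  have hgg := hg.integrable_sq
  have hfg : Integrable (fun a => f a * g a) μ := hf.integrable_mul hg
  have h : ∀ t : ℝ, 0 ≤ (∫ a, g a ^ 2 ∂μ) * (t * t) + (2 * ∫ a, f a * g a ∂μ) * t +
      ∫ a, f a ^ 2 ∂μ := by
    intro t
    have e : ∫ a, (f a + t * g a) ^ 2 ∂μ = (∫ a, g a ^ 2 ∂μ) * (t * t) +
        (2 * ∫ a, f a * g a ∂μ) * t + ∫ a, f a ^ 2 ∂μ := by
      have e1 : (fun a => (f a + t * g a) ^ 2) = fun a =>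
          (t * t) * g a ^ 2 + (2 * t) * (f a * g a) + f a ^ 2 := by ext a; ring
      have i1 : Integrable (fun a => (t * t) * g a ^ 2 + (2 * t) * (f a * g a)) μ :=
        (hgg.const_mul _).add (hfg.const_mul _)
      rw [e1, integral_add i1 hff, integral_add (hgg.const_mul _) (hfg.const_mul _),
        integral_const_mul, integral_const_mul]
      ring
    rw [← e]
    exact integral_nonneg fun a => sq_nonneg _
  have := discrim_le_zero h
  rw [discrim] at this
  nlinarith

lemma abs_integral_mul_le {α : Type*} [MeasurableSpace α] {μ : Measure α} {f g : α → ℝ}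
    (hf : MemLp f 2 μ) (hg : MemLp g 2 μ) :
    |∫ a, f a * g a ∂μ| ≤ Real.sqrt (∫ a, f a ^ 2 ∂μ) * Real.sqrt (∫ a, g a ^ 2 ∂μ) := by
  rw [← Real.sqrt_mul (integral_nonneg fun a => sq_nonneg _)]
  exact Real.abs_le_sqrt (integral_mul_sq_le hf hg)

lemma sq_integral_le {α : Type*} [MeasurableSpace α] {μ : Measure α} [IsProbabilityMeasure μ]
    {f : α → ℝ} (hf : MemLp f 2 μ) : (∫ a, f a ∂μ) ^ 2 ≤ ∫ a, f a ^ 2 ∂μ := by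
  simpa using integral_mul_sq_le hf (memLp_const (1 : ℝ))

lemma integrable_id_gaussianReal (m : ℝ) (v : NNReal) : Integrable id (gaussianReal m v) :=
  (memLp_id_gaussianReal 1).integrable (by simp)

lemma integrable_sq_gaussianReal (v : NNReal) : Integrable (fun x : ℝ => x ^ 2) (gaussianReal 0 v) :=
  (memLp_id_gaussianReal (μ := 0) (v := v) 2).integrable_sq

lemma integral_sq_gaussianReal (v : NNReal) : ∫ x, x ^ 2 ∂(gaussianReal 0 v) = v := by
  have h := variance_fun_id_gaussianReal (μ := 0) (v := v)
  rw [variance_eq_integral (by fun_prop)] at h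
  simpa using h

lemma inv_sqrt_two_pi_le : (Real.sqrt (2 * Real.pi))⁻¹ ≤ 1 / 2 := by
  rw [one_div]
  apply inv_anti₀ (by norm_num)
  apply Real.le_sqrt_of_sq_le
  nlinarith [Real.pi_gt_three]

lemma gaussianPDFReal_std (x : ℝ) :
    gaussianPDFReal 0 1 x = (Real.sqrt (2 * Real.pi))⁻¹ * Real.exp (-x ^ 2 / 2) := by
  simp [gaussianPDFReal]

lemma Phi_sub (x y : ℝ) (h : x ≤ y) : Phi y - Phi x = ∫ u in x..y, gaussianPDFReal 0 1 u := by
  have h1 : Phi y - Phi x = (gaussianReal 0 1).real (Ioc x y) := by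
    unfold Phi
    rw [cdf_eq_real, cdf_eq_real, ← Iic_sdiff_Iic, measureReal_sdiff (Iic_subset_Iic.2 h)
      measurableSet_Iic]
  rw [h1, intervalIntegral.integral_of_le h, measureReal_def,
    gaussianReal_apply_eq_integral _ one_ne_zero, ENNReal.toReal_ofReal]
  exact integral_nonneg fun u => gaussianPDFReal_nonneg _ _ _

lemma Phi_sub_le (x y : ℝ) (h : x ≤ y) : Phi y - Phi x ≤ (y - x) / 2 := by
  rw [Phi_sub x y h]
  have : ∫ u in x..y, gaussianPDFReal 0 1 u ≤ ∫ u in x..y, (1 / 2 : ℝ) := by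
    apply intervalIntegral.integral_mono_on h
      ((integrable_gaussianPDFReal 0 1).intervalIntegrable) (by simp)
    intro u _
    rw [gaussianPDFReal_std]
    calc _ ≤ (Real.sqrt (2 * Real.pi))⁻¹ * 1 := by
          gcongr; rw [Real.exp_le_one_iff]; nlinarith [sq_nonneg u]
      _ ≤ _ := by linarith [inv_sqrt_two_pi_le]
  rw [intervalIntegral.integral_const, smul_eq_mul] at this
  linarith

lemma Phi_nonneg (x : ℝ) : 0 ≤ Phi x := cdf_nonneg _ _
lemma Phi_le_one (x : ℝ) : Phi x ≤ 1 := cdf_le_one _ _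
lemma monotone_Phi : Monotone Phi := monotone_cdf _

/-! ### The smoothing inequality for the Kolmogorov distance. -/

/-- The Kolmogorov distance of a measure on the line to the standard normal law. -/
noncomputable def kolDist (μ : Measure ℝ) : ℝ := ⨆ x : ℝ, |cdf μ x - Phi x|

lemma abs_cdf_sub_le_one (μ : Measure ℝ) (x : ℝ) : |cdf μ x - Phi x| ≤ 1 := by
  rw [abs_le]
  constructor <;> linarith [cdf_nonneg μ x, cdf_le_one μ x, Phi_nonneg x, Phi_le_one x]

lemma abs_cdf_sub_le_kolDist (μ : Measure ℝ) (x : ℝ) : |cdf μ x - Phi x| ≤ kolDist μ :=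
  le_ciSup (f := fun x => |cdf μ x - Phi x|)
    ⟨1, by rintro _ ⟨x, rfl⟩; exact abs_cdf_sub_le_one μ x⟩ x

lemma kolDist_nonneg (μ : Measure ℝ) : 0 ≤ kolDist μ :=
  (abs_nonneg _).trans (abs_cdf_sub_le_kolDist μ 0)

lemma kolDist_le_one (μ : Measure ℝ) : kolDist μ ≤ 1 := ciSup_le fun x => abs_cdf_sub_le_one μ x

lemma measurable_cdf_sub (μ : Measure ℝ) : Measurable fun x => cdf μ x - Phi x :=
  (monotone_cdf μ).measurable.sub (monotone_cdf _).measurable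

/-- The Kolmogorov distance is controlled by a Gaussian regularization. -/
lemma kolDist_le_of_smoothed (μ : Measure ℝ) {σ M : ℝ} (hσ : 0 < σ)
    (hM : ∀ x, |∫ u, (cdf μ (x + σ * u) - Phi (x + σ * u)) ∂(gaussianReal 0 1)| ≤ M) :
    kolDist μ ≤ 2 * M + 3 * σ := by
  have hM0 : 0 ≤ M := (abs_nonneg _).trans (hM 0)
  set ρ := kolDist μ with hρ
  have hρ0 : 0 ≤ ρ := kolDist_nonneg μ
  have hint : ∀ x, Integrable (fun u => cdf μ (x + σ * u) - Phi (x + σ * u)) (gaussianReal 0 1) :=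
    fun x => Integrable.of_bound
      ((measurable_cdf_sub μ).comp (by fun_prop : Measurable fun u : ℝ => x + σ * u)).aestronglyMeasurable
      1 (Filter.Eventually.of_forall fun u => abs_cdf_sub_le_one μ _)
  have hsq := integrable_sq_gaussianReal 1
  have hsq1 : ∫ x, x ^ 2 ∂(gaussianReal 0 1) = 1 := by simpa using integral_sq_gaussianReal 1
  have hquad : ∀ d : ℝ, Integrable (fun u : ℝ => (d - 2 * σ) - (d - 2 * σ + ρ) / 4 * u ^ 2)
      (gaussianReal 0 1) ∧ ∫ u : ℝ, ((d - 2 * σ) - (d - 2 * σ + ρ) / 4 * u ^ 2)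
      ∂(gaussianReal 0 1) = (d - 2 * σ) * (3 / 4) - ρ / 4 := by
    intro d
    refine ⟨(integrable_const _).sub (hsq.const_mul _), ?_⟩
    rw [integral_sub (integrable_const _) (hsq.const_mul _), integral_const_mul, hsq1]
    simp; ring
  -- A deviation d at x persists, up to 2σ, on a one-sided window of length 4σ, because F is
  -- monotone and Φ is 1/2-Lipschitz. Outside the window only D ≥ -ρ is known. The parabola lies
  -- below D in both cases and has an explicit Gaussian mean, which replaces a tail estimate.
  have key : ∀ d : ℝ, 2 * σ ≤ d → ∀ u : ℝ, ∀ D : ℝ, (|u| ≤ 2 → d - 2 * σ ≤ D) → -ρ ≤ D →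
      (d - 2 * σ) - (d - 2 * σ + ρ) / 4 * u ^ 2 ≤ D := by
    intro d hd u D h1 h2
    by_cases hu : |u| ≤ 2
    · have : 0 ≤ (d - 2 * σ + ρ) / 4 * u ^ 2 := by
        have : 0 ≤ d - 2 * σ + ρ := by linarith
        positivity
      linarith [h1 hu]
    · have h4 : 4 ≤ u ^ 2 := by
        rw [← sq_abs]; push Not at hu; nlinarith
      nlinarith
  -- This is 3/4 (d - 2σ) - ρ/4 ≤ M solved for d. Since the coefficient of ρ is below 1, it is
  -- absorbed after taking the supremum. The window lies to the right or left of x according to the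
  -- sign of the deviation.
  have hpt : ∀ x, |cdf μ x - Phi x| ≤ 4 / 3 * M + ρ / 3 + 2 * σ := by
    intro x
    rcases le_or_gt (|cdf μ x - Phi x|) (2 * σ) with h | h
    · linarith
    set d := |cdf μ x - Phi x| with hd
    rcases abs_cases (cdf μ x - Phi x) with ⟨h1, h2⟩ | ⟨h1, h2⟩
    · have := integral_mono (hquad d).1 (hint (x + 2 * σ)) (fun u => key d h.le u _ (fun hu => by
        rw [abs_le] at hu
        have hle : x ≤ x + 2 * σ + σ * u := by nlinarith
        have e1 := monotone_cdf μ hle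
        have e2 := Phi_sub_le _ _ hle
        have : σ * u ≤ σ * 2 := by gcongr; exact hu.2
        linarith) (neg_le_of_abs_le (abs_cdf_sub_le_kolDist μ _)))
      rw [(hquad d).2] at this
      linarith [(abs_le.1 (hM (x + 2 * σ))).2]
    · have := integral_mono (hquad d).1 (hint (x - 2 * σ)).neg (fun u => key d h.le u _ (fun hu => by
        rw [abs_le] at hu
        have hle : x - 2 * σ + σ * u ≤ x := by nlinarith
        have e1 := monotone_cdf μ hle
        have e2 := Phi_sub_le _ _ hle
        have : σ * (-2) ≤ σ * u := by gcongr; exact hu.1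
        simp only [Pi.neg_apply]
        linarith) (by
          have := (abs_le.1 (abs_cdf_sub_le_kolDist μ (x - 2 * σ + σ * u))).2
          simp only [Pi.neg_apply]; linarith))
      simp only [Pi.neg_apply] at this
      rw [(hquad d).2, integral_neg] at this
      linarith [(abs_le.1 (hM (x - 2 * σ))).1]
  have : ρ ≤ 4 / 3 * M + ρ / 3 + 2 * σ := ciSup_le hpt
  linarith

lemma integral_gaussianReal_comp_affine (f : ℝ → ℝ) (x : ℝ) {σ : ℝ} (hσ : 0 < σ) :
    ∫ u, f (x + σ * u) ∂(gaussianReal 0 1) =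
      (σ * Real.sqrt (2 * Real.pi))⁻¹ * ∫ y, f y * Real.exp (-(y - x) ^ 2 / (2 * σ ^ 2)) := by
  rw [integral_gaussianReal_eq_integral_smul one_ne_zero]
  have h1 := integral_add_left_eq_self (μ := (volume : Measure ℝ))
    (fun y => f y * Real.exp (-(y - x) ^ 2 / (2 * σ ^ 2))) x
  have h2 := Measure.integral_comp_mul_left
    (fun u => f (x + u) * Real.exp (-(x + u - x) ^ 2 / (2 * σ ^ 2))) σ
  rw [← h1]
  rw [abs_of_pos (inv_pos.2 hσ), smul_eq_mul] at h2
  have h3 : ∫ y, f (x + y) * Real.exp (-(x + y - x) ^ 2 / (2 * σ ^ 2)) =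
      σ * ∫ u, f (x + σ * u) * Real.exp (-(x + σ * u - x) ^ 2 / (2 * σ ^ 2)) := by
    rw [h2]; field_simp
  rw [h3, ← integral_const_mul, ← integral_const_mul]
  congr 1; ext u
  rw [gaussianPDFReal_std, smul_eq_mul,
    show -(x + σ * u - x) ^ 2 / (2 * σ ^ 2) = -u ^ 2 / 2 by field_simp; ring]
  field_simp

/-- Smoothing inequality in terms of characteristic functions. -/
lemma kolDist_le_integral_charFun (μ : Measure ℝ) [IsProbabilityMeasure μ] (hμ : Integrable id μ)
    {σ : ℝ} (hσ : 0 < σ) :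
    kolDist μ ≤ Real.pi⁻¹ * (∫ t : ℝ, Real.exp (-σ ^ 2 * t ^ 2 / 2) *
      (‖charFun μ t - charFun (gaussianReal 0 1) t‖ / |t|)) + 3 * σ := by
  set ν := gaussianReal 0 1
  have hν : Integrable id ν := integrable_id_gaussianReal 0 1
  have hΔ := integrable_cdf_sub hμ hν
  set J := ∫ t : ℝ, Real.exp (-σ ^ 2 * t ^ 2 / 2) * (‖charFun μ t - charFun ν t‖ / |t|)
  have main := kolDist_le_of_smoothed μ (M := (2 * Real.pi)⁻¹ * J) hσ ?_
  · refine main.trans (le_of_eq ?_)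
    have := Real.pi_pos
    field_simp
  intro x
  have hs : (0 : ℝ) < Real.sqrt (2 * Real.pi) := Real.sqrt_pos.2 (by positivity)
  -- The smoothing kernel of width σ is the characteristic function of N(0, σ⁻²). Writing it so
  -- turns the smoothed difference into an average of Fourier transforms of F - Φ.
  obtain ⟨v, hv⟩ : ∃ v : NNReal, (v : ℝ) = (σ ^ 2)⁻¹ :=
    ⟨Real.toNNReal (σ ^ 2)⁻¹, Real.coe_toNNReal _ (by positivity)⟩
  have hv0 : v ≠ 0 := by
    rw [ne_eq, ← NNReal.coe_eq_zero, hv]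
    positivity
  set κ := gaussianReal 0 v
  have hexp : ∀ y : ℝ, ((Real.exp (-(y - x) ^ 2 / (2 * σ ^ 2)) : ℝ) : ℂ) =
      ∫ t, Complex.exp (((y - x : ℝ) : ℂ) * t * Complex.I) ∂κ := by
    intro y
    rw [← charFun_apply_real, charFun_gaussianReal]
    have hv' : ((v : ℝ) : ℂ) = ((σ : ℂ) ^ 2)⁻¹ := by rw [hv]; push_cast; rfl
    rw [hv']
    push_cast
    congr 1
    field_simp
    ring
  rw [integral_gaussianReal_comp_affine (fun y => cdf μ y - Phi y) x hσ, abs_mul,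
    abs_of_pos (by positivity : 0 < (σ * Real.sqrt (2 * Real.pi))⁻¹)]
  have hswap : ((∫ y, (cdf μ y - Phi y) * Real.exp (-(y - x) ^ 2 / (2 * σ ^ 2)) : ℝ) : ℂ) =
      ∫ t, Complex.exp (-((x * t : ℝ) * Complex.I)) *
        (∫ y, (cdf μ y - cdf ν y) • Complex.exp (t * y * Complex.I)) ∂κ := by
    rw [← integral_complex_ofReal]
    push_cast
    have e1 : ∀ y : ℝ, ((cdf μ y : ℝ) - (Phi y : ℝ) : ℂ) * Complex.exp (-(y - x) ^ 2 / (2 * σ ^ 2)) =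
        ∫ t, (cdf μ y - cdf ν y) • Complex.exp (((y - x : ℝ) : ℂ) * t * Complex.I) ∂κ := by
      intro y
      have := hexp y
      push_cast at this
      rw [this, integral_smul, Complex.real_smul]
      push_cast; rfl
    simp_rw [e1]
    rw [integral_integral_swap]
    · refine integral_congr_ae (Filter.Eventually.of_forall fun t => ?_)
      beta_reduce
      rw [← integral_const_mul]
      refine integral_congr_ae (Filter.Eventually.of_forall fun y => ?_)
      beta_reduce
      rw [mul_smul_comm, ← Complex.exp_add]
      congr 2
      push_cast; ring
    · refine (hΔ.comp_fst κ).smul_bdd 1 ?_ (Filter.Eventually.of_forall fun q => ?_)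
      · exact Continuous.aestronglyMeasurable (by fun_prop)
      · rw [← Complex.ofReal_mul, Complex.norm_exp_ofReal_mul_I]
  have hnorm : |∫ y, (cdf μ y - Phi y) * Real.exp (-(y - x) ^ 2 / (2 * σ ^ 2))| ≤
      ∫ t, ‖∫ y, (cdf μ y - cdf ν y) • Complex.exp (t * y * Complex.I)‖ ∂κ := by
    rw [← Real.norm_eq_abs, ← Complex.norm_real, hswap]
    refine (norm_integral_le_integral_norm _).trans (le_of_eq ?_)
    refine integral_congr_ae (Filter.Eventually.of_forall fun t => ?_)
    beta_reduce
    rw [norm_mul, ← neg_mul, ← Complex.ofReal_neg, Complex.norm_exp_ofReal_mul_I, one_mul]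
  have hJ : ∫ t, ‖∫ y, (cdf μ y - cdf ν y) • Complex.exp (t * y * Complex.I)‖ ∂κ =
      σ * (Real.sqrt (2 * Real.pi))⁻¹ * J := by
    rw [integral_gaussianReal_eq_integral_smul hv0, ← integral_const_mul]
    refine integral_congr_ae ?_
    have hne : ∀ᵐ t : ℝ, t ≠ 0 := by simp [ae_iff]
    filter_upwards [hne] with t ht
    rw [norm_integral_cdf_sub_mul_cexp hμ hν ht, smul_eq_mul]
    have e : gaussianPDFReal 0 v t = σ * (Real.sqrt (2 * Real.pi))⁻¹ *
        Real.exp (-σ ^ 2 * t ^ 2 / 2) := by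
      simp only [gaussianPDFReal, hv]
      rw [Real.sqrt_mul (by positivity), Real.sqrt_inv, Real.sqrt_sq hσ.le, mul_inv, inv_inv,
        mul_comm σ]
      congr 2
      field_simp
      ring
    rw [e]; ring
  calc _ ≤ (σ * Real.sqrt (2 * Real.pi))⁻¹ * (σ * (Real.sqrt (2 * Real.pi))⁻¹ * J) := by
        gcongr; rw [← hJ]; exact hnorm
    _ = (2 * Real.pi)⁻¹ * J := by
        have := Real.sq_sqrt (by positivity : (0 : ℝ) ≤ 2 * Real.pi)
        field_simp
        rw [this]

/-! ### Smooth statistics as lower bounds for the distances. -/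

/-- A smooth statistic is controlled by the Kolmogorov distance and by the `L²`-distance. -/
lemma integral_sub_integral_gaussian_eq {U U' : ℝ → ℝ} (hU : ∀ x, HasDerivAt U (U' x) x)
    (hU' : Continuous U') {B C : ℝ} (hB : ∀ x, |U x| ≤ B) (hC : ∀ x, |U' x| ≤ C)
    (μ : Measure ℝ) [IsProbabilityMeasure μ] (hμ : Integrable id μ) :
    ∫ x, U x ∂μ - ∫ x, U x ∂(gaussianReal 0 1) = - ∫ x, (cdf μ x - Phi x) * U' x := by
  have hν := integrable_id_gaussianReal 0 1
  have h := integral_cdf_sub_smul hμ hν hU'.stronglyMeasurable (C := C) hC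
  have hUc : Continuous U := continuous_iff_continuousAt.2 fun x => (hU x).continuousAt
  have i : ∀ (κ : Measure ℝ) [IsProbabilityMeasure κ], Integrable U κ := fun κ _ =>
    Integrable.of_bound hUc.aestronglyMeasurable B (Filter.Eventually.of_forall hB)
  have h1 : ∀ p : ℝ × ℝ, ∫ y in p.1..p.2, U' y = U p.2 - U p.1 := fun p =>
    intervalIntegral.integral_eq_sub_of_hasDerivAt (fun x _ => hU x) (hU'.intervalIntegrable _ _)
  simp_rw [h1] at h
  rw [integral_sub ((i _).comp_snd μ) ((i μ).comp_fst _), integral_fun_fst U, integral_fun_snd U] at h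
  simp only [smul_eq_mul, probReal_univ, one_mul] at h
  change ∫ x, (cdf μ x - Phi x) * U' x = _ at h
  linarith

lemma abs_integral_sub_le_kolDist {U U' : ℝ → ℝ} (hU : ∀ x, HasDerivAt U (U' x) x)
    (hU' : Continuous U') {B C : ℝ} (hB : ∀ x, |U x| ≤ B) (hC : ∀ x, |U' x| ≤ C)
    (hi : Integrable U') (μ : Measure ℝ) [IsProbabilityMeasure μ] (hμ : Integrable id μ) :
    |∫ x, U x ∂μ - ∫ x, U x ∂(gaussianReal 0 1)| ≤ kolDist μ * ∫ x, |U' x| := by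
  rw [integral_sub_integral_gaussian_eq hU hU' hB hC μ hμ, abs_neg, ← integral_const_mul]
  refine (abs_integral_le_integral_abs).trans (integral_mono_of_nonneg ?_ (hi.abs.const_mul _) ?_)
  · exact Filter.Eventually.of_forall fun x => abs_nonneg _
  · refine Filter.Eventually.of_forall fun x => ?_
    simp only [abs_mul]
    gcongr
    exact abs_cdf_sub_le_kolDist μ x

lemma memLp_cdf_sub (μ : Measure ℝ) [IsProbabilityMeasure μ] (hμ : Integrable id μ) :
    MemLp (fun x => cdf μ x - Phi x) 2 :=
  (memLp_two_iff_integrable_sq (measurable_cdf_sub μ).aestronglyMeasurable).2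
    (integral_cdf_sub_sq hμ (integrable_id_gaussianReal 0 1)).1

lemma abs_integral_sub_le_l2 {U U' : ℝ → ℝ} (hU : ∀ x, HasDerivAt U (U' x) x)
    (hU' : Continuous U') {B C : ℝ} (hB : ∀ x, |U x| ≤ B) (hC : ∀ x, |U' x| ≤ C)
    (hi : MemLp U' 2) (μ : Measure ℝ) [IsProbabilityMeasure μ] (hμ : Integrable id μ) :
    |∫ x, U x ∂μ - ∫ x, U x ∂(gaussianReal 0 1)| ≤
      Real.sqrt (∫ x, (cdf μ x - Phi x) ^ 2) * Real.sqrt (∫ x, U' x ^ 2) := by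
  rw [integral_sub_integral_gaussian_eq hU hU' hB hC μ hμ, abs_neg]
  exact abs_integral_mul_le (memLp_cdf_sub μ hμ) hi


/-! ### Gaussian integrals on the line. -/

lemma integral_exp_quadratic_gaussian {a : ℝ} (ha : 0 ≤ a) (b : ℝ) :
    ∫ x, Real.exp (-a * x ^ 2 / 2 + b * x) ∂(gaussianReal 0 1) =
      (Real.sqrt (1 + a))⁻¹ * Real.exp (b ^ 2 / (2 * (1 + a))) := by
  have h1 : (0 : ℝ) < 1 + a := by linarith
  rw [integral_gaussianReal_eq_integral_smul one_ne_zero]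
  have e : ∀ x : ℝ, gaussianPDFReal 0 1 x • Real.exp (-a * x ^ 2 / 2 + b * x) =
      ((Real.sqrt (2 * Real.pi))⁻¹ * Real.exp (b ^ 2 / (2 * (1 + a)))) *
        Real.exp (-((1 + a) / 2) * (x - b / (1 + a)) ^ 2) := by
    intro x
    rw [gaussianPDFReal_std, smul_eq_mul, mul_assoc, mul_assoc, ← Real.exp_add, ← Real.exp_add]
    congr 2
    field_simp
    ring
  simp_rw [e]
  rw [integral_const_mul, integral_sub_right_eq_self
    (fun x => Real.exp (-((1 + a) / 2) * x ^ 2)), integral_gaussian,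
    show Real.pi / ((1 + a) / 2) = (2 * Real.pi) / (1 + a) by field_simp,
    Real.sqrt_div (by positivity)]
  have : Real.sqrt (2 * Real.pi) ≠ 0 := (Real.sqrt_pos.2 (by positivity)).ne'
  field_simp

lemma integral_exp_sq_gaussian {a : ℝ} (ha : 0 ≤ a) :
    ∫ x, Real.exp (-a * x ^ 2 / 2) ∂(gaussianReal 0 1) = (Real.sqrt (1 + a))⁻¹ := by
  simpa using integral_exp_quadratic_gaussian ha 0

lemma integral_abs_gaussian : ∫ x, |x| ∂(gaussianReal 0 1) = Real.sqrt (2 / Real.pi) := by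
  rw [integral_gaussianReal_eq_integral_smul one_ne_zero]
  have e : ∀ x : ℝ, gaussianPDFReal 0 1 x • |x| =
      (fun y => (Real.sqrt (2 * Real.pi))⁻¹ * (y * Real.exp (-(1 / 2) * y ^ 2))) |x| := by
    intro x
    beta_reduce
    rw [gaussianPDFReal_std, smul_eq_mul, sq_abs]
    ring_nf
  simp_rw [e]
  rw [integral_comp_abs (f := fun y => (Real.sqrt (2 * Real.pi))⁻¹ *
    (y * Real.exp (-(1 / 2) * y ^ 2))), integral_const_mul]
  have := integral_rpow_mul_exp_neg_mul_rpow (p := 2) (q := 1) (b := 1 / 2) (by norm_num)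
    (by norm_num) (by norm_num)
  simp only [Real.rpow_one, Real.rpow_two] at this
  rw [this]
  norm_num
  have h2 : Real.sqrt 2 * Real.sqrt 2 = 2 := Real.mul_self_sqrt (by norm_num)
  have hp : Real.sqrt Real.pi ≠ 0 := (Real.sqrt_pos.2 Real.pi_pos).ne'
  field_simp
  nlinarith

/-! ### The standard Gaussian measure of a Euclidean space. -/

section Space

variable {E : Type*} [NormedAddCommGroup E] [InnerProductSpace ℝ E] [FiniteDimensional ℝ E]
  [MeasurableSpace E] [BorelSpace E]

lemma stdGaussian_map_inner (v : E) :
    (stdGaussian E).map (fun g => inner ℝ v g) = gaussianReal 0 (‖v‖₊ ^ 2) := by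
  have h := IsGaussian.map_eq_gaussianReal (μ := stdGaussian E) (innerSL ℝ v)
  rw [integral_strongDual_stdGaussian, variance_dual_stdGaussian, innerSL_apply_norm] at h
  have hv : (‖v‖ ^ 2).toNNReal = ‖v‖₊ ^ 2 := by ext; simp
  rw [hv] at h
  exact h

lemma integral_inner_stdGaussian (v : E) (f : ℝ → ℝ) (hf : Measurable f) :
    ∫ g, f (inner ℝ v g) ∂(stdGaussian E) = ∫ x, f (‖v‖ * x) ∂(gaussianReal 0 1) := by
  have h1 : ∫ g, f (inner ℝ v g) ∂(stdGaussian E) = ∫ x, f x ∂(gaussianReal 0 (‖v‖₊ ^ 2)) := by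
    rw [← stdGaussian_map_inner, integral_map (by fun_prop) hf.aestronglyMeasurable]
  have h2 : gaussianReal 0 (‖v‖₊ ^ 2) = (gaussianReal 0 1).map (‖v‖ * ·) := by
    rw [gaussianReal_map_const_mul]
    congr 1
    · simp
    · ext; simp
  rw [h1, h2, integral_map (by fun_prop) hf.aestronglyMeasurable]

lemma integrable_inner_stdGaussian_iff (v : E) (f : ℝ → ℝ) (hf : Measurable f) :
    Integrable (fun g => f (inner ℝ v g)) (stdGaussian E) ↔
      Integrable f (gaussianReal 0 (‖v‖₊ ^ 2)) := by
  rw [← stdGaussian_map_inner, integrable_map_measure hf.aestronglyMeasurable (by fun_prop)]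
  rfl

lemma integrable_exp_neg_nonneg {α : Type*} [MeasurableSpace α] {μ : Measure α} [IsFiniteMeasure μ]
    {f : α → ℝ} (hf : Measurable f) (h : ∀ a, 0 ≤ f a) :
    Integrable (fun a => Real.exp (-f a)) μ :=
  Integrable.of_bound (by fun_prop) 1 (Filter.Eventually.of_forall fun a => by
    rw [Real.norm_eq_abs, Real.abs_exp, Real.exp_le_one_iff]; linarith [h a])

/-- The joint Laplace transform of the squares of two Gaussian linear forms. -/
lemma integral_exp_sq_inner_stdGaussian (u w : E) {a b : ℝ} (ha : 0 ≤ a) (hb : 0 ≤ b) :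
    ∫ g, Real.exp (-(a * inner ℝ u g ^ 2 + b * inner ℝ w g ^ 2) / 2) ∂(stdGaussian E) =
      (Real.sqrt ((1 + a * ‖u‖ ^ 2) * (1 + b * ‖w‖ ^ 2) - a * b * inner ℝ u w ^ 2))⁻¹ := by
  set γ := gaussianReal 0 1
  -- The squares are linearized by two auxiliary normal variables. The integral over g is then a
  -- characteristic function, and only a Gaussian integral over the plane remains.
  have hcf : ∀ s : ℝ, ((Real.exp (-s ^ 2 / 2) : ℝ) : ℂ) = ∫ z, Complex.exp (s * z * Complex.I) ∂γ := by
    intro s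
    rw [← charFun_apply_real, charFun_gaussianReal]
    push_cast
    congr 1
    simp
    ring
  set α := Real.sqrt a
  set β := Real.sqrt b
  have hα : α ^ 2 = a := Real.sq_sqrt ha
  have hβ : β ^ 2 = b := Real.sq_sqrt hb
  have h1 : ∀ g : E, ((Real.exp (-(a * inner ℝ u g ^ 2 + b * inner ℝ w g ^ 2) / 2) : ℝ) : ℂ) =
      ∫ z : ℝ × ℝ, Complex.exp ((inner ℝ g ((α * z.1) • u + (β * z.2) • w) : ℝ) * Complex.I)
        ∂(γ.prod γ) := by
    intro g
    have : Real.exp (-(a * inner ℝ u g ^ 2 + b * inner ℝ w g ^ 2) / 2) =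
        Real.exp (-(α * inner ℝ u g) ^ 2 / 2) * Real.exp (-(β * inner ℝ w g) ^ 2 / 2) := by
      rw [← Real.exp_add]; congr 1; rw [mul_pow, mul_pow, hα, hβ]; ring
    rw [this, Complex.ofReal_mul, hcf, hcf, ← integral_prod_mul]
    congr 1; ext z
    rw [← Complex.exp_add]
    congr 1
    rw [inner_add_right, inner_smul_right, inner_smul_right, real_inner_comm u, real_inner_comm w]
    push_cast; ring
  have h2 : ((∫ g, Real.exp (-(a * inner ℝ u g ^ 2 + b * inner ℝ w g ^ 2) / 2) ∂(stdGaussian E) : ℝ)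
      : ℂ) = ((∫ z : ℝ × ℝ, Real.exp (-‖(α * z.1) • u + (β * z.2) • w‖ ^ 2 / 2) ∂(γ.prod γ) : ℝ) : ℂ) := by
    rw [← integral_complex_ofReal, ← integral_complex_ofReal]
    simp_rw [h1]
    rw [integral_integral_swap]
    · congr 1; ext z
      have := charFun_stdGaussian ((α * z.1) • u + (β * z.2) • w)
      rw [charFun_apply] at this
      rw [this]; push_cast; rfl
    · refine Integrable.of_bound (Continuous.aestronglyMeasurable (by fun_prop)) 1
        (Filter.Eventually.of_forall fun q => ?_)
      simp only [Function.uncurry]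
      rw [Complex.norm_exp_ofReal_mul_I]
  have h3 := Complex.ofReal_injective h2
  have hpos : 0 < 1 + b * ‖w‖ ^ 2 := by positivity
  -- The Schur complement: the coefficient left in x after the integration over y. It is nonnegative
  -- by Cauchy–Schwarz.
  set d := a * ‖u‖ ^ 2 - a * b * inner ℝ u w ^ 2 / (1 + b * ‖w‖ ^ 2) with hd
  have hcs : inner ℝ u w ^ 2 ≤ ‖u‖ ^ 2 * ‖w‖ ^ 2 := by
    rw [← mul_pow, ← sq_abs]
    gcongr
    exact abs_real_inner_le_norm u w
  have hd0 : 0 ≤ d := by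
    rw [hd, sub_nonneg, div_le_iff₀ hpos]
    nlinarith [mul_le_mul_of_nonneg_left hcs (mul_nonneg ha hb), mul_nonneg ha (sq_nonneg ‖u‖)]
  rw [h3, integral_prod]
  · have hin : ∀ x : ℝ, ∫ y, Real.exp (-‖(α * x) • u + (β * y) • w‖ ^ 2 / 2) ∂γ =
        (Real.sqrt (1 + b * ‖w‖ ^ 2))⁻¹ * Real.exp (-d * x ^ 2 / 2) := by
      intro x
      have e : ∀ y : ℝ, Real.exp (-‖(α * x) • u + (β * y) • w‖ ^ 2 / 2) =
          Real.exp (-a * ‖u‖ ^ 2 * x ^ 2 / 2) *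
          Real.exp (-(b * ‖w‖ ^ 2) * y ^ 2 / 2 + (-(α * β * x * inner ℝ u w)) * y) := by
        intro y
        rw [← Real.exp_add]
        congr 1
        rw [norm_add_sq_real, norm_smul, norm_smul, inner_smul_left, inner_smul_right, mul_pow,
          mul_pow, Real.norm_eq_abs, Real.norm_eq_abs, sq_abs, sq_abs, mul_pow, mul_pow, hα, hβ]
        simp
        ring
      simp_rw [e]
      rw [integral_const_mul, integral_exp_quadratic_gaussian (by positivity), mul_left_comm,
        ← Real.exp_add]
      congr 2
      rw [hd, neg_sq, mul_pow, mul_pow, mul_pow, hα, hβ]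
      field_simp
      ring
    simp_rw [hin]
    rw [integral_const_mul, integral_exp_sq_gaussian hd0, ← mul_inv, ← Real.sqrt_mul hpos.le]
    congr 2
    rw [hd]; field_simp
    ring
  · refine Integrable.of_bound (Continuous.aestronglyMeasurable (by fun_prop)) 1
      (Filter.Eventually.of_forall fun q => ?_)
    rw [Real.norm_eq_abs, Real.abs_exp, Real.exp_le_one_iff]
    nlinarith [sq_nonneg ‖(α * q.1) • u + (β * q.2) • w‖]

/-- The standard Gaussian measure has the usual density. -/
lemma stdGaussian_eq_withDensity :
    stdGaussian E = (volume : Measure E).withDensity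
      (fun x => ENNReal.ofReal ((2 * Real.pi) ^ (-(Module.finrank ℝ E / 2 : ℝ)) *
        Real.exp (-‖x‖ ^ 2 / 2))) := by
  set c : ℝ := (2 * Real.pi) ^ (-(Module.finrank ℝ E / 2 : ℝ))
  have hc : 0 < c := by positivity
  have hint : Integrable (fun x : E => Real.exp (-‖x‖ ^ 2 / 2)) := by
    have h := GaussianFourier.integrable_cexp_neg_mul_sq_norm_add (V := E) (b := 1 / 2)
      (by norm_num) 0 0
    have h' := h.norm
    refine h'.congr (Filter.Eventually.of_forall fun x => ?_)
    simp only [zero_mul, add_zero, Complex.norm_exp]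
    congr 1
    have e : ((‖x‖ : ℂ) ^ 2).re = ‖x‖ ^ 2 := by rw [← Complex.ofReal_pow, Complex.ofReal_re]
    simp [e]
    ring
  have hI : Integrable (fun x : E => c * Real.exp (-‖x‖ ^ 2 / 2)) := hint.const_mul c
  have hfin : IsFiniteMeasure ((volume : Measure E).withDensity
      (fun x => ENNReal.ofReal (c * Real.exp (-‖x‖ ^ 2 / 2)))) :=
    isFiniteMeasure_withDensity_ofReal hI.2
  -- Characteristic functions determine finite measures, so no orthonormal basis has to be chosen.
  refine Measure.ext_of_charFun (funext fun t => ?_)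
  rw [charFun_stdGaussian, charFun_apply, integral_withDensity_eq_integral_toReal_smul
    (by fun_prop) (Filter.Eventually.of_forall fun x => ENNReal.ofReal_lt_top)]
  have e : ∀ x : E, (ENNReal.ofReal (c * Real.exp (-‖x‖ ^ 2 / 2))).toReal •
      Complex.exp ((inner ℝ x t : ℝ) * Complex.I) =
      (c : ℂ) * Complex.exp (-(1 / 2 : ℂ) * ‖x‖ ^ 2 + Complex.I * (inner ℝ t x : ℝ)) := by
    intro x
    rw [ENNReal.toReal_ofReal (by positivity), Complex.real_smul, real_inner_comm, Complex.exp_add]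
    push_cast
    rw [mul_assoc]
    congr 2
    · congr 1; ring
    · congr 1; ring
  simp_rw [e]
  rw [integral_const_mul, GaussianFourier.integral_cexp_neg_mul_sq_norm_add (by norm_num)]
  have hc' : (c : ℂ) * ((Real.pi : ℂ) / (1 / 2)) ^ (Module.finrank ℝ E / 2 : ℂ) = 1 := by
    rw [show (Real.pi : ℂ) / (1 / 2) = ((2 * Real.pi : ℝ) : ℂ) by push_cast; ring,
      show (Module.finrank ℝ E / 2 : ℂ) = ((Module.finrank ℝ E / 2 : ℝ) : ℂ) by push_cast; rfl,
      ← Complex.ofReal_cpow (by positivity), ← Complex.ofReal_mul, ← Real.rpow_add (by positivity)]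
    simp
  rw [← mul_assoc, hc', one_mul]
  congr 1
  rw [Complex.I_sq]
  ring

end Space

/-! ### Polar decomposition of a Gaussian vector. -/

section Radial

variable (ι : Type*) [Fintype ι]

/-- The law of the norm of a standard Gaussian vector. -/
noncomputable def radialLaw : Measure ℝ := (stdGaussian (EuclideanSpace ℝ ι)).map norm

instance : IsProbabilityMeasure (radialLaw ι) :=
  Measure.isProbabilityMeasure_map (by fun_prop)

instance [Nonempty ι] : IsProbabilityMeasure (sphereMeasure ι) := by
  constructor
  rw [sphereMeasure, Measure.smul_apply, smul_eq_mul, ENNReal.inv_mul_cancel]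
  · exact Measure.measure_univ_ne_zero.2
      (Measure.toSphere_ne_zero (volume : Measure (EuclideanSpace ℝ ι)))
  · exact measure_ne_top _ _

/-- The origin is a null set, and off it x ↦ (x/|x|, |x|) carries volume to surface measure times
r^(n-1) dr. -/
lemma lintegral_volume_polar [Nonempty ι] (G : EuclideanSpace ℝ ι → ENNReal) (hG : Measurable G) :
    ∫⁻ x, G x = ∫⁻ θ, ∫⁻ r, G (r.1 • θ.1)
      ∂(Measure.volumeIoiPow (Module.finrank ℝ (EuclideanSpace ℝ ι) - 1))
      ∂(volume : Measure (EuclideanSpace ℝ ι)).toSphere := by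
  have hm : Measurable (fun p : Metric.sphere (0 : EuclideanSpace ℝ ι) 1 × Ioi (0 : ℝ) =>
      G (p.2.1 • p.1.1)) := hG.comp (by fun_prop)
  rw [← lintegral_prod _ hm.aemeasurable,
    ← (volume : Measure (EuclideanSpace ℝ ι)).measurePreserving_homeomorphUnitSphereProd.lintegral_comp hm]
  have e : ∀ a : ({0}ᶜ : Set (EuclideanSpace ℝ ι)),
      ((homeomorphUnitSphereProd (EuclideanSpace ℝ ι) a).2.1 •
        (homeomorphUnitSphereProd (EuclideanSpace ℝ ι) a).1.1) = a.1 := by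
    intro a
    have ha : ‖a.1‖ ≠ 0 := norm_ne_zero_iff.2 a.2
    simp [smul_smul, ha]
  simp_rw [e]
  rw [lintegral_subtype_comap (measurableSet_singleton _).compl G, restrict_compl_singleton]

lemma lintegral_stdGaussian_polar [Nonempty ι] (F : EuclideanSpace ℝ ι → ENNReal)
    (hF : Measurable F) :
    ∫⁻ x, F x ∂(stdGaussian (EuclideanSpace ℝ ι)) =
      ∫⁻ θ, ∫⁻ r, F (r • θ.1) ∂(radialLaw ι) ∂(sphereMeasure ι) := by
  set σ := (volume : Measure (EuclideanSpace ℝ ι)).toSphere with hσ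
  set m := Module.finrank ℝ (EuclideanSpace ℝ ι) - 1
  set c : ℝ := (2 * Real.pi) ^ (-(Module.finrank ℝ (EuclideanSpace ℝ ι) / 2 : ℝ))
  set w : ℝ → ENNReal := fun r => ENNReal.ofReal (c * Real.exp (-r ^ 2 / 2)) with hw
  have hwm : Measurable w := by fun_prop
  have hpol : ∀ F : EuclideanSpace ℝ ι → ENNReal, Measurable F →
      ∫⁻ x, F x ∂(stdGaussian (EuclideanSpace ℝ ι)) =
      ∫⁻ θ, ∫⁻ r : Ioi (0 : ℝ), w r * F (r.1 • θ.1) ∂(Measure.volumeIoiPow m) ∂σ := by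
    intro F hF
    rw [stdGaussian_eq_withDensity, lintegral_withDensity_eq_lintegral_mul _ (by fun_prop) hF,
      lintegral_volume_polar ι _ (Measurable.mul (by fun_prop) hF)]
    refine lintegral_congr fun θ => lintegral_congr fun r => ?_
    have h1 : ‖θ.1‖ = 1 := by simp
    simp only [Pi.mul_apply, norm_smul, h1, mul_one, hw, Real.norm_eq_abs, sq_abs]
    rfl
  -- The density depends on the norm only. Applying the polar formula to functions of the norm
  -- therefore identifies the weighted radial measure with the law of the norm, up to the total
  -- surface area.
  have hrad : ∀ k : ℝ → ENNReal, Measurable k →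
      ∫⁻ r : Ioi (0 : ℝ), w r * k r ∂(Measure.volumeIoiPow m) =
        (σ univ)⁻¹ * ∫⁻ r, k r ∂(radialLaw ι) := by
    intro k hk
    have h2 := hpol (fun x => k ‖x‖) (hk.comp measurable_norm)
    rw [radialLaw, lintegral_map hk measurable_norm, h2]
    have h3 : ∀ θ : Metric.sphere (0 : EuclideanSpace ℝ ι) 1, ∀ r : Ioi (0 : ℝ),
        ‖r.1 • θ.1‖ = r.1 := by
      intro θ r
      have h1 : ‖θ.1‖ = 1 := by simp
      rw [norm_smul, h1, mul_one, Real.norm_eq_abs, abs_of_pos r.2.out]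
    simp_rw [h3]
    rw [lintegral_const, mul_comm _ (σ univ), ← mul_assoc, ENNReal.inv_mul_cancel, one_mul]
    · exact Measure.measure_univ_ne_zero.2
        (Measure.toSphere_ne_zero (volume : Measure (EuclideanSpace ℝ ι)))
    · exact measure_ne_top _ _
  rw [hpol F hF, sphereMeasure, lintegral_smul_measure, ← hσ, smul_eq_mul, ← lintegral_const_mul]
  · refine lintegral_congr fun θ => ?_
    exact hrad (fun r => F (r • θ.1)) (hF.comp (by fun_prop))
  · exact Measurable.lintegral_prod_right' (f := fun p : Metric.sphere (0 : EuclideanSpace ℝ ι) 1 × ℝ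
      => F (p.2 • p.1.1)) (hF.comp (by fun_prop))

/-- A standard Gaussian vector is the product of a uniform direction and an independent radius. -/
lemma map_smul_sphere_prod_radial [Nonempty ι] :
    ((sphereMeasure ι).prod (radialLaw ι)).map
      (fun p : Metric.sphere (0 : EuclideanSpace ℝ ι) 1 × ℝ => p.2 • p.1.1) =
      stdGaussian (EuclideanSpace ℝ ι) := by
  refine Measure.ext_of_lintegral _ fun F hF => ?_
  rw [lintegral_stdGaussian_polar ι F hF, lintegral_map hF (by fun_prop), lintegral_prod]
  exact (hF.comp (by fun_prop)).aemeasurable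

lemma integral_stdGaussian_polar [Nonempty ι] (F : EuclideanSpace ℝ ι → ℝ) (hF : Measurable F) :
    ∫ p : Metric.sphere (0 : EuclideanSpace ℝ ι) 1 × ℝ, F (p.2 • p.1.1)
      ∂((sphereMeasure ι).prod (radialLaw ι)) = ∫ x, F x ∂(stdGaussian (EuclideanSpace ℝ ι)) := by
  rw [← map_smul_sphere_prod_radial ι, integral_map (by fun_prop) hF.aestronglyMeasurable]

lemma integrable_stdGaussian_polar [Nonempty ι] (F : EuclideanSpace ℝ ι → ℝ) (hF : Measurable F) :
    Integrable (fun p : Metric.sphere (0 : EuclideanSpace ℝ ι) 1 × ℝ => F (p.2 • p.1.1))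
      ((sphereMeasure ι).prod (radialLaw ι)) ↔ Integrable F (stdGaussian (EuclideanSpace ℝ ι)) := by
  rw [← map_smul_sphere_prod_radial ι, integrable_map_measure hF.aestronglyMeasurable (by fun_prop)]
  rfl

lemma radialLaw_nonneg : ∀ᵐ r ∂(radialLaw ι), 0 ≤ r := by
  rw [radialLaw, ae_map_iff (by fun_prop) measurableSet_Ici]
  exact Filter.Eventually.of_forall fun x => norm_nonneg x

end Radial

/-! ### Moments of the Gaussian radius. -/

lemma integral_pow_mul_exp_neg_sq_succ (q : ℕ) :
    ∫ y in Ioi (0 : ℝ), y ^ (q + 2) * Real.exp (-y ^ 2 / 2) =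
      (q + 1) * ∫ y in Ioi (0 : ℝ), y ^ q * Real.exp (-y ^ 2 / 2) := by
  have h : ∀ q : ℕ, ∫ y in Ioi (0 : ℝ), y ^ q * Real.exp (-y ^ 2 / 2) =
      (1 / 2 : ℝ) ^ (-((q : ℝ) + 1) / 2) * (1 / 2) * Real.Gamma (((q : ℝ) + 1) / 2) := by
    intro q
    rw [← integral_rpow_mul_exp_neg_mul_rpow (p := 2) (q := q) (b := 1 / 2) (by norm_num)
      (by have : (0 : ℝ) ≤ q := q.cast_nonneg
          linarith) (by norm_num)]
    refine setIntegral_congr_fun measurableSet_Ioi fun y hy => ?_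
    simp only [Real.rpow_natCast, Real.rpow_two]
    congr 2
    ring
  have hq : (0 : ℝ) ≤ q := q.cast_nonneg
  rw [h, h]
  push_cast
  rw [show ((q : ℝ) + 2 + 1) / 2 = (q + 1) / 2 + 1 by ring, Real.Gamma_add_one (by positivity),
    show -((q : ℝ) + 2 + 1) / 2 = -(q + 1) / 2 + (-1) by ring, Real.rpow_add (by norm_num),
    Real.rpow_neg_one]
  norm_num
  ring

section Moments

variable {E : Type*} [NormedAddCommGroup E] [InnerProductSpace ℝ E] [FiniteDimensional ℝ E]
  [MeasurableSpace E] [BorelSpace E]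

lemma integrable_norm_pow_stdGaussian (k : ℕ) :
    Integrable (fun x => ‖x‖ ^ k) (stdGaussian E) := by
  rcases Nat.eq_zero_or_pos k with rfl | hk
  · simp
  · exact (IsGaussian.memLp_id (stdGaussian E) k (by simp)).integrable_norm_pow (by omega)

/-- In polar coordinates the even moments are, up to one common constant, the half-line integrals
with exponent n - 1 + 2j, so the recursion is that of the Gamma function. -/
lemma integral_norm_pow_succ_stdGaussian [Nontrivial E] (j : ℕ) :
    ∫ x, ‖x‖ ^ (2 * (j + 1)) ∂(stdGaussian E) =
      (Module.finrank ℝ E + 2 * j) * ∫ x, ‖x‖ ^ (2 * j) ∂(stdGaussian E) := by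
  set c : ℝ := (2 * Real.pi) ^ (-(Module.finrank ℝ E / 2 : ℝ)) with hc
  have hn : 0 < Module.finrank ℝ E := Module.finrank_pos
  have hc0 : 0 ≤ c := by positivity
  set K : ℝ := Module.finrank ℝ E * (volume.real (Metric.ball (0 : E) 1))
  have h : ∀ j : ℕ, ∫ x, ‖x‖ ^ (2 * j) ∂(stdGaussian E) =
      K * c * ∫ y in Ioi (0 : ℝ), y ^ (Module.finrank ℝ E - 1 + 2 * j) * Real.exp (-y ^ 2 / 2) := by
    intro j
    rw [stdGaussian_eq_withDensity, integral_withDensity_eq_integral_toReal_smul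
      (by fun_prop) (Filter.Eventually.of_forall fun x => ENNReal.ofReal_lt_top)]
    have e : ∀ x : E, (ENNReal.ofReal (c * Real.exp (-‖x‖ ^ 2 / 2))).toReal • ‖x‖ ^ (2 * j) =
        (fun y : ℝ => c * Real.exp (-y ^ 2 / 2) * y ^ (2 * j)) ‖x‖ := by
      intro x
      rw [ENNReal.toReal_ofReal (by positivity), smul_eq_mul]
    simp_rw [← hc, e]
    rw [integral_fun_norm_addHaar volume (fun y : ℝ => c * Real.exp (-y ^ 2 / 2) * y ^ (2 * j)),
      mul_assoc, ← integral_const_mul]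
    simp only [smul_eq_mul, nsmul_eq_mul, K, mul_assoc]
    congr 3
    ext y
    rw [pow_add]; ring
  rw [h, h, show Module.finrank ℝ E - 1 + 2 * (j + 1) = Module.finrank ℝ E - 1 + 2 * j + 2 by ring,
    integral_pow_mul_exp_neg_sq_succ]
  push_cast [Nat.cast_sub (show 1 ≤ Module.finrank ℝ E from hn)]
  ring

end Moments

section RadialMoments

variable (ι : Type*) [Fintype ι]

/-- The normalized squared radius, centered. -/
noncomputable def radDev (r : ℝ) : ℝ := r ^ 2 / Fintype.card ι - 1

lemma neg_one_le_radDev (r : ℝ) : -1 ≤ radDev ι r := by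
  unfold radDev
  have : 0 ≤ r ^ 2 / (Fintype.card ι : ℝ) := by positivity
  linarith

lemma integrable_pow_radialLaw (k : ℕ) : Integrable (fun r => r ^ k) (radialLaw ι) := by
  rw [radialLaw, integrable_map_measure (by fun_prop) (by fun_prop)]
  exact integrable_norm_pow_stdGaussian k

lemma integrable_radDev_pow (k : ℕ) : Integrable (fun r => radDev ι r ^ k) (radialLaw ι) := by
  have : (fun r => radDev ι r ^ k) = fun r => ∑ m ∈ Finset.range (k + 1),
      r ^ (2 * m) * ((1 / (Fintype.card ι : ℝ) ^ m) * (-1) ^ (k - m) * (k.choose m)) := by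
    ext r
    rw [radDev, sub_eq_add_neg, add_pow]
    refine Finset.sum_congr rfl fun m _ => ?_
    rw [div_pow, ← pow_mul]; ring
  rw [this]
  exact integrable_finsetSum _ fun m _ => (integrable_pow_radialLaw ι _).mul_const _

lemma radial_moments [Nonempty ι] :
    ∫ r, r ^ 2 ∂(radialLaw ι) = Fintype.card ι ∧
    ∫ r, r ^ 4 ∂(radialLaw ι) = Fintype.card ι * (Fintype.card ι + 2) ∧
    ∫ r, r ^ 6 ∂(radialLaw ι) = Fintype.card ι * (Fintype.card ι + 2) * (Fintype.card ι + 4) ∧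
    ∫ r, r ^ 8 ∂(radialLaw ι) = Fintype.card ι * (Fintype.card ι + 2) * (Fintype.card ι + 4) *
      (Fintype.card ι + 6) := by
  have h : ∀ k : ℕ, ∫ r, r ^ k ∂(radialLaw ι) =
      ∫ x, ‖x‖ ^ k ∂(stdGaussian (EuclideanSpace ℝ ι)) := fun k => by
    rw [radialLaw, integral_map (by fun_prop) (by fun_prop)]
  have s := integral_norm_pow_succ_stdGaussian (E := EuclideanSpace ℝ ι)
  have s0 := s 0
  have s1 := s 1
  have s2 := s 2
  have s3 := s 3
  simp only [finrank_euclideanSpace] at s0 s1 s2 s3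
  norm_num at s0 s1 s2 s3
  simp only [h]
  rw [s3, s2, s1, s0]
  refine ⟨rfl, ?_, ?_, ?_⟩ <;> ring

lemma integral_radDev [Nonempty ι] : ∫ r, radDev ι r ∂(radialLaw ι) = 0 := by
  have hn : (Fintype.card ι : ℝ) ≠ 0 := by simp
  obtain ⟨m1, -⟩ := radial_moments ι
  unfold radDev
  rw [integral_sub ((integrable_pow_radialLaw ι 2).div_const _) (integrable_const _), integral_div,
    m1]
  simp [hn]

lemma integral_radDev_sq [Nonempty ι] :
    ∫ r, radDev ι r ^ 2 ∂(radialLaw ι) = 2 / Fintype.card ι := by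
  have hn : (Fintype.card ι : ℝ) ≠ 0 := by simp
  obtain ⟨m1, m2, -⟩ := radial_moments ι
  set n : ℝ := (Fintype.card ι : ℝ)
  have e : (fun r => radDev ι r ^ 2) = fun r => r ^ 4 / n ^ 2 - r ^ 2 * (2 / n) + 1 := by
    ext r; unfold radDev; field_simp; ring
  have i4 := (integrable_pow_radialLaw ι 4).div_const (n ^ 2)
  have i2 := (integrable_pow_radialLaw ι 2).mul_const (2 / n)
  have i42 : Integrable (fun r => r ^ 4 / n ^ 2 - r ^ 2 * (2 / n)) (radialLaw ι) := i4.sub i2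
  rw [e, integral_add i42 (integrable_const _), integral_sub i4 i2, integral_div,
    integral_mul_const, m1, m2]
  simp; field_simp; ring

/-- The third moment is of order n⁻², not merely n^(-3/2), so the cubic term of an expansion in
`radDev` is no larger than the fourth order remainder. -/
lemma integral_radDev_cube [Nonempty ι] :
    ∫ r, radDev ι r ^ 3 ∂(radialLaw ι) = 8 / (Fintype.card ι : ℝ) ^ 2 := by
  have hn : (Fintype.card ι : ℝ) ≠ 0 := by simp
  obtain ⟨m1, m2, m3, -⟩ := radial_moments ι
  set n : ℝ := (Fintype.card ι : ℝ)
  have e : (fun r => radDev ι r ^ 3) = fun r =>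
      r ^ 6 / n ^ 3 - r ^ 4 * (3 / n ^ 2) + (r ^ 2 * (3 / n) - 1) := by
    ext r; unfold radDev; field_simp; ring
  have i6 := (integrable_pow_radialLaw ι 6).div_const (n ^ 3)
  have i4 := (integrable_pow_radialLaw ι 4).mul_const (3 / n ^ 2)
  have i2 := (integrable_pow_radialLaw ι 2).mul_const (3 / n)
  have i64 : Integrable (fun r => r ^ 6 / n ^ 3 - r ^ 4 * (3 / n ^ 2)) (radialLaw ι) := i6.sub i4
  have i20 : Integrable (fun r => r ^ 2 * (3 / n) - 1) (radialLaw ι) := i2.sub (integrable_const _)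
  rw [e, integral_add i64 i20, integral_sub i6 i4, integral_sub i2 (integrable_const _),
    integral_div, integral_mul_const, integral_mul_const, m1, m2, m3]
  simp; field_simp; ring

lemma integral_radDev_four_le [Nonempty ι] :
    ∫ r, radDev ι r ^ 4 ∂(radialLaw ι) ≤ 60 / (Fintype.card ι : ℝ) ^ 2 := by
  have hn : (Fintype.card ι : ℝ) ≠ 0 := by simp
  have hn1 : (1 : ℝ) ≤ Fintype.card ι := by exact_mod_cast Fintype.card_pos
  obtain ⟨m1, m2, m3, m4⟩ := radial_moments ι
  set n : ℝ := (Fintype.card ι : ℝ)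
  have e : (fun r => radDev ι r ^ 4) = fun r =>
      r ^ 8 / n ^ 4 - r ^ 6 * (4 / n ^ 3) + (r ^ 4 * (6 / n ^ 2) - r ^ 2 * (4 / n)) + 1 := by
    ext r; unfold radDev; field_simp; ring
  have i8 := (integrable_pow_radialLaw ι 8).div_const (n ^ 4)
  have i6 := (integrable_pow_radialLaw ι 6).mul_const (4 / n ^ 3)
  have i4 := (integrable_pow_radialLaw ι 4).mul_const (6 / n ^ 2)
  have i2 := (integrable_pow_radialLaw ι 2).mul_const (4 / n)
  have i86 : Integrable (fun r => r ^ 8 / n ^ 4 - r ^ 6 * (4 / n ^ 3)) (radialLaw ι) := i8.sub i6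
  have i42 : Integrable (fun r => r ^ 4 * (6 / n ^ 2) - r ^ 2 * (4 / n)) (radialLaw ι) := i4.sub i2
  have i8642 : Integrable (fun r => r ^ 8 / n ^ 4 - r ^ 6 * (4 / n ^ 3) +
    (r ^ 4 * (6 / n ^ 2) - r ^ 2 * (4 / n))) (radialLaw ι) := i86.add i42
  have : ∫ r, radDev ι r ^ 4 ∂(radialLaw ι) = (12 * n ^ 2 + 48 * n) / n ^ 4 := by
    rw [e, integral_add i8642 (integrable_const _), integral_add i86 i42, integral_sub i8 i6,
      integral_sub i4 i2,
      integral_div, integral_mul_const, integral_mul_const, integral_mul_const, m1, m2, m3, m4]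
    simp; field_simp; ring
  rw [this, div_le_div_iff₀ (by positivity) (by positivity)]
  nlinarith [mul_le_mul_of_nonneg_left hn1 (by positivity : 0 ≤ n ^ 3)]

end RadialMoments

/-! ### Marginals of isotropic laws and their measurability in the direction. -/

lemma continuousWithinAt_cdf_sub (μ : Measure ℝ) (x : ℝ) :
    ContinuousWithinAt (fun x => cdf μ x - Phi x) (Ici x) x :=
  ((cdf μ).right_continuous x).sub ((cdf _).right_continuous x)

/-- Right continuity lets rational points decide the supremum; a countable supremum is what makes
the distance measurable as a function of the direction. -/
lemma kolDist_eq_iSup_rat (μ : Measure ℝ) : kolDist μ = ⨆ q : ℚ, |cdf μ q - Phi q| := by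
  have hbdd : BddAbove (range fun q : ℚ => |cdf μ q - Phi q|) :=
    ⟨1, by rintro _ ⟨x, rfl⟩; exact abs_cdf_sub_le_one μ x⟩
  refine le_antisymm (ciSup_le fun x => ?_) (ciSup_le fun q => abs_cdf_sub_le_kolDist μ q)
  by_contra! h
  have hc := (continuousWithinAt_cdf_sub μ x).abs
  have he := hc.eventually (lt_mem_nhds h)
  obtain ⟨u, hu, hsub⟩ := (mem_nhdsGE_iff_exists_Ico_subset' (show x < x + 1 by linarith)).1 he
  obtain ⟨q, hq1, hq2⟩ := exists_rat_btwn (mem_Ioi.1 hu)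
  have h1 := hsub ⟨hq1.le, hq2⟩
  exact absurd (le_ciSup hbdd q) (not_le.2 h1)

section Marginals

variable {E : Type*} [NormedAddCommGroup E] [InnerProductSpace ℝ E] [FiniteDimensional ℝ E]
  [MeasurableSpace E] [BorelSpace E]

/-- The law of the linear form `⟨g, ·⟩` under `Q`. -/
noncomputable def marg (Q : Measure E) (g : E) : Measure ℝ := Q.map (fun x => inner ℝ g x)

variable (Q : Measure E) [IsProbabilityMeasure Q]

instance (g : E) : IsProbabilityMeasure (marg Q g) :=
  Measure.isProbabilityMeasure_map (by fun_prop)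

lemma cdf_marg (g : E) (x : ℝ) : cdf (marg Q g) x = Q.real {y | inner ℝ g y ≤ x} := by
  rw [cdf_eq_real, marg, map_measureReal_apply (by fun_prop) measurableSet_Iic]
  rfl

lemma measurable_cdf_marg : Measurable (fun p : E × ℝ => cdf (marg Q p.1) p.2) := by
  simp_rw [cdf_marg]
  have hs : MeasurableSet {q : (E × ℝ) × E | inner ℝ q.1.1 q.2 ≤ q.1.2} :=
    measurableSet_le (by fun_prop) (by fun_prop)
  exact (measurable_measure_prodMk_left hs).ennreal_toReal

lemma measurable_kolDist_marg : Measurable (fun g : E => kolDist (marg Q g)) := by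
  simp_rw [kolDist_eq_iSup_rat]
  refine Measurable.iSup fun q => ?_
  exact (((measurable_cdf_marg Q).comp (by fun_prop : Measurable fun g : E => (g, (q : ℝ)))).sub
    measurable_const).abs

/-- The squared `L²`-distance of a law to the standard normal law. -/
noncomputable def l2Dist (μ : Measure ℝ) : ℝ := ∫ x : ℝ, (cdf μ x - Phi x) ^ 2

lemma l2Dist_nonneg (μ : Measure ℝ) : 0 ≤ l2Dist μ := integral_nonneg fun _ => sq_nonneg _

lemma measurable_l2Dist_marg : Measurable (fun g : E => l2Dist (marg Q g)) := by
  have h : Measurable (fun p : E × ℝ => (cdf (marg Q p.1) p.2 - Phi p.2) ^ 2) :=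
    ((measurable_cdf_marg Q).sub (monotone_Phi.measurable.comp measurable_snd)).pow_const 2
  exact h.stronglyMeasurable.integral_prod_right.measurable

/-- Isotropic laws, normalized by `E |x|² = 1`, with small fluctuations of the norm. -/
structure IsoLaw (Q : Measure E) (C : ℝ) : Prop where
  integrable_norm_four : Integrable (fun x => ‖x‖ ^ 4) Q
  integral_inner_sq : ∀ v : E, ∫ x, inner ℝ v x ^ 2 ∂Q = ‖v‖ ^ 2 / Module.finrank ℝ E
  integral_dev_sq_le : ∫ x, (‖x‖ ^ 2 - 1) ^ 2 ∂Q ≤ C / Module.finrank ℝ E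

namespace IsoLaw

variable {Q} {C : ℝ} (h : IsoLaw Q C)
include h

lemma integrable_norm_sq : Integrable (fun x => ‖x‖ ^ 2) Q := by
  have hm : MemLp (fun x : E => ‖x‖ ^ 2) 2 Q :=
    (memLp_two_iff_integrable_sq (by fun_prop)).2
      (h.integrable_norm_four.congr (Filter.Eventually.of_forall fun x => by ring))
  exact hm.integrable (by norm_num)

lemma memLp_norm : MemLp (fun x => ‖x‖) 2 Q :=
  (memLp_two_iff_integrable_sq (by fun_prop)).2 h.integrable_norm_sq

lemma integrable_norm : Integrable (fun x => ‖x‖) Q := h.memLp_norm.integrable (by norm_num)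

lemma integrable_id : Integrable (fun x : E => x) Q :=
  (integrable_norm_iff (by fun_prop)).1 h.integrable_norm

lemma memLp_inner (v : E) : MemLp (fun x => inner ℝ v x) 2 Q := by
  refine (h.memLp_norm.const_mul ‖v‖).mono (by fun_prop) (Filter.Eventually.of_forall fun x => ?_)
  rw [norm_mul, norm_norm, norm_norm]
  exact norm_inner_le_norm v x

lemma integrable_id_marg (g : E) : Integrable id (marg Q g) := by
  rw [marg, integrable_map_measure (by fun_prop) (by fun_prop)]
  exact (h.memLp_inner g).integrable (by norm_num)

lemma integrable_dev_sq : Integrable (fun x => (‖x‖ ^ 2 - 1) ^ 2) Q := by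
  have : (fun x : E => (‖x‖ ^ 2 - 1) ^ 2) = fun x => ‖x‖ ^ 4 - 2 * ‖x‖ ^ 2 + 1 := by
    ext x; ring
  rw [this]
  exact (h.integrable_norm_four.sub (h.integrable_norm_sq.const_mul 2)).add (integrable_const _)

lemma memLp_dev : MemLp (fun x => ‖x‖ ^ 2 - 1) 2 Q :=
  (memLp_two_iff_integrable_sq (by fun_prop)).2 h.integrable_dev_sq

lemma integral_norm_sq [Nontrivial E] : ∫ x, ‖x‖ ^ 2 ∂Q = 1 := by
  have hn : (Module.finrank ℝ E : ℝ) ≠ 0 := by exact_mod_cast (Module.finrank_pos (R := ℝ)).ne'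
  set b := stdOrthonormalBasis ℝ E
  have e : ∀ x : E, ‖x‖ ^ 2 = ∑ i, inner ℝ (b i) x ^ 2 := fun x =>
    (b.sum_sq_inner_right x).symm
  simp_rw [e]
  rw [integral_finsetSum _ fun i _ => (h.memLp_inner (b i)).integrable_sq]
  simp_rw [h.integral_inner_sq]
  simp [hn]

/-- With m the mean, isotropy tested at v = m gives |m|⁴ = (E⟨m,x⟩)² ≤ E⟨m,x⟩² = |m|²/n. -/
lemma sq_norm_mean_le [Nontrivial E] : ‖∫ x, x ∂Q‖ ^ 2 ≤ 1 / Module.finrank ℝ E := by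
  have hn : (0 : ℝ) < Module.finrank ℝ E := by exact_mod_cast (Module.finrank_pos (R := ℝ))
  set m := ∫ x, x ∂Q with hm
  have h1 : ‖m‖ ^ 2 = ∫ x, inner ℝ m x ∂Q := by
    rw [integral_inner h.integrable_id, ← hm, real_inner_self_eq_norm_sq]
  have h2 := sq_integral_le (h.memLp_inner m)
  rw [h.integral_inner_sq, ← h1] at h2
  rcases (sq_nonneg ‖m‖).eq_or_lt with h0 | h0
  · rw [← h0]; positivity
  · rw [le_div_iff₀ hn] at h2 ⊢
    nlinarith

lemma integrable_inner_sq_prod :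
    Integrable (fun p : E × E => inner ℝ p.1 p.2 ^ 2) (Q.prod Q) := by
  refine (h.integrable_norm_sq.mul_prod h.integrable_norm_sq).mono'
    (Continuous.aestronglyMeasurable (by fun_prop)) (Filter.Eventually.of_forall fun p => ?_)
  rw [Real.norm_eq_abs, abs_of_nonneg (sq_nonneg _), ← mul_pow, ← sq_abs]
  gcongr
  exact abs_real_inner_le_norm _ _

lemma memLp_inner_prod : MemLp (fun p : E × E => inner ℝ p.1 p.2) 2 (Q.prod Q) :=
  (memLp_two_iff_integrable_sq (Continuous.aestronglyMeasurable (by fun_prop))).2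
    h.integrable_inner_sq_prod

lemma integral_inner_sq_prod [Nontrivial E] :
    ∫ p : E × E, inner ℝ p.1 p.2 ^ 2 ∂(Q.prod Q) = 1 / Module.finrank ℝ E := by
  rw [integral_prod _ h.integrable_inner_sq_prod]
  simp only [h.integral_inner_sq]
  rw [integral_div, h.integral_norm_sq]

lemma integral_inner_prod :
    ∫ p : E × E, inner ℝ p.1 p.2 ∂(Q.prod Q) = ‖∫ x, x ∂Q‖ ^ 2 := by
  rw [integral_prod _ (h.memLp_inner_prod.integrable (by norm_num))]
  simp only [integral_inner h.integrable_id]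
  simp_rw [real_inner_comm (∫ x, x ∂Q)]
  rw [integral_inner h.integrable_id, real_inner_self_eq_norm_sq]

/-- Expanding the square, |x-y|²/2 - 1 is half the sum of the two centered norm deviations minus
⟨x,y⟩. All three pieces are small in L², so |x-y|²/2 concentrates at 1, and its mean differs from 1
by the squared norm of the barycenter only. -/
lemma memLp_integral_halfDist [Nontrivial E] :
    MemLp (fun p : E × E => ‖p.1 - p.2‖ ^ 2 / 2 - 1) 2 (Q.prod Q) ∧
    ∫ p : E × E, (‖p.1 - p.2‖ ^ 2 / 2 - 1) ∂(Q.prod Q) = - ‖∫ x, x ∂Q‖ ^ 2 := by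
  have e : (fun p : E × E => ‖p.1 - p.2‖ ^ 2 / 2 - 1) = fun p =>
      (‖p.1‖ ^ 2 - 1) * (1 / 2) + (‖p.2‖ ^ 2 - 1) * (1 / 2) - inner ℝ p.1 p.2 := by
    ext p; rw [norm_sub_sq_real]; ring
  have m1 : MemLp (fun p : E × E => (‖p.1‖ ^ 2 - 1) * (1 / 2)) 2 (Q.prod Q) :=
    (h.memLp_dev.mul_const (1 / 2)).comp_fst Q
  have m2 : MemLp (fun p : E × E => (‖p.2‖ ^ 2 - 1) * (1 / 2)) 2 (Q.prod Q) :=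
    (h.memLp_dev.mul_const (1 / 2)).comp_snd Q
  have m12 : MemLp (fun p : E × E => (‖p.1‖ ^ 2 - 1) * (1 / 2) + (‖p.2‖ ^ 2 - 1) * (1 / 2)) 2
    (Q.prod Q) := m1.add m2
  rw [e]
  refine ⟨m12.sub h.memLp_inner_prod, ?_⟩
  rw [integral_sub (m12.integrable (by norm_num)) (h.memLp_inner_prod.integrable (by norm_num)),
    integral_add (m1.integrable (by norm_num)) (m2.integrable (by norm_num)),
    integral_fun_fst (fun x : E => (‖x‖ ^ 2 - 1) * (1 / 2)),
    integral_fun_snd (fun x : E => (‖x‖ ^ 2 - 1) * (1 / 2)), h.integral_inner_prod,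
    integral_mul_const, integral_sub h.integrable_norm_sq (integrable_const _), h.integral_norm_sq]
  simp

lemma memLp_halfDist_sub [Nontrivial E] :
    MemLp (fun p : E × E => ‖p.1 - p.2‖ ^ 2 / 2 - 1) 2 (Q.prod Q) :=
  h.memLp_integral_halfDist.1

lemma integral_halfDist_sub [Nontrivial E] :
    -(1 / (Module.finrank ℝ E : ℝ)) ≤ ∫ p : E × E, (‖p.1 - p.2‖ ^ 2 / 2 - 1) ∂(Q.prod Q) ∧
    ∫ p : E × E, (‖p.1 - p.2‖ ^ 2 / 2 - 1) ∂(Q.prod Q) ≤ 0 := by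
  have := h.sq_norm_mean_le
  rw [h.memLp_integral_halfDist.2]
  constructor <;> nlinarith [sq_nonneg ‖∫ x, x ∂Q‖]

lemma integral_halfDist_sub_sq_le [Nontrivial E] :
    ∫ p : E × E, (‖p.1 - p.2‖ ^ 2 / 2 - 1) ^ 2 ∂(Q.prod Q) ≤
      (2 * C + 2) / Module.finrank ℝ E := by
  have i1 := h.integrable_dev_sq.comp_fst Q
  have i2 := h.integrable_dev_sq.comp_snd Q
  have i3 := h.integrable_inner_sq_prod.const_mul 2
  have i12 : Integrable (fun p : E × E => (‖p.1‖ ^ 2 - 1) ^ 2 + (‖p.2‖ ^ 2 - 1) ^ 2) (Q.prod Q) :=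
    i1.add i2
  have hle : ∫ p : E × E, (‖p.1 - p.2‖ ^ 2 / 2 - 1) ^ 2 ∂(Q.prod Q) ≤
      ∫ p : E × E, ((‖p.1‖ ^ 2 - 1) ^ 2 + (‖p.2‖ ^ 2 - 1) ^ 2 + 2 * inner ℝ p.1 p.2 ^ 2)
        ∂(Q.prod Q) := by
    refine integral_mono h.memLp_halfDist_sub.integrable_sq (i12.add i3) fun p => ?_
    beta_reduce
    rw [norm_sub_sq_real]
    nlinarith [sq_nonneg (‖p.1‖ ^ 2 - ‖p.2‖ ^ 2),
      sq_nonneg ((‖p.1‖ ^ 2 - 1) + (‖p.2‖ ^ 2 - 1) + 2 * inner ℝ p.1 p.2)]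
  rw [integral_add i12 i3, integral_add i1 i2, integral_fun_fst (fun x : E => (‖x‖ ^ 2 - 1) ^ 2),
    integral_fun_snd (fun x : E => (‖x‖ ^ 2 - 1) ^ 2), integral_const_mul,
    h.integral_inner_sq_prod] at hle
  simp only [probReal_univ, one_smul] at hle
  have := h.integral_dev_sq_le
  calc _ ≤ _ := hle
    _ ≤ C / Module.finrank ℝ E + C / Module.finrank ℝ E + 2 * (1 / Module.finrank ℝ E) := by gcongr
    _ = _ := by ring

end IsoLaw

end Marginals

/-! ### Elementary estimates for exponentials and the logarithmic weight. -/

lemma sq_mul_exp_neg_half_le {τ : ℝ} (hτ : 0 ≤ τ) : τ ^ 2 * Real.exp (-τ / 2) ≤ 8 * min 1 τ := by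
  have h := Real.quadratic_le_exp_of_nonneg (show 0 ≤ τ / 2 by positivity)
  have e : Real.exp (-τ / 2) = (Real.exp (τ / 2))⁻¹ := by rw [← Real.exp_neg]; congr 1; ring
  rw [e, ← div_eq_mul_inv, div_le_iff₀ (Real.exp_pos _)]
  rcases min_cases 1 τ with ⟨h1, h2⟩ | ⟨h1, h2⟩
  · rw [h1]; nlinarith
  · rw [h1]; nlinarith [mul_le_mul_of_nonneg_left h hτ]

lemma exp_neg_sub_le (u : ℝ) : Real.exp (-u) - 1 + u ≤ u ^ 2 * max 1 (Real.exp (-u)) := by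
  rcases le_total 0 u with h | h
  · have h1 := Real.add_one_le_exp u
    have h2 : Real.exp (-u) ≤ 1 / (1 + u) := by
      rw [Real.exp_neg, ← one_div]
      exact one_div_le_one_div_of_le (by linarith) (by linarith)
    have h3 : 1 / (1 + u) - 1 + u ≤ u ^ 2 := by
      have e : 1 / (1 + u) - 1 + u = u ^ 2 / (1 + u) := by field_simp; ring
      rw [e]
      exact div_le_self (sq_nonneg u) (by linarith)
    calc _ ≤ u ^ 2 * 1 := by linarith
      _ ≤ _ := by gcongr; exact le_max_left _ _
  · have h1 := Real.add_one_le_exp u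
    have h2 : Real.exp (-u) * Real.exp u = 1 := by rw [← Real.exp_add]; simp
    have h3 := Real.exp_pos (-u)
    calc Real.exp (-u) - 1 + u ≤ u ^ 2 * Real.exp (-u) := by
          have : 1 - u ≥ 0 := by linarith
          nlinarith [mul_le_mul_of_nonneg_left (mul_le_mul_of_nonneg_left h1 h3.le) this]
      _ ≤ _ := by gcongr; exact le_max_right _ _

/-- A second order Taylor bound at D = 1, uniform in τ. The factor min(1,τ) in the remainder
matters: with τ = t² it compensates the later division by t² near the origin. For D ≥ 1/2 the
remainder is τ² e^(-τ/2) (D-1)²; for D < 1/2 one has (D-1)² ≥ 1/4 and a crude bound suffices. -/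
lemma exp_deviation_le {τ D : ℝ} (hτ : 0 ≤ τ) (hD : 0 ≤ D) :
    Real.exp (-τ * D) ≤ Real.exp (-τ) * (1 - τ * (D - 1)) + 8 * min 1 τ * (D - 1) ^ 2 := by
  have hmin : 0 ≤ min 1 τ := le_min (by norm_num) hτ
  rcases le_total (1 / 2) D with h | h
  · have h1 := exp_neg_sub_le (τ * (D - 1))
    have h2 : max 1 (Real.exp (-(τ * (D - 1)))) ≤ Real.exp (τ / 2) := by
      refine max_le (Real.one_le_exp (by positivity)) (Real.exp_le_exp.2 ?_)
      nlinarith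
    have h3 : Real.exp (-τ * D) = Real.exp (-τ) * Real.exp (-(τ * (D - 1))) := by
      rw [← Real.exp_add]; congr 1; ring
    have h4 : Real.exp (-τ) * Real.exp (τ / 2) = Real.exp (-τ / 2) := by
      rw [← Real.exp_add]; congr 1; ring
    have h5 := sq_mul_exp_neg_half_le hτ
    have h6 : Real.exp (-(τ * (D - 1))) ≤
        1 - τ * (D - 1) + (τ * (D - 1)) ^ 2 * Real.exp (τ / 2) := by
      have := mul_le_mul_of_nonneg_left h2 (sq_nonneg (τ * (D - 1)))
      linarith
    rw [h3]
    calc _ ≤ Real.exp (-τ) * (1 - τ * (D - 1) + (τ * (D - 1)) ^ 2 * Real.exp (τ / 2)) := by gcongr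
      _ = Real.exp (-τ) * (1 - τ * (D - 1)) + τ ^ 2 * (Real.exp (-τ) * Real.exp (τ / 2)) * (D - 1) ^ 2 := by
          ring
      _ ≤ _ := by rw [h4]; gcongr
  · have h1 : Real.exp (-τ * D) - Real.exp (-τ) ≤ min 1 τ := by
      refine le_min ?_ ?_
      · have : Real.exp (-τ * D) ≤ 1 := by rw [Real.exp_le_one_iff]; nlinarith
        linarith [Real.exp_pos (-τ)]
      · have e : Real.exp (-τ) = Real.exp (-τ * D) * Real.exp (-(τ * (1 - D))) := by
          rw [← Real.exp_add]; congr 1; ring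
        have h2 := Real.add_one_le_exp (-(τ * (1 - D)))
        have h3 : Real.exp (-τ * D) ≤ 1 := by rw [Real.exp_le_one_iff]; nlinarith
        have h4 := Real.exp_pos (-τ * D)
        have h5 : 0 ≤ τ * (1 - D) := mul_nonneg hτ (by linarith)
        have h6 : Real.exp (-τ * D) - Real.exp (-τ) ≤ Real.exp (-τ * D) * (τ * (1 - D)) := by
          rw [e]; nlinarith
        have h7 : Real.exp (-τ * D) * (τ * (1 - D)) ≤ 1 * (τ * 1) := by
          gcongr; linarith
        linarith
    have h2 : 0 ≤ Real.exp (-τ) * (τ * (1 - D)) :=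
      mul_nonneg (Real.exp_pos _).le (mul_nonneg hτ (by linarith))
    have h4 : 1 / 4 ≤ (D - 1) ^ 2 := by nlinarith
    have h3 : min 1 τ ≤ 8 * min 1 τ * (D - 1) ^ 2 := by nlinarith
    nlinarith

/-- The weight `min 1 (1/t)` has logarithmic mass on the scale `1/σ`. -/
lemma integral_gaussian_weight_le {σ : ℝ} (hσ : 0 < σ) (hσ1 : σ ≤ 1) :
    Integrable (fun t : ℝ => Real.exp (-σ ^ 2 * t ^ 2 / 2) * min 1 |t|⁻¹) ∧
    ∫ t : ℝ, Real.exp (-σ ^ 2 * t ^ 2 / 2) * min 1 |t|⁻¹ ≤ 6 + 2 * Real.log σ⁻¹ := by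
  have hg : Integrable (fun t : ℝ => Real.exp (-(σ ^ 2 / 2) * t ^ 2)) :=
    integrable_exp_neg_mul_sq (by positivity)
  have hexp : ∀ t : ℝ, Real.exp (-σ ^ 2 * t ^ 2 / 2) = Real.exp (-(σ ^ 2 / 2) * t ^ 2) := fun t => by
    congr 1; ring
  have hmeas : Measurable (fun t : ℝ => Real.exp (-σ ^ 2 * t ^ 2 / 2) * min 1 |t|⁻¹) := by fun_prop
  have hint : Integrable (fun t : ℝ => Real.exp (-σ ^ 2 * t ^ 2 / 2) * min 1 |t|⁻¹) := by
    refine hg.mono' hmeas.aestronglyMeasurable (Filter.Eventually.of_forall fun t => ?_)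
    have h0 : 0 ≤ min 1 |t|⁻¹ := le_min (by norm_num) (by positivity)
    rw [hexp, Real.norm_eq_abs, abs_of_nonneg (mul_nonneg (Real.exp_pos _).le h0)]
    calc _ ≤ Real.exp (-(σ ^ 2 / 2) * t ^ 2) * 1 := by gcongr; exact min_le_left _ _
      _ = _ := mul_one _
  refine ⟨hint, ?_⟩
  have hσi : 1 ≤ σ⁻¹ := (one_le_inv₀ hσ).2 hσ1
  have e1 : ∀ t : ℝ, Real.exp (-σ ^ 2 * t ^ 2 / 2) * min 1 |t|⁻¹ =
      (fun y => Real.exp (-σ ^ 2 * y ^ 2 / 2) * min 1 y⁻¹) |t| := fun t => by simp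
  simp_rw [e1]
  rw [integral_comp_abs (f := fun y => Real.exp (-σ ^ 2 * y ^ 2 / 2) * min 1 y⁻¹)]
  -- Three ranges: the weight is at most 1 on (0,1], at most 1/y on (1,1/σ], which gives the
  -- logarithm, and beyond 1/σ it is at most σ against an integrable Gaussian.
  set A : ℝ → ℝ := (Ioc (0 : ℝ) 1).indicator 1
  set B : ℝ → ℝ := (Ioc (1 : ℝ) σ⁻¹).indicator fun y => y⁻¹
  have iA : Integrable A := (integrable_indicator_iff measurableSet_Ioc).2
    (integrableOn_const (C := (1 : ℝ)) (by simp) (by simp))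
  have iB : Integrable B := by
    refine (integrable_indicator_iff measurableSet_Ioc).2 ?_
    rw [← intervalIntegrable_iff_integrableOn_Ioc_of_le hσi]
    exact intervalIntegral.intervalIntegrable_inv (fun x hx => by
      rw [uIcc_of_le hσi] at hx; linarith [hx.1]) continuousOn_id
  have vA : ∫ y in Ioi (0 : ℝ), A y ≤ 1 := by
    calc ∫ y in Ioi (0 : ℝ), A y ≤ ∫ y, A y := setIntegral_le_integral iA
          (Filter.Eventually.of_forall fun y => indicator_nonneg (fun _ _ => by simp) y)
      _ = 1 := by rw [integral_indicator_one measurableSet_Ioc]; simp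
  have vB : ∫ y in Ioi (0 : ℝ), B y ≤ Real.log σ⁻¹ := by
    calc ∫ y in Ioi (0 : ℝ), B y ≤ ∫ y, B y := setIntegral_le_integral iB
          (Filter.Eventually.of_forall fun y => indicator_nonneg
            (fun z hz => by have := hz.1; positivity) y)
      _ = Real.log σ⁻¹ := by
          rw [integral_indicator measurableSet_Ioc, ← intervalIntegral.integral_of_le hσi,
            integral_inv_of_pos (by norm_num) (by positivity)]
          simp
  have vG : ∫ y in Ioi (0 : ℝ), Real.exp (-(σ ^ 2 / 2) * y ^ 2) * σ ≤ 2 := by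
    rw [integral_mul_const, integral_gaussian_Ioi, show Real.pi / (σ ^ 2 / 2) = 2 * Real.pi / σ ^ 2 by
      field_simp, Real.sqrt_div' _ (by positivity), Real.sqrt_sq hσ.le]
    have : Real.sqrt (2 * Real.pi) ≤ 4 := by
      rw [Real.sqrt_le_left (by norm_num)]; nlinarith [Real.pi_le_four]
    field_simp
    linarith
  have hle : ∫ y in Ioi (0 : ℝ), Real.exp (-σ ^ 2 * y ^ 2 / 2) * min 1 y⁻¹ ≤
      ∫ y in Ioi (0 : ℝ), ((A y + B y) + Real.exp (-(σ ^ 2 / 2) * y ^ 2) * σ) := by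
    refine setIntegral_mono_on ?_ ((iA.add iB).add (hg.mul_const σ)).integrableOn measurableSet_Ioi ?_
    · refine hint.integrableOn.congr_fun (fun y hy => ?_) measurableSet_Ioi
      simp only [abs_of_pos (mem_Ioi.1 hy)]
    · intro y hy
      have hy0 : 0 < y := hy
      have hA0 : 0 ≤ A y := indicator_nonneg (fun _ _ => by simp) y
      have hB0 : 0 ≤ B y := indicator_nonneg (fun z hz => by have := hz.1; positivity) y
      have hexp1 : Real.exp (-σ ^ 2 * y ^ 2 / 2) ≤ 1 := by
        rw [Real.exp_le_one_iff]; nlinarith [mul_nonneg (sq_nonneg σ) (sq_nonneg y)]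
      have hG0 : 0 ≤ Real.exp (-(σ ^ 2 / 2) * y ^ 2) * σ := by positivity
      have hmin0 : 0 ≤ min 1 y⁻¹ := le_min (by norm_num) (by positivity)
      by_cases h1 : y ≤ 1
      · have : A y = 1 := indicator_of_mem (show y ∈ Ioc (0 : ℝ) 1 from ⟨hy0, h1⟩) _
        have : Real.exp (-σ ^ 2 * y ^ 2 / 2) * min 1 y⁻¹ ≤ 1 * 1 := by
          gcongr; exact min_le_left _ _
        linarith
      by_cases h2 : y ≤ σ⁻¹
      · have : B y = y⁻¹ := indicator_of_mem (show y ∈ Ioc (1 : ℝ) σ⁻¹ from ⟨not_le.1 h1, h2⟩) _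
        have : Real.exp (-σ ^ 2 * y ^ 2 / 2) * min 1 y⁻¹ ≤ 1 * y⁻¹ := by
          gcongr; exact min_le_right _ _
        linarith
      · have h3 : y⁻¹ ≤ σ := by
          rw [inv_le_comm₀ hy0 hσ]; exact (not_le.1 h2).le
        have : Real.exp (-σ ^ 2 * y ^ 2 / 2) * min 1 y⁻¹ ≤ Real.exp (-(σ ^ 2 / 2) * y ^ 2) * σ := by
          rw [hexp]; gcongr; exact (min_le_right _ _).trans h3
        linarith
  have iAB : Integrable (fun y => A y + B y) := iA.add iB
  rw [integral_add iAB.integrableOn (hg.mul_const σ).integrableOn,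
    integral_add iA.integrableOn iB.integrableOn] at hle
  linarith

lemma integrable_and_integral_le_of_lintegral {α : Type*} [MeasurableSpace α] {μ : Measure α}
    {f : α → ℝ} (hf : AEStronglyMeasurable f μ) (h0 : ∀ a, 0 ≤ f a) {B : ℝ} (hB : 0 ≤ B)
    (h : ∫⁻ a, ENNReal.ofReal (f a) ∂μ ≤ ENNReal.ofReal B) :
    Integrable f μ ∧ ∫ a, f a ∂μ ≤ B := by
  have hi : Integrable f μ := ⟨hf, by
    rw [hasFiniteIntegral_iff_ofReal (Filter.Eventually.of_forall h0)]
    exact h.trans_lt ENNReal.ofReal_lt_top⟩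
  refine ⟨hi, ?_⟩
  rw [← ENNReal.ofReal_le_ofReal_iff hB,
    ofReal_integral_eq_lintegral_ofReal hi (Filter.Eventually.of_forall h0)]
  exact h

/-! ### Characteristic functions of typical marginals. -/

section CharFun

variable {E : Type*} [NormedAddCommGroup E] [InnerProductSpace ℝ E] [FiniteDimensional ℝ E]
  [MeasurableSpace E] [BorelSpace E]

lemma integral_cos_inner_stdGaussian (v : E) (t : ℝ) :
    ∫ g, Real.cos (t * inner ℝ g v) ∂(stdGaussian E) = Real.exp (-t ^ 2 * (‖v‖ ^ 2 / 2)) := by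
  have h := congrArg Complex.re (charFun_stdGaussian (t • v))
  have hi : Integrable (fun g : E => Complex.exp ((inner ℝ g (t • v) : ℝ) * Complex.I))
      (stdGaussian E) := Integrable.of_bound (Continuous.aestronglyMeasurable (by fun_prop)) 1
    (Filter.Eventually.of_forall fun g => by rw [Complex.norm_exp_ofReal_mul_I])
  rw [charFun_apply] at h
  have h2 := Complex.reCLM.integral_comp_comm hi
  simp only [Complex.reCLM_apply, Complex.exp_ofReal_mul_I_re, inner_smul_right] at h2 h
  rw [h2, h, ← Complex.ofReal_pow, ← Complex.ofReal_neg,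
    show ((-‖t • v‖ ^ 2 : ℝ) : ℂ) / 2 = ((-‖t • v‖ ^ 2 / 2 : ℝ) : ℂ) by push_cast; ring,
    Complex.exp_ofReal_re, norm_smul, mul_pow, Real.norm_eq_abs, sq_abs]
  congr 1; ring

lemma charFun_marg (Q : Measure E) (g : E) (t : ℝ) :
    charFun (marg Q g) t = ∫ x, Complex.exp ((t * inner ℝ g x : ℝ) * Complex.I) ∂Q := by
  rw [charFun_apply_real, marg, integral_map (by fun_prop)
    (Continuous.aestronglyMeasurable (by fun_prop))]
  push_cast; rfl

variable (Q : Measure E) [IsProbabilityMeasure Q]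

lemma stronglyMeasurable_charFun_marg :
    StronglyMeasurable (fun p : E × ℝ => charFun (marg Q p.1) p.2) := by
  simp_rw [charFun_marg]
  exact StronglyMeasurable.integral_prod_right (f := fun (p : E × ℝ) (x : E) =>
    Complex.exp ((p.2 * inner ℝ p.1 x : ℝ) * Complex.I)) (Continuous.stronglyMeasurable (by fun_prop))

/-- The square |E e^{itξ}|² is the mean of cos t(ξ-ξ') over an independent copy, and a real c meets
only the real part. The result is linear in cosines of linear forms in g, ready to be averaged over
g. -/
lemma norm_charFun_marg_sub_sq (g : E) (t c : ℝ) :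
    ‖charFun (marg Q g) t - c‖ ^ 2 = ∫ p : E × E, Real.cos (t * inner ℝ g (p.1 - p.2)) ∂(Q.prod Q)
      - 2 * c * ∫ x, Real.cos (t * inner ℝ g x) ∂Q + c ^ 2 := by
  have hi : Integrable (fun x : E => Complex.exp ((t * inner ℝ g x : ℝ) * Complex.I)) Q :=
    Integrable.of_bound (Continuous.aestronglyMeasurable (by fun_prop)) 1
    (Filter.Eventually.of_forall fun g => by rw [Complex.norm_exp_ofReal_mul_I])
  have hre := Complex.reCLM.integral_comp_comm hi
  have him := Complex.imCLM.integral_comp_comm hi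
  simp only [Complex.reCLM_apply, Complex.imCLM_apply, Complex.exp_ofReal_mul_I_re,
    Complex.exp_ofReal_mul_I_im] at hre him
  have hcos : ∀ κ : Measure E, IsProbabilityMeasure κ →
      Integrable (fun x : E => Real.cos (t * inner ℝ g x)) κ := fun κ _ =>
    Integrable.of_bound (Continuous.aestronglyMeasurable (by fun_prop)) 1
      (Filter.Eventually.of_forall fun x => Real.abs_cos_le_one _)
  have hsin : ∀ κ : Measure E, IsProbabilityMeasure κ →
      Integrable (fun x : E => Real.sin (t * inner ℝ g x)) κ := fun κ _ =>
    Integrable.of_bound (Continuous.aestronglyMeasurable (by fun_prop)) 1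
      (Filter.Eventually.of_forall fun x => Real.abs_sin_le_one _)
  have hprod : ∫ p : E × E, Real.cos (t * inner ℝ g (p.1 - p.2)) ∂(Q.prod Q) =
      (∫ x, Real.cos (t * inner ℝ g x) ∂Q) ^ 2 + (∫ x, Real.sin (t * inner ℝ g x) ∂Q) ^ 2 := by
    simp_rw [inner_sub_right, mul_sub, Real.cos_sub]
    rw [integral_add ((hcos Q ‹_›).mul_prod (hcos Q ‹_›)) ((hsin Q ‹_›).mul_prod (hsin Q ‹_›)),
      integral_prod_mul (fun x : E => Real.cos (t * inner ℝ g x))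
        (fun x : E => Real.cos (t * inner ℝ g x)),
      integral_prod_mul (fun x : E => Real.sin (t * inner ℝ g x))
        (fun x : E => Real.sin (t * inner ℝ g x))]
    ring
  rw [hprod, charFun_marg, ← Complex.normSq_eq_norm_sq, Complex.normSq_apply, Complex.sub_re,
    Complex.sub_im, Complex.ofReal_re, Complex.ofReal_im, ← hre, ← him]
  ring

/-- Typical marginals have a nearly Gaussian characteristic function. -/
lemma IsoLaw.integral_norm_charFun_marg_sub_sq_le {Q : Measure E} [IsProbabilityMeasure Q]
    [Nontrivial E] {C : ℝ} (h : IsoLaw Q C) (t : ℝ) :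
    ∫ g, ‖charFun (marg Q g) t - Real.exp (-t ^ 2 / 2)‖ ^ 2 ∂(stdGaussian E) ≤
      min 1 (t ^ 2) * ((16 * C + 17) / Module.finrank ℝ E) := by
  set c := Real.exp (-t ^ 2 / 2) with hc
  have b1 : Integrable (fun q : E × (E × E) => Real.cos (t * inner ℝ q.1 (q.2.1 - q.2.2)))
      ((stdGaussian E).prod (Q.prod Q)) :=
    Integrable.of_bound (Continuous.aestronglyMeasurable (by fun_prop)) 1
      (Filter.Eventually.of_forall fun x => Real.abs_cos_le_one _)
  have b2 : Integrable (fun q : E × E => Real.cos (t * inner ℝ q.1 q.2)) ((stdGaussian E).prod Q) :=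
    Integrable.of_bound (Continuous.aestronglyMeasurable (by fun_prop)) 1
      (Filter.Eventually.of_forall fun x => Real.abs_cos_le_one _)
  have s1 := integral_integral_swap (f := fun (g : E) (p : E × E) =>
    Real.cos (t * inner ℝ g (p.1 - p.2))) b1
  have s2 := integral_integral_swap (f := fun (g : E) (x : E) => Real.cos (t * inner ℝ g x)) b2
  simp only [integral_cos_inner_stdGaussian] at s1 s2
  simp_rw [norm_charFun_marg_sub_sq]
  have j1 := b1.integral_prod_left
  have j2 := b2.integral_prod_left.const_mul (2 * c)
  have j12 : Integrable (fun g : E => ∫ p : E × E, Real.cos (t * inner ℝ g (p.1 - p.2)) ∂(Q.prod Q)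
    - 2 * c * ∫ x, Real.cos (t * inner ℝ g x) ∂Q) (stdGaussian E) := j1.sub j2
  rw [integral_add j12 (integrable_const _), integral_sub j1 j2, integral_const_mul, s1, s2]
  have hcc : Real.exp (-t ^ 2) = c ^ 2 := by rw [hc, ← Real.exp_nat_mul]; congr 1; push_cast; ring
  have mD := h.memLp_halfDist_sub
  have iD := mD.integrable (by norm_num)
  -- The averaged pair term, expanded around |x-y|²/2 = 1; there e^(-t²) is c².
  have k1 : ∫ p : E × E, Real.exp (-t ^ 2 * (‖p.1 - p.2‖ ^ 2 / 2)) ∂(Q.prod Q) ≤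
      ∫ p : E × E, (c ^ 2 - (c ^ 2 * t ^ 2) * (‖p.1 - p.2‖ ^ 2 / 2 - 1) +
        (8 * min 1 (t ^ 2)) * (‖p.1 - p.2‖ ^ 2 / 2 - 1) ^ 2) ∂(Q.prod Q) := by
    refine integral_mono_of_nonneg (Filter.Eventually.of_forall fun p => (Real.exp_pos _).le)
      (((integrable_const _).sub (iD.const_mul _)).add (mD.integrable_sq.const_mul _))
      (Filter.Eventually.of_forall fun p => ?_)
    have := exp_deviation_le (sq_nonneg t) (show 0 ≤ ‖p.1 - p.2‖ ^ 2 / 2 by positivity)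
    rw [hcc] at this
    beta_reduce
    linarith
  have iD' := iD.const_mul (c ^ 2 * t ^ 2)
  have iDc : Integrable (fun p : E × E => c ^ 2 - (c ^ 2 * t ^ 2) * (‖p.1 - p.2‖ ^ 2 / 2 - 1))
    (Q.prod Q) := (integrable_const _).sub iD'
  rw [integral_add iDc (mD.integrable_sq.const_mul _), integral_sub (integrable_const _) iD',
    integral_const_mul, integral_const_mul] at k1
  have iA : Integrable (fun x : E => ‖x‖ ^ 2 - 1) Q := h.memLp_dev.integrable (by norm_num)
  -- The cross term enters with a minus sign, so the tangent line below the exponential is enough,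
  -- and its linear part has mean zero. With `k1` the leading terms c² - 2c² + c² cancel.
  have k2 : ∫ x : E, (c - (c * t ^ 2 / 2) * (‖x‖ ^ 2 - 1)) ∂Q ≤
      ∫ x : E, Real.exp (-t ^ 2 * (‖x‖ ^ 2 / 2)) ∂Q := by
    refine integral_mono ((integrable_const _).sub (iA.const_mul _)) ?_ fun x => ?_
    · refine Integrable.of_bound (Continuous.aestronglyMeasurable (by fun_prop)) 1
        (Filter.Eventually.of_forall fun x => ?_)
      rw [Real.norm_eq_abs, Real.abs_exp, Real.exp_le_one_iff]
      nlinarith [mul_nonneg (sq_nonneg t) (sq_nonneg ‖x‖)]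
    · have e : Real.exp (-t ^ 2 * (‖x‖ ^ 2 / 2)) = c * Real.exp (-(t ^ 2 / 2) * (‖x‖ ^ 2 - 1)) := by
        rw [hc, ← Real.exp_add]; congr 1; ring
      beta_reduce
      rw [e]
      have := Real.add_one_le_exp (-(t ^ 2 / 2) * (‖x‖ ^ 2 - 1))
      nlinarith [mul_le_mul_of_nonneg_left this (Real.exp_pos (-t ^ 2 / 2)).le]
  rw [integral_sub (integrable_const _) (iA.const_mul _), integral_const_mul,
    integral_sub h.integrable_norm_sq (integrable_const _), h.integral_norm_sq] at k2
  have l1 := h.integral_halfDist_sub.1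
  have l2 := h.integral_halfDist_sub_sq_le
  simp only [integral_const, probReal_univ, smul_eq_mul, one_mul, mul_one, sub_self, mul_zero,
    sub_zero] at k1 k2 ⊢
  set n : ℝ := (Module.finrank ℝ E : ℝ)
  have hn0 : 0 ≤ n := Nat.cast_nonneg _
  have hw : c ^ 2 * t ^ 2 ≤ min 1 (t ^ 2) := by
    rw [← hcc]
    refine le_min ?_ ?_
    · have := Real.add_one_le_exp (t ^ 2)
      rw [Real.exp_neg, inv_mul_le_iff₀ (Real.exp_pos _)]
      linarith
    · have : Real.exp (-t ^ 2) ≤ 1 := by rw [Real.exp_le_one_iff]; nlinarith [sq_nonneg t]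
      nlinarith [sq_nonneg t]
  have hm0 : 0 ≤ min 1 (t ^ 2) := le_min (by norm_num) (sq_nonneg t)
  have hc0 : 0 ≤ c := (Real.exp_pos _).le
  have f1 : -(c ^ 2 * t ^ 2 * ∫ p : E × E, (‖p.1 - p.2‖ ^ 2 / 2 - 1) ∂(Q.prod Q)) ≤
      min 1 (t ^ 2) * (1 / n) := by
    calc _ = c ^ 2 * t ^ 2 * -(∫ p : E × E, (‖p.1 - p.2‖ ^ 2 / 2 - 1) ∂(Q.prod Q)) := by ring
      _ ≤ c ^ 2 * t ^ 2 * (1 / n) := by gcongr; linarith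
      _ ≤ _ := by gcongr
  have f2 := mul_le_mul_of_nonneg_left l2 (by positivity : 0 ≤ 8 * min 1 (t ^ 2))
  have f3 := mul_le_mul_of_nonneg_left k2 (by positivity : 0 ≤ 2 * c)
  have e : min 1 (t ^ 2) * ((16 * C + 17) / n) =
      min 1 (t ^ 2) * (1 / n) + 8 * min 1 (t ^ 2) * ((2 * C + 2) / n) := by ring
  rw [e]
  nlinarith

end CharFun

/-! ### The Kolmogorov distance of typical marginals: upper bound. -/

section KolUpper

variable {E : Type*} [NormedAddCommGroup E] [InnerProductSpace ℝ E] [FiniteDimensional ℝ E]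
  [MeasurableSpace E] [BorelSpace E]

lemma charFun_std (t : ℝ) : charFun (gaussianReal 0 1) t = ((Real.exp (-t ^ 2 / 2) : ℝ) : ℂ) := by
  rw [charFun_gaussianReal]; push_cast; congr 1; simp; ring

/-- For a law with a first moment, the characteristic function is Lipschitz at the origin,
relative to the normal one. -/
lemma exists_norm_charFun_sub_div_le {μ : Measure ℝ} [IsProbabilityMeasure μ]
    (hμ : Integrable id μ) :
    ∃ c : ℝ, ∀ t : ℝ, ‖charFun μ t - charFun (gaussianReal 0 1) t‖ / |t| ≤ c := by
  refine ⟨∫ y, |cdf μ y - cdf (gaussianReal 0 1) y|, fun t => ?_⟩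
  rcases eq_or_ne t 0 with rfl | ht
  · simpa using integral_nonneg fun y => abs_nonneg _
  · rw [← norm_integral_cdf_sub_mul_cexp hμ (integrable_id_gaussianReal 0 1) ht]
    refine (norm_integral_le_integral_norm _).trans (le_of_eq ?_)
    congr 1; ext y
    rw [norm_smul, ← Complex.ofReal_mul, Complex.norm_exp_ofReal_mul_I, mul_one, Real.norm_eq_abs]

/-- The weighted `L²`-deviation of the characteristic function of `μ` from the normal one. -/
noncomputable def charDev (σ : ℝ) (μ : Measure ℝ) : ℝ :=
  ∫ t : ℝ, Real.exp (-σ ^ 2 * t ^ 2 / 2) * max 1 |t| *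
    (‖charFun μ t - charFun (gaussianReal 0 1) t‖ / |t|) ^ 2

/-- Cauchy–Schwarz in the smoothing integral with the weights min(1,1/|t|) and max(1,|t|), whose
product is 1 off the origin. The first has logarithmic mass; the second goes into `charDev`, which
is quadratic in the deviation and can be averaged over directions. -/
lemma kolDist_sq_le (μ : Measure ℝ) [IsProbabilityMeasure μ] (hμ : Integrable id μ) {σ : ℝ}
    (hσ : 0 < σ) (hσ1 : σ ≤ 1) :
    kolDist μ ^ 2 ≤ (6 + 2 * Real.log σ⁻¹) * charDev σ μ + 18 * σ ^ 2 := by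
  have h := kolDist_le_integral_charFun μ hμ hσ
  obtain ⟨c, hc⟩ := exists_norm_charFun_sub_div_le hμ
  set H : ℝ → ℝ := fun t => ‖charFun μ t - charFun (gaussianReal 0 1) t‖ / |t| with hH
  have hH0 : ∀ t, 0 ≤ H t := fun t => by positivity
  have hHm : Measurable H := by
    have := measurable_charFun (μ := μ)
    have := measurable_charFun (μ := gaussianReal 0 1)
    fun_prop
  set e : ℝ → ℝ := fun t => Real.exp (-σ ^ 2 * t ^ 2 / 2) with he
  have he0 : ∀ t, 0 < e t := fun t => Real.exp_pos _
  obtain ⟨w1, w2⟩ := integral_gaussian_weight_le hσ hσ1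
  have hmin : ∀ t : ℝ, 0 ≤ min 1 |t|⁻¹ := fun t => le_min (by norm_num) (by positivity)
  have hmax : ∀ t : ℝ, 0 ≤ max 1 |t| := fun t => le_max_of_le_left (by norm_num)
  have hmm : ∀ t : ℝ, t ≠ 0 → min 1 |t|⁻¹ * max 1 |t| = 1 := by
    intro t ht
    have h0 : 0 < |t| := abs_pos.2 ht
    rcases le_total |t| 1 with h1 | h1
    · rw [min_eq_left ((one_le_inv₀ h0).2 h1), max_eq_left h1, one_mul]
    · rw [min_eq_right (inv_le_one_of_one_le₀ h1), max_eq_right h1, inv_mul_cancel₀ h0.ne']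
  have mf : MemLp (fun t => Real.sqrt (e t * min 1 |t|⁻¹)) 2 := by
    refine (memLp_two_iff_integrable_sq (by fun_prop)).2 (w1.congr ?_)
    exact Filter.Eventually.of_forall fun t =>
      (Real.sq_sqrt (mul_nonneg (he0 t).le (hmin t))).symm
  have hsq : ∀ t, (Real.sqrt (e t * max 1 |t|) * H t) ^ 2 = e t * max 1 |t| * H t ^ 2 := fun t => by
    rw [mul_pow, Real.sq_sqrt (mul_nonneg (he0 t).le (hmax t))]
  have mg : MemLp (fun t => Real.sqrt (e t * max 1 |t|) * H t) 2 := by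
    refine (memLp_two_iff_integrable_sq (by fun_prop)).2 ?_
    simp_rw [hsq]
    have i1 : Integrable (fun t : ℝ => Real.exp (-(σ ^ 2 / 2) * t ^ 2)) :=
      integrable_exp_neg_mul_sq (by positivity)
    have i2 := (integrable_mul_exp_neg_mul_sq (show 0 < σ ^ 2 / 2 by positivity)).abs
    refine ((i1.add i2).mul_const (c ^ 2)).mono' (by fun_prop)
      (Filter.Eventually.of_forall fun t => ?_)
    rw [Real.norm_eq_abs, abs_of_nonneg (mul_nonneg (mul_nonneg (he0 t).le (hmax t)) (sq_nonneg _))]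
    have e1 : e t = Real.exp (-(σ ^ 2 / 2) * t ^ 2) := by simp only [he]; congr 1; ring
    simp only [Pi.add_apply]
    rw [abs_mul, Real.abs_exp, ← e1]
    have hm : max 1 |t| ≤ 1 + |t| := max_le (by linarith [abs_nonneg t]) (by linarith)
    calc _ ≤ e t * (1 + |t|) * c ^ 2 := by
          gcongr
          exact hc t
      _ = _ := by ring
  have hcs := integral_mul_sq_le mf mg
  have e1 : ∫ t, Real.sqrt (e t * min 1 |t|⁻¹) * (Real.sqrt (e t * max 1 |t|) * H t) =
      ∫ t, e t * H t := by
    refine integral_congr_ae ?_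
    have hne : ∀ᵐ t : ℝ, t ≠ 0 := by simp [ae_iff]
    filter_upwards [hne] with t ht
    rw [← mul_assoc, ← Real.sqrt_mul (mul_nonneg (he0 t).le (hmin t)),
      show e t * min 1 |t|⁻¹ * (e t * max 1 |t|) = e t ^ 2 * (min 1 |t|⁻¹ * max 1 |t|) by ring,
      hmm t ht, mul_one, Real.sqrt_sq (he0 t).le]
  have e2 : ∫ t, Real.sqrt (e t * min 1 |t|⁻¹) ^ 2 = ∫ t, e t * min 1 |t|⁻¹ := by
    congr 1; ext t; exact Real.sq_sqrt (mul_nonneg (he0 t).le (hmin t))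
  have e3 : ∫ t, (Real.sqrt (e t * max 1 |t|) * H t) ^ 2 = charDev σ μ := by
    simp_rw [hsq]; rfl
  rw [e1, e2, e3] at hcs
  have hY : 0 ≤ charDev σ μ := by
    rw [← e3]; exact integral_nonneg fun t => sq_nonneg _
  have hJ0 : 0 ≤ ∫ t, e t * H t := integral_nonneg fun t => mul_nonneg (he0 t).le (hH0 t)
  have hpi : Real.pi⁻¹ ≤ 1 / 2 := by
    rw [one_div]; exact inv_anti₀ (by norm_num) (by linarith [Real.pi_gt_three])
  have h' : kolDist μ ≤ 1 / 2 * (∫ t, e t * H t) + 3 * σ :=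
    h.trans (by gcongr)
  have h0 := kolDist_nonneg μ
  have hfin : (∫ t, e t * H t) ^ 2 ≤ (6 + 2 * Real.log σ⁻¹) * charDev σ μ :=
    hcs.trans (by gcongr)
  have hsq1 : kolDist μ ^ 2 ≤ (1 / 2 * (∫ t, e t * H t) + 3 * σ) ^ 2 := by gcongr
  nlinarith [sq_nonneg (1 / 2 * (∫ t, e t * H t) - 3 * σ)]

lemma IsoLaw.charDev_bound {Q : Measure E} [IsProbabilityMeasure Q] [Nontrivial E] {C : ℝ}
    (hC : 0 ≤ C) (h : IsoLaw Q C) {σ : ℝ} (hσ : 0 < σ) (hσ1 : σ ≤ 1) :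
    Integrable (fun g => charDev σ (marg Q g)) (stdGaussian E) ∧
    ∫ g, charDev σ (marg Q g) ∂(stdGaussian E) ≤
      (6 + 2 * Real.log σ⁻¹) * ((16 * C + 17) / Module.finrank ℝ E) := by
  set K : ℝ := (16 * C + 17) / Module.finrank ℝ E
  have hK : 0 ≤ K := by positivity
  obtain ⟨w1, w2⟩ := integral_gaussian_weight_le hσ hσ1
  have hlog : 0 ≤ Real.log σ⁻¹ := Real.log_nonneg ((one_le_inv₀ hσ).2 hσ1)
  have hmin : ∀ t : ℝ, 0 ≤ min 1 |t|⁻¹ := fun t => le_min (by norm_num) (by positivity)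
  have hmax : ∀ t : ℝ, 0 ≤ max 1 |t| := fun t => le_max_of_le_left (by norm_num)
  set k : E → ℝ → ℝ := fun g t => Real.exp (-σ ^ 2 * t ^ 2 / 2) * max 1 |t| *
    (‖charFun (marg Q g) t - charFun (gaussianReal 0 1) t‖ / |t|) ^ 2 with hk
  have hk0 : ∀ g t, 0 ≤ k g t := fun g t =>
    mul_nonneg (mul_nonneg (Real.exp_pos _).le (hmax t)) (sq_nonneg _)
  have hkm : Measurable (fun p : E × ℝ => k p.1 p.2) := by
    have h1 := (stronglyMeasurable_charFun_marg Q).measurable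
    have h2 : Measurable fun p : E × ℝ => charFun (gaussianReal 0 1) p.2 :=
      measurable_charFun.comp measurable_snd
    exact (by fun_prop : Measurable fun p : E × ℝ =>
      Real.exp (-σ ^ 2 * p.2 ^ 2 / 2) * max 1 |p.2|).mul
        (((h1.sub h2).norm.div (by fun_prop)).pow_const 2)
  have hkt : ∀ t : ℝ, ∫⁻ g, ENNReal.ofReal (k g t) ∂(stdGaussian E) ≤
      ENNReal.ofReal (Real.exp (-σ ^ 2 * t ^ 2 / 2) * min 1 |t|⁻¹ * K) := by
    intro t
    have hb : Integrable (fun g => ‖charFun (marg Q g) t - Real.exp (-t ^ 2 / 2)‖ ^ 2)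
        (stdGaussian E) := by
      refine Integrable.of_bound ?_ 4 (Filter.Eventually.of_forall fun g => ?_)
      · have := (stronglyMeasurable_charFun_marg Q).comp_measurable
          (by fun_prop : Measurable fun g : E => (g, t))
        exact ((this.sub stronglyMeasurable_const).norm.pow 2).aestronglyMeasurable
      · rw [Real.norm_eq_abs, abs_of_nonneg (sq_nonneg _)]
        have h1 : ‖charFun (marg Q g) t - (Real.exp (-t ^ 2 / 2) : ℝ)‖ ≤ 2 := by
          refine (norm_sub_le _ _).trans ?_
          have h3 := norm_charFun_le_one (μ := marg Q g) (t := t)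
          have h4 : ‖((Real.exp (-t ^ 2 / 2) : ℝ) : ℂ)‖ ≤ 1 := by
            rw [Complex.norm_real, Real.norm_eq_abs, Real.abs_exp, Real.exp_le_one_iff]
            nlinarith [sq_nonneg t]
          linarith
        calc _ ≤ (2 : ℝ) ^ 2 := by gcongr
          _ = 4 := by norm_num
    have e : ∀ g, k g t = (Real.exp (-σ ^ 2 * t ^ 2 / 2) * max 1 |t| / |t| ^ 2) *
        ‖charFun (marg Q g) t - Real.exp (-t ^ 2 / 2)‖ ^ 2 := by
      intro g
      simp only [hk, charFun_std]
      rw [div_pow]; ring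
    have hi : Integrable (fun g => k g t) (stdGaussian E) := by
      simp_rw [e]; exact hb.const_mul _
    rw [← ofReal_integral_eq_lintegral_ofReal hi (Filter.Eventually.of_forall fun g => hk0 g t)]
    refine ENNReal.ofReal_le_ofReal ?_
    simp_rw [e]
    rw [integral_const_mul]
    have hmain := h.integral_norm_charFun_marg_sub_sq_le t
    rcases eq_or_ne t 0 with rfl | ht
    · simp only [abs_zero, ne_eq, OfNat.ofNat_ne_zero, not_false_eq_true, zero_pow, div_zero, zero_mul]
      exact mul_nonneg (mul_nonneg (Real.exp_pos _).le (by simp)) hK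
    have h0 : 0 < |t| := abs_pos.2 ht
    -- The factor min(1,t²) of the mean square deviation turns the weight of `charDev` back into the
    -- logarithmic one, hence the second logarithm.
    have hw : max 1 |t| / |t| ^ 2 * min 1 (t ^ 2) = min 1 |t|⁻¹ := by
      rcases le_total |t| 1 with h1 | h1
      · have : t ^ 2 ≤ 1 := by rw [← sq_abs]; nlinarith
        rw [min_eq_left ((one_le_inv₀ h0).2 h1), max_eq_left h1, min_eq_right this, ← sq_abs t]
        field_simp
      · have : 1 ≤ t ^ 2 := by rw [← sq_abs]; nlinarith
        rw [min_eq_right (inv_le_one_of_one_le₀ h1), max_eq_right h1, min_eq_left this]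
        field_simp
    calc _ ≤ (Real.exp (-σ ^ 2 * t ^ 2 / 2) * max 1 |t| / |t| ^ 2) * (min 1 (t ^ 2) * K) := by
          gcongr
      _ = Real.exp (-σ ^ 2 * t ^ 2 / 2) * (max 1 |t| / |t| ^ 2 * min 1 (t ^ 2)) * K := by ring
      _ = _ := by rw [hw]
  have hdev0 : ∀ g, 0 ≤ charDev σ (marg Q g) := fun g => integral_nonneg fun t => hk0 g t
  refine integrable_and_integral_le_of_lintegral ?_ hdev0 (by positivity) ?_
  · exact (hkm.stronglyMeasurable.integral_prod_right).aestronglyMeasurable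
  have hle : ∀ g, ENNReal.ofReal (charDev σ (marg Q g)) ≤ ∫⁻ t, ENNReal.ofReal (k g t) := by
    intro g
    have := integral_eq_lintegral_of_nonneg_ae (μ := (volume : Measure ℝ))
      (Filter.Eventually.of_forall fun t => hk0 g t)
      (hkm.comp (by fun_prop : Measurable fun t : ℝ => (g, t))).aestronglyMeasurable
    rw [charDev, this]
    exact ENNReal.ofReal_toReal_le
  calc ∫⁻ g, ENNReal.ofReal (charDev σ (marg Q g)) ∂(stdGaussian E)
      ≤ ∫⁻ g, (∫⁻ t, ENNReal.ofReal (k g t)) ∂(stdGaussian E) := lintegral_mono hle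
    _ = ∫⁻ t, (∫⁻ g, ENNReal.ofReal (k g t) ∂(stdGaussian E)) :=
        lintegral_lintegral_swap (hkm.ennreal_ofReal).aemeasurable
    _ ≤ ∫⁻ t, ENNReal.ofReal (Real.exp (-σ ^ 2 * t ^ 2 / 2) * min 1 |t|⁻¹ * K) := lintegral_mono hkt
    _ = ENNReal.ofReal (∫ t, Real.exp (-σ ^ 2 * t ^ 2 / 2) * min 1 |t|⁻¹ * K) :=
        (ofReal_integral_eq_lintegral_ofReal (w1.mul_const K) (Filter.Eventually.of_forall fun t =>
          mul_nonneg (mul_nonneg (Real.exp_pos _).le (hmin t)) hK)).symm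
    _ ≤ _ := by
        refine ENNReal.ofReal_le_ofReal ?_
        rw [integral_mul_const]
        gcongr

/-- The Kolmogorov distance of a typical Gaussian marginal to the normal law. -/
lemma IsoLaw.integral_kolDist_sq_le {Q : Measure E} [IsProbabilityMeasure Q] [Nontrivial E] {C : ℝ}
    (hC : 0 ≤ C) (h : IsoLaw Q C) :
    ∫ g, kolDist (marg Q g) ^ 2 ∂(stdGaussian E) ≤
      ((6 + Real.log (Module.finrank ℝ E)) ^ 2 * (16 * C + 17) + 18) / Module.finrank ℝ E := by
  set n : ℝ := (Module.finrank ℝ E : ℝ)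
  have hn : 1 ≤ n := Nat.one_le_cast.2 (Module.finrank_pos (R := ℝ) (M := E))
  -- At this scale the smoothing error 18σ² is of order 1/n like the main term, and 2 log σ⁻¹ is log
  -- n.
  set σ : ℝ := (Real.sqrt n)⁻¹ with hσ
  have hs1 : 1 ≤ Real.sqrt n := Real.one_le_sqrt.2 hn
  have hσ0 : 0 < σ := by positivity
  have hσ1 : σ ≤ 1 := inv_le_one_of_one_le₀ hs1
  have hlog : 2 * Real.log σ⁻¹ = Real.log n := by
    rw [hσ, inv_inv, Real.log_sqrt (by linarith)]; ring
  have hσ2 : σ ^ 2 = 1 / n := by rw [hσ, inv_pow, Real.sq_sqrt (by linarith), one_div]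
  obtain ⟨i1, i2⟩ := h.charDev_bound hC hσ0 hσ1
  rw [hlog] at i2
  have hL : 0 ≤ Real.log n := Real.log_nonneg hn
  calc ∫ g, kolDist (marg Q g) ^ 2 ∂(stdGaussian E)
      ≤ ∫ g, ((6 + Real.log n) * charDev σ (marg Q g) + 18 * (1 / n)) ∂(stdGaussian E) := by
        refine integral_mono_of_nonneg (Filter.Eventually.of_forall fun g => sq_nonneg _)
          ((i1.const_mul _).add (integrable_const _)) (Filter.Eventually.of_forall fun g => ?_)
        have := kolDist_sq_le (marg Q g) (h.integrable_id_marg g) hσ0 hσ1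
        rwa [hlog, hσ2] at this
    _ = (6 + Real.log n) * ∫ g, charDev σ (marg Q g) ∂(stdGaussian E) + 18 * (1 / n) := by
        rw [integral_add (i1.const_mul _) (integrable_const _), integral_const_mul]
        simp
    _ ≤ (6 + Real.log n) * ((6 + Real.log n) * ((16 * C + 17) / n)) + 18 * (1 / n) := by
        gcongr
    _ = _ := by ring

end KolUpper

/-! ### The L²-distance of typical marginals: upper bound. -/

lemma meanDist_eq_integral_map {α β : Type*} [MeasurableSpace α] [MeasurableSpace β]
    {μ : Measure α} {ν : Measure β} [IsProbabilityMeasure μ] [IsProbabilityMeasure ν]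
    {f : α → ℝ} {g : β → ℝ} (hf : Measurable f) (hg : Measurable g) :
    meanDist (μ.map f) (ν.map g) = ∫ p : α × β, |f p.1 - g p.2| ∂(μ.prod ν) := by
  rw [meanDist, Measure.map_prod_map μ ν hf hg, integral_map]
  · rfl
  · exact (hf.prodMap hg).aemeasurable
  · exact Continuous.aestronglyMeasurable (by fun_prop)

lemma integral_abs_gaussianReal (v : NNReal) :
    ∫ x, |x| ∂(gaussianReal 0 v) = Real.sqrt (2 / Real.pi) * Real.sqrt v := by
  have h2 : gaussianReal 0 v = (gaussianReal 0 1).map (Real.sqrt v * ·) := by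
    rw [gaussianReal_map_const_mul]
    congr 1
    · simp
    · ext; simp
  rw [h2, integral_map (by fun_prop) (by fun_prop)]
  simp_rw [abs_mul, abs_of_nonneg (Real.sqrt_nonneg _)]
  rw [integral_const_mul, integral_abs_gaussian, mul_comm]

lemma meanDist_gaussianReal (v w : NNReal) :
    meanDist (gaussianReal 0 v) (gaussianReal 0 w) =
      Real.sqrt (2 / Real.pi) * Real.sqrt (v + w) := by
  have h : ((gaussianReal 0 v).prod (gaussianReal 0 w)).map (fun p : ℝ × ℝ => p.1 - p.2) =
      gaussianReal 0 (v + w) := by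
    have h1 := gaussianReal_conv_gaussianReal (m₁ := 0) (m₂ := 0) (v₁ := v) (v₂ := w)
    have h2 : (gaussianReal 0 w).map (fun x : ℝ => -x) = gaussianReal 0 w := by
      rw [gaussianReal_map_neg, neg_zero]
    rw [← h2, Measure.conv] at h1
    nth_rw 1 [← Measure.map_id (μ := gaussianReal 0 v)] at h1
    rw [Measure.map_prod_map _ _ measurable_id (by fun_prop), Measure.map_map (by fun_prop)
      (by fun_prop), add_zero] at h1
    rw [← h1]
    congr 1
  have h3 := integral_abs_gaussianReal (v + w)
  rw [← h, integral_map (by fun_prop) (by fun_prop)] at h3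
  rw [meanDist, h3]
  push_cast; rfl

lemma sqrt_two_div_pi_le_one : Real.sqrt (2 / Real.pi) ≤ 1 := by
  rw [Real.sqrt_le_left one_pos.le, one_pow, div_le_one Real.pi_pos]; linarith [Real.pi_gt_three]

section L2Gauss

variable {E : Type*} [NormedAddCommGroup E] [InnerProductSpace ℝ E] [FiniteDimensional ℝ E]
  [MeasurableSpace E] [BorelSpace E] {Q : Measure E} [IsProbabilityMeasure Q]

lemma integral_abs_inner_stdGaussian (v : E) :
    ∫ g, |inner ℝ g v| ∂(stdGaussian E) = Real.sqrt (2 / Real.pi) * ‖v‖ := by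
  simp_rw [real_inner_comm v]
  rw [integral_inner_stdGaussian v (fun x => |x|) (by fun_prop)]
  simp_rw [abs_mul, abs_norm]
  rw [integral_const_mul, integral_abs_gaussian, mul_comm]

lemma meanDist_marg_gaussian (g : E) :
    meanDist (marg Q g) (gaussianReal 0 1) =
      ∫ p : E × ℝ, |inner ℝ g p.1 - p.2| ∂(Q.prod (gaussianReal 0 1)) := by
  have := meanDist_eq_integral_map (μ := Q) (ν := gaussianReal 0 1)
    (f := fun x => inner ℝ g x) (g := id) (by fun_prop) measurable_id
  rw [Measure.map_id] at this
  exact this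

lemma meanDist_marg_self (g : E) :
    meanDist (marg Q g) (marg Q g) = ∫ p : E × E, |inner ℝ g (p.1 - p.2)| ∂(Q.prod Q) := by
  have := meanDist_eq_integral_map (μ := Q) (ν := Q)
    (f := fun x => inner ℝ g x) (g := fun x => inner ℝ g x) (by fun_prop) (by fun_prop)
  simp_rw [inner_sub_right]
  exact this

/-- The energy identity against N(0,1), for which half the mean distance of two independent copies
is 1/√π. -/
lemma l2Dist_eq (μ : Measure ℝ) [IsProbabilityMeasure μ] (hμ : Integrable id μ) :
    l2Dist μ = meanDist μ (gaussianReal 0 1) - meanDist μ μ / 2 - 1 / Real.sqrt Real.pi := by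
  have h := (integral_cdf_sub_sq hμ (integrable_id_gaussianReal 0 1)).2
  have h2 := meanDist_gaussianReal 1 1
  have e : Real.sqrt (2 / Real.pi) * Real.sqrt ((1 : NNReal) + (1 : NNReal)) / 2 =
      1 / Real.sqrt Real.pi := by
    have : Real.sqrt 2 * Real.sqrt 2 = 2 := Real.mul_self_sqrt (by norm_num)
    rw [NNReal.coe_one, show (1 : ℝ) + 1 = 2 by norm_num, Real.sqrt_div (by norm_num)]
    have hp : Real.sqrt Real.pi ≠ 0 := (Real.sqrt_pos.2 Real.pi_pos).ne'
    field_simp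
    linarith
  rw [h2, e] at h
  exact h

lemma integrable_inner_sub_prod (hQ : Integrable (fun x : E => ‖x‖) Q) :
    Integrable (fun q : E × (E × ℝ) => |inner ℝ q.1 q.2.1 - q.2.2|)
      ((stdGaussian E).prod (Q.prod (gaussianReal 0 1))) := by
  have i1 : Integrable (fun g : E => ‖g‖) (stdGaussian E) := by
    simpa using integrable_norm_pow_stdGaussian (E := E) 1
  have i2 := (integrable_id_gaussianReal 0 1).norm
  have j1 : Integrable (fun q : E × (E × ℝ) => ‖q.1‖ * ‖q.2.1‖)
      ((stdGaussian E).prod (Q.prod (gaussianReal 0 1))) :=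
    i1.mul_prod (hQ.comp_fst (gaussianReal 0 1))
  have j2 : Integrable (fun q : E × (E × ℝ) => ‖q.2.2‖)
      ((stdGaussian E).prod (Q.prod (gaussianReal 0 1))) :=
    (i2.comp_snd Q).comp_snd (stdGaussian E)
  refine (j1.add j2).mono' (Continuous.aestronglyMeasurable (by fun_prop))
    (Filter.Eventually.of_forall fun q => ?_)
  rw [Real.norm_eq_abs, abs_abs]
  exact (abs_sub _ _).trans (add_le_add (abs_real_inner_le_norm _ _) le_rfl)

/-- For fixed x the variable ⟨g,x⟩ - Z is normal with variance |x|² + 1, so the average over g is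
taken first. -/
lemma integral_meanDist_marg_gaussian (hQ : Integrable (fun x : E => ‖x‖) Q) :
    Integrable (fun g => meanDist (marg Q g) (gaussianReal 0 1)) (stdGaussian E) ∧
    ∫ g, meanDist (marg Q g) (gaussianReal 0 1) ∂(stdGaussian E) =
      Real.sqrt (2 / Real.pi) * ∫ x, Real.sqrt (‖x‖ ^ 2 + 1) ∂Q := by
  have hi := integrable_inner_sub_prod hQ
  simp_rw [meanDist_marg_gaussian]
  refine ⟨hi.integral_prod_left, ?_⟩
  rw [integral_integral_swap (f := fun (g : E) (p : E × ℝ) => |inner ℝ g p.1 - p.2|) hi,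
    integral_prod _ hi.integral_prod_right, ← integral_const_mul]
  congr 1; ext x
  have h1 := meanDist_eq_integral_map (μ := stdGaussian E) (ν := gaussianReal 0 1)
    (f := fun g => inner ℝ x g) (g := id) (by fun_prop) measurable_id
  rw [Measure.map_id, stdGaussian_map_inner, meanDist_gaussianReal] at h1
  have i1 : Integrable (fun g : E => ‖g‖) (stdGaussian E) := by
    simpa using integrable_norm_pow_stdGaussian (E := E) 1
  have h2 : Integrable (fun p : E × ℝ => |inner ℝ x p.1 - id p.2|)
      ((stdGaussian E).prod (gaussianReal 0 1)) := by
    refine (((i1.const_mul ‖x‖).comp_fst (gaussianReal 0 1)).add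
      ((integrable_id_gaussianReal 0 1).norm.comp_snd (stdGaussian E))).mono'
      (Continuous.aestronglyMeasurable (by fun_prop)) (Filter.Eventually.of_forall fun q => ?_)
    rw [Real.norm_eq_abs, abs_abs]
    exact (abs_sub _ _).trans (add_le_add (abs_real_inner_le_norm _ _) le_rfl)
  rw [integral_prod_symm _ h2] at h1
  simp_rw [real_inner_comm x]
  push_cast at h1
  simp only [id] at h1
  exact h1.symm

/-- For fixed x and y the variable ⟨g,x-y⟩ is normal with standard deviation |x-y|. -/
lemma integral_meanDist_marg_self (hQ : Integrable (fun x : E => ‖x‖) Q) :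
    Integrable (fun g => meanDist (marg Q g) (marg Q g)) (stdGaussian E) ∧
    ∫ g, meanDist (marg Q g) (marg Q g) ∂(stdGaussian E) =
      Real.sqrt (2 / Real.pi) * ∫ p : E × E, ‖p.1 - p.2‖ ∂(Q.prod Q) := by
  have i1 : Integrable (fun g : E => ‖g‖) (stdGaussian E) := by
    simpa using integrable_norm_pow_stdGaussian (E := E) 1
  have iQ : Integrable (fun p : E × E => ‖p.1‖ + ‖p.2‖) (Q.prod Q) :=
    (hQ.comp_fst Q).add (hQ.comp_snd Q)
  have hi : Integrable (fun q : E × (E × E) => |inner ℝ q.1 (q.2.1 - q.2.2)|)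
      ((stdGaussian E).prod (Q.prod Q)) := by
    refine (i1.mul_prod iQ).mono' (Continuous.aestronglyMeasurable (by fun_prop))
      (Filter.Eventually.of_forall fun q => ?_)
    rw [Real.norm_eq_abs, abs_abs]
    refine (abs_real_inner_le_norm _ _).trans ?_
    gcongr
    exact norm_sub_le _ _
  simp_rw [meanDist_marg_self]
  refine ⟨hi.integral_prod_left, ?_⟩
  rw [integral_integral_swap (f := fun (g : E) (p : E × E) => |inner ℝ g (p.1 - p.2)|) hi,
    ← integral_const_mul]
  simp_rw [integral_abs_inner_stdGaussian]

/-- With s = √D the difference of the two sides is s(s+2)(s-1)²/2. Unlike the Taylor parabola, this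
minorant holds down to D = 0. -/
lemma sqrt_ge_of_nonneg {D : ℝ} (hD : 0 ≤ D) :
    1 + (D - 1) / 2 - (D - 1) ^ 2 / 2 ≤ Real.sqrt D := by
  have h := Real.sq_sqrt hD
  set s := Real.sqrt D
  have hs : 0 ≤ s := Real.sqrt_nonneg D
  rw [← h]
  nlinarith [mul_nonneg (mul_nonneg hs (sq_nonneg (s - 1))) (by linarith : 0 ≤ s + 2)]

lemma sqrt_sq_add_one_le (r : ℝ) :
    Real.sqrt (r ^ 2 + 1) ≤ Real.sqrt 2 * (1 + (r ^ 2 - 1) / 4) := by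
  rw [Real.sqrt_le_left (by nlinarith [Real.sqrt_nonneg 2, sq_nonneg r, mul_nonneg (Real.sqrt_nonneg 2) (sq_nonneg r)]), mul_pow, Real.sq_sqrt (by norm_num)]
  nlinarith [sq_nonneg (r ^ 2 - 1)]

/-- The `L²`-distance of a typical Gaussian marginal to the normal law. -/
lemma IsoLaw.integral_l2Dist_le [Nontrivial E] {C : ℝ} (h : IsoLaw Q C) :
    Integrable (fun g => l2Dist (marg Q g)) (stdGaussian E) ∧
    ∫ g, l2Dist (marg Q g) ∂(stdGaussian E) ≤ (2 * C + 3) / Module.finrank ℝ E := by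
  obtain ⟨a1, a2⟩ := integral_meanDist_marg_gaussian h.integrable_norm
  obtain ⟨b1, b2⟩ := integral_meanDist_marg_self h.integrable_norm
  have e : (fun g => l2Dist (marg Q g)) = fun g => meanDist (marg Q g) (gaussianReal 0 1) -
      meanDist (marg Q g) (marg Q g) / 2 - 1 / Real.sqrt Real.pi :=
    funext fun g => l2Dist_eq _ (h.integrable_id_marg g)
  have ab : Integrable (fun g => meanDist (marg Q g) (gaussianReal 0 1) -
      meanDist (marg Q g) (marg Q g) / 2) (stdGaussian E) := a1.sub (b1.div_const 2)
  rw [e]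
  refine ⟨ab.sub (integrable_const _), ?_⟩
  rw [integral_sub ab (integrable_const _), integral_sub a1 (b1.div_const 2), integral_div, a2, b2]
  set κ := Real.sqrt (2 / Real.pi)
  have hκ0 : 0 ≤ κ := Real.sqrt_nonneg _
  have hκ1 : κ ≤ 1 := sqrt_two_div_pi_le_one
  have hs2 : Real.sqrt 2 * Real.sqrt 2 = 2 := Real.mul_self_sqrt (by norm_num)
  have hs0 : 0 < Real.sqrt 2 := Real.sqrt_pos.2 (by norm_num)
  have hc : 1 / Real.sqrt Real.pi = κ * (Real.sqrt 2 / 2) := by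
    have hp : Real.sqrt Real.pi ≠ 0 := (Real.sqrt_pos.2 Real.pi_pos).ne'
    simp only [κ]
    rw [Real.sqrt_div (by norm_num)]
    field_simp
    linarith
  -- The leading terms √2, √2/2 and √2/2 cancel in the combination. Here concavity suffices, the
  -- linear term having mean zero; below, the quadratic minorant of the root leaves an error of
  -- order 1/n.
  have k1 : ∫ x : E, Real.sqrt (‖x‖ ^ 2 + 1) ∂Q ≤ Real.sqrt 2 := by
    have iA : Integrable (fun x : E => ‖x‖ ^ 2 - 1) Q := h.memLp_dev.integrable (by norm_num)
    calc _ ≤ ∫ x : E, Real.sqrt 2 * (1 + (‖x‖ ^ 2 - 1) / 4) ∂Q :=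
          integral_mono_of_nonneg (Filter.Eventually.of_forall fun x => Real.sqrt_nonneg _)
            (((integrable_const _).add (iA.div_const 4)).const_mul _)
            (Filter.Eventually.of_forall fun x => sqrt_sq_add_one_le ‖x‖)
      _ = _ := by
          rw [integral_const_mul, integral_add (integrable_const _) (iA.div_const 4), integral_div,
            integral_sub h.integrable_norm_sq (integrable_const _), h.integral_norm_sq]
          simp
  have mD := h.memLp_halfDist_sub
  have iD := mD.integrable (by norm_num)
  have iq : Integrable (fun p : E × E => ‖p.1 - p.2‖) (Q.prod Q) := by
    have iQ : Integrable (fun p : E × E => ‖p.1‖ + ‖p.2‖) (Q.prod Q) :=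
      (h.integrable_norm.comp_fst Q).add (h.integrable_norm.comp_snd Q)
    refine iQ.mono' (Continuous.aestronglyMeasurable (by fun_prop))
      (Filter.Eventually.of_forall fun q => ?_)
    rw [norm_norm]; exact norm_sub_le _ _
  have i1 : Integrable (fun p : E × E => 1 + (‖p.1 - p.2‖ ^ 2 / 2 - 1) / 2) (Q.prod Q) :=
    (integrable_const _).add (iD.div_const 2)
  have i2 : Integrable (fun p : E × E => 1 + (‖p.1 - p.2‖ ^ 2 / 2 - 1) / 2 -
    (‖p.1 - p.2‖ ^ 2 / 2 - 1) ^ 2 / 2) (Q.prod Q) := i1.sub (mD.integrable_sq.div_const 2)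
  have k2 : Real.sqrt 2 * (1 + (∫ p : E × E, (‖p.1 - p.2‖ ^ 2 / 2 - 1) ∂(Q.prod Q)) / 2 -
      (∫ p : E × E, (‖p.1 - p.2‖ ^ 2 / 2 - 1) ^ 2 ∂(Q.prod Q)) / 2) ≤
      ∫ p : E × E, ‖p.1 - p.2‖ ∂(Q.prod Q) := by
    calc _ = ∫ p : E × E, Real.sqrt 2 * (1 + (‖p.1 - p.2‖ ^ 2 / 2 - 1) / 2 -
          (‖p.1 - p.2‖ ^ 2 / 2 - 1) ^ 2 / 2) ∂(Q.prod Q) := by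
          rw [integral_const_mul, integral_sub i1 (mD.integrable_sq.div_const 2),
            integral_add (integrable_const _) (iD.div_const 2), integral_div, integral_div]
          simp
      _ ≤ _ := by
          refine integral_mono (i2.const_mul _) iq fun p => ?_
          have := sqrt_ge_of_nonneg (show 0 ≤ ‖p.1 - p.2‖ ^ 2 / 2 by positivity)
          calc _ ≤ Real.sqrt 2 * Real.sqrt (‖p.1 - p.2‖ ^ 2 / 2) := by gcongr
            _ = ‖p.1 - p.2‖ := by
                rw [← Real.sqrt_mul (by norm_num), mul_div_cancel₀ _ (by norm_num),
                  Real.sqrt_sq (norm_nonneg _)]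
  have l1 := h.integral_halfDist_sub.1
  have l2 := h.integral_halfDist_sub_sq_le
  simp only [integral_const, probReal_univ, smul_eq_mul, one_mul]
  rw [hc]
  set n : ℝ := (Module.finrank ℝ E : ℝ)
  have hn0 : 0 ≤ n := Nat.cast_nonneg _
  set I1 := ∫ p : E × E, (‖p.1 - p.2‖ ^ 2 / 2 - 1) ∂(Q.prod Q)
  set I2 := ∫ p : E × E, (‖p.1 - p.2‖ ^ 2 / 2 - 1) ^ 2 ∂(Q.prod Q)
  have hI2 : 0 ≤ I2 := integral_nonneg fun p => sq_nonneg _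
  have hs2' : Real.sqrt 2 ≤ 2 := by nlinarith
  have f0 : (1 : ℝ) / n + (2 * C + 2) / n = (2 * C + 3) / n := by ring
  have hB : 0 ≤ (1 : ℝ) / n + (2 * C + 2) / n := by
    have : 0 ≤ (1 : ℝ) / n := by positivity
    linarith
  calc _ = κ * ((∫ x : E, Real.sqrt (‖x‖ ^ 2 + 1) ∂Q) -
        (∫ p : E × E, ‖p.1 - p.2‖ ∂(Q.prod Q)) / 2 - Real.sqrt 2 / 2) := by ring
    _ ≤ κ * (Real.sqrt 2 / 4 * (1 / n + (2 * C + 2) / n)) := by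
        gcongr
        nlinarith
    _ ≤ 1 * (1 * (1 / n + (2 * C + 2) / n)) := by
        gcongr
        linarith
    _ = _ := by rw [← f0]; ring

end L2Gauss

/-! ### Behaviour of the distances under rescaling. -/

lemma cdf_map_mul (μ : Measure ℝ) [IsProbabilityMeasure μ] {R : ℝ} (hR : 0 < R) (x : ℝ) :
    cdf (μ.map (R * ·)) (R * x) = cdf μ x := by
  have : IsProbabilityMeasure (μ.map (R * ·)) := Measure.isProbabilityMeasure_map (by fun_prop)
  rw [cdf_eq_real, cdf_eq_real, map_measureReal_apply (by fun_prop) measurableSet_Iic]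
  congr 1
  ext y
  simp [mul_le_mul_iff_right₀ hR]

lemma Phi_sub_le_exp {x y c : ℝ} (h : x ≤ y) (hc : ∀ u ∈ Icc x y, c ^ 2 ≤ u ^ 2) :
    Phi y - Phi x ≤ (y - x) / 2 * Real.exp (-c ^ 2 / 2) := by
  rw [Phi_sub x y h]
  have : ∫ u in x..y, gaussianPDFReal 0 1 u ≤ ∫ u in x..y, (1 / 2 * Real.exp (-c ^ 2 / 2) : ℝ) := by
    apply intervalIntegral.integral_mono_on h
      ((integrable_gaussianPDFReal 0 1).intervalIntegrable) (by simp)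
    intro u hu
    rw [gaussianPDFReal_std]
    have h1 := hc u hu
    have h2 : -u ^ 2 / 2 ≤ -c ^ 2 / 2 := by linarith
    have h3 := inv_sqrt_two_pi_le
    gcongr
  rw [intervalIntegral.integral_const, smul_eq_mul] at this
  linarith

/-- Between ax and bx the density is at most e^(-(ax)²/2)/2, and a|x| times that exponential is
bounded; this makes the estimate uniform in x. -/
lemma abs_Phi_mul_sub_le {a b : ℝ} (ha : 0 < a) (hab : a ≤ b) (x : ℝ) :
    |Phi (b * x) - Phi (a * x)| ≤ (b - a) / (2 * a) := by
  have key : (b - a) * |x| / 2 * Real.exp (-(a * x) ^ 2 / 2) ≤ (b - a) / (2 * a) := by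
    have h1 : a * |x| * Real.exp (-(a * x) ^ 2 / 2) ≤ 1 := by
      rw [neg_div, Real.exp_neg, ← div_eq_mul_inv, div_le_one (Real.exp_pos _)]
      have h2 := Real.add_one_le_exp ((a * x) ^ 2 / 2)
      have h3 : (a * |x|) ^ 2 = (a * x) ^ 2 := by rw [mul_pow, mul_pow, sq_abs]
      nlinarith [sq_nonneg (a * |x| - 1)]
    calc _ = (b - a) / (2 * a) * (a * |x| * Real.exp (-(a * x) ^ 2 / 2)) := by field_simp
      _ ≤ (b - a) / (2 * a) * 1 := by
          gcongr
      _ = _ := mul_one _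
  refine le_trans ?_ key
  rcases le_total 0 x with hx | hx
  · have h1 : a * x ≤ b * x := by gcongr
    rw [abs_of_nonneg (sub_nonneg.2 (monotone_Phi h1)), abs_of_nonneg hx, sub_mul]
    refine Phi_sub_le_exp h1 fun u hu => ?_
    have h2 : 0 ≤ a * x := by positivity
    have := hu.1
    gcongr
  · have h1 : b * x ≤ a * x := mul_le_mul_of_nonpos_right hab hx
    rw [abs_sub_comm, abs_of_nonneg (sub_nonneg.2 (monotone_Phi h1)), abs_of_nonpos hx]
    have e : (b - a) * -x / 2 = (a * x - b * x) / 2 := by ring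
    rw [e]
    refine Phi_sub_le_exp h1 fun u hu => ?_
    have h2 : a * x ≤ 0 := mul_nonpos_of_nonneg_of_nonpos ha.le hx
    have := hu.2
    nlinarith

lemma abs_Phi_mul_sub_self_le {R : ℝ} (hR : 0 ≤ R) (x : ℝ) :
    |Phi (R * x) - Phi x| ≤ 2 * |R ^ 2 - 1| := by
  rcases le_total 1 R with h1 | h1
  · have := abs_Phi_mul_sub_le one_pos h1 x
    rw [one_mul] at this
    refine this.trans ?_
    rw [abs_of_nonneg (by nlinarith)]
    nlinarith
  rw [abs_of_nonpos (by nlinarith : R ^ 2 - 1 ≤ 0)]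
  rcases le_total (1 / 2) R with h2 | h2
  · have := abs_Phi_mul_sub_le (by linarith : 0 < R) h1 x
    rw [one_mul, abs_sub_comm] at this
    refine this.trans ?_
    rw [div_le_iff₀ (by linarith)]
    nlinarith [mul_nonneg (sub_nonneg.2 h1) (sub_nonneg.2 h2)]
  · have : |Phi (R * x) - Phi x| ≤ 1 := by
      rw [abs_le]
      constructor <;> linarith [Phi_nonneg (R * x), Phi_nonneg x, Phi_le_one (R * x), Phi_le_one x]
    nlinarith

/-- Scaling both laws changes nothing, so scaling μ alone costs the distance between two centered
normal laws. The error is stated through R² - 1 because the moments of the squared radius are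
explicit. At R = 0 the error term 2 is trivially enough. -/
lemma kolDist_le_kolDist_map_mul (μ : Measure ℝ) [IsProbabilityMeasure μ] {R : ℝ} (hR : 0 ≤ R) :
    kolDist μ ≤ kolDist (μ.map (R * ·)) + 2 * |R ^ 2 - 1| := by
  rcases hR.eq_or_lt with rfl | h
  · have := kolDist_le_one μ
    have h2 := kolDist_nonneg (μ.map ((0 : ℝ) * ·))
    norm_num at *
    linarith
  · refine ciSup_le fun x => ?_
    have h1 := abs_cdf_sub_le_kolDist (μ.map (R * ·)) (R * x)
    rw [cdf_map_mul μ h] at h1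
    have h2 := abs_Phi_mul_sub_self_le hR x
    calc _ = |(cdf μ x - Phi (R * x)) + (Phi (R * x) - Phi x)| := by ring_nf
      _ ≤ _ := (abs_add_le _ _).trans (add_le_add h1 h2)

lemma integrable_id_map_mul {μ : Measure ℝ} (hμ : Integrable id μ) (R : ℝ) :
    Integrable id (μ.map (R * ·)) := by
  rw [integrable_map_measure (by fun_prop) (by fun_prop)]
  exact hμ.const_mul R

/-- The energy identity gives the closed form √(2/π)(√(R²+1) - (R+1)/√2), which vanishes to second
order at R = 1. -/
lemma l2Dist_gaussianReal_map_mul_le {R : ℝ} (hR : 0 ≤ R) :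
    ∫ x, (cdf ((gaussianReal 0 1).map (R * ·)) x - Phi x) ^ 2 ≤ (R - 1) ^ 2 / 2 := by
  obtain ⟨v, hv⟩ : ∃ v : NNReal, (v : ℝ) = R ^ 2 := ⟨(R ^ 2).toNNReal, Real.coe_toNNReal _ (sq_nonneg R)⟩
  have e : (gaussianReal 0 1).map (R * ·) = gaussianReal 0 v := by
    rw [gaussianReal_map_const_mul]
    congr 1
    · simp
    · rw [mul_one]; exact NNReal.eq hv.symm
  rw [e]
  have h1 := (integral_cdf_sub_sq (integrable_id_gaussianReal 0 v)
    (integrable_id_gaussianReal 0 1)).2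
  simp only [meanDist_gaussianReal] at h1
  change ∫ x, (_ - cdf (gaussianReal 0 1) x) ^ 2 ≤ _
  rw [h1]
  have hk := sqrt_two_div_pi_le_one
  set κ := Real.sqrt (2 / Real.pi)
  have hκ : 0 ≤ κ := Real.sqrt_nonneg _
  simp only [hv, NNReal.coe_one]
  have s1 : Real.sqrt (R ^ 2 + R ^ 2) = Real.sqrt 2 * R := by
    rw [← two_mul, Real.sqrt_mul (by norm_num), Real.sqrt_sq hR]
  have h2 : Real.sqrt 2 ^ 2 = 2 := Real.sq_sqrt (by norm_num)
  have h20 : 0 ≤ Real.sqrt 2 := Real.sqrt_nonneg 2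
  rw [s1, show (1 : ℝ) + 1 = 2 by norm_num]
  have s2 : Real.sqrt (R ^ 2 + 1) ^ 2 = R ^ 2 + 1 := Real.sq_sqrt (by positivity)
  have s3 : 1 ≤ Real.sqrt (R ^ 2 + 1) := Real.one_le_sqrt.2 (by nlinarith)
  set w := Real.sqrt (R ^ 2 + 1)
  have key : w - Real.sqrt 2 * R / 2 - Real.sqrt 2 / 2 ≤ (R - 1) ^ 2 / 2 := by
    set u := Real.sqrt 2 * R / 2 + Real.sqrt 2 / 2 with hu
    have hu0 : 0 ≤ u := by positivity
    have e1 : w ^ 2 - u ^ 2 = (R - 1) ^ 2 / 2 := by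
      rw [s2, hu]; nlinarith
    have : w - u ≤ (R - 1) ^ 2 / 2 := by
      by_contra hcon
      push Not at hcon
      nlinarith [sq_nonneg (R - 1)]
    rw [hu] at this; linarith
  calc _ = κ * (w - Real.sqrt 2 * R / 2 - Real.sqrt 2 / 2) := by ring
    _ ≤ κ * ((R - 1) ^ 2 / 2) := by gcongr
    _ ≤ 1 * ((R - 1) ^ 2 / 2) := by gcongr
    _ = _ := one_mul _

/-- The substitution y = Rx produces the factor R, and the scaled normal law is compared with N(0,1)
in L². Keeping R on the left avoids negative moments of the radius. -/
lemma mul_l2Dist_le (μ : Measure ℝ) [IsProbabilityMeasure μ] (hμ : Integrable id μ) {R : ℝ}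
    (hR : 0 ≤ R) : R * l2Dist μ ≤ 2 * l2Dist (μ.map (R * ·)) + (R ^ 2 - 1) ^ 2 := by
  rcases hR.eq_or_lt with rfl | h
  · have := l2Dist_nonneg (μ.map ((0 : ℝ) * ·))
    norm_num at *
    linarith
  have p1 : IsProbabilityMeasure (μ.map (R * ·)) := Measure.isProbabilityMeasure_map (by fun_prop)
  have p2 : IsProbabilityMeasure ((gaussianReal 0 1).map (R * ·)) :=
    Measure.isProbabilityMeasure_map (by fun_prop)
  have hγ := integrable_id_gaussianReal 0 1
  have i1 := (integral_cdf_sub_sq (integrable_id_map_mul hμ R) hγ).1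
  have i2 := (integral_cdf_sub_sq (integrable_id_map_mul hγ R) hγ).1
  have i3 := (integral_cdf_sub_sq (integrable_id_map_mul hμ R) (integrable_id_map_mul hγ R)).1
  have e : R * l2Dist μ = ∫ y, (cdf (μ.map (R * ·)) y - cdf ((gaussianReal 0 1).map (R * ·)) y) ^ 2 := by
    have := Measure.integral_comp_mul_left
      (fun y => (cdf (μ.map (R * ·)) y - cdf ((gaussianReal 0 1).map (R * ·)) y) ^ 2) R
    simp only [cdf_map_mul _ h] at this
    rw [l2Dist]
    unfold Phi
    rw [this, abs_of_pos (inv_pos.2 h), smul_eq_mul, mul_inv_cancel_left₀ h.ne']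
  have hg := l2Dist_gaussianReal_map_mul_le hR
  calc R * l2Dist μ ≤ ∫ y, (2 * (cdf (μ.map (R * ·)) y - cdf (gaussianReal 0 1) y) ^ 2 +
        2 * (cdf ((gaussianReal 0 1).map (R * ·)) y - cdf (gaussianReal 0 1) y) ^ 2) := by
        rw [e]
        refine integral_mono i3 ((i1.const_mul 2).add (i2.const_mul 2)) fun y => ?_
        dsimp only
        nlinarith [sq_nonneg ((cdf (μ.map (R * ·)) y - cdf (gaussianReal 0 1) y) +
          (cdf ((gaussianReal 0 1).map (R * ·)) y - cdf (gaussianReal 0 1) y))]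
    _ = 2 * l2Dist (μ.map (R * ·)) +
        2 * ∫ x, (cdf ((gaussianReal 0 1).map (R * ·)) x - Phi x) ^ 2 := by
        rw [integral_add (i1.const_mul 2) (i2.const_mul 2), integral_const_mul, integral_const_mul]
        rfl
    _ ≤ _ := by nlinarith [mul_nonneg (sq_nonneg (R - 1)) (by nlinarith : 0 ≤ (R + 1) ^ 2 - 1)]

lemma marg_smul {E : Type*} [NormedAddCommGroup E] [InnerProductSpace ℝ E] [MeasurableSpace E]
    [BorelSpace E] [FiniteDimensional ℝ E] (Q : Measure E) (R : ℝ) (g : E) :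
    marg Q (R • g) = (marg Q g).map (R * ·) := by
  rw [marg, marg, Measure.map_map (by fun_prop) (by fun_prop)]
  congr 1
  ext y
  simp [inner_smul_left]

/-! ### Upper bounds on the sphere. -/

section Sphere

variable {ι : Type*} [Fintype ι] [Nontrivial ι] {Q : Measure (EuclideanSpace ℝ ι)}
  [IsProbabilityMeasure Q] {C : ℝ}

/-- The marginal law of `√n Q` in a direction of the unit sphere. -/
noncomputable def sphereMarg (Q : Measure (EuclideanSpace ℝ ι))
    (θ : Metric.sphere (0 : EuclideanSpace ℝ ι) 1) : Measure ℝ :=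
  marg Q (Real.sqrt (Fintype.card ι) • θ.1)

lemma measurable_sphereMarg_comp {F : Measure ℝ → ℝ} (hF : Measurable fun g => F (marg Q g)) :
    Measurable fun θ => F (sphereMarg Q θ) :=
  hF.comp (by fun_prop : Measurable fun θ : Metric.sphere (0 : EuclideanSpace ℝ ι) 1 =>
    Real.sqrt (Fintype.card ι) • θ.1)

lemma sphereMarg_map_mul (θ : Metric.sphere (0 : EuclideanSpace ℝ ι) 1) (r : ℝ) :
    (sphereMarg Q θ).map (r / Real.sqrt (Fintype.card ι) * ·) = marg Q (r • θ.1) := by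
  rw [sphereMarg, ← marg_smul, smul_smul, div_mul_cancel₀]
  exact (Real.sqrt_pos.2 (Nat.cast_pos.2 Fintype.card_pos)).ne'

lemma sq_div_sqrt_sub_one (ι : Type*) [Fintype ι] (r : ℝ) :
    (r / Real.sqrt (Fintype.card ι)) ^ 2 - 1 = radDev ι r := by
  rw [radDev, div_pow, Real.sq_sqrt (Nat.cast_nonneg _)]

/-- Writing g = rθ, the marginal in direction g is the spherical one rescaled by r/√n. The rescaling
error has mean square of order 1/n, by the variance 2/n of the normalized squared radius. -/
lemma integral_sphere_kolDist_sq_le (hC : 0 ≤ C) (h : IsoLaw Q C) :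
    ∫ θ, kolDist (sphereMarg Q θ) ^ 2 ∂(sphereMeasure ι) ≤
      2 * (((6 + Real.log (Fintype.card ι)) ^ 2 * (16 * C + 17) + 18) / Fintype.card ι) +
        16 / Fintype.card ι := by
  have hb := h.integral_kolDist_sq_le hC
  rw [finrank_euclideanSpace] at hb
  have hm := measurable_kolDist_marg Q
  have i0 : Integrable (fun g => kolDist (marg Q g) ^ 2) (stdGaussian (EuclideanSpace ℝ ι)) :=
    Integrable.of_bound (hm.pow_const 2).aestronglyMeasurable 1 (Filter.Eventually.of_forall fun g => by
      rw [Real.norm_eq_abs, abs_of_nonneg (sq_nonneg _)]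
      exact pow_le_one₀ (kolDist_nonneg _) (kolDist_le_one _))
  have i1 := (integrable_stdGaussian_polar ι _ (hm.pow_const 2)).2 i0
  have i2 : Integrable (fun p : Metric.sphere (0 : EuclideanSpace ℝ ι) 1 × ℝ => radDev ι p.2 ^ 2)
      ((sphereMeasure ι).prod (radialLaw ι)) := (integrable_radDev_pow ι 2).comp_snd _
  have i3 : Integrable (fun θ => kolDist (sphereMarg Q θ) ^ 2) (sphereMeasure ι) :=
    Integrable.of_bound ((measurable_sphereMarg_comp hm).pow_const 2).aestronglyMeasurable 1
      (Filter.Eventually.of_forall fun g => by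
        rw [Real.norm_eq_abs, abs_of_nonneg (sq_nonneg _)]
        exact pow_le_one₀ (kolDist_nonneg _) (kolDist_le_one _))
  have hle : ∫ p : Metric.sphere (0 : EuclideanSpace ℝ ι) 1 × ℝ, kolDist (sphereMarg Q p.1) ^ 2
        ∂((sphereMeasure ι).prod (radialLaw ι)) ≤
      ∫ p : Metric.sphere (0 : EuclideanSpace ℝ ι) 1 × ℝ,
        (2 * kolDist (marg Q (p.2 • p.1.1)) ^ 2 + 8 * radDev ι p.2 ^ 2)
        ∂((sphereMeasure ι).prod (radialLaw ι)) := by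
    refine integral_mono_ae (i3.comp_fst _) ((i1.const_mul 2).add (i2.const_mul 8)) ?_
    have hr : ∀ᵐ p ∂((sphereMeasure ι).prod (radialLaw ι)), 0 ≤ p.2 :=
      Measure.quasiMeasurePreserving_snd.ae (radialLaw_nonneg ι)
    filter_upwards [hr] with p hp
    have k1 : IsProbabilityMeasure (sphereMarg Q p.1) := by unfold sphereMarg; infer_instance
    have k := kolDist_le_kolDist_map_mul (sphereMarg Q p.1)
      (R := p.2 / Real.sqrt (Fintype.card ι)) (by positivity)
    rw [sphereMarg_map_mul, sq_div_sqrt_sub_one] at k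
    have k2 := kolDist_nonneg (sphereMarg Q p.1)
    calc kolDist (sphereMarg Q p.1) ^ 2
        ≤ (kolDist (marg Q (p.2 • p.1.1)) + 2 * |radDev ι p.2|) ^ 2 := by gcongr
      _ ≤ _ := by
        rw [← sq_abs (radDev ι p.2)]
        nlinarith [sq_nonneg (kolDist (marg Q (p.2 • p.1.1)) - 2 * |radDev ι p.2|)]
  rw [integral_add (i1.const_mul 2) (i2.const_mul 8), integral_const_mul, integral_const_mul,
    integral_stdGaussian_polar ι _ (hm.pow_const 2), integral_fun_fst
      (fun θ => kolDist (sphereMarg Q θ) ^ 2), integral_fun_snd (fun r => radDev ι r ^ 2),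
    integral_radDev_sq] at hle
  simp only [probReal_univ, one_smul] at hle
  calc _ ≤ _ := hle
    _ ≤ 2 * (((6 + Real.log (Fintype.card ι)) ^ 2 * (16 * C + 17) + 18) / Fintype.card ι) +
        8 * (2 / Fintype.card ι) := by gcongr
    _ = _ := by ring

lemma integral_abs_sphereMarg_le (h : IsoLaw Q C) (θ : Metric.sphere (0 : EuclideanSpace ℝ ι) 1) :
    ∫ x, |x| ∂(sphereMarg Q θ) ≤ 1 := by
  set v := Real.sqrt (Fintype.card ι) • θ.1 with hv
  have h1 := sq_integral_le (h.memLp_inner v).norm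
  simp only [Real.norm_eq_abs, sq_abs] at h1
  rw [h.integral_inner_sq, finrank_euclideanSpace, hv, norm_smul, mul_pow, Real.norm_eq_abs, sq_abs,
    Real.sq_sqrt (Nat.cast_nonneg _), norm_eq_of_mem_sphere, one_pow, mul_one,
    div_self (Nat.cast_ne_zero.2 Fintype.card_ne_zero)] at h1
  rw [sphereMarg, marg, integral_map (by fun_prop) (by fun_prop)]
  have h2 : 0 ≤ ∫ x, |inner ℝ v x| ∂Q := integral_nonneg fun x => abs_nonneg _
  nlinarith

instance (θ : Metric.sphere (0 : EuclideanSpace ℝ ι) 1) : IsProbabilityMeasure (sphereMarg Q θ) := by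
  unfold sphereMarg; infer_instance

lemma integrable_id_sphereMarg (h : IsoLaw Q C) (θ : Metric.sphere (0 : EuclideanSpace ℝ ι) 1) :
    Integrable id (sphereMarg Q θ) := h.integrable_id_marg _

/-- A crude uniform bound from the first absolute moments, for integrability over the sphere. -/
lemma l2Dist_sphereMarg_le (h : IsoLaw Q C) (θ : Metric.sphere (0 : EuclideanSpace ℝ ι) 1) :
    l2Dist (sphereMarg Q θ) ≤ 2 := by
  have hi := integrable_id_sphereMarg h θ
  have hγ := integrable_id_gaussianReal 0 1
  rw [l2Dist_eq _ hi]
  have h1 : 0 ≤ meanDist (sphereMarg Q θ) (sphereMarg Q θ) := integral_nonneg fun _ => abs_nonneg _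
  have h2 : 0 ≤ 1 / Real.sqrt Real.pi := by positivity
  have h3 : meanDist (sphereMarg Q θ) (gaussianReal 0 1) ≤
      ∫ p : ℝ × ℝ, (|p.1| + |p.2|) ∂((sphereMarg Q θ).prod (gaussianReal 0 1)) := by
    have i1 : Integrable (fun p : ℝ × ℝ => |p.1| + |p.2|)
      ((sphereMarg Q θ).prod (gaussianReal 0 1)) := (hi.abs.comp_fst _).add (hγ.abs.comp_snd _)
    exact integral_mono_of_nonneg (Filter.Eventually.of_forall fun _ => abs_nonneg _) i1
      (Filter.Eventually.of_forall fun p => abs_sub _ _)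
  have i2 : Integrable (fun p : ℝ × ℝ => |p.1|) ((sphereMarg Q θ).prod (gaussianReal 0 1)) :=
    hi.abs.comp_fst _
  have i3 : Integrable (fun p : ℝ × ℝ => |p.2|) ((sphereMarg Q θ).prod (gaussianReal 0 1)) :=
    hγ.abs.comp_snd _
  rw [integral_add i2 i3, integral_fun_fst (fun x : ℝ => |x|),
    integral_fun_snd (fun x : ℝ => |x|)] at h3
  have h4 := integral_abs_sphereMarg_le h θ
  have h5 := sqrt_two_div_pi_le_one
  rw [← integral_abs_gaussian] at h5
  simp only [probReal_univ, one_smul] at h3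
  linarith

lemma integrable_l2Dist_sphereMarg (h : IsoLaw Q C) :
    Integrable (fun θ => l2Dist (sphereMarg Q θ)) (sphereMeasure ι) :=
  Integrable.of_bound (measurable_sphereMarg_comp (measurable_l2Dist_marg Q)).aestronglyMeasurable 2
    (Filter.Eventually.of_forall fun θ => by
      rw [Real.norm_eq_abs, abs_of_nonneg (l2Dist_nonneg _)]
      exact l2Dist_sphereMarg_le h θ)

lemma integrable_radius : Integrable (fun r => r / Real.sqrt (Fintype.card ι)) (radialLaw ι) := by
  simpa using (integrable_pow_radialLaw ι 1).div_const (Real.sqrt (Fintype.card ι))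

/-- The same quadratic minorant of the square root as in `sqrt_ge_of_nonneg`, averaged. For n ≥ 2
the variance 2/n of the squared radius is at most 1. -/
lemma integral_radius_ge :
    1 / 2 ≤ ∫ r, r / Real.sqrt (Fintype.card ι) ∂(radialLaw ι) := by
  have hn : (2 : ℝ) ≤ Fintype.card ι := by
    exact_mod_cast (Fintype.one_lt_card (α := ι))
  have j1 : Integrable (fun r => radDev ι r) (radialLaw ι) := by
    simpa using integrable_radDev_pow ι 1
  have j2 := integrable_radDev_pow ι 2
  have j3 : Integrable (fun r => 2 + radDev ι r) (radialLaw ι) := (integrable_const _).add j1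
  have j4 : Integrable (fun r => 2 + radDev ι r - radDev ι r ^ 2) (radialLaw ι) := j3.sub j2
  calc (1 : ℝ) / 2 ≤ (2 + 0 - 2 / Fintype.card ι) / 2 := by
        have : 2 / (Fintype.card ι : ℝ) ≤ 1 := (div_le_one (by linarith)).2 hn
        linarith
    _ = ∫ r, (2 + radDev ι r - radDev ι r ^ 2) / 2 ∂(radialLaw ι) := by
        rw [integral_div, integral_sub j3 j2, integral_add (integrable_const _) j1, integral_radDev,
          integral_radDev_sq]
        simp
    _ ≤ _ := by
        refine integral_mono_ae (j4.div_const 2) integrable_radius ?_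
        filter_upwards [radialLaw_nonneg ι] with r hr
        rw [← sq_div_sqrt_sub_one]
        have : 0 ≤ r / Real.sqrt (Fintype.card ι) := by positivity
        set R := r / Real.sqrt (Fintype.card ι)
        nlinarith [mul_nonneg (mul_nonneg this (sq_nonneg (R - 1))) (by linarith : 0 ≤ R + 2)]

/-- The factor R from `mul_l2Dist_le` is independent of θ, so its mean, at least 1/2, splits off. -/
lemma integral_sphere_l2Dist_le (h : IsoLaw Q C) :
    ∫ θ, l2Dist (sphereMarg Q θ) ∂(sphereMeasure ι) ≤ (8 * C + 16) / Fintype.card ι := by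
  obtain ⟨i0, hb⟩ := h.integral_l2Dist_le
  rw [finrank_euclideanSpace] at hb
  have hm := measurable_l2Dist_marg Q
  have i1 := (integrable_stdGaussian_polar ι _ hm).2 i0
  have i2 : Integrable (fun p : Metric.sphere (0 : EuclideanSpace ℝ ι) 1 × ℝ => radDev ι p.2 ^ 2)
      ((sphereMeasure ι).prod (radialLaw ι)) := (integrable_radDev_pow ι 2).comp_snd _
  have i3 := integrable_l2Dist_sphereMarg h
  have hle : ∫ p : Metric.sphere (0 : EuclideanSpace ℝ ι) 1 × ℝ, l2Dist (sphereMarg Q p.1) *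
        (p.2 / Real.sqrt (Fintype.card ι)) ∂((sphereMeasure ι).prod (radialLaw ι)) ≤
      ∫ p : Metric.sphere (0 : EuclideanSpace ℝ ι) 1 × ℝ,
        (2 * l2Dist (marg Q (p.2 • p.1.1)) + radDev ι p.2 ^ 2)
        ∂((sphereMeasure ι).prod (radialLaw ι)) := by
    refine integral_mono_ae (i3.mul_prod integrable_radius) ((i1.const_mul 2).add i2) ?_
    have hr : ∀ᵐ p ∂((sphereMeasure ι).prod (radialLaw ι)), 0 ≤ p.2 :=
      Measure.quasiMeasurePreserving_snd.ae (radialLaw_nonneg ι)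
    filter_upwards [hr] with p hp
    have k := mul_l2Dist_le (sphereMarg Q p.1) (integrable_id_sphereMarg h p.1)
      (R := p.2 / Real.sqrt (Fintype.card ι)) (by positivity)
    rw [sphereMarg_map_mul, sq_div_sqrt_sub_one] at k
    linarith
  rw [integral_add (i1.const_mul 2) i2, integral_const_mul, integral_stdGaussian_polar ι _ hm,
    integral_fun_snd (fun r => radDev ι r ^ 2), integral_radDev_sq,
    integral_prod_mul (fun θ => l2Dist (sphereMarg Q θ)) (fun r => r / Real.sqrt (Fintype.card ι))]
    at hle
  simp only [probReal_univ, one_smul] at hle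
  have k1 := integral_radius_ge (ι := ι)
  have k2 : 0 ≤ ∫ θ, l2Dist (sphereMarg Q θ) ∂(sphereMeasure ι) :=
    integral_nonneg fun _ => l2Dist_nonneg _
  have k3 : (8 * C + 16) / (Fintype.card ι : ℝ) =
    2 * (2 * ((2 * C + 3) / Fintype.card ι) + 2 / Fintype.card ι) := by ring
  rw [k3]
  nlinarith

end Sphere

/-! ### From random vectors to laws; the upper bounds for systems. -/

section Link

variable {Ω ι : Type*} [MeasurableSpace Ω] [Fintype ι]

/-- The law of the random vector `X / √n`. -/
noncomputable def scaledLaw (P : Measure Ω) (X : ι → Ω → ℝ) : Measure (EuclideanSpace ℝ ι) :=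
  P.map fun w => (Real.sqrt (Fintype.card ι))⁻¹ • WithLp.toLp 2 fun k => X k w

/-- A measurable random vector. -/
lemma measurable_scaledVector {X : ι → Ω → ℝ} (hX : ∀ k, Measurable (X k)) :
    Measurable fun w => (Real.sqrt (Fintype.card ι))⁻¹ • WithLp.toLp 2 fun k => X k w := by
  have : Measurable fun w => (fun k => X k w) := measurable_pi_lambda _ hX
  fun_prop

variable {P : Measure Ω} [IsProbabilityMeasure P] {X : ι → Ω → ℝ} (hX : ∀ k, Measurable (X k))
  [Nontrivial ι]
include hX

lemma isProbabilityMeasure_scaledLaw : IsProbabilityMeasure (scaledLaw P X) :=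
  Measure.isProbabilityMeasure_map (measurable_scaledVector hX).aemeasurable

/-- The normalization 1/√n of the law and the factor √n of the direction cancel. -/
lemma distFun_eq_cdf (θ : Metric.sphere (0 : EuclideanSpace ℝ ι) 1) (x : ℝ) :
    distFun P X θ x = cdf (sphereMarg (scaledLaw P X) θ) x := by
  have := isProbabilityMeasure_scaledLaw (P := P) hX
  have hm := measurable_scaledVector hX
  rw [sphereMarg, cdf_marg, scaledLaw, map_measureReal_apply hm
    (measurableSet_le (by fun_prop) (by fun_prop)), distFun]
  congr 1
  ext w
  have hn : Real.sqrt (Fintype.card ι) ≠ 0 :=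
    (Real.sqrt_pos.2 (Nat.cast_pos.2 Fintype.card_pos)).ne'
  rw [mem_preimage, mem_ofPred_eq, mem_ofPred_eq, real_inner_smul_left, real_inner_smul_right,
    mul_inv_cancel_left₀ hn]
  simp [PiLp.inner_apply, weightedSum, mul_comm]

lemma rho_eq (θ : Metric.sphere (0 : EuclideanSpace ℝ ι) 1) :
    rho P X θ = kolDist (sphereMarg (scaledLaw P X) θ) := by
  simp_rw [rho, distFun_eq_cdf hX, kolDist]

lemma omega_eq (θ : Metric.sphere (0 : EuclideanSpace ℝ ι) 1) :
    omega P X θ = Real.sqrt (l2Dist (sphereMarg (scaledLaw P X) θ)) := by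
  simp_rw [omega, distFun_eq_cdf hX, l2Dist]

lemma omega_sq_eq (θ : Metric.sphere (0 : EuclideanSpace ℝ ι) 1) :
    omega P X θ ^ 2 = l2Dist (sphereMarg (scaledLaw P X) θ) := by
  rw [omega_eq hX, Real.sq_sqrt (l2Dist_nonneg _)]

lemma measurable_rho :
    Measurable fun θ : Metric.sphere (0 : EuclideanSpace ℝ ι) 1 => rho P X θ := by
  have := isProbabilityMeasure_scaledLaw (P := P) hX
  simp_rw [rho_eq hX]
  exact measurable_sphereMarg_comp (measurable_kolDist_marg _)

lemma measurable_omega :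
    Measurable fun θ : Metric.sphere (0 : EuclideanSpace ℝ ι) 1 => omega P X θ := by
  have := isProbabilityMeasure_scaledLaw (P := P) hX
  simp_rw [omega_eq hX]
  exact (measurable_sphereMarg_comp (measurable_l2Dist_marg _)).sqrt

variable {C : ℝ} (h : IsoLaw (scaledLaw P X) C)
include h

lemma wellDefined_of_isoLaw : WellDefined P X := by
  have := isProbabilityMeasure_scaledLaw (P := P) hX
  refine ⟨fun θ => ?_, ?_, ?_⟩
  · simp_rw [distFun_eq_cdf hX]
    exact (integral_cdf_sub_sq (integrable_id_sphereMarg h θ) (integrable_id_gaussianReal 0 1)).1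
  · refine (memLp_two_iff_integrable_sq (measurable_omega hX).aestronglyMeasurable).2 ?_
    simp_rw [omega_sq_eq hX]
    exact integrable_l2Dist_sphereMarg h
  · refine MemLp.of_bound (measurable_rho hX).aestronglyMeasurable 1
      (Filter.Eventually.of_forall fun θ => ?_)
    rw [rho_eq hX, Real.norm_eq_abs, abs_of_nonneg (kolDist_nonneg _)]
    exact kolDist_le_one _

lemma upperBounds_of_isoLaw (hC : 0 ≤ C) : UpperBounds P X (5408 * C + 6000) := by
  have := isProbabilityMeasure_scaledLaw (P := P) hX
  have hw := wellDefined_of_isoLaw hX h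
  have hn : (2 : ℝ) ≤ Fintype.card ι := by exact_mod_cast (Fintype.one_lt_card (α := ι))
  have b1 : sphereMean (ι := ι) (fun θ => omega P X θ ^ 2) ≤ (8 * C + 16) / Fintype.card ι := by
    simp_rw [omega_sq_eq hX]
    exact integral_sphere_l2Dist_le h
  have b2 : sphereMean (ι := ι) (fun θ => rho P X θ ^ 2) ≤
      2 * (((6 + Real.log (Fintype.card ι)) ^ 2 * (16 * C + 17) + 18) / Fintype.card ι) +
        16 / Fintype.card ι := by
    simp_rw [rho_eq hX]
    exact integral_sphere_kolDist_sq_le hC h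
  have hl : 1 / 2 ≤ Real.log (Fintype.card ι) := by
    refine le_trans ?_ (Real.log_le_log (by norm_num) hn)
    linarith [Real.log_two_gt_d9]
  set n : ℝ := (Fintype.card ι : ℝ)
  set L := Real.log n
  have hn0 : 0 < n := by linarith
  refine ⟨b1.trans ?_, ?_, ?_, ?_⟩
  · gcongr <;> linarith
  · have h1 := (sq_integral_le hw.memLp_omega).trans b1
    refine (Real.le_sqrt_of_sq_le h1).trans ?_
    rw [Real.sqrt_div (by linarith)]
    gcongr
    rw [Real.sqrt_le_left (by linarith)]
    nlinarith
  · exact Real.le_sqrt_of_sq_le (sq_integral_le hw.memLp_rho)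
  · have h1 : sphereMean (ι := ι) (fun θ => rho P X θ ^ 2) ≤ (5408 * C + 6000) * L ^ 2 / n := by
      refine b2.trans ?_
      rw [← mul_div_assoc, ← add_div]
      gcongr
      -- As log n ≥ log 2 ≥ 1/2, additive constants are absorbed into the logarithm; this yields
      -- 5408 = 2·13²·16 in the final constant.
      have h6 : 6 + L ≤ 13 * L := by linarith
      have h6' : (6 + L) ^ 2 ≤ (13 * L) ^ 2 := by gcongr
      have h7 := mul_le_mul_of_nonneg_right h6' (by linarith : 0 ≤ 16 * C + 17)
      nlinarith
    refine (Real.sqrt_le_sqrt h1).trans ?_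
    rw [Real.sqrt_div (by positivity), Real.sqrt_mul (by linarith), Real.sqrt_sq (by linarith)]
    gcongr
    rw [Real.sqrt_le_left (by linarith)]
    nlinarith

end Link

/-! ### The test function and the expansion of its Gaussian covariance. -/

lemma exists_invSqrt_series : ∃ b : ℕ → ℝ, (∀ k, 0 < b k) ∧ b 0 = 1 ∧
    ∀ z : ℝ, |z| < 1 → HasSum (fun k => b k * z ^ k) (Real.sqrt (1 - z))⁻¹ := by
  -- The coefficients are binomial coefficients of k - 1/2 over k. Besides b 0 = 1, only their
  -- positivity matters, since it keeps the kernels below positive semidefinite.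
  have hs : ∀ (k : ℕ) (r : ℝ), (k : ℝ) - 1 < r → 0 < Ring.choose r k := by
    intro k r hr
    have h2 : 0 < (ascPochhammer ℝ k).eval (r - k + 1) := ascPochhammer_pos _ _ (by linarith)
    rw [Ring.choose_eq_smul, Polynomial.descPochhammer_smeval_eq_ascPochhammer,
      Polynomial.ascPochhammer_smeval_eq_eval]
    positivity
  refine ⟨fun k => Ring.choose ((1 / 2 : ℝ) + k - 1) k, fun k => hs _ _ (by linarith), by simp, ?_⟩
  intro z hz
  have h := (Real.one_div_one_sub_rpow_hasFPowerSeriesOnBall_zero (1 / 2)).hasSum (y := z)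
    (by rw [← ENNReal.ofReal_one, Metric.eball_ofReal]; simpa using hz)
  rw [Real.sqrt_eq_rpow]
  simpa [mul_comm] using h


/-- The coefficients in the expansion of Gaussian covariances of exponentials of squares. -/
noncomputable def expCoef (a : ℝ) (k : ℕ) (A : ℝ) : ℝ :=
  (a / (1 + a * A)) ^ k * (Real.sqrt (1 + a * A))⁻¹

/-- The test function, whose Gaussian expansion has no second order term. -/
noncomputable def testFun (s : ℝ) : ℝ :=
  64 * Real.exp (-(3 * s ^ 2) / 2) - 81 * Real.exp (-(8 * s ^ 2) / 2)

/-- The expansion coefficients of `testFun`. -/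
noncomputable def testCoef (k : ℕ) (A : ℝ) : ℝ := 64 * expCoef 3 k A - 81 * expCoef 8 k A

lemma abs_expCoef_mul_le {a A s : ℝ} (ha : 0 ≤ a) (hA : 0 ≤ A) (hs : 0 ≤ s) (hsA : s ≤ A) (k : ℕ) :
    |expCoef a k A * s ^ k| ≤ (a * A / (1 + a * A)) ^ k := by
  have h1 : 0 < 1 + a * A := by positivity
  have h2 : (Real.sqrt (1 + a * A))⁻¹ ≤ 1 :=
    inv_le_one_of_one_le₀ (Real.one_le_sqrt.2 (by nlinarith [mul_nonneg ha hA]))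
  rw [expCoef, abs_of_nonneg (by positivity)]
  calc _ = (a * s / (1 + a * A)) ^ k * (Real.sqrt (1 + a * A))⁻¹ := by
        rw [mul_right_comm, ← mul_pow]; ring
    _ ≤ (a * A / (1 + a * A)) ^ k * 1 := by gcongr
    _ = _ := mul_one _

lemma continuousOn_expCoef {a : ℝ} (ha : 0 ≤ a) (k : ℕ) : ContinuousOn (expCoef a k) (Ici 0) := by
  unfold expCoef
  have h : ∀ A ∈ Ici (0 : ℝ), 1 + a * A ≠ 0 := fun A hA => by
    have : 0 ≤ a * A := mul_nonneg ha hA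
    positivity
  refine ((ContinuousOn.div (by fun_prop) (by fun_prop) h).pow k).mul
    (ContinuousOn.inv₀ (by fun_prop) fun A hA => ?_)
  have : 0 ≤ a * A := mul_nonneg ha hA
  positivity

section Covariance

variable {E : Type*} [NormedAddCommGroup E] [InnerProductSpace ℝ E] [FiniteDimensional ℝ E]
  [MeasurableSpace E] [BorelSpace E]

/-- The joint Laplace transform factors as ((1+a|u|²)(1+c|w|²))^(-1/2) (1-z)^(-1/2) with z
proportional to ⟨u,w⟩², and z < 1 by Cauchy–Schwarz. In each term of the binomial series the
dependence on |u| and on |w| separates. -/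
lemma hasSum_expCov {b : ℕ → ℝ}
    (hb : ∀ z : ℝ, |z| < 1 → HasSum (fun k => b k * z ^ k) (Real.sqrt (1 - z))⁻¹)
    {a c : ℝ} (ha : 0 ≤ a) (hc : 0 ≤ c) (u w : E) :
    HasSum (fun k => b k * (expCoef a k (‖u‖ ^ 2) * expCoef c k (‖w‖ ^ 2) * inner ℝ u w ^ (2 * k)))
      (∫ g, Real.exp (-(a * inner ℝ u g ^ 2) / 2) * Real.exp (-(c * inner ℝ w g ^ 2) / 2)
        ∂(stdGaussian E)) := by
  have h0 := integral_exp_sq_inner_stdGaussian u w ha hc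
  simp_rw [← Real.exp_add, ← add_div, ← neg_add]
  rw [h0]
  have hA : 0 < 1 + a * ‖u‖ ^ 2 := by positivity
  have hB : 0 < 1 + c * ‖w‖ ^ 2 := by positivity
  have hx : inner ℝ u w ^ 2 ≤ ‖u‖ ^ 2 * ‖w‖ ^ 2 := by
    rw [← mul_pow, ← sq_abs]
    gcongr
    exact abs_real_inner_le_norm u w
  set z := a * c * inner ℝ u w ^ 2 / ((1 + a * ‖u‖ ^ 2) * (1 + c * ‖w‖ ^ 2)) with hz
  have hz0 : 0 ≤ z := by positivity
  have hz1 : z < 1 := by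
    rw [hz, div_lt_one (by positivity)]
    have := mul_le_mul_of_nonneg_left hx (mul_nonneg ha hc)
    nlinarith [mul_nonneg ha (sq_nonneg ‖u‖), mul_nonneg hc (sq_nonneg ‖w‖)]
  have h1 := (hb z (by rwa [abs_of_nonneg hz0])).mul_left
    ((Real.sqrt (1 + a * ‖u‖ ^ 2))⁻¹ * (Real.sqrt (1 + c * ‖w‖ ^ 2))⁻¹)
  have e1 : (fun k => b k * (expCoef a k (‖u‖ ^ 2) * expCoef c k (‖w‖ ^ 2) *
      inner ℝ u w ^ (2 * k))) = fun k => (Real.sqrt (1 + a * ‖u‖ ^ 2))⁻¹ *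
      (Real.sqrt (1 + c * ‖w‖ ^ 2))⁻¹ * (b k * z ^ k) := by
    ext k
    have e3 : z ^ k = (a / (1 + a * ‖u‖ ^ 2)) ^ k * (c / (1 + c * ‖w‖ ^ 2)) ^ k *
        inner ℝ u w ^ (2 * k) := by
      rw [hz, pow_mul, ← mul_pow, ← mul_pow]
      congr 1
      field_simp
    rw [e3, expCoef, expCoef]
    ring
  have e2 : (Real.sqrt ((1 + a * ‖u‖ ^ 2) * (1 + c * ‖w‖ ^ 2) - a * c * inner ℝ u w ^ 2))⁻¹ =
      (Real.sqrt (1 + a * ‖u‖ ^ 2))⁻¹ * (Real.sqrt (1 + c * ‖w‖ ^ 2))⁻¹ *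
        (Real.sqrt (1 - z))⁻¹ := by
    rw [← mul_inv, ← mul_inv, ← Real.sqrt_mul hA.le, ← Real.sqrt_mul (by positivity)]
    congr 2
    rw [hz]
    field_simp
  rw [e1, e2]
  exact h1

/-- By bilinearity the separated coefficients combine, so the same function `testCoef k` appears at
both points. This symmetry is what makes every term a positive semidefinite kernel. -/
lemma hasSum_testCov {b : ℕ → ℝ}
    (hb : ∀ z : ℝ, |z| < 1 → HasSum (fun k => b k * z ^ k) (Real.sqrt (1 - z))⁻¹) (u w : E) :
    HasSum (fun k => b k * (testCoef k (‖u‖ ^ 2) * testCoef k (‖w‖ ^ 2) * inner ℝ u w ^ (2 * k)))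
      (∫ g, testFun (inner ℝ u g) * testFun (inner ℝ w g) ∂(stdGaussian E)) := by
  have hi : ∀ a c : ℝ, 0 ≤ a → 0 ≤ c → Integrable (fun g => Real.exp (-(a * inner ℝ u g ^ 2) / 2) *
      Real.exp (-(c * inner ℝ w g ^ 2) / 2)) (stdGaussian E) := by
    intro a c ha hc
    refine Integrable.of_bound (Continuous.aestronglyMeasurable (by fun_prop)) 1
      (Filter.Eventually.of_forall fun g => ?_)
    rw [← Real.exp_add, Real.norm_eq_abs, Real.abs_exp, Real.exp_le_one_iff]
    have h1 : 0 ≤ a * inner ℝ u g ^ 2 := by positivity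
    have h2 : 0 ≤ c * inner ℝ w g ^ 2 := by positivity
    linarith
  have h33 := hi 3 3 (by norm_num) (by norm_num)
  have h38 := hi 3 8 (by norm_num) (by norm_num)
  have h83 := hi 8 3 (by norm_num) (by norm_num)
  have h88 := hi 8 8 (by norm_num) (by norm_num)
  have e : (fun g => testFun (inner ℝ u g) * testFun (inner ℝ w g)) = fun g =>
      64 * 64 * (Real.exp (-(3 * inner ℝ u g ^ 2) / 2) * Real.exp (-(3 * inner ℝ w g ^ 2) / 2)) -
      64 * 81 * (Real.exp (-(3 * inner ℝ u g ^ 2) / 2) * Real.exp (-(8 * inner ℝ w g ^ 2) / 2)) -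
      81 * 64 * (Real.exp (-(8 * inner ℝ u g ^ 2) / 2) * Real.exp (-(3 * inner ℝ w g ^ 2) / 2)) +
      81 * 81 * (Real.exp (-(8 * inner ℝ u g ^ 2) / 2) * Real.exp (-(8 * inner ℝ w g ^ 2) / 2)) := by
    ext g; unfold testFun; ring
  have e' := integral_add' (((h33.const_mul (64 * 64)).sub (h38.const_mul (64 * 81))).sub
    (h83.const_mul (81 * 64))) (h88.const_mul (81 * 81))
  rw [integral_sub' ((h33.const_mul _).sub (h38.const_mul _)) (h83.const_mul _),
    integral_sub' (h33.const_mul _) (h38.const_mul _), integral_const_mul, integral_const_mul,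
    integral_const_mul, integral_const_mul] at e'
  rw [e]
  refine Eq.subst (motive := fun x => HasSum _ x) e'.symm ?_
  have s33 := hasSum_expCov hb (show (0 : ℝ) ≤ 3 by norm_num) (show (0 : ℝ) ≤ 3 by norm_num) u w
  have s38 := hasSum_expCov hb (show (0 : ℝ) ≤ 3 by norm_num) (show (0 : ℝ) ≤ 8 by norm_num) u w
  have s83 := hasSum_expCov hb (show (0 : ℝ) ≤ 8 by norm_num) (show (0 : ℝ) ≤ 3 by norm_num) u w
  have s88 := hasSum_expCov hb (show (0 : ℝ) ≤ 8 by norm_num) (show (0 : ℝ) ≤ 8 by norm_num) u w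
  have s := (((s33.mul_left (64 * 64)).sub (s38.mul_left (64 * 81))).sub
    (s83.mul_left (81 * 64))).add (s88.mul_left (81 * 81))
  refine Eq.subst (motive := fun x => HasSum x _) (funext fun k => ?_) s
  unfold testCoef
  ring

/-- Kernels `f ⊗ f · ⟨·,·⟩ᵐ` are positive semidefinite. -/
lemma integral_mul_inner_pow_nonneg {Q : Measure E} [IsProbabilityMeasure Q] {B K : ℝ}
    (hB : ∀ᵐ y ∂Q, ‖y‖ ≤ B) {f : E → ℝ} (hf : Measurable f) (hK : ∀ y, |f y| ≤ K) (m : ℕ) :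
    0 ≤ ∫ p : E × E, f p.1 * f p.2 * inner ℝ p.1 p.2 ^ m ∂(Q.prod Q) := by
  set e := stdOrthonormalBasis ℝ E
  -- In coordinates the power of the scalar product is a sum of products of equal monomials in the
  -- two points, and each summand integrates to a square.
  have hexp : ∀ p : E × E, f p.1 * f p.2 * inner ℝ p.1 p.2 ^ m =
      ∑ σ : Fin m → Fin (Module.finrank ℝ E),
        (f p.1 * ∏ j, inner ℝ (e (σ j)) p.1) * (f p.2 * ∏ j, inner ℝ (e (σ j)) p.2) := by
    intro p
    rw [← e.sum_inner_mul_inner p.1 p.2, Fintype.sum_pow, Finset.mul_sum]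
    refine Finset.sum_congr rfl fun σ _ => ?_
    rw [Finset.prod_mul_distrib]
    simp_rw [real_inner_comm (e _) p.1]
    ring
  have hi : ∀ σ : Fin m → Fin (Module.finrank ℝ E),
      Integrable (fun y => f y * ∏ j, inner ℝ (e (σ j)) y) Q := by
    intro σ
    refine Integrable.of_bound (by fun_prop) (K * B ^ m) ?_
    filter_upwards [hB] with y hy
    rw [norm_mul, norm_prod]
    have hK0 : 0 ≤ K := (abs_nonneg _).trans (hK y)
    have h1 : ∏ j, ‖(inner ℝ (e (σ j)) y : ℝ)‖ ≤ ∏ _j : Fin m, B :=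
      Finset.prod_le_prod (fun _ _ => norm_nonneg _) fun j _ => by
        refine (norm_inner_le_norm _ _).trans ?_
        simpa using hy
    rw [Finset.prod_const, Finset.card_univ, Fintype.card_fin] at h1
    exact mul_le_mul (hK y) h1 (Finset.prod_nonneg fun _ _ => norm_nonneg _) hK0
  simp_rw [hexp]
  rw [integral_finsetSum _ fun σ _ => (hi σ).mul_prod (hi σ)]
  refine Finset.sum_nonneg fun σ _ => ?_
  rw [integral_prod_mul (fun y => f y * ∏ j, inner ℝ (e (σ j)) y)
    (fun y => f y * ∏ j, inner ℝ (e (σ j)) y)]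
  exact mul_self_nonneg _

end Covariance

@[fun_prop]
lemma continuous_testFun : Continuous testFun := by unfold testFun; fun_prop

lemma exp_neg_mul_sq_le_one {a : ℝ} (ha : 0 ≤ a) (s : ℝ) : Real.exp (-(a * s ^ 2) / 2) ≤ 1 := by
  rw [Real.exp_le_one_iff]
  have : 0 ≤ a * s ^ 2 := by positivity
  linarith

lemma abs_testFun_le (s : ℝ) : |testFun s| ≤ 145 := by
  have h1 := exp_neg_mul_sq_le_one (show (0 : ℝ) ≤ 3 by norm_num) s
  have h2 := exp_neg_mul_sq_le_one (show (0 : ℝ) ≤ 8 by norm_num) s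
  have h3 := Real.exp_pos (-(3 * s ^ 2) / 2)
  have h4 := Real.exp_pos (-(8 * s ^ 2) / 2)
  rw [testFun, abs_le]
  constructor <;> linarith

@[fun_prop]
lemma measurable_expCoef (a : ℝ) (k : ℕ) : Measurable (expCoef a k) := by
  unfold expCoef; fun_prop

@[fun_prop]
lemma measurable_testCoef (k : ℕ) : Measurable (testCoef k) := by
  unfold testCoef; fun_prop

lemma expCoef_nonneg {a A : ℝ} (ha : 0 ≤ a) (hA : 0 ≤ A) (k : ℕ) : 0 ≤ expCoef a k A := by
  unfold expCoef; positivity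

lemma expCoef_le {a A : ℝ} (ha : 0 ≤ a) (hA : 0 ≤ A) (k : ℕ) : expCoef a k A ≤ a ^ k := by
  have h1 : 1 ≤ 1 + a * A := by nlinarith [mul_nonneg ha hA]
  have h2 : (Real.sqrt (1 + a * A))⁻¹ ≤ 1 := inv_le_one_of_one_le₀ (Real.one_le_sqrt.2 h1)
  have h3 : a / (1 + a * A) ≤ a := div_le_self ha h1
  calc expCoef a k A ≤ a ^ k * 1 := by unfold expCoef; gcongr
    _ = _ := mul_one _

lemma abs_testCoef_le {A : ℝ} (hA : 0 ≤ A) (k : ℕ) : |testCoef k A| ≤ 64 * 3 ^ k + 81 * 8 ^ k := by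
  have h1 := expCoef_le (show (0 : ℝ) ≤ 3 by norm_num) hA k
  have h2 := expCoef_le (show (0 : ℝ) ≤ 8 by norm_num) hA k
  have h3 := expCoef_nonneg (show (0 : ℝ) ≤ 3 by norm_num) hA k
  have h4 := expCoef_nonneg (show (0 : ℝ) ≤ 8 by norm_num) hA k
  rw [testCoef, abs_le]
  constructor <;> linarith

/-- Geometric decay with a ratio below 1 that depends only on the radius of the support; it
dominates the series for the termwise integration. -/
lemma abs_testCoef_mul_pow_le {A D : ℝ} (hA : 0 ≤ A) (hD : A ≤ D) (k : ℕ) :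
    |testCoef k A| * A ^ k ≤ 145 * (8 * D / (1 + 8 * D)) ^ k := by
  have key : ∀ a : ℝ, 0 ≤ a → a ≤ 8 → |expCoef a k A * A ^ k| ≤ (8 * D / (1 + 8 * D)) ^ k := by
    intro a ha ha8
    refine (abs_expCoef_mul_le ha hA hA le_rfl k).trans ?_
    have h1 : a * A ≤ 8 * D := mul_le_mul ha8 hD hA (by norm_num)
    have h0 : 0 ≤ a * A := mul_nonneg ha hA
    gcongr ?_ ^ k
    rw [div_le_div_iff₀ (by linarith) (by linarith)]
    nlinarith
  have h3 := key 3 (by norm_num) (by norm_num)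
  have h8 := key 8 (by norm_num) le_rfl
  calc |testCoef k A| * A ^ k = |64 * (expCoef 3 k A * A ^ k) - 81 * (expCoef 8 k A * A ^ k)| := by
        rw [← abs_of_nonneg (pow_nonneg hA k), ← abs_mul, testCoef, abs_of_nonneg (pow_nonneg hA k)]
        congr 1; ring
    _ ≤ 64 * |expCoef 3 k A * A ^ k| + 81 * |expCoef 8 k A * A ^ k| := by
        refine (abs_sub _ _).trans ?_
        rw [abs_mul, abs_mul]
        norm_num
    _ ≤ 64 * (8 * D / (1 + 8 * D)) ^ k + 81 * (8 * D / (1 + 8 * D)) ^ k := by gcongr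
    _ = _ := by ring

section SecondMoment

variable {E : Type*} [NormedAddCommGroup E] [InnerProductSpace ℝ E] [FiniteDimensional ℝ E]
  [MeasurableSpace E] [BorelSpace E]

/-- The mean of the test function over the marginal of `Q` in direction `g`. -/
noncomputable def testMean (Q : Measure E) (g : E) : ℝ := ∫ y, testFun (inner ℝ y g) ∂Q

variable {Q : Measure E} [IsProbabilityMeasure Q]

lemma measurable_testMean : Measurable (testMean Q) := by
  have h : StronglyMeasurable (fun p : E × E => testFun (inner ℝ p.2 p.1)) :=
    Continuous.stronglyMeasurable (by fun_prop)
  exact h.integral_prod_right.measurable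

lemma abs_testMean_le (g : E) : |testMean Q g| ≤ 145 := by
  have := norm_integral_le_of_norm_le_const (μ := Q) (C := 145)
    (f := fun y => testFun (inner ℝ y g)) (Filter.Eventually.of_forall fun y => abs_testFun_le _)
  rw [probReal_univ, mul_one] at this
  exact this

lemma integral_testMean :
    ∫ g, testMean Q g ∂(stdGaussian E) = ∫ y, testCoef 0 (‖y‖ ^ 2) ∂Q := by
  have hi : Integrable (fun p : E × E => testFun (inner ℝ p.2 p.1)) ((stdGaussian E).prod Q) :=
    Integrable.of_bound (Continuous.aestronglyMeasurable (by fun_prop)) 145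
      (Filter.Eventually.of_forall fun _ => abs_testFun_le _)
  unfold testMean
  rw [integral_integral_swap (f := fun g y => testFun (inner ℝ y g)) hi]
  refine integral_congr_ae (Filter.Eventually.of_forall fun y => ?_)
  have key : ∀ a : ℝ, 0 ≤ a → Integrable (fun g => Real.exp (-(a * inner ℝ y g ^ 2) / 2))
      (stdGaussian E) ∧ ∫ g, Real.exp (-(a * inner ℝ y g ^ 2) / 2) ∂(stdGaussian E) =
        expCoef a 0 (‖y‖ ^ 2) := by
    intro a ha
    refine ⟨Integrable.of_bound (Continuous.aestronglyMeasurable (by fun_prop)) 1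
      (Filter.Eventually.of_forall fun g => ?_), ?_⟩
    · rw [Real.norm_eq_abs, Real.abs_exp]; exact exp_neg_mul_sq_le_one ha _
    · have := integral_exp_sq_inner_stdGaussian y (0 : E) ha le_rfl
      simpa [expCoef] using this
  obtain ⟨a1, a2⟩ := key 3 (by norm_num)
  obtain ⟨b1, b2⟩ := key 8 (by norm_num)
  simp only [testFun]
  rw [integral_sub (a1.const_mul _) (b1.const_mul _), integral_const_mul, integral_const_mul, a2, b2,
    testCoef]

lemma integral_testMean_sq :
    ∫ g, testMean Q g ^ 2 ∂(stdGaussian E) =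
      ∫ p : E × E, (∫ g, testFun (inner ℝ p.1 g) * testFun (inner ℝ p.2 g) ∂(stdGaussian E))
        ∂(Q.prod Q) := by
  have e : ∀ g, testMean Q g ^ 2 =
      ∫ p : E × E, testFun (inner ℝ p.1 g) * testFun (inner ℝ p.2 g) ∂(Q.prod Q) := by
    intro g
    rw [integral_prod_mul (fun y => testFun (inner ℝ y g)) (fun y => testFun (inner ℝ y g)), sq]
    rfl
  simp_rw [e]
  refine integral_integral_swap
    (f := fun g (p : E × E) => testFun (inner ℝ p.1 g) * testFun (inner ℝ p.2 g)) ?_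
  refine Integrable.of_bound (Continuous.aestronglyMeasurable (by fun_prop)) (145 * 145)
    (Filter.Eventually.of_forall fun q => ?_)
  rw [Function.uncurry, norm_mul]
  exact mul_le_mul (abs_testFun_le _) (abs_testFun_le _) (norm_nonneg _) (by norm_num)

lemma ae_prod_norm_le {B : ℝ} (hB : ∀ᵐ y ∂Q, ‖y‖ ≤ B) :
    ∀ᵐ p ∂(Q.prod Q), ‖p.1‖ ≤ B ∧ ‖p.2‖ ≤ B :=
  (Measure.quasiMeasurePreserving_fst.ae hB).and (Measure.quasiMeasurePreserving_snd.ae hB)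

/-- The fourth order term bounds the variance of `testMean` from below. -/
lemma exists_integral_testMean_sq_ge : ∃ β : ℝ, 0 < β ∧
    ∀ {E : Type*} [NormedAddCommGroup E] [InnerProductSpace ℝ E] [FiniteDimensional ℝ E]
      [MeasurableSpace E] [BorelSpace E] {Q : Measure E} [IsProbabilityMeasure Q] {B : ℝ},
      (∀ᵐ y ∂Q, ‖y‖ ≤ B) →
      (∫ g, testMean Q g ∂(stdGaussian E)) ^ 2 +
        β * ∫ p : E × E, testCoef 2 (‖p.1‖ ^ 2) * testCoef 2 (‖p.2‖ ^ 2) * inner ℝ p.1 p.2 ^ 4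
          ∂(Q.prod Q) ≤ ∫ g, testMean Q g ^ 2 ∂(stdGaussian E) := by
  obtain ⟨b, hb0, hb1, hb⟩ := exists_invSqrt_series
  refine ⟨b 2, hb0 2, ?_⟩
  intro E _ _ _ _ _ Q _ B hB
  set F : ℕ → E × E → ℝ := fun k p =>
    b k * (testCoef k (‖p.1‖ ^ 2) * testCoef k (‖p.2‖ ^ 2) * inner ℝ p.1 p.2 ^ (2 * k)) with hF
  have hs : ∀ p : E × E, HasSum (fun k => F k p)
      (∫ g, testFun (inner ℝ p.1 g) * testFun (inner ℝ p.2 g) ∂(stdGaussian E)) :=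
    fun p => hasSum_testCov hb p.1 p.2
  set q : ℝ := 8 * B ^ 2 / (1 + 8 * B ^ 2) with hq
  have hq0 : 0 ≤ q := by positivity
  have hq1 : q < 1 := by rw [hq, div_lt_one (by positivity)]; linarith
  have hq2 : q ^ 2 < 1 := by nlinarith
  have hFle : ∀ k, ∀ᵐ p ∂(Q.prod Q), ‖F k p‖ ≤ 145 ^ 2 * (b k * (q ^ 2) ^ k) := by
    intro k
    filter_upwards [ae_prod_norm_le hB] with p hp
    have hx : |inner ℝ p.1 p.2 ^ (2 * k)| ≤ (‖p.1‖ ^ 2) ^ k * (‖p.2‖ ^ 2) ^ k := by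
      rw [abs_pow, ← mul_pow, ← mul_pow, ← pow_mul]
      gcongr
      exact abs_real_inner_le_norm _ _
    have k1 := abs_testCoef_mul_pow_le (sq_nonneg ‖p.1‖)
      (pow_le_pow_left₀ (norm_nonneg _) hp.1 2) k
    have k2 := abs_testCoef_mul_pow_le (sq_nonneg ‖p.2‖)
      (pow_le_pow_left₀ (norm_nonneg _) hp.2 2) k
    rw [Real.norm_eq_abs, hF, abs_mul, abs_mul, abs_mul, abs_of_pos (hb0 k)]
    calc _ ≤ b k * (|testCoef k (‖p.1‖ ^ 2)| * |testCoef k (‖p.2‖ ^ 2)| *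
          ((‖p.1‖ ^ 2) ^ k * (‖p.2‖ ^ 2) ^ k)) := by have := hb0 k; gcongr
      _ = b k * ((|testCoef k (‖p.1‖ ^ 2)| * (‖p.1‖ ^ 2) ^ k) *
          (|testCoef k (‖p.2‖ ^ 2)| * (‖p.2‖ ^ 2) ^ k)) := by ring
      _ ≤ b k * ((145 * q ^ k) * (145 * q ^ k)) := by have := hb0 k; gcongr
      _ = _ := by ring_nf
  have hFi : ∀ k, Integrable (F k) (Q.prod Q) := fun k =>
    Integrable.of_bound (Measurable.aestronglyMeasurable (by fun_prop)) _ (hFle k)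
  have hsum : Summable fun k => ∫ p, ‖F k p‖ ∂(Q.prod Q) := by
    refine Summable.of_nonneg_of_le (fun k => integral_nonneg fun _ => norm_nonneg _) (fun k => ?_)
      ((hb (q ^ 2) (by rwa [abs_of_nonneg (sq_nonneg q)])).summable.mul_left (145 ^ 2))
    calc _ ≤ ∫ p, 145 ^ 2 * (b k * (q ^ 2) ^ k) ∂(Q.prod Q) :=
          integral_mono_ae (hFi k).norm (integrable_const _) (hFle k)
      _ = _ := by simp
  have hH := hasSum_integral_of_summable_integral_norm hFi hsum
  simp_rw [(hs _).tsum_eq] at hH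
  have hnn : ∀ k, 0 ≤ ∫ p, F k p ∂(Q.prod Q) := by
    intro k
    rw [hF, integral_const_mul]
    refine mul_nonneg (hb0 k).le (integral_mul_inner_pow_nonneg hB
      (f := fun y => testCoef k (‖y‖ ^ 2)) (by fun_prop)
      (fun y => abs_testCoef_le (sq_nonneg _) k) (2 * k))
  -- All terms are nonnegative, so two may be kept: k = 0 is the square of the mean, and k = 2
  -- carries the fourth power of the scalar product. The coefficient for k = 1 vanishes at unit norm
  -- and would give nothing.
  have hle := sum_le_hasSum {0, 2} (fun k _ => hnn k) hH
  rw [integral_testMean_sq, integral_testMean]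
  refine le_trans (le_of_eq ?_) hle
  rw [Finset.sum_pair (by norm_num), hF]
  simp only [integral_const_mul, hb1, one_mul, mul_zero, pow_zero, mul_one]
  rw [integral_prod_mul (fun y => testCoef 0 (‖y‖ ^ 2)) (fun y => testCoef 0 (‖y‖ ^ 2)), sq]

end SecondMoment

/-! ### Fourth moment concentration of the statistic by Gaussian rotation. -/

/-- The derivative of `testFun`. -/
noncomputable def testDeriv (s : ℝ) : ℝ :=
  -192 * (s * Real.exp (-(3 * s ^ 2) / 2)) + 648 * (s * Real.exp (-(8 * s ^ 2) / 2))

@[fun_prop]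
lemma continuous_testDeriv : Continuous testDeriv := by unfold testDeriv; fun_prop

lemma hasDerivAt_testFun (s : ℝ) : HasDerivAt testFun (testDeriv s) s := by
  have key : ∀ a : ℝ, HasDerivAt (fun s : ℝ => Real.exp (-(a * s ^ 2) / 2))
      (Real.exp (-(a * s ^ 2) / 2) * (-(a * s))) s := by
    intro a
    refine HasDerivAt.exp ?_
    exact ((((hasDerivAt_pow 2 s).const_mul a).fun_neg).div_const 2).congr_deriv (by simp; ring)
  exact (((key 3).const_mul 64).fun_sub ((key 8).const_mul 81)).congr_deriv
    (by unfold testDeriv; ring)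

lemma abs_mul_exp_neg_sq_le_one {a : ℝ} (ha : 1 ≤ a) (s : ℝ) :
    |s * Real.exp (-(a * s ^ 2) / 2)| ≤ 1 := by
  rw [abs_mul, Real.abs_exp, neg_div, Real.exp_neg, ← div_eq_mul_inv, div_le_one (Real.exp_pos _)]
  have h1 := Real.add_one_le_exp (a * s ^ 2 / 2)
  have h2 := mul_le_mul_of_nonneg_right ha (sq_nonneg s)
  have h3 := sq_abs s
  nlinarith [sq_nonneg (|s| - 1)]

lemma abs_testDeriv_le (s : ℝ) : |testDeriv s| ≤ 840 := by
  have h1 := abs_mul_exp_neg_sq_le_one (show (1 : ℝ) ≤ 3 by norm_num) s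
  have h2 := abs_mul_exp_neg_sq_le_one (show (1 : ℝ) ≤ 8 by norm_num) s
  rw [abs_le] at h1 h2
  rw [testDeriv, abs_le]
  constructor <;> linarith [h1.1, h1.2, h2.1, h2.2]

lemma integral_pow_four_gaussian : ∫ x, x ^ 4 ∂(gaussianReal 0 1) = 3 := by
  have h1 := integral_inner_stdGaussian (1 : ℝ) (fun x => x ^ 4) (by fun_prop)
  have h2 := integral_norm_pow_succ_stdGaussian (E := ℝ) 1
  have h3 := integral_norm_pow_succ_stdGaussian (E := ℝ) 0
  simp only [norm_one, one_mul] at h1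
  rw [← h1]
  norm_num at h2 h3
  simp only [RCLike.inner_apply, conj_trivial, mul_one]
  rw [h3, mul_one] at h2
  rw [← h2]
  refine integral_congr_ae (Filter.Eventually.of_forall fun x => ?_)
  simp [← abs_pow, abs_of_nonneg (show (0 : ℝ) ≤ x ^ 4 by positivity)]

/-- Cauchy–Schwarz against the constant 1, used twice. -/
lemma pow_four_intervalIntegral_le {f : ℝ → ℝ} {a b : ℝ} (hab : a ≤ b)
    (hf : Measurable f) {K : ℝ} (hK : ∀ t, |f t| ≤ K) :
    (∫ t in a..b, f t) ^ 4 ≤ (b - a) ^ 3 * ∫ t in a..b, f t ^ 4 := by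
  have hm : ∀ k : ℕ, MemLp (fun t => f t ^ k) 2 (volume.restrict (Ioc a b)) := fun k =>
    MemLp.of_bound (hf.pow_const k).aestronglyMeasurable (K ^ k)
      (Filter.Eventually.of_forall fun t => by
        rw [norm_pow]; exact pow_le_pow_left₀ (norm_nonneg _) (hK t) k)
  have key : ∀ k : ℕ, (∫ t in Ioc a b, f t ^ k) ^ 2 ≤ (∫ t in Ioc a b, f t ^ (2 * k)) * (b - a) := by
    intro k
    have h := integral_mul_sq_le (hm k) (memLp_const (1 : ℝ))
    simpa [← pow_mul, mul_comm k 2, hab] using h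
  have h1 := key 1
  have h2 := key 2
  simp only [pow_one] at h1
  rw [intervalIntegral.integral_of_le hab, intervalIntegral.integral_of_le hab]
  have h3 : 0 ≤ (∫ t in Ioc a b, f t) ^ 2 := sq_nonneg _
  calc (∫ t in Ioc a b, f t) ^ 4 = ((∫ t in Ioc a b, f t) ^ 2) ^ 2 := by ring
    _ ≤ ((∫ t in Ioc a b, f t ^ (2 * 1)) * (b - a)) ^ 2 := by gcongr
    _ = (∫ t in Ioc a b, f t ^ 2) ^ 2 * (b - a) ^ 2 := by rw [mul_one, mul_pow]
    _ ≤ ((∫ t in Ioc a b, f t ^ (2 * 2)) * (b - a)) * (b - a) ^ 2 := by gcongr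
    _ = _ := by norm_num; ring

section Rotation

variable {E : Type*} [NormedAddCommGroup E] [InnerProductSpace ℝ E] [FiniteDimensional ℝ E]
  [MeasurableSpace E] [BorelSpace E] {Q : Measure E} [IsProbabilityMeasure Q]

/-- The gradient of `testMean Q`. -/
noncomputable def testGrad (Q : Measure E) (g : E) : E := ∫ y, testDeriv (inner ℝ y g) • y ∂Q

lemma measurable_testGrad : Measurable (testGrad Q) := by
  have h : StronglyMeasurable (fun p : E × E => testDeriv (inner ℝ p.2 p.1) • p.2) :=
    Continuous.stronglyMeasurable (by fun_prop)
  exact h.integral_prod_right.measurable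

lemma integrable_testDeriv_smul (hQ : Integrable (fun y : E => ‖y‖) Q) (g : E) :
    Integrable (fun y => testDeriv (inner ℝ y g) • y) Q := by
  refine (hQ.const_mul 840).mono' (Continuous.aestronglyMeasurable (by fun_prop))
    (Filter.Eventually.of_forall fun y => ?_)
  rw [norm_smul]
  exact mul_le_mul_of_nonneg_right (abs_testDeriv_le _) (norm_nonneg _)

lemma inner_testGrad (hQ : Integrable (fun y : E => ‖y‖) Q) (g v : E) :
    inner ℝ v (testGrad Q g) = ∫ y, testDeriv (inner ℝ y g) * inner ℝ v y ∂Q := by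
  rw [testGrad, ← integral_inner (integrable_testDeriv_smul hQ g)]
  simp_rw [inner_smul_right]

/-- Duality: pairing the gradient D with itself and using Cauchy–Schwarz and isotropy, |D|⁴ ≤ 840²
|D|²/n. The gain of 1/n comes from isotropy, not from the size of the support. -/
lemma IsoLaw.norm_testGrad_sq_le [Nontrivial E] {C : ℝ} (h : IsoLaw Q C) (g : E) :
    ‖testGrad Q g‖ ^ 2 ≤ 840 ^ 2 / Module.finrank ℝ E := by
  have hn : (0 : ℝ) < Module.finrank ℝ E := by exact_mod_cast (Module.finrank_pos (R := ℝ))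
  set D := testGrad Q g with hD
  have h1 : ‖D‖ ^ 2 = ∫ y, testDeriv (inner ℝ y g) * inner ℝ D y ∂Q := by
    rw [← real_inner_self_eq_norm_sq]
    exact inner_testGrad h.integrable_norm g D
  have hm : MemLp (fun y : E => testDeriv (inner ℝ y g)) 2 Q :=
    MemLp.of_bound (Continuous.aestronglyMeasurable (by fun_prop)) 840
      (Filter.Eventually.of_forall fun y => abs_testDeriv_le _)
  have h2 := integral_mul_sq_le hm (h.memLp_inner D)
  rw [← h1, h.integral_inner_sq] at h2
  have h3 : ∫ y, testDeriv (inner ℝ y g) ^ 2 ∂Q ≤ 840 ^ 2 := by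
    have := integral_mono (g := fun _ => (840 : ℝ) ^ 2) hm.integrable_sq (integrable_const _)
      (fun y => sq_le_sq' (abs_le.1 (abs_testDeriv_le _)).1 (abs_le.1 (abs_testDeriv_le _)).2)
    simpa using this
  have h4 : (‖D‖ ^ 2) ^ 2 ≤ 840 ^ 2 * (‖D‖ ^ 2 / Module.finrank ℝ E) :=
    h2.trans (mul_le_mul_of_nonneg_right h3 (by positivity))
  rcases (sq_nonneg ‖D‖).eq_or_lt with h0 | h0
  · rw [← h0]; positivity
  · rw [le_div_iff₀ hn]
    rw [← mul_div_assoc, le_div_iff₀ hn] at h4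
    nlinarith

/-- The derivative of `testMean` along a rotation. -/
lemma hasDerivAt_testMean_rotation (hQ : Integrable (fun y : E => ‖y‖) Q) (p : E × E) (t : ℝ) :
    HasDerivAt (fun t => testMean Q (Real.cos t • p.1 + Real.sin t • p.2))
      (inner ℝ (-Real.sin t • p.1 + Real.cos t • p.2)
        (testGrad Q (Real.cos t • p.1 + Real.sin t • p.2))) t := by
  rw [inner_testGrad hQ]
  refine (hasDerivAt_integral_of_dominated_loc_of_deriv_le (s := univ)
    (F := fun t y => testFun (inner ℝ y (Real.cos t • p.1 + Real.sin t • p.2)))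
    (F' := fun t y => testDeriv (inner ℝ y (Real.cos t • p.1 + Real.sin t • p.2)) *
      inner ℝ (-Real.sin t • p.1 + Real.cos t • p.2) y)
    (bound := fun y => 840 * ((‖p.1‖ + ‖p.2‖) * ‖y‖)) Filter.univ_mem ?_ ?_ ?_ ?_ ?_ ?_).2
  · exact Filter.Eventually.of_forall fun t => Continuous.aestronglyMeasurable (by fun_prop)
  · exact Integrable.of_bound (Continuous.aestronglyMeasurable (by fun_prop)) 145
      (Filter.Eventually.of_forall fun _ => abs_testFun_le _)
  · exact Continuous.aestronglyMeasurable (by fun_prop)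
  · refine Filter.Eventually.of_forall fun y t _ => ?_
    rw [norm_mul]
    refine mul_le_mul (abs_testDeriv_le _) ((norm_inner_le_norm _ _).trans ?_) (norm_nonneg _)
      (by norm_num)
    gcongr
    refine (norm_add_le _ _).trans ?_
    rw [norm_smul, norm_smul, norm_neg]
    refine add_le_add (mul_le_of_le_one_left (norm_nonneg _) (Real.abs_sin_le_one t))
      (mul_le_of_le_one_left (norm_nonneg _) (Real.abs_cos_le_one t))
  · exact (hQ.const_mul _).const_mul _
  · refine Filter.Eventually.of_forall fun y t _ => ?_
    have h1 : HasDerivAt (fun t : ℝ => inner ℝ y (Real.cos t • p.1 + Real.sin t • p.2))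
        (inner ℝ (-Real.sin t • p.1 + Real.cos t • p.2) y) t := by
      simp only [inner_add_right, inner_smul_right, inner_add_left, inner_smul_left, conj_trivial]
      rw [real_inner_comm p.1 y, real_inner_comm p.2 y]
      exact ((Real.hasDerivAt_cos t).mul_const _).add ((Real.hasDerivAt_sin t).mul_const _)
    exact (hasDerivAt_testFun _).comp t h1

lemma integral_inner_pow_four (v : E) :
    Integrable (fun g => inner ℝ v g ^ 4) (stdGaussian E) ∧
    ∫ g, inner ℝ v g ^ 4 ∂(stdGaussian E) = 3 * ‖v‖ ^ 4 := by
  constructor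
  · refine ((integrable_norm_pow_stdGaussian (E := E) 4).const_mul (‖v‖ ^ 4)).mono'
      (Continuous.aestronglyMeasurable (by fun_prop)) (Filter.Eventually.of_forall fun g => ?_)
    rw [norm_pow, ← mul_pow]
    gcongr
    exact norm_inner_le_norm _ _
  · rw [integral_inner_stdGaussian v (fun x => x ^ 4) (by fun_prop)]
    simp_rw [mul_pow]
    rw [integral_const_mul, integral_pow_four_gaussian, mul_comm]

/-- The derivative of `testMean Q` along the rotation of a pair of vectors. -/
noncomputable def rotDeriv (Q : Measure E) (p : E × E) (t : ℝ) : ℝ :=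
  inner ℝ (-Real.sin t • p.1 + Real.cos t • p.2) (testGrad Q (Real.cos t • p.1 + Real.sin t • p.2))

lemma measurable_rotDeriv : Measurable (fun q : (E × E) × ℝ => rotDeriv Q q.1 q.2) := by
  have := measurable_testGrad (Q := Q)
  unfold rotDeriv
  fun_prop

lemma abs_rotDeriv_le {K : ℝ} (hK : ∀ g, ‖testGrad Q g‖ ≤ K) (p : E × E) (t : ℝ) :
    |rotDeriv Q p t| ≤ (‖p.1‖ + ‖p.2‖) * K := by
  refine (norm_inner_le_norm (𝕜 := ℝ) _ _).trans (mul_le_mul ?_ (hK _) (norm_nonneg _)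
    (by positivity : 0 ≤ ‖p.1‖ + ‖p.2‖))
  refine (norm_add_le _ _).trans ?_
  rw [norm_smul, norm_smul, norm_neg]
  exact add_le_add (mul_le_of_le_one_left (norm_nonneg _) (Real.abs_sin_le_one t))
    (mul_le_of_le_one_left (norm_nonneg _) (Real.abs_cos_le_one t))

/-- A rotated pair of independent standard Gaussian vectors is again such a pair. So the derivative
has the law of the second vector paired with the gradient at the first, which is conditionally
normal with fourth moment 3|∇|⁴. -/
lemma lintegral_rotDeriv_pow_four_le {D : ℝ} (hD : ∀ g, ‖testGrad Q g‖ ^ 2 ≤ D) (t : ℝ) :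
    ∫⁻ p, ENNReal.ofReal (rotDeriv Q p t ^ 4) ∂((stdGaussian E).prod (stdGaussian E)) ≤
      ENNReal.ofReal (3 * D ^ 2) := by
  have hmap := IsGaussian.map_rotation_eq_self (μ := stdGaussian E) integral_id_stdGaussian t
  have hm : Measurable (fun p : E × E => ENNReal.ofReal (inner ℝ p.2 (testGrad Q p.1) ^ 4)) := by
    have := measurable_testGrad (Q := Q)
    fun_prop
  have e := lintegral_map (μ := (stdGaussian E).prod (stdGaussian E)) hm
    (g := ContinuousLinearMap.rotation t) (by fun_prop)
  rw [hmap] at e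
  refine (le_of_eq e.symm).trans ?_
  rw [lintegral_prod _ hm.aemeasurable]
  calc _ ≤ ∫⁻ _, ENNReal.ofReal (3 * D ^ 2) ∂(stdGaussian E) := by
        refine lintegral_mono fun g => ?_
        simp_rw [real_inner_comm (testGrad Q g)]
        obtain ⟨i1, i2⟩ := integral_inner_pow_four (testGrad Q g)
        rw [← ofReal_integral_eq_lintegral_ofReal i1
          (Filter.Eventually.of_forall fun t => by positivity), i2]
        refine ENNReal.ofReal_le_ofReal ?_
        have h1 := hD g
        calc 3 * ‖testGrad Q g‖ ^ 4 = 3 * (‖testGrad Q g‖ ^ 2) ^ 2 := by ring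
          _ ≤ _ := by gcongr
    _ = _ := by simp

/-- The rotation through a quarter turn joins the two points; the increment is the integral of
`rotDeriv` along this path. -/
lemma ofReal_testMean_sub_pow_four_le (hQ : Integrable (fun y : E => ‖y‖) Q) {K : ℝ}
    (hK : ∀ g, ‖testGrad Q g‖ ≤ K) (p : E × E) :
    ENNReal.ofReal ((testMean Q p.2 - testMean Q p.1) ^ 4) ≤ ENNReal.ofReal ((Real.pi / 2) ^ 3) *
      ∫⁻ t in Ioc 0 (Real.pi / 2), ENNReal.ofReal (rotDeriv Q p t ^ 4) := by
  have hm : Measurable (fun t => rotDeriv Q p t) := by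
    have := measurable_testGrad (Q := Q)
    unfold rotDeriv
    fun_prop
  have hb := abs_rotDeriv_le hK p
  have hpi : (0 : ℝ) ≤ Real.pi / 2 := by positivity
  have hd : ∀ t, HasDerivAt (fun t => testMean Q (Real.cos t • p.1 + Real.sin t • p.2))
      (rotDeriv Q p t) t := fun t => hasDerivAt_testMean_rotation hQ p t
  have hftc : testMean Q p.2 - testMean Q p.1 =
      ∫ t in (0 : ℝ)..(Real.pi / 2), rotDeriv Q p t := by
    rw [intervalIntegral.integral_eq_sub_of_hasDerivAt (fun t _ => hd t)]
    · simp
    · exact (intervalIntegrable_const (c := (‖p.1‖ + ‖p.2‖) * K)).mono_fun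
        hm.aestronglyMeasurable (Filter.Eventually.of_forall fun t => by
          rw [Real.norm_eq_abs]; exact (hb t).trans (le_abs_self _))
  have h1 := pow_four_intervalIntegral_le hpi hm hb
  rw [sub_zero, ← hftc] at h1
  refine (ENNReal.ofReal_le_ofReal h1).trans ?_
  rw [ENNReal.ofReal_mul (by positivity), intervalIntegral.integral_of_le hpi,
    ofReal_integral_eq_lintegral_ofReal]
  · exact Integrable.of_bound (hm.pow_const 4).aestronglyMeasurable
      (((‖p.1‖ + ‖p.2‖) * K) ^ 4) (Filter.Eventually.of_forall fun t => by
        rw [norm_pow]; exact pow_le_pow_left₀ (norm_nonneg _) (hb t) 4)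
  · exact Filter.Eventually.of_forall fun t => by positivity

/-- The fourth moment of the difference of `testMean` at two independent Gaussian points. -/
lemma lintegral_testMean_sub_pow_four_le (hQ : Integrable (fun y : E => ‖y‖) Q) {D : ℝ}
    (hD : ∀ g, ‖testGrad Q g‖ ^ 2 ≤ D) :
    ∫⁻ p : E × E, ENNReal.ofReal ((testMean Q p.2 - testMean Q p.1) ^ 4)
      ∂((stdGaussian E).prod (stdGaussian E)) ≤ ENNReal.ofReal (24 * D ^ 2) := by
  have hgrad : ∀ g, ‖testGrad Q g‖ ≤ Real.sqrt D := fun g => Real.le_sqrt_of_sq_le (hD g)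
  have hm : Measurable (Function.uncurry fun p t => ENNReal.ofReal (rotDeriv Q p t ^ 4)) :=
    (measurable_rotDeriv.pow_const 4).ennreal_ofReal
  have hm' : Measurable fun p : E × E =>
      ∫⁻ t in Ioc 0 (Real.pi / 2), ENNReal.ofReal (rotDeriv Q p t ^ 4) :=
    Measurable.lintegral_prod_right' (f := fun q : (E × E) × ℝ =>
      ENNReal.ofReal (rotDeriv Q q.1 q.2 ^ 4)) hm
  have hpi0 := Real.pi_pos
  calc _ ≤ ∫⁻ p : E × E, ENNReal.ofReal ((Real.pi / 2) ^ 3) *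
        (∫⁻ t in Ioc 0 (Real.pi / 2), ENNReal.ofReal (rotDeriv Q p t ^ 4))
          ∂((stdGaussian E).prod (stdGaussian E)) :=
        lintegral_mono (ofReal_testMean_sub_pow_four_le hQ hgrad)
    _ = ENNReal.ofReal ((Real.pi / 2) ^ 3) * ∫⁻ t in Ioc 0 (Real.pi / 2),
        (∫⁻ p : E × E, ENNReal.ofReal (rotDeriv Q p t ^ 4)
          ∂((stdGaussian E).prod (stdGaussian E))) := by
        rw [lintegral_const_mul _ hm', lintegral_lintegral_swap hm.aemeasurable]
    _ ≤ ENNReal.ofReal ((Real.pi / 2) ^ 3) * ∫⁻ _ in Ioc 0 (Real.pi / 2),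
        ENNReal.ofReal (3 * D ^ 2) := by
        gcongr with t
        exact lintegral_rotDeriv_pow_four_le hD t
    _ = ENNReal.ofReal ((Real.pi / 2) ^ 4 * (3 * D ^ 2)) := by
        rw [lintegral_const, Measure.restrict_apply_univ, Real.volume_Ioc, sub_zero,
          ← ENNReal.ofReal_mul (by positivity), ← ENNReal.ofReal_mul (by positivity)]
        congr 1; ring
    _ ≤ _ := by
        refine ENNReal.ofReal_le_ofReal ?_
        -- The quarter turn contributes (π/2)⁴ ≤ 8, and 8·3 = 24.
        have h1 : (Real.pi / 2) ^ 2 ≤ 2.5 := by nlinarith [Real.pi_lt_d2]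
        have h2 : (Real.pi / 2) ^ 4 ≤ 8 := by nlinarith [sq_nonneg (Real.pi / 2)]
        calc _ ≤ 8 * (3 * D ^ 2) := by gcongr
          _ = 24 * D ^ 2 := by ring

/-- Fourth moment concentration of `testMean` under the Gaussian measure. -/
lemma integral_testMean_sub_pow_four_le (hQ : Integrable (fun y : E => ‖y‖) Q) {D : ℝ}
    (hD : ∀ g, ‖testGrad Q g‖ ^ 2 ≤ D) :
    ∫ g, (testMean Q g - ∫ x, testMean Q x ∂(stdGaussian E)) ^ 4 ∂(stdGaussian E) ≤ 24 * D ^ 2 := by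
  set γ := stdGaussian E
  have hmeas := measurable_testMean (Q := Q)
  obtain ⟨j1, j2⟩ := integrable_and_integral_le_of_lintegral
    (f := fun p : E × E => (testMean Q p.2 - testMean Q p.1) ^ 4)
    (Measurable.aestronglyMeasurable (by fun_prop)) (fun p => by positivity) (by positivity)
    (lintegral_testMean_sub_pow_four_le hQ hD)
  refine le_trans ?_ j2
  rw [integral_prod _ j1]
  have hbd : ∀ (k : ℕ) (c : ℝ), |c| ≤ 145 → MemLp (fun x => (testMean Q x - c) ^ k) 2 γ := by
    intro k c hc
    refine MemLp.of_bound (Measurable.aestronglyMeasurable (by fun_prop)) ((145 + 145) ^ k)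
      (Filter.Eventually.of_forall fun g => ?_)
    rw [norm_pow]
    refine pow_le_pow_left₀ (norm_nonneg _) ((norm_sub_le _ _).trans ?_) k
    exact add_le_add (abs_testMean_le g) hc
  have hm145 : |∫ x, testMean Q x ∂γ| ≤ 145 := by
    have := norm_integral_le_of_norm_le_const (μ := γ) (C := 145)
      (f := fun y => testMean Q y) (Filter.Eventually.of_forall fun y => abs_testMean_le _)
    rw [probReal_univ, mul_one] at this
    exact this
  have hi4 : Integrable (fun g => (testMean Q g - ∫ x, testMean Q x ∂γ) ^ 4) γ :=
    (hbd 4 _ hm145).integrable (by norm_num)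
  -- Jensen in the independent copy: the centering at the mean is bounded by the difference of two
  -- independent values.
  refine integral_mono hi4 j1.integral_prod_left fun g => ?_
  have e1 : ∫ x, testMean Q x ∂γ - testMean Q g = ∫ x, (testMean Q x - testMean Q g) ∂γ := by
    rw [integral_sub (Integrable.of_bound hmeas.aestronglyMeasurable 145
      (Filter.Eventually.of_forall fun y => abs_testMean_le _)) (integrable_const _)]
    simp
  have k1 := sq_integral_le (hbd 1 _ (abs_testMean_le (Q := Q) g))
  have k2 := sq_integral_le (hbd 2 _ (abs_testMean_le (Q := Q) g))
  simp only [pow_one, ← pow_mul] at k1 k2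
  norm_num at k2
  dsimp only
  calc _ = ((∫ x, testMean Q x ∂γ - testMean Q g) ^ 2) ^ 2 := by ring
    _ = ((∫ x, (testMean Q x - testMean Q g) ∂γ) ^ 2) ^ 2 := by rw [e1]
    _ ≤ (∫ x, (testMean Q x - testMean Q g) ^ 2 ∂γ) ^ 2 := by gcongr
    _ ≤ _ := k2

end Rotation

/-! ### The coefficients of the test function near unit norm. -/

lemma abs_inv_sqrt_sub_le {a : ℝ} (ha : -8 / 9 ≤ a) :
    |(Real.sqrt (1 + a))⁻¹ - 1 + a / 2| ≤ 7 / 2 * a ^ 2 := by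
  have h0 : (1 / 3) ^ 2 ≤ 1 + a := by linarith
  have hs : 1 / 3 ≤ Real.sqrt (1 + a) := Real.le_sqrt_of_sq_le h0
  have hsq : Real.sqrt (1 + a) ^ 2 = 1 + a := Real.sq_sqrt (by linarith)
  set s := Real.sqrt (1 + a)
  have hs0 : 0 < s := by linarith
  have ea : a = s ^ 2 - 1 := by linarith
  have e : s⁻¹ - 1 + a / 2 = (s - 1) ^ 2 * ((s + 2) / (2 * s)) := by
    rw [ea]; field_simp; ring
  have h1 : (s + 2) / (2 * s) ≤ 7 / 2 := by
    rw [div_le_iff₀ (by positivity)]; linarith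
  rw [e, abs_of_nonneg (by positivity), ea]
  calc _ ≤ (s - 1) ^ 2 * (7 / 2) := by gcongr
    _ ≤ _ := by nlinarith [mul_nonneg (sq_nonneg (s - 1)) (by nlinarith : 0 ≤ (s + 1) ^ 2 - 1)]

/-- The weights 64 and 81 are chosen for the rates 3 and 8 so that the linear terms at A = 1, both
of size 12, cancel; the value there is 32 - 27 = 5. Deviations of squared norms, of order n^(-1/2),
therefore move the mean of the statistic by O(1/n) only. -/
lemma abs_testCoef_zero_sub_le {A : ℝ} (hA : 0 ≤ A) : |testCoef 0 A - 5| ≤ 150 * (A - 1) ^ 2 := by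
  have e3 : (Real.sqrt (1 + 3 * A))⁻¹ = 1 / 2 * (Real.sqrt (1 + 3 / 4 * (A - 1)))⁻¹ := by
    rw [show 1 + 3 * A = 2 ^ 2 * (1 + 3 / 4 * (A - 1)) by ring, Real.sqrt_mul (by norm_num),
      Real.sqrt_sq (by norm_num), mul_inv, one_div]
  have e8 : (Real.sqrt (1 + 8 * A))⁻¹ = 1 / 3 * (Real.sqrt (1 + 8 / 9 * (A - 1)))⁻¹ := by
    rw [show 1 + 8 * A = 3 ^ 2 * (1 + 8 / 9 * (A - 1)) by ring, Real.sqrt_mul (by norm_num),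
      Real.sqrt_sq (by norm_num), mul_inv, one_div]
  have h3 := abs_inv_sqrt_sub_le (a := 3 / 4 * (A - 1)) (by linarith)
  have h8 := abs_inv_sqrt_sub_le (a := 8 / 9 * (A - 1)) (by linarith)
  simp only [testCoef, expCoef, pow_zero, one_mul]
  rw [e3, e8]
  rw [abs_le] at h3 h8 ⊢
  constructor <;> nlinarith [h3.1, h3.2, h8.1, h8.2, sq_nonneg (A - 1)]

/-- The value is 18 - 64/3 = -10/3; a nonzero fourth order coefficient is what gives the statistic
its variance. -/
lemma testCoef_two_one : testCoef 2 1 < -3 := by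
  have e3 : Real.sqrt (1 + 3 * 1) = 2 := by
    rw [show (1 : ℝ) + 3 * 1 = 2 ^ 2 by norm_num, Real.sqrt_sq (by norm_num)]
  have e8 : Real.sqrt (1 + 8 * 1) = 3 := by
    rw [show (1 : ℝ) + 8 * 1 = 3 ^ 2 by norm_num, Real.sqrt_sq (by norm_num)]
  unfold testCoef expCoef
  rw [e3, e8]
  norm_num

/-- Near A = A' = 1 both factors are below -3 by continuity. If A or A' is away from 1, a large K
makes the left side smaller than the crude bound on the product. -/
lemma exists_testCoef_two_mul_ge : ∃ K : ℝ, 0 ≤ K ∧ ∀ A A' : ℝ, 0 ≤ A → 0 ≤ A' →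
    9 - K * (|A - 1| + |A' - 1|) ≤ testCoef 2 A * testCoef 2 A' := by
  have hc : ContinuousAt (testCoef 2) 1 := by
    have h : ContinuousOn (testCoef 2) (Ici 0) := by
      unfold testCoef
      exact ((continuousOn_expCoef (by norm_num) 2).const_mul 64).sub
        ((continuousOn_expCoef (by norm_num) 2).const_mul 81)
    exact h.continuousAt (Ici_mem_nhds one_pos)
  have hev := hc.eventually (gt_mem_nhds testCoef_two_one)
  obtain ⟨δ, hδ, hb⟩ := Metric.eventually_nhds_iff.1 hev
  refine ⟨(5760 ^ 2 + 9) / δ, by positivity, fun A A' hA hA' => ?_⟩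
  have b1 := abs_testCoef_le hA 2
  have b2 := abs_testCoef_le hA' 2
  norm_num at b1 b2
  have hp : |testCoef 2 A * testCoef 2 A'| ≤ 5760 ^ 2 := by
    rw [abs_mul, sq]; exact mul_le_mul b1 b2 (abs_nonneg _) (by norm_num)
  by_cases h1 : |A - 1| < δ
  · by_cases h2 : |A' - 1| < δ
    · have k1 := hb (y := A) (by rwa [Real.dist_eq])
      have k2 := hb (y := A') (by rwa [Real.dist_eq])
      have : 0 ≤ (5760 ^ 2 + 9) / δ * (|A - 1| + |A' - 1|) := by positivity
      nlinarith
    · have : (5760 ^ 2 + 9) / δ * δ ≤ (5760 ^ 2 + 9) / δ * (|A - 1| + |A' - 1|) := by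
        have := abs_nonneg (A - 1)
        gcongr; linarith
      rw [div_mul_cancel₀ _ hδ.ne'] at this
      linarith [(abs_le.1 hp).1]
  · have : (5760 ^ 2 + 9) / δ * δ ≤ (5760 ^ 2 + 9) / δ * (|A - 1| + |A' - 1|) := by
      have := abs_nonneg (A' - 1)
      gcongr; linarith
    rw [div_mul_cancel₀ _ hδ.ne'] at this
    linarith [(abs_le.1 hp).1]

/-! ### The fluctuation of the statistic from below. -/

section Lower

variable {E : Type*} [NormedAddCommGroup E] [InnerProductSpace ℝ E] [FiniteDimensional ℝ E]
  [MeasurableSpace E] [BorelSpace E] [Nontrivial E] {Q : Measure E} [IsProbabilityMeasure Q]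
  {B C : ℝ}

/-- The mean fourth power of the scalar product of two independent points. -/
noncomputable def overlap (Q : Measure E) : ℝ :=
  ∫ p : E × E, inner ℝ p.1 p.2 ^ 4 ∂(Q.prod Q)

/-- Two of the four factors ⟨x,y⟩ are bounded by the support, the other two are integrated by
isotropy and give |x|²/n, and E||x|²-1| ≤ √(C/n). The result, of order n^(-3/2), is negligible
against an overlap of order 1/n. -/
lemma IsoLaw.integral_abs_dev_mul_le (h : IsoLaw Q C) (hC : 0 ≤ C) (hB0 : 0 ≤ B)
    (hB : ∀ᵐ y ∂Q, ‖y‖ ≤ B) :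
    Integrable (fun p : E × E => |‖p.1‖ ^ 2 - 1| * inner ℝ p.1 p.2 ^ 4) (Q.prod Q) ∧
    ∫ p : E × E, |‖p.1‖ ^ 2 - 1| * inner ℝ p.1 p.2 ^ 4 ∂(Q.prod Q) ≤
      B ^ 6 * Real.sqrt C / (Module.finrank ℝ E * Real.sqrt (Module.finrank ℝ E)) := by
  have hdev := h.memLp_dev.integrable (by norm_num)
  set n : ℝ := (Module.finrank ℝ E : ℝ) with hn
  have hn0 : 0 < n := Nat.cast_pos.2 (Module.finrank_pos (R := ℝ) (M := E))
  have h2 : ∀ᵐ p ∂(Q.prod Q), |‖p.1‖ ^ 2 - 1| * inner ℝ p.1 p.2 ^ 4 ≤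
      B ^ 4 * (|‖p.1‖ ^ 2 - 1| * inner ℝ p.1 p.2 ^ 2) := by
    filter_upwards [ae_prod_norm_le hB] with p hp
    have hx : inner ℝ p.1 p.2 ^ 2 ≤ B ^ 4 := by
      rw [← sq_abs, show B ^ 4 = (B * B) ^ 2 by ring]
      have := abs_real_inner_le_norm p.1 p.2
      gcongr
      exact this.trans (mul_le_mul hp.1 hp.2 (norm_nonneg _) hB0)
    have h0 : 0 ≤ |‖p.1‖ ^ 2 - 1| * inner ℝ p.1 p.2 ^ 2 := by positivity
    nlinarith
  have h3 : Integrable (fun p : E × E => |‖p.1‖ ^ 2 - 1| * inner ℝ p.1 p.2 ^ 2) (Q.prod Q) := by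
    refine Integrable.of_bound (Continuous.aestronglyMeasurable (by fun_prop))
      ((B ^ 2 + 1) * (B * B) ^ 2) ?_
    filter_upwards [ae_prod_norm_le hB] with p hp
    rw [norm_mul, norm_pow, Real.norm_eq_abs, abs_abs]
    have a1 : |‖p.1‖ ^ 2 - 1| ≤ B ^ 2 + 1 := by
      have : ‖p.1‖ ^ 2 ≤ B ^ 2 := pow_le_pow_left₀ (norm_nonneg _) hp.1 2
      rw [abs_le]; constructor <;> nlinarith [sq_nonneg ‖p.1‖]
    have a2 : ‖(inner ℝ p.1 p.2 : ℝ)‖ ≤ B * B :=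
      (norm_inner_le_norm _ _).trans (mul_le_mul hp.1 hp.2 (norm_nonneg _) hB0)
    gcongr
  have h4 : Integrable (fun p : E × E => |‖p.1‖ ^ 2 - 1| * inner ℝ p.1 p.2 ^ 4) (Q.prod Q) := by
    refine (h3.const_mul (B ^ 4)).mono' (Continuous.aestronglyMeasurable (by fun_prop)) ?_
    filter_upwards [h2] with p hp
    rwa [Real.norm_eq_abs, abs_of_nonneg (by positivity)]
  refine ⟨h4, ?_⟩
  have e1 : ∫ p : E × E, |‖p.1‖ ^ 2 - 1| * inner ℝ p.1 p.2 ^ 2 ∂(Q.prod Q) =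
      ∫ y, |‖y‖ ^ 2 - 1| * (‖y‖ ^ 2 / n) ∂Q := by
    rw [integral_prod _ h3]
    simp_rw [integral_const_mul]
    simp only [h.integral_inner_sq]
    rfl
  have h5 : ∫ y, |‖y‖ ^ 2 - 1| * (‖y‖ ^ 2 / n) ∂Q ≤ ∫ y, |‖y‖ ^ 2 - 1| * (B ^ 2 / n) ∂Q := by
    refine integral_mono_of_nonneg (Filter.Eventually.of_forall fun y => by positivity)
      (hdev.abs.mul_const _) ?_
    filter_upwards [hB] with y hy
    gcongr
  have h6 : ∫ y, |‖y‖ ^ 2 - 1| ∂Q ≤ Real.sqrt (C / n) := by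
    refine Real.le_sqrt_of_sq_le ?_
    have := sq_integral_le h.memLp_dev.norm
    simp only [Real.norm_eq_abs, sq_abs] at this
    exact this.trans h.integral_dev_sq_le
  calc _ ≤ ∫ p : E × E, B ^ 4 * (|‖p.1‖ ^ 2 - 1| * inner ℝ p.1 p.2 ^ 2) ∂(Q.prod Q) :=
        integral_mono_ae h4 (h3.const_mul _) h2
    _ ≤ B ^ 4 * (Real.sqrt (C / n) * (B ^ 2 / n)) := by
        rw [integral_const_mul, e1]
        rw [integral_mul_const] at h5
        gcongr
        exact h5.trans (by gcongr)
    _ = _ := by rw [Real.sqrt_div hC]; field_simp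

/-- Pointwise s v² - s³ v⁴ ≤ v for v ≥ 0, as is seen separately for sv ≤ 1 and sv ≥ 1. The parameter
s is free, to be matched to the size of w. -/
lemma integral_abs_ge_of_moments {α : Type*} [MeasurableSpace α] {μ : Measure α}
    {w : α → ℝ} (h1 : Integrable w μ) (h2 : Integrable (fun x => w x ^ 2) μ)
    (h4 : Integrable (fun x => w x ^ 4) μ) {s : ℝ} (hs : 0 ≤ s) :
    s * ∫ x, w x ^ 2 ∂μ - s ^ 3 * ∫ x, w x ^ 4 ∂μ ≤ ∫ x, |w x| ∂μ := by
  rw [← integral_const_mul, ← integral_const_mul, ← integral_sub (h2.const_mul _) (h4.const_mul _)]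
  refine integral_mono ((h2.const_mul _).sub (h4.const_mul _)) h1.abs fun x => ?_
  dsimp only
  have e2 : w x ^ 2 = |w x| ^ 2 := (sq_abs _).symm
  have e4 : w x ^ 4 = |w x| ^ 4 := by rw [show w x ^ 4 = (w x ^ 2) ^ 2 by ring, e2]; ring
  rw [e2, e4]
  set v := |w x|
  have hv : 0 ≤ v := abs_nonneg _
  rcases le_total (s * v) 1 with h | h
  · nlinarith [mul_nonneg (pow_nonneg hs 3) (pow_nonneg hv 4), mul_nonneg hv (sub_nonneg.2 h)]
  · have : s * v ^ 2 * 1 ≤ s * v ^ 2 * (s * v) ^ 2 := by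
      gcongr
      exact one_le_pow₀ h
    nlinarith

lemma IsoLaw.abs_integral_testMean_sub_le (h : IsoLaw Q C) :
    |∫ g, testMean Q g ∂(stdGaussian E) - 5| ≤ 150 * (C / Module.finrank ℝ E) := by
  rw [integral_testMean]
  have hi : Integrable (fun y : E => testCoef 0 (‖y‖ ^ 2)) Q :=
    Integrable.of_bound (Measurable.aestronglyMeasurable (by fun_prop)) _
      (Filter.Eventually.of_forall fun y => abs_testCoef_le (sq_nonneg _) 0)
  have e : ∫ y, testCoef 0 (‖y‖ ^ 2) ∂Q - 5 = ∫ y, (testCoef 0 (‖y‖ ^ 2) - 5) ∂Q := by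
    rw [integral_sub hi (integrable_const _)]; simp
  rw [e]
  refine (abs_integral_le_integral_abs).trans ?_
  calc _ ≤ ∫ y, 150 * (‖y‖ ^ 2 - 1) ^ 2 ∂Q :=
        integral_mono (hi.sub (integrable_const _)).abs (h.integrable_dev_sq.const_mul _)
          fun y => abs_testCoef_zero_sub_le (sq_nonneg _)
    _ ≤ _ := by
        rw [integral_const_mul]
        gcongr
        exact h.integral_dev_sq_le

lemma memLp_testMean_sub_pow (k : ℕ) (c : ℝ) :
    MemLp (fun x => (testMean Q x - c) ^ k) 2 (stdGaussian E) := by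
  have := measurable_testMean (Q := Q)
  refine MemLp.of_bound (Measurable.aestronglyMeasurable (by fun_prop)) ((145 + |c|) ^ k)
    (Filter.Eventually.of_forall fun g => ?_)
  rw [norm_pow]
  refine pow_le_pow_left₀ (norm_nonneg _) ((norm_sub_le _ _).trans ?_) k
  exact add_le_add (abs_testMean_le g) le_rfl

lemma integrable_testMean_sub_pow (k : ℕ) (c : ℝ) :
    Integrable (fun x => (testMean Q x - c) ^ k) (stdGaussian E) :=
  (memLp_testMean_sub_pow k c).integrable (by norm_num)

lemma IsoLaw.integral_testMean_sub_five_pow_four_le (h : IsoLaw Q C) :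
    ∫ g, (testMean Q g - 5) ^ 4 ∂(stdGaussian E) ≤
      (192 * (840 ^ 2) ^ 2 + 8 * (150 * C) ^ 4) / (Module.finrank ℝ E : ℝ) ^ 2 := by
  have h1 := integral_testMean_sub_pow_four_le h.integrable_norm h.norm_testGrad_sq_le
  have h2 := h.abs_integral_testMean_sub_le
  set m := ∫ g, testMean Q g ∂(stdGaussian E)
  set n : ℝ := (Module.finrank ℝ E : ℝ)
  have hn1 : 1 ≤ n := Nat.one_le_cast.2 (Module.finrank_pos (R := ℝ) (M := E))
  have h3 : (m - 5) ^ 4 ≤ (150 * C) ^ 4 / n ^ 2 := by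
    have : (m - 5) ^ 4 ≤ (150 * (C / n)) ^ 4 := by
      rw [← Even.pow_abs (by decide : Even 4)]; gcongr
    refine this.trans ?_
    rw [← mul_div_assoc, div_pow]
    gcongr
    · norm_num
  calc _ ≤ ∫ g, (8 * (testMean Q g - m) ^ 4 + 8 * (m - 5) ^ 4) ∂(stdGaussian E) := by
        refine integral_mono (integrable_testMean_sub_pow 4 5)
          (((integrable_testMean_sub_pow 4 m).const_mul 8).add (integrable_const _)) fun g => ?_
        dsimp only
        generalize testMean Q g = a
        have e : a - 5 = (a - m) + (m - 5) := by ring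
        rw [e]
        generalize a - m = u
        generalize m - 5 = v
        nlinarith [sq_nonneg (u ^ 2 - v ^ 2), sq_nonneg (u - v), sq_nonneg (u + v),
          mul_nonneg (sq_nonneg (u - v)) (sq_nonneg (u + v)), mul_nonneg (sq_nonneg (u - v)) (sq_nonneg (u - v)), mul_nonneg (sq_nonneg (u - v)) (sq_nonneg u), mul_nonneg (sq_nonneg (u - v)) (sq_nonneg v)]
    _ = 8 * ∫ g, (testMean Q g - m) ^ 4 ∂(stdGaussian E) + 8 * (m - 5) ^ 4 := by
        rw [integral_add ((integrable_testMean_sub_pow 4 m).const_mul 8) (integrable_const _),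
          integral_const_mul]
        simp
    _ ≤ 8 * (24 * (840 ^ 2 / n) ^ 2) + 8 * ((150 * C) ^ 4 / n ^ 2) := by gcongr
    _ = _ := by ring

end Lower

/-- The first absolute moment of the centered `testMean` is at least of order `1 / √n`. -/
lemma exists_integral_abs_testMean_sub_ge {B C c : ℝ} (hB0 : 0 ≤ B) (hC : 0 ≤ C) (hc : 0 < c) :
    ∃ δ N : ℝ, 0 < δ ∧ ∀ {E : Type*} [NormedAddCommGroup E] [InnerProductSpace ℝ E]
      [FiniteDimensional ℝ E] [MeasurableSpace E] [BorelSpace E] [Nontrivial E] {Q : Measure E}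
      [IsProbabilityMeasure Q], IsoLaw Q C → (∀ᵐ y ∂Q, ‖y‖ ≤ B) →
      c / Module.finrank ℝ E ≤ overlap Q → N ≤ Module.finrank ℝ E →
      δ / Real.sqrt (Module.finrank ℝ E) ≤ ∫ g, |testMean Q g - 5| ∂(stdGaussian E) := by
  obtain ⟨β, hβ, hvar⟩ := exists_integral_testMean_sq_ge
  obtain ⟨K, hK, hcoef⟩ := exists_testCoef_two_mul_ge
  set D : ℝ := 192 * (840 ^ 2) ^ 2 + 8 * (150 * C) ^ 4 with hD
  have hD0 : 0 < D := by positivity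
  set a : ℝ := 8 * β * c with ha
  have ha0 : 0 < a := by positivity
  -- With s = σ√n the lower bound is σ(a - σ²D)/√n; this σ makes the loss one half of the gain.
  set σ : ℝ := Real.sqrt (a / (2 * D)) with hσ
  have hσ0 : 0 < σ := Real.sqrt_pos.2 (by positivity)
  have hσ2 : σ ^ 2 = a / (2 * D) := Real.sq_sqrt (by positivity)
  -- Beyond this dimension the errors from the norm deviations, of order n^(-3/2), stay below c/n,
  -- so that 9c/n drops to no less than 8c/n.
  refine ⟨σ * a / 2, (2 * K * (B ^ 6 * Real.sqrt C) / c) ^ 2, by positivity, ?_⟩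
  intro E _ _ _ _ _ _ Q _ h hB hov hN
  have h4 := h.integral_testMean_sub_five_pow_four_le
  obtain ⟨i1, i2⟩ := h.integral_abs_dev_mul_le hC hB0 hB
  have hv := hvar hB
  have hn0 : (0 : ℝ) < Module.finrank ℝ E := Nat.cast_pos.2 (Module.finrank_pos (R := ℝ) (M := E))
  rw [← hD] at h4
  clear_value D
  set n : ℝ := (Module.finrank ℝ E : ℝ)
  set r := Real.sqrt n with hr
  have hr0 : 0 < r := Real.sqrt_pos.2 hn0
  have hrn : r ^ 2 = n := Real.sq_sqrt hn0.le
  have hrN : 2 * K * (B ^ 6 * Real.sqrt C) ≤ c * r := by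
    have : 2 * K * (B ^ 6 * Real.sqrt C) / c ≤ r := Real.le_sqrt_of_sq_le hN
    rwa [div_le_iff₀ hc, mul_comm r] at this
  have ix : Integrable (fun p : E × E => inner ℝ p.1 p.2 ^ 4) (Q.prod Q) := by
    refine Integrable.of_bound (Continuous.aestronglyMeasurable (by fun_prop)) ((B * B) ^ 4) ?_
    filter_upwards [ae_prod_norm_le hB] with p hp
    rw [norm_pow]
    gcongr
    exact (norm_inner_le_norm _ _).trans (mul_le_mul hp.1 hp.2 (norm_nonneg _) hB0)
  have i1' : Integrable (fun p : E × E => |‖p.2‖ ^ 2 - 1| * inner ℝ p.1 p.2 ^ 4) (Q.prod Q) := by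
    refine i1.swap.congr (Filter.Eventually.of_forall fun p => ?_)
    simp [real_inner_comm]
  have e1 : ∫ p : E × E, |‖p.2‖ ^ 2 - 1| * inner ℝ p.1 p.2 ^ 4 ∂(Q.prod Q) =
      ∫ p : E × E, |‖p.1‖ ^ 2 - 1| * inner ℝ p.1 p.2 ^ 4 ∂(Q.prod Q) := by
    rw [← integral_prod_swap]
    simp [real_inner_comm]
  have hT : 8 * c / n ≤ ∫ p : E × E, testCoef 2 (‖p.1‖ ^ 2) * testCoef 2 (‖p.2‖ ^ 2) *
      inner ℝ p.1 p.2 ^ 4 ∂(Q.prod Q) := by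
    have iT : Integrable (fun p : E × E => testCoef 2 (‖p.1‖ ^ 2) * testCoef 2 (‖p.2‖ ^ 2) *
        inner ℝ p.1 p.2 ^ 4) (Q.prod Q) := by
      refine (ix.const_mul (5760 * 5760)).mono' (Measurable.aestronglyMeasurable (by fun_prop))
        (Filter.Eventually.of_forall fun p => ?_)
      have b1 := abs_testCoef_le (sq_nonneg ‖p.1‖) 2
      have b2 := abs_testCoef_le (sq_nonneg ‖p.2‖) 2
      norm_num at b1 b2
      rw [norm_mul, norm_mul, Real.norm_eq_abs, Real.norm_eq_abs,
        Real.norm_of_nonneg (by positivity : 0 ≤ inner ℝ p.1 p.2 ^ 4)]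
      gcongr
    calc 8 * c / n ≤ 9 * overlap Q - K * (2 * (B ^ 6 * Real.sqrt C / (n * r))) := by
          have : K * (2 * (B ^ 6 * Real.sqrt C / (n * r))) ≤ c / n := by
            rw [show K * (2 * (B ^ 6 * Real.sqrt C / (n * r))) =
              2 * K * (B ^ 6 * Real.sqrt C) / (n * r) by ring, div_le_div_iff₀ (by positivity) hn0]
            nlinarith
          have e : 8 * c / n = 9 * (c / n) - c / n := by ring
          rw [e]; linarith
      _ ≤ 9 * overlap Q - K * ((∫ p : E × E, |‖p.1‖ ^ 2 - 1| * inner ℝ p.1 p.2 ^ 4 ∂(Q.prod Q)) +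
          ∫ p : E × E, |‖p.2‖ ^ 2 - 1| * inner ℝ p.1 p.2 ^ 4 ∂(Q.prod Q)) := by
          rw [e1]
          have := mul_le_mul_of_nonneg_left i2 hK
          linarith
      _ = ∫ p : E × E, (9 * inner ℝ p.1 p.2 ^ 4 - K * (|‖p.1‖ ^ 2 - 1| * inner ℝ p.1 p.2 ^ 4 +
          |‖p.2‖ ^ 2 - 1| * inner ℝ p.1 p.2 ^ 4)) ∂(Q.prod Q) := by
          have is : Integrable (fun p : E × E => |‖p.1‖ ^ 2 - 1| * inner ℝ p.1 p.2 ^ 4 +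
            |‖p.2‖ ^ 2 - 1| * inner ℝ p.1 p.2 ^ 4) (Q.prod Q) := i1.add i1'
          rw [integral_sub (ix.const_mul _) (is.const_mul _), integral_const_mul,
            integral_const_mul, integral_add i1 i1', overlap]
      _ ≤ _ := by
          refine integral_mono ((ix.const_mul _).sub ((i1.add i1').const_mul _)) iT fun p => ?_
          have := mul_le_mul_of_nonneg_right (hcoef (‖p.1‖ ^ 2) (‖p.2‖ ^ 2) (sq_nonneg _)
            (sq_nonneg _)) (by positivity : 0 ≤ inner ℝ p.1 p.2 ^ 4)
          dsimp only
          linarith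
  -- The second moment about 5 is the variance plus (m - 5)², and the latter is discarded.
  have h2 : a / n ≤ ∫ g, (testMean Q g - 5) ^ 2 ∂(stdGaussian E) := by
    set m := ∫ g, testMean Q g ∂(stdGaussian E) with hm
    have j1 : Integrable (testMean Q) (stdGaussian E) := by
      simpa using integrable_testMean_sub_pow (Q := Q) 1 0
    have j2 : Integrable (fun g => testMean Q g ^ 2) (stdGaussian E) := by
      simpa using integrable_testMean_sub_pow (Q := Q) 2 0
    have j3 : Integrable (fun g => testMean Q g ^ 2 - 10 * testMean Q g) (stdGaussian E) :=
      j2.sub (j1.const_mul 10)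
    have e : ∀ g, (testMean Q g - 5) ^ 2 = testMean Q g ^ 2 - 10 * testMean Q g + 25 := fun g => by
      ring
    simp_rw [e]
    rw [integral_add j3 (integrable_const _), integral_sub j2 (j1.const_mul 10),
      integral_const_mul, ← hm]
    simp only [integral_const, probReal_univ, smul_eq_mul, one_mul]
    have := mul_le_mul_of_nonneg_left hT hβ.le
    have e' : β * (8 * c / n) = a / n := by rw [ha]; ring
    nlinarith [sq_nonneg (m - 5)]
  have key := integral_abs_ge_of_moments (w := fun g => testMean Q g - 5)
    (by simpa using integrable_testMean_sub_pow (Q := Q) 1 5) (integrable_testMean_sub_pow 2 5)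
    (integrable_testMean_sub_pow 4 5) (s := σ * r) (by positivity)
  refine le_trans ?_ key
  have k1 : σ * r * (a / n) ≤ σ * r * ∫ g, (testMean Q g - 5) ^ 2 ∂(stdGaussian E) := by gcongr
  have k2 : (σ * r) ^ 3 * ∫ g, (testMean Q g - 5) ^ 4 ∂(stdGaussian E) ≤ (σ * r) ^ 3 * (D / n ^ 2) := by
    gcongr
  have k3 : σ * a / 2 / r = σ * r * (a / n) - (σ * r) ^ 3 * (D / n ^ 2) := by
    have : σ ^ 3 = σ * (a / (2 * D)) := by rw [← hσ2]; ring
    rw [mul_pow, this, ← hrn]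
    field_simp
    ring
  linarith

/-! ### From the statistic back to the distances on the sphere. -/

lemma integrable_mul_exp_neg_sq {a : ℝ} (ha : 0 < a) :
    Integrable (fun s : ℝ => s * Real.exp (-(a * s ^ 2) / 2)) := by
  have := integrable_mul_exp_neg_mul_sq (b := a / 2) (by positivity)
  refine this.congr (Filter.Eventually.of_forall fun s => ?_)
  dsimp only
  congr 2; ring

lemma integrable_testDeriv : Integrable testDeriv :=
  ((integrable_mul_exp_neg_sq (by norm_num)).const_mul _).add
    ((integrable_mul_exp_neg_sq (by norm_num)).const_mul _)

lemma memLp_testDeriv : MemLp testDeriv 2 := by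
  refine (memLp_two_iff_integrable_sq (Continuous.aestronglyMeasurable (by fun_prop))).2 ?_
  refine (integrable_testDeriv.abs.const_mul 840).mono' (Continuous.aestronglyMeasurable
    (by fun_prop)) (Filter.Eventually.of_forall fun s => ?_)
  rw [norm_pow, Real.norm_eq_abs, sq]
  exact mul_le_mul_of_nonneg_right (abs_testDeriv_le s) (abs_nonneg _)

lemma integral_testFun_mul_gaussian (R : ℝ) :
    ∫ x, testFun (R * x) ∂(gaussianReal 0 1) = testCoef 0 (R ^ 2) := by
  have key : ∀ a : ℝ, 0 ≤ a → Integrable (fun x => Real.exp (-(a * (R * x) ^ 2) / 2))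
      (gaussianReal 0 1) ∧ ∫ x, Real.exp (-(a * (R * x) ^ 2) / 2) ∂(gaussianReal 0 1) =
        expCoef a 0 (R ^ 2) := by
    intro a ha
    constructor
    · refine Integrable.of_bound (Continuous.aestronglyMeasurable (by fun_prop)) 1
        (Filter.Eventually.of_forall fun g => ?_)
      rw [Real.norm_eq_abs, Real.abs_exp]; exact exp_neg_mul_sq_le_one ha _
    · have := integral_exp_sq_gaussian (a := a * R ^ 2) (by positivity)
      rw [expCoef, pow_zero, one_mul, ← this]
      congr 1; ext x; congr 1; ring
  obtain ⟨a1, a2⟩ := key 3 (by norm_num)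
  obtain ⟨b1, b2⟩ := key 8 (by norm_num)
  simp only [testFun]
  rw [integral_sub (a1.const_mul _) (b1.const_mul _), integral_const_mul, integral_const_mul, a2, b2,
    testCoef]

/-- The rescaled test function is used on the spherical marginal instead of rescaling the marginal.
The L¹-norm of its derivative does not depend on R, while the L²-norm grows like √R. -/
lemma abs_integral_testFun_mul_sub_le (μ : Measure ℝ) [IsProbabilityMeasure μ]
    (hμ : Integrable id μ) {R : ℝ} (hR : 0 ≤ R) :
    |∫ x, testFun (R * x) ∂μ - testCoef 0 (R ^ 2)| ≤ kolDist μ * ∫ s, |testDeriv s| ∧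
    |∫ x, testFun (R * x) ∂μ - testCoef 0 (R ^ 2)| ≤
      Real.sqrt (l2Dist μ) * (Real.sqrt R * Real.sqrt (∫ s, testDeriv s ^ 2)) := by
  rw [← integral_testFun_mul_gaussian]
  rcases hR.eq_or_lt with rfl | hR0
  · have h1 : 0 ≤ kolDist μ * ∫ s, |testDeriv s| :=
      mul_nonneg (kolDist_nonneg μ) (integral_nonneg fun _ => abs_nonneg _)
    simp [h1]
  have hd : ∀ x, HasDerivAt (fun x => testFun (R * x)) (R * testDeriv (R * x)) x := by
    intro x
    have h1 : HasDerivAt (fun x : ℝ => R * x) R x := by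
      simpa using (hasDerivAt_id x).const_mul R
    exact ((hasDerivAt_testFun (R * x)).comp x h1).congr_deriv (mul_comm _ _)
  have hb : ∀ x, |R * testDeriv (R * x)| ≤ R * 840 := fun x => by
    rw [abs_mul, abs_of_pos hR0]
    exact mul_le_mul_of_nonneg_left (abs_testDeriv_le _) hR
  constructor
  · have h1 := abs_integral_sub_le_kolDist hd (by fun_prop) (fun x => abs_testFun_le (R * x)) hb
      ((integrable_testDeriv.comp_mul_left' hR0.ne').const_mul R) μ hμ
    refine h1.trans (le_of_eq ?_)
    congr 1
    simp_rw [abs_mul]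
    rw [integral_const_mul, Measure.integral_comp_mul_left (fun x => |testDeriv x|),
      abs_of_pos hR0, abs_of_pos (inv_pos.2 hR0), smul_eq_mul, mul_inv_cancel_left₀ hR0.ne']
  · have hi : Integrable fun x => testDeriv (R * x) ^ 2 :=
      memLp_testDeriv.integrable_sq.comp_mul_left' hR0.ne'
    have hm : MemLp (fun x => R * testDeriv (R * x)) 2 :=
      ((memLp_two_iff_integrable_sq (Continuous.aestronglyMeasurable (by fun_prop))).2 hi).const_mul R
    have h1 := abs_integral_sub_le_l2 hd (by fun_prop) (fun x => abs_testFun_le (R * x)) hb hm μ hμ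
    refine h1.trans (le_of_eq ?_)
    rw [l2Dist, ← Real.sqrt_mul hR]
    congr 2
    simp_rw [mul_pow]
    rw [integral_const_mul, Measure.integral_comp_mul_left (fun x => testDeriv x ^ 2),
      abs_of_pos (inv_pos.2 hR0), smul_eq_mul]
    field_simp

section Sphere

variable {ι : Type*} [Fintype ι] [Nontrivial ι] {Q : Measure (EuclideanSpace ℝ ι)}
  [IsProbabilityMeasure Q] {B C : ℝ}

lemma testMean_smul_eq (θ : Metric.sphere (0 : EuclideanSpace ℝ ι) 1) (r : ℝ) :
    testMean Q (r • θ.1) =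
      ∫ x, testFun (r / Real.sqrt (Fintype.card ι) * x) ∂(sphereMarg Q θ) := by
  have hn : Real.sqrt (Fintype.card ι) ≠ 0 :=
    (Real.sqrt_pos.2 (Nat.cast_pos.2 Fintype.card_pos)).ne'
  rw [sphereMarg, marg, integral_map (by fun_prop) (Continuous.aestronglyMeasurable (by fun_prop)),
    testMean]
  congr 1; ext y; congr 1
  rw [inner_smul_right, real_inner_smul_left, real_inner_comm]
  field_simp

/-- Thanks to the stationarity of `testCoef 0`, the radius enters only through `radDev ι r ^ 2`,
whose mean 2/n is negligible against n^(-1/2). The bound √R ≤ 2 + `radDev` replaces the root by a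
factor with mean exactly 2. -/
lemma abs_testMean_smul_sub_le (h : IsoLaw Q C) (θ : Metric.sphere (0 : EuclideanSpace ℝ ι) 1)
    {r : ℝ} (hr : 0 ≤ r) :
    |testMean Q (r • θ.1) - 5| ≤
      kolDist (sphereMarg Q θ) * (∫ s, |testDeriv s|) + 150 * radDev ι r ^ 2 ∧
    |testMean Q (r • θ.1) - 5| ≤ Real.sqrt (l2Dist (sphereMarg Q θ)) *
      ((2 + radDev ι r) * Real.sqrt (∫ s, testDeriv s ^ 2)) + 150 * radDev ι r ^ 2 := by
  have hR : 0 ≤ r / Real.sqrt (Fintype.card ι) := by positivity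
  obtain ⟨h1, h2⟩ := abs_integral_testFun_mul_sub_le _ (integrable_id_sphereMarg h θ) hR
  rw [← testMean_smul_eq] at h1 h2
  have h3 := abs_testCoef_zero_sub_le (sq_nonneg (r / Real.sqrt (Fintype.card ι)))
  have h4 := sq_div_sqrt_sub_one ι r
  rw [h4] at h3
  set R := r / Real.sqrt (Fintype.card ι)
  have h5 : Real.sqrt R ≤ 2 + radDev ι r := by
    rw [Real.sqrt_le_left (by nlinarith)]
    nlinarith [sq_nonneg (R - 1), sq_nonneg R]
  have h6 := abs_sub_le (testMean Q (r • θ.1)) (testCoef 0 (R ^ 2)) 5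
  refine ⟨by linarith, h6.trans (add_le_add (h2.trans ?_) h3)⟩
  gcongr

lemma integrable_sqrt_l2Dist (h : IsoLaw Q C) :
    Integrable (fun θ => Real.sqrt (l2Dist (sphereMarg Q θ))) (sphereMeasure ι) := by
  refine Integrable.of_bound (measurable_sphereMarg_comp
    (measurable_l2Dist_marg Q)).sqrt.aestronglyMeasurable (Real.sqrt 2)
    (Filter.Eventually.of_forall fun θ => ?_)
  rw [Real.norm_of_nonneg (Real.sqrt_nonneg _)]
  exact Real.sqrt_le_sqrt (l2Dist_sphereMarg_le h θ)

lemma integrable_kolDist_sphereMarg :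
    Integrable (fun θ => kolDist (sphereMarg Q θ)) (sphereMeasure ι) :=
  Integrable.of_bound (measurable_sphereMarg_comp (measurable_kolDist_marg Q)).aestronglyMeasurable 1
    (Filter.Eventually.of_forall fun g => by
      rw [Real.norm_eq_abs, abs_of_nonneg (kolDist_nonneg _)]
      exact kolDist_le_one _)

lemma integral_abs_testMean_sub_le (h : IsoLaw Q C) :
    ∫ g, |testMean Q g - 5| ∂(stdGaussian (EuclideanSpace ℝ ι)) ≤
      (∫ θ, kolDist (sphereMarg Q θ) ∂(sphereMeasure ι)) * (∫ s, |testDeriv s|) +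
        300 / Fintype.card ι ∧
    ∫ g, |testMean Q g - 5| ∂(stdGaussian (EuclideanSpace ℝ ι)) ≤
      (∫ θ, Real.sqrt (l2Dist (sphereMarg Q θ)) ∂(sphereMeasure ι)) *
        (2 * Real.sqrt (∫ s, testDeriv s ^ 2)) + 300 / Fintype.card ι := by
  have hm : Measurable (fun g => |testMean Q g - 5|) :=
    (measurable_testMean.sub_const 5).abs
  have i0 : Integrable (fun g => |testMean Q g - 5|) (stdGaussian (EuclideanSpace ℝ ι)) := by
    have := integrable_testMean_sub_pow (Q := Q) 1 5
    simp only [pow_one] at this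
    exact this.abs
  have i1 := (integrable_stdGaussian_polar ι _ hm).2 i0
  have i2 : Integrable (fun p : Metric.sphere (0 : EuclideanSpace ℝ ι) 1 × ℝ =>
      150 * radDev ι p.2 ^ 2) ((sphereMeasure ι).prod (radialLaw ι)) :=
    ((integrable_radDev_pow ι 2).comp_snd _).const_mul 150
  have e2 : ∫ p : Metric.sphere (0 : EuclideanSpace ℝ ι) 1 × ℝ, 150 * radDev ι p.2 ^ 2
      ∂((sphereMeasure ι).prod (radialLaw ι)) = 300 / (Fintype.card ι : ℝ) := by
    rw [integral_const_mul, integral_fun_snd (fun r => radDev ι r ^ 2), integral_radDev_sq]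
    simp
    ring
  have hr : ∀ᵐ p ∂((sphereMeasure ι).prod (radialLaw ι)), 0 ≤ p.2 :=
    Measure.quasiMeasurePreserving_snd.ae (radialLaw_nonneg ι)
  have j1 : Integrable (fun r => radDev ι r) (radialLaw ι) := by
    simpa using integrable_radDev_pow ι 1
  have j2 : Integrable (fun r => 2 + radDev ι r) (radialLaw ι) := (integrable_const _).add j1
  rw [← integral_stdGaussian_polar ι _ hm]
  constructor
  · have i3 : Integrable (fun p : Metric.sphere (0 : EuclideanSpace ℝ ι) 1 × ℝ =>
        kolDist (sphereMarg Q p.1) * ∫ s, |testDeriv s|) ((sphereMeasure ι).prod (radialLaw ι)) :=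
      (integrable_kolDist_sphereMarg.mul_const _).comp_fst _
    calc _ ≤ ∫ p : Metric.sphere (0 : EuclideanSpace ℝ ι) 1 × ℝ,
          (kolDist (sphereMarg Q p.1) * (∫ s, |testDeriv s|) + 150 * radDev ι p.2 ^ 2)
          ∂((sphereMeasure ι).prod (radialLaw ι)) := by
          refine integral_mono_ae i1 (i3.add i2) ?_
          filter_upwards [hr] with p hp using (abs_testMean_smul_sub_le h p.1 hp).1
      _ = _ := by
          rw [integral_add i3 i2, e2, integral_mul_const,
            integral_fun_fst (fun θ => kolDist (sphereMarg Q θ))]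
          simp
  · have i3 : Integrable (fun p : Metric.sphere (0 : EuclideanSpace ℝ ι) 1 × ℝ =>
        Real.sqrt (l2Dist (sphereMarg Q p.1)) *
          ((2 + radDev ι p.2) * Real.sqrt (∫ s, testDeriv s ^ 2)))
          ((sphereMeasure ι).prod (radialLaw ι)) :=
      (integrable_sqrt_l2Dist h).mul_prod (j2.mul_const _)
    calc _ ≤ ∫ p : Metric.sphere (0 : EuclideanSpace ℝ ι) 1 × ℝ,
          (Real.sqrt (l2Dist (sphereMarg Q p.1)) * ((2 + radDev ι p.2) *
            Real.sqrt (∫ s, testDeriv s ^ 2)) + 150 * radDev ι p.2 ^ 2)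
          ∂((sphereMeasure ι).prod (radialLaw ι)) := by
          refine integral_mono_ae i1 (i3.add i2) ?_
          filter_upwards [hr] with p hp using (abs_testMean_smul_sub_le h p.1 hp).2
      _ = _ := by
          rw [integral_add i3 i2, e2, integral_prod_mul
            (fun θ => Real.sqrt (l2Dist (sphereMarg Q θ)))
            (fun r => (2 + radDev ι r) * Real.sqrt (∫ s, testDeriv s ^ 2)), integral_mul_const,
            integral_add (integrable_const _) j1, integral_radDev]
          simp

lemma Phi_lt_one (x : ℝ) : Phi x < 1 := by
  have h : 0 < gaussianReal 0 1 (Ioi x) := by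
    have := gaussianReal_absolutelyContinuous' 0 (v := 1) one_ne_zero
    by_contra hcon
    have h0 : (volume : Measure ℝ) (Ioi x) = 0 := this (by simpa using hcon)
    simp at h0
  have h1 : (gaussianReal 0 1).real (Ioi x) = 1 - Phi x := by
    rw [Phi, cdf_eq_real, ← compl_Iic, probReal_compl_eq_one_sub measurableSet_Iic]
  have h2 : 0 < (gaussianReal 0 1).real (Ioi x) := by
    rw [measureReal_def]; exact ENNReal.toReal_pos h.ne' (measure_ne_top _ _)
  linarith

/-- To the right of the support F is 1, while Φ stays below its value at b + 1. This takes care of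
bounded dimensions. -/
lemma dist_ge_of_bounded {μ : Measure ℝ} [IsProbabilityMeasure μ] (hμ : Integrable id μ) {b : ℝ}
    (hb : ∀ᵐ x ∂μ, x ≤ b) :
    1 - Phi (b + 1) ≤ kolDist μ ∧ 1 - Phi (b + 1) ≤ Real.sqrt (l2Dist μ) := by
  have hc : ∀ x, b ≤ x → cdf μ x = 1 := by
    intro x hx
    rw [cdf_eq_real, measureReal_def]
    have : μ (Iic x) = 1 := by
      rw [← prob_compl_eq_zero_iff measurableSet_Iic]
      filter_upwards [hb] with y hy using hy.trans hx
    simp [this]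
  have h0 : 0 ≤ 1 - Phi (b + 1) := by linarith [Phi_le_one (b + 1)]
  constructor
  · have h1 := abs_cdf_sub_le_kolDist μ (b + 1)
    rw [hc _ (by linarith), abs_of_nonneg h0] at h1
    exact h1
  · refine Real.le_sqrt_of_sq_le ?_
    have hi := (memLp_cdf_sub μ hμ).integrable_sq
    calc (1 - Phi (b + 1)) ^ 2 = ∫ x in Ioc b (b + 1), (1 - Phi (b + 1)) ^ 2 := by simp
      _ ≤ ∫ x in Ioc b (b + 1), (cdf μ x - Phi x) ^ 2 := by
          refine setIntegral_mono_on (by simp) hi.integrableOn measurableSet_Ioc fun x hx => ?_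
          rw [hc x hx.1.le]
          have := monotone_Phi hx.2
          gcongr
      _ ≤ l2Dist μ := setIntegral_le_integral hi (Filter.Eventually.of_forall fun x => sq_nonneg _)

end Sphere

lemma ae_sphereMarg_le {ι : Type*} [Fintype ι] {Q : Measure (EuclideanSpace ℝ ι)} {B : ℝ}
    (hB : ∀ᵐ y ∂Q, ‖y‖ ≤ B) (θ : Metric.sphere (0 : EuclideanSpace ℝ ι) 1) :
    ∀ᵐ x ∂(sphereMarg Q θ), x ≤ Real.sqrt (Fintype.card ι) * B := by
  rw [sphereMarg, marg, ae_map_iff (by fun_prop) measurableSet_Iic]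
  filter_upwards [hB] with y hy
  refine (real_inner_le_norm _ _).trans ?_
  rw [norm_smul, norm_eq_of_mem_sphere, mul_one, Real.norm_of_nonneg (Real.sqrt_nonneg _)]
  gcongr

/-! ### Lower bounds on the sphere and the two-sided bounds. -/

/-- The mean distances are at least of order `1 / √n`. -/
lemma exists_sphere_lower_bound {B C c : ℝ} (hB0 : 0 ≤ B) (hC : 0 ≤ C) (hc : 0 < c) :
    ∃ c₀ : ℝ, 0 < c₀ ∧ ∀ {ι : Type*} [Fintype ι] [Nontrivial ι]
      {Q : Measure (EuclideanSpace ℝ ι)} [IsProbabilityMeasure Q], IsoLaw Q C →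
      (∀ᵐ y ∂Q, ‖y‖ ≤ B) → c / Fintype.card ι ≤ overlap Q →
      c₀ / Real.sqrt (Fintype.card ι) ≤ ∫ θ, kolDist (sphereMarg Q θ) ∂(sphereMeasure ι) ∧
      c₀ / Real.sqrt (Fintype.card ι) ≤
        ∫ θ, Real.sqrt (l2Dist (sphereMarg Q θ)) ∂(sphereMeasure ι) := by
  obtain ⟨δ, N, hδ, hmain⟩ := exists_integral_abs_testMean_sub_ge hB0 hC hc
  set V := ∫ s, |testDeriv s|
  set V' := 2 * Real.sqrt (∫ s, testDeriv s ^ 2)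
  have hV : 0 ≤ V := integral_nonneg fun _ => abs_nonneg _
  have hV' : 0 ≤ V' := by positivity
  set W := V + V' + 1 with hW
  have hW0 : 0 < W := by positivity
  -- The second threshold makes the radial error 300/n at most half of the main term δ/√n.
  -- Dimensions up to N' use the bounded support.
  set N' : ℝ := max N ((600 / δ) ^ 2) with hN'
  have hN'0 : 0 ≤ N' := (sq_nonneg _).trans (le_max_right _ _)
  set η : ℝ := 1 - Phi (Real.sqrt N' * B + 1) with hη
  have hη0 : 0 < η := by linarith [Phi_lt_one (Real.sqrt N' * B + 1)]
  refine ⟨min η (δ / (2 * W)), lt_min hη0 (by positivity), ?_⟩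
  intro ι _ _ Q _ h hB hov
  set n : ℝ := (Fintype.card ι : ℝ) with hn
  have hn1 : (1 : ℝ) ≤ n := Nat.one_le_cast.2 Fintype.card_pos
  have hr1 : 1 ≤ Real.sqrt n := Real.one_le_sqrt.2 hn1
  have hrn : Real.sqrt n * Real.sqrt n = n := Real.mul_self_sqrt (by linarith)
  rcases le_total n N' with hle | hge
  · have hs : ∀ θ : Metric.sphere (0 : EuclideanSpace ℝ ι) 1, η ≤ kolDist (sphereMarg Q θ) ∧
        η ≤ Real.sqrt (l2Dist (sphereMarg Q θ)) := by
      intro θ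
      obtain ⟨h1, h2⟩ := dist_ge_of_bounded (integrable_id_sphereMarg h θ) (ae_sphereMarg_le hB θ)
      have h3 : η ≤ 1 - Phi (Real.sqrt n * B + 1) := by
        have := monotone_Phi (show Real.sqrt n * B + 1 ≤ Real.sqrt N' * B + 1 by gcongr)
        linarith
      exact ⟨h3.trans h1, h3.trans h2⟩
    have h4 : min η (δ / (2 * W)) / Real.sqrt n ≤ η :=
      (div_le_self (le_min hη0.le (by positivity)) hr1).trans (min_le_left _ _)
    constructor
    · refine h4.trans ?_
      have := integral_mono (integrable_const η) (integrable_kolDist_sphereMarg (Q := Q))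
        fun θ => (hs θ).1
      simpa using this
    · refine h4.trans ?_
      have := integral_mono (integrable_const η) (integrable_sqrt_l2Dist h) fun θ => (hs θ).2
      simpa using this
  · have h1 := hmain h hB (by rwa [finrank_euclideanSpace])
      (by rw [finrank_euclideanSpace]; exact (le_max_left _ _).trans hge)
    rw [finrank_euclideanSpace, ← hn] at h1
    obtain ⟨h2, h3⟩ := integral_abs_testMean_sub_le h
    rw [← hn] at h2 h3
    have h4 : 300 / n ≤ δ / 2 / Real.sqrt n := by
      have : 600 / δ ≤ Real.sqrt n := Real.le_sqrt_of_sq_le ((le_max_right _ _).trans hge)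
      rw [div_le_iff₀ hδ] at this
      rw [div_le_div_iff₀ (by linarith) (by linarith)]
      nlinarith
    have h5 : δ / 2 / Real.sqrt n = δ / Real.sqrt n - δ / 2 / Real.sqrt n := by ring
    have key : ∀ I v : ℝ, 0 ≤ I → v ≤ W → δ / 2 / Real.sqrt n ≤ I * v →
        min η (δ / (2 * W)) / Real.sqrt n ≤ I := by
      intro I v hI hv hle
      calc _ ≤ δ / (2 * W) / Real.sqrt n := by gcongr; exact min_le_right _ _
        _ = δ / 2 / Real.sqrt n / W := by field_simp
        _ ≤ I := by
            rw [div_le_iff₀ hW0]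
            exact hle.trans (by gcongr)
    exact ⟨key _ V (integral_nonneg fun _ => kolDist_nonneg _) (by linarith) (by linarith),
      key _ V' (integral_nonneg fun _ => Real.sqrt_nonneg _) (by linarith) (by linarith)⟩

/-- Two-sided bounds for isotropic bounded vectors with nondegenerate overlaps. -/
theorem exists_twoSidedBounds {B C c : ℝ} (hB0 : 0 ≤ B) (hC : 0 ≤ C) (hc : 0 < c) :
    ∃ c₀ c₁ : ℝ, 0 < c₀ ∧ 0 < c₁ ∧ ∀ {Ω ι : Type*} [MeasurableSpace Ω] [Fintype ι] [Nontrivial ι]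
      {P : Measure Ω} [IsProbabilityMeasure P] {X : ι → Ω → ℝ}, (∀ k, Measurable (X k)) →
      IsoLaw (scaledLaw P X) C → (∀ᵐ y ∂(scaledLaw P X), ‖y‖ ≤ B) →
      c / Fintype.card ι ≤ overlap (scaledLaw P X) → TwoSidedBounds P X c₀ c₁ := by
  obtain ⟨a, ha, hlow⟩ := exists_sphere_lower_bound hB0 hC hc
  -- Since log n ≥ 1/2, both powers of the logarithm are at least 1/16, so a/16 serves for the means
  -- of ω and ρ; a² serves for the mean of ω², by Jensen.
  refine ⟨min (a / 16) (a ^ 2), 5408 * C + 6000, lt_min (by positivity) (by positivity),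
    by positivity, ?_⟩
  intro Ω ι _ _ _ P _ X hX h hB hov
  have hp := isProbabilityMeasure_scaledLaw (P := P) hX
  have hw := wellDefined_of_isoLaw hX h
  refine ⟨hw, ?_, upperBounds_of_isoLaw hX h hC⟩
  obtain ⟨h1, h2⟩ := hlow h hB hov
  have e1 : sphereMean (ι := ι) (fun θ => rho P X θ) =
      ∫ θ, kolDist (sphereMarg (scaledLaw P X) θ) ∂(sphereMeasure ι) := by
    simp_rw [rho_eq hX]; rfl
  have e2 : sphereMean (ι := ι) (fun θ => omega P X θ) =
      ∫ θ, Real.sqrt (l2Dist (sphereMarg (scaledLaw P X) θ)) ∂(sphereMeasure ι) := by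
    simp_rw [omega_eq hX]; rfl
  have hn : (2 : ℝ) ≤ Fintype.card ι := by exact_mod_cast (Fintype.one_lt_card (α := ι))
  have hl : 1 / 2 ≤ Real.log (Fintype.card ι) := by
    refine le_trans ?_ (Real.log_le_log (by norm_num) hn)
    linarith [Real.log_two_gt_d9]
  rw [← e1] at h1
  rw [← e2] at h2
  set n : ℝ := (Fintype.card ι : ℝ)
  set L := Real.log n
  have hL4 : 1 / 16 ≤ L ^ 4 := by
    calc (1 / 16 : ℝ) = (1 / 2) ^ 4 := by norm_num
      _ ≤ L ^ 4 := by gcongr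
  have hL154 : 1 / 16 ≤ L ^ (15 / 4 : ℝ) := by
    calc (1 / 16 : ℝ) = (1 / 2) ^ (4 : ℝ) := by norm_num
      _ ≤ (1 / 2) ^ (15 / 4 : ℝ) :=
          Real.rpow_le_rpow_of_exponent_ge (by norm_num) (by norm_num) (by norm_num)
      _ ≤ L ^ (15 / 4 : ℝ) := by gcongr
  have key : ∀ ℓ I : ℝ, 1 / 16 ≤ ℓ → a / Real.sqrt n ≤ I →
      min (a / 16) (a ^ 2) / (ℓ * Real.sqrt n) ≤ I := by
    intro ℓ I hℓ hI
    refine le_trans ?_ hI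
    have hr : 0 < Real.sqrt n := Real.sqrt_pos.2 (by linarith)
    calc _ ≤ a / 16 / (1 / 16 * Real.sqrt n) := by
          gcongr
          exact min_le_left _ _
      _ = _ := by field_simp
  refine ⟨?_, key _ _ hL154 h2, key _ _ hL4 h1⟩
  have h3 := sq_integral_le hw.memLp_omega
  calc min (a / 16) (a ^ 2) / n ≤ a ^ 2 / n := by gcongr; exact min_le_right _ _
    _ = (a / Real.sqrt n) ^ 2 := by rw [div_pow, Real.sq_sqrt (by linarith)]
    _ ≤ (sphereMean (ι := ι) (fun θ => omega P X θ)) ^ 2 := by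
        have : 0 ≤ a / Real.sqrt n := by positivity
        gcongr
    _ ≤ _ := h3


/-! ### Criteria for orthonormal systems. -/

section Systems

variable {Ω ι : Type*} [MeasurableSpace Ω] [Fintype ι] [Nontrivial ι] {P : Measure Ω}
  [IsProbabilityMeasure P] {X : ι → Ω → ℝ}

lemma norm_scaledVector_sq (w : Ω) :
    ‖(Real.sqrt (Fintype.card ι))⁻¹ • WithLp.toLp 2 fun k => X k w‖ ^ 2 =
      (∑ k, X k w ^ 2) / Fintype.card ι := by
  rw [norm_smul, mul_pow, EuclideanSpace.norm_sq_eq, norm_inv, inv_pow,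
    Real.norm_of_nonneg (Real.sqrt_nonneg _), Real.sq_sqrt (Nat.cast_nonneg _)]
  simp [div_eq_inv_mul]

/-- Isotropy is orthonormality, read off from the double sum for ⟨v,X⟩²; the fluctuation of the norm
is the variance of ∑ X_k² divided by n². -/
lemma isoLaw_scaledLaw (hX : ∀ k, Measurable (X k)) {C : ℝ}
    (h4 : ∀ k, Integrable (fun w => X k w ^ 4) P)
    (horth : ∀ k, ∫ w, X k w ^ 2 ∂P = 1)
    (horth' : ∀ k l, k ≠ l → ∫ w, X k w * X l w ∂P = 0)
    (hvar : ∫ w, (∑ k, X k w ^ 2 - Fintype.card ι) ^ 2 ∂P ≤ C * Fintype.card ι) :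
    IsoLaw (scaledLaw P X) C := by
  have hm := measurable_scaledVector hX
  have hn : (0 : ℝ) < Fintype.card ι := Nat.cast_pos.2 Fintype.card_pos
  have hL2 : ∀ k, MemLp (fun w => X k w ^ 2) 2 P := fun k =>
    (memLp_two_iff_integrable_sq ((hX k).pow_const 2).aestronglyMeasurable).2
      ((h4 k).congr (Filter.Eventually.of_forall fun w => by ring))
  have hX2 : ∀ k, MemLp (X k) 2 P := fun k =>
    (memLp_two_iff_integrable_sq (hX k).aestronglyMeasurable).2 ((hL2 k).integrable (by norm_num))
  refine ⟨?_, fun v => ?_, ?_⟩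
  · rw [scaledLaw, integrable_map_measure (by fun_prop) hm.aemeasurable]
    have : MemLp (fun w => (∑ k, X k w ^ 2) / (Fintype.card ι : ℝ)) 2 P :=
      (memLp_finsetSum _ fun k _ => hL2 k).mul_const _
    refine this.integrable_sq.congr (Filter.Eventually.of_forall fun w => ?_)
    simp only [Function.comp]
    rw [← norm_scaledVector_sq]; ring
  · rw [scaledLaw, integral_map hm.aemeasurable (Continuous.aestronglyMeasurable (by fun_prop)),
      finrank_euclideanSpace]
    have e : ∀ w, inner ℝ v ((Real.sqrt (Fintype.card ι))⁻¹ • WithLp.toLp 2 fun k => X k w) ^ 2 =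
        (∑ k, ∑ l, v k * v l * (X k w * X l w)) / Fintype.card ι := by
      intro w
      rw [real_inner_smul_right, mul_pow, inv_pow, Real.sq_sqrt (Nat.cast_nonneg _),
        div_eq_inv_mul]
      congr 1
      simp only [PiLp.inner_apply, RCLike.inner_apply, conj_trivial]
      rw [sq, Finset.sum_mul_sum]
      refine Finset.sum_congr rfl fun k _ => Finset.sum_congr rfl fun l _ => by ring
    simp_rw [e]
    have hi : ∀ k l, Integrable (fun w => v k * v l * (X k w * X l w)) P := fun k l =>
      ((hX2 k).integrable_mul (hX2 l)).const_mul _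
    rw [integral_div, integral_finsetSum _ fun k _ => integrable_finsetSum _ fun l _ => hi k l]
    congr 1
    rw [EuclideanSpace.norm_sq_eq]
    refine Finset.sum_congr rfl fun k _ => ?_
    rw [integral_finsetSum _ fun l _ => hi k l, Finset.sum_eq_single k]
    · rw [integral_const_mul]
      simp_rw [← sq]
      rw [horth k]
      simp
    · intro l _ hl
      rw [integral_const_mul, horth' k l hl.symm, mul_zero]
    · simp
  · rw [scaledLaw, integral_map hm.aemeasurable (Continuous.aestronglyMeasurable (by fun_prop)),
      finrank_euclideanSpace]
    simp_rw [norm_scaledVector_sq]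
    have e : ∀ w, ((∑ k, X k w ^ 2) / (Fintype.card ι : ℝ) - 1) ^ 2 =
        (∑ k, X k w ^ 2 - Fintype.card ι) ^ 2 / (Fintype.card ι : ℝ) ^ 2 := by
      intro w; field_simp
    simp_rw [e]
    rw [integral_div, div_le_div_iff₀ (by positivity) hn]
    nlinarith

/-- If the points of a thin strip around the diagonal have close values, then overlaps are
nondegenerate. -/
lemma overlap_ge_of_strip {E : Type*} [NormedAddCommGroup E] [InnerProductSpace ℝ E]
    [FiniteDimensional ℝ E] [MeasurableSpace E] [BorelSpace E] {Y : Ω → E} (hY : Measurable Y)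
    {B : ℝ} (hB : ∀ᵐ w ∂P, ‖Y w‖ ≤ B) (h1 : ∫ w, ‖Y w‖ ^ 2 ∂P = 1) {S : Set (Ω × Ω)}
    (hS : MeasurableSet S) {p : ℝ}
    (hlow : ∀ᵐ w ∂P, p ≤ P.real (Prod.mk w ⁻¹' S)) (hup : ∀ w, P.real (Prod.mk w ⁻¹' S) ≤ 4 * p)
    (hclose : ∀ w w', (w, w') ∈ S → ‖Y w - Y w'‖ ^ 2 ≤ 1 / 8) :
    p / 27648 ≤ overlap (P.map Y) := by
  have : IsProbabilityMeasure (P.map Y) := Measure.isProbabilityMeasure_map hY.aemeasurable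
  have hB2 : ∀ᵐ q ∂(P.prod P), ‖Y q.1‖ ≤ B ∧ ‖Y q.2‖ ≤ B :=
    (Measure.quasiMeasurePreserving_fst.ae hB).and (Measure.quasiMeasurePreserving_snd.ae hB)
  have e0 : overlap (P.map Y) = ∫ q : Ω × Ω, inner ℝ (Y q.1) (Y q.2) ^ 4 ∂(P.prod P) := by
    rw [overlap, Measure.map_prod_map P P hY hY, integral_map (hY.prodMap hY).aemeasurable
      (Continuous.aestronglyMeasurable (by fun_prop))]
    rfl
  have ix : Integrable (fun q : Ω × Ω => inner ℝ (Y q.1) (Y q.2) ^ 4) (P.prod P) := by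
    refine Integrable.of_bound (Measurable.aestronglyMeasurable (by fun_prop)) ((B * B) ^ 4) ?_
    filter_upwards [hB2] with q hq
    rw [norm_pow]
    gcongr
    exact (norm_inner_le_norm _ _).trans
      (mul_le_mul hq.1 hq.2 (norm_nonneg _) ((norm_nonneg _).trans hq.1))
  have hms : Measurable fun w => P.real (Prod.mk w ⁻¹' S) :=
    (measurable_measure_prodMk_left hS).ennreal_toReal
  have iA : Integrable (fun w => ‖Y w‖ ^ 2) P := by
    refine Integrable.of_bound (Measurable.aestronglyMeasurable (by fun_prop)) (B ^ 2) ?_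
    filter_upwards [hB] with w hw
    rw [norm_pow, norm_norm]
    gcongr
  have iS : Integrable (fun q : Ω × Ω => S.indicator (fun _ => (1 : ℝ)) q) (P.prod P) :=
    (integrable_const (1 : ℝ)).indicator hS
  have iAS : Integrable (fun q : Ω × Ω => ‖Y q.1‖ ^ 2 * S.indicator (fun _ => (1 : ℝ)) q)
      (P.prod P) := by
    refine (iA.comp_fst P).mono' (((hY.comp measurable_fst).norm.pow_const 2).mul
      (measurable_const.indicator hS)).aestronglyMeasurable (Filter.Eventually.of_forall fun q => ?_)
    rw [norm_mul, norm_pow, norm_norm]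
    refine mul_le_of_le_one_right (by positivity) ?_
    by_cases hq : q ∈ S <;> simp [hq]
  have hind : ∀ w, ∫ w', S.indicator (fun _ => (1 : ℝ)) (w, w') ∂P = P.real (Prod.mk w ⁻¹' S) := by
    intro w
    have : (fun w' => S.indicator (fun _ => (1 : ℝ)) (w, w')) =
        (Prod.mk w ⁻¹' S).indicator (fun _ => (1 : ℝ)) := by
      rfl
    rw [this, integral_indicator (measurable_prodMk_left hS)]
    simp
  have eS : ∫ q, S.indicator (fun _ => (1 : ℝ)) q ∂(P.prod P) ≤ 4 * p := by
    rw [integral_prod _ iS]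
    simp_rw [hind]
    have hb : Integrable (fun w => P.real (Prod.mk w ⁻¹' S)) P :=
      Integrable.of_bound hms.aestronglyMeasurable (4 * p) (Filter.Eventually.of_forall fun w => by
        rw [Real.norm_of_nonneg measureReal_nonneg]; exact hup w)
    have := integral_mono hb (integrable_const (4 * p)) hup
    simpa using this
  have eAS : p ≤ ∫ q : Ω × Ω, ‖Y q.1‖ ^ 2 * S.indicator (fun _ => (1 : ℝ)) q ∂(P.prod P) := by
    rw [integral_prod _ iAS]
    simp_rw [integral_const_mul, hind]
    calc p = ∫ w, ‖Y w‖ ^ 2 * p ∂P := by rw [integral_mul_const, h1, one_mul]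
      _ ≤ _ := by
          refine integral_mono_ae (iA.mul_const _) ?_ ?_
          · refine (iA.mul_const (4 * p)).mono' (by fun_prop) (Filter.Eventually.of_forall fun w => ?_)
            rw [Real.norm_of_nonneg (by positivity)]
            gcongr
            exact hup w
          · filter_upwards [hlow] with w hw
            gcongr
  -- On the strip ⟨Y,Y'⟩ ≥ |Y|²/2 - 1/16, and x⁴ lies above its tangent at x = 1/24. A bound affine
  -- in |Y|² is wanted, since only the mean of |Y|² is known. The sections have mass between p and
  -- 4p, so what remains is p(1/6912 - 4/36864) = p/27648.
  have hpt : ∀ q : Ω × Ω, (1 / 6912) * ‖Y q.1‖ ^ 2 * S.indicator (fun _ => (1 : ℝ)) q -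
      (1 / 36864) * S.indicator (fun _ => (1 : ℝ)) q ≤ inner ℝ (Y q.1) (Y q.2) ^ 4 := by
    intro q
    by_cases hq : q ∈ S
    · have h3 := hclose q.1 q.2 hq
      rw [@norm_sub_sq_real] at h3
      have h4 : 0 ≤ ‖Y q.2‖ ^ 2 := by positivity
      simp only [indicator_of_mem hq, mul_one]
      set x : ℝ := inner ℝ (Y q.1) (Y q.2)
      have hx : ‖Y q.1‖ ^ 2 / 2 - 1 / 16 ≤ x := by linarith
      have hx4 : 4 * (1 / 24) ^ 3 * x - 3 * (1 / 24) ^ 4 ≤ x ^ 4 := by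
        nlinarith [sq_nonneg (x ^ 2 - (1 / 24) ^ 2), sq_nonneg (x - 1 / 24)]
      linarith
    · simp only [indicator_of_notMem hq, mul_zero, sub_zero]
      positivity
  have i1 : Integrable (fun q : Ω × Ω => (1 / 6912) * ‖Y q.1‖ ^ 2 *
      S.indicator (fun _ => (1 : ℝ)) q) (P.prod P) := by
    simpa only [mul_assoc] using iAS.const_mul (1 / 6912)
  have hfin := integral_mono (i1.sub (iS.const_mul (1 / 36864))) ix hpt
  rw [integral_sub' i1 (iS.const_mul _), integral_const_mul] at hfin
  simp_rw [mul_assoc] at hfin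
  rw [integral_const_mul] at hfin
  rw [e0]
  linarith

end Systems

/-- Two-sided bounds for orthonormal systems, bounded in the mean square, whose values at close
points are close. -/
theorem exists_twoSidedBounds_of_strip {B C c : ℝ} (hB0 : 0 ≤ B) (hC : 0 ≤ C) (hc : 0 < c) :
    ∃ c₀ c₁ : ℝ, 0 < c₀ ∧ 0 < c₁ ∧ ∀ {Ω ι : Type*} [MeasurableSpace Ω] [Fintype ι] [Nontrivial ι]
      {P : Measure Ω} [IsProbabilityMeasure P] {X : ι → Ω → ℝ}, (∀ k, Measurable (X k)) →
      (∀ w, ∑ k, X k w ^ 2 ≤ B ^ 2 * Fintype.card ι) →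
      (∀ k, ∫ w, X k w ^ 2 ∂P = 1) → (∀ k l, k ≠ l → ∫ w, X k w * X l w ∂P = 0) →
      (∫ w, (∑ k, X k w ^ 2 - Fintype.card ι) ^ 2 ∂P ≤ C * Fintype.card ι) →
      ∀ {S : Set (Ω × Ω)} {p : ℝ}, MeasurableSet S → c / Fintype.card ι ≤ p →
      (∀ᵐ w ∂P, p ≤ P.real (Prod.mk w ⁻¹' S)) → (∀ w, P.real (Prod.mk w ⁻¹' S) ≤ 4 * p) →
      (∀ w w', (w, w') ∈ S → ∑ k, (X k w - X k w') ^ 2 ≤ Fintype.card ι / 8) →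
      TwoSidedBounds P X c₀ c₁ := by
  obtain ⟨c₀, c₁, h0, h1, hmain⟩ := exists_twoSidedBounds hB0 hC (div_pos hc (by norm_num : (0 : ℝ) < 27648))
  refine ⟨c₀, c₁, h0, h1, ?_⟩
  intro Ω ι _ _ _ P _ X hX hB horth horth' hvar S p hS hp hlow hup hclose
  have hm := measurable_scaledVector hX
  have hn : (0 : ℝ) < Fintype.card ι := Nat.cast_pos.2 Fintype.card_pos
  have h4 : ∀ k, Integrable (fun w => X k w ^ 4) P := fun k =>
    Integrable.of_bound ((hX k).pow_const 4).aestronglyMeasurable ((B ^ 2 * Fintype.card ι) ^ 2)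
      (Filter.Eventually.of_forall fun w => by
        have h5 : X k w ^ 2 ≤ B ^ 2 * Fintype.card ι :=
          (Finset.single_le_sum (f := fun k => X k w ^ 2) (fun _ _ => sq_nonneg _)
            (Finset.mem_univ k)).trans (hB w)
        rw [Real.norm_of_nonneg (by positivity), show X k w ^ 4 = (X k w ^ 2) ^ 2 by ring]
        gcongr)
  have hiso := isoLaw_scaledLaw hX h4 horth horth' hvar
  have hYB : ∀ w, ‖(Real.sqrt (Fintype.card ι))⁻¹ • WithLp.toLp 2 fun k => X k w‖ ≤ B := by
    intro w
    refine (pow_le_pow_iff_left₀ (norm_nonneg _) hB0 two_ne_zero).1 ?_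
    rw [norm_scaledVector_sq, div_le_iff₀ hn]
    exact hB w
  have hp1 := isProbabilityMeasure_scaledLaw (P := P) hX
  refine hmain hX hiso ?_ ?_
  · rw [scaledLaw, ae_map_iff hm.aemeasurable (measurableSet_le (by fun_prop) (by fun_prop))]
    exact Filter.Eventually.of_forall hYB
  · refine le_trans ?_ (overlap_ge_of_strip hm (Filter.Eventually.of_forall hYB) ?_ hS hlow hup ?_)
    · rw [div_right_comm]; gcongr
    · have := hiso.integral_norm_sq
      rwa [scaledLaw, integral_map hm.aemeasurable (Continuous.aestronglyMeasurable (by fun_prop))]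
        at this
    · intro w w' hw
      rw [← smul_sub, ← WithLp.toLp_sub]
      have := norm_scaledVector_sq (ι := ι) (X := fun k (q : Ω × Ω) => X k q.1 - X k q.2) (w, w')
      refine (le_of_eq this).trans ?_
      rw [div_le_iff₀ hn]
      linarith [hclose w w' hw]

/-- All quantities depend on the system through its distribution functions only; this carries the
bounds from the cosines to the Chebyshev polynomials. -/
lemma distFun_congr_bounds {Ω Ω' ι : Type*} [MeasurableSpace Ω] [MeasurableSpace Ω'] [Fintype ι]
    {P : Measure Ω} {X : ι → Ω → ℝ} {P' : Measure Ω'} {X' : ι → Ω' → ℝ}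
    (h : ∀ θ x, distFun P X θ x = distFun P' X' θ x) {c₀ c₁ : ℝ} (hb : TwoSidedBounds P X c₀ c₁) :
    TwoSidedBounds P' X' c₀ c₁ := by
  have h0 : distFun P X = distFun P' X' := funext fun θ => funext fun x => h θ x
  have h1 : omega P X = omega P' X' := by unfold omega; rw [h0]
  have h2 : rho P X = rho P' X' := by unfold rho; rw [h0]
  obtain ⟨⟨a1, a2, a3⟩, ⟨b1, b2, b3⟩, ⟨d1, d2, d3, d4⟩⟩ := hb
  rw [h0] at a1
  rw [h1] at a2 b1 b2 d1 d2
  rw [h2] at a3 b3 d3 d4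
  exact ⟨⟨a1, a2, a3⟩, ⟨b1, b2, b3⟩, ⟨d1, d2, d3, d4⟩⟩


/-! ### Uniform distributions on intervals -/

lemma isProbabilityMeasure_cond_Ioo {a b : ℝ} (hab : a < b) :
    IsProbabilityMeasure (cond (volume : Measure ℝ) (Ioo a b)) := by
  refine cond_isProbabilityMeasure_of_finite ?_ ?_ <;> simp [Real.volume_Ioo, hab]

lemma integral_cond_Ioo {a b : ℝ} (hab : a < b) (f : ℝ → ℝ) :
    ∫ t, f t ∂(cond (volume : Measure ℝ) (Ioo a b)) = (b - a)⁻¹ * ∫ t in a..b, f t := by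
  rw [ProbabilityTheory.cond, integral_smul_measure, Real.volume_Ioo, ENNReal.toReal_inv,
    ENNReal.toReal_ofReal (by linarith), intervalIntegral.integral_of_le hab.le,
    integral_Ioc_eq_integral_Ioo, smul_eq_mul]

lemma cond_Ioo_real_apply {a b : ℝ} (hab : a < b) (A : Set ℝ) :
    (cond (volume : Measure ℝ) (Ioo a b)).real A =
      (b - a)⁻¹ * (volume : Measure ℝ).real (Ioo a b ∩ A) := by
  rw [measureReal_def, cond_apply measurableSet_Ioo, ENNReal.toReal_mul, Real.volume_Ioo,
    ENNReal.toReal_inv, ENNReal.toReal_ofReal (by linarith), measureReal_def]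

lemma cond_Ioo_strip_le {a b ε : ℝ} (hab : a < b) (hε : 0 ≤ ε) (t : ℝ) :
    (cond (volume : Measure ℝ) (Ioo a b)).real {t' | |t - t'| ≤ ε} ≤ 2 * (ε / (b - a)) := by
  have h1 : {t' | |t - t'| ≤ ε} = Icc (t - ε) (t + ε) := by
    ext u; simp only [mem_ofPred_eq, abs_le, mem_Icc]; constructor <;> rintro ⟨h, h'⟩ <;>
      constructor <;> linarith
  have h2 : (volume : Measure ℝ).real (Ioo a b ∩ Icc (t - ε) (t + ε)) ≤ 2 * ε := by
    refine (measureReal_mono inter_subset_right (by simp)).trans ?_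
    rw [Real.volume_real_Icc_of_le (by linarith)]; linarith
  rw [cond_Ioo_real_apply hab, h1]
  have h3 : 0 < b - a := sub_pos.2 hab
  calc _ ≤ (b - a)⁻¹ * (2 * ε) := by gcongr
    _ = _ := by ring

/-- Near an endpoint half of the neighbourhood may fall outside, but the half towards the midpoint
stays inside. The resulting factor 2 between the bounds, squared for the square, is the factor 4 in
the strip condition. -/
lemma le_cond_Ioo_strip {a b ε : ℝ} (hab : a < b) (hε : 0 ≤ ε) (hε' : ε ≤ (b - a) / 2) {t : ℝ}
    (ht : t ∈ Ioo a b) :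
    ε / (b - a) ≤ (cond (volume : Measure ℝ) (Ioo a b)).real {t' | |t - t'| ≤ ε} := by
  rw [cond_Ioo_real_apply hab]
  have h3 : 0 < b - a := sub_pos.2 hab
  have key : ε ≤ (volume : Measure ℝ).real (Ioo a b ∩ {t' | |t - t'| ≤ ε}) := by
    have hfin : volume (Ioo a b ∩ {t' | |t - t'| ≤ ε}) ≠ ⊤ :=
      ((measure_mono inter_subset_left).trans_lt (by simp)).ne
    rcases le_total t ((a + b) / 2) with h | h
    · have : Ioo t (t + ε) ⊆ Ioo a b ∩ {t' | |t - t'| ≤ ε} := by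
        rintro u ⟨h1, h2⟩
        exact ⟨⟨ht.1.trans h1, by linarith⟩, (abs_le (a := t - u)).2 ⟨by linarith, by linarith⟩⟩
      have := measureReal_mono this hfin
      rwa [Real.volume_real_Ioo_of_le (by linarith), add_sub_cancel_left] at this
    · have : Ioo (t - ε) t ⊆ Ioo a b ∩ {t' | |t - t'| ≤ ε} := by
        rintro u ⟨h1, h2⟩
        exact ⟨⟨by linarith, h2.trans ht.2⟩, (abs_le (a := t - u)).2 ⟨by linarith, by linarith⟩⟩
      have := measureReal_mono this hfin
      rwa [Real.volume_real_Ioo_of_le (by linarith), sub_sub_cancel] at this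
  calc ε / (b - a) = (b - a)⁻¹ * ε := by ring
    _ ≤ _ := by gcongr

/-- The square of a sum of orthogonal functions. -/
lemma integral_sq_sum_of_orthogonal {Ω ι : Type*} [MeasurableSpace Ω] [Fintype ι]
    {P : Measure Ω} {f : ι → Ω → ℝ} (hint : ∀ k l, Integrable (fun w => f k w * f l w) P)
    (horth : ∀ k l, k ≠ l → ∫ w, f k w * f l w ∂P = 0) :
    ∫ w, (∑ k, f k w) ^ 2 ∂P = ∑ k, ∫ w, f k w ^ 2 ∂P := by
  classical
  calc ∫ w, (∑ k, f k w) ^ 2 ∂P = ∫ w, ∑ k, ∑ l, f k w * f l w ∂P := by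
        simp_rw [sq, Finset.sum_mul_sum]
    _ = ∑ k, ∑ l, ∫ w, f k w * f l w ∂P := by
        rw [integral_finsetSum _ fun k _ => integrable_finsetSum _ fun l _ => hint k l]
        exact Finset.sum_congr rfl fun k _ => integral_finsetSum _ fun l _ => hint k l
    _ = ∑ k, ∫ w, f k w ^ 2 ∂P := by
        refine Finset.sum_congr rfl fun k _ => ?_
        rw [Finset.sum_eq_single k (fun l _ h => horth k l h.symm) (by simp)]
        simp_rw [sq]

/-! ### Trigonometric integrals -/

lemma integral_cos_int_mul {m : ℤ} (hm : m ≠ 0) (p q : ℤ) :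
    ∫ t in (p * Real.pi)..(q * Real.pi), Real.cos (m * t) = 0 := by
  have h1 : (m : ℝ) ≠ 0 := Int.cast_ne_zero.2 hm
  rw [intervalIntegral.integral_comp_mul_left (fun t => Real.cos t) h1, integral_cos,
    ← mul_assoc, ← mul_assoc, ← Int.cast_mul, ← Int.cast_mul, Real.sin_int_mul_pi,
    Real.sin_int_mul_pi]
  simp

lemma integral_sin_int_mul (m : ℤ) : ∫ t in (-Real.pi)..Real.pi, Real.sin (m * t) = 0 := by
  rcases eq_or_ne m 0 with rfl | hm
  · simp
  have h1 : (m : ℝ) ≠ 0 := Int.cast_ne_zero.2 hm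
  rw [intervalIntegral.integral_comp_mul_left (fun t => Real.sin t) h1, integral_sin,
    mul_neg, Real.cos_neg, sub_self, smul_zero]

lemma integral_cos_mul_cos (k l p q : ℤ) (h1 : k - l ≠ 0) (h2 : k + l ≠ 0) :
    ∫ t in (p * Real.pi)..(q * Real.pi), Real.cos (k * t) * Real.cos (l * t) = 0 := by
  have h : ∀ t : ℝ, Real.cos (k * t) * Real.cos (l * t) =
      (Real.cos ((k - l : ℤ) * t) + Real.cos ((k + l : ℤ) * t)) / 2 := by
    intro t; push_cast; rw [sub_mul, add_mul, Real.cos_sub, Real.cos_add]; ring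
  simp_rw [h]
  rw [intervalIntegral.integral_div, intervalIntegral.integral_add
    ((by fun_prop : Continuous _).intervalIntegrable _ _)
    ((by fun_prop : Continuous _).intervalIntegrable _ _),
    integral_cos_int_mul h1, integral_cos_int_mul h2]
  simp

lemma integral_sin_mul_sin (k l p q : ℤ) (h1 : k - l ≠ 0) (h2 : k + l ≠ 0) :
    ∫ t in (p * Real.pi)..(q * Real.pi), Real.sin (k * t) * Real.sin (l * t) = 0 := by
  have h : ∀ t : ℝ, Real.sin (k * t) * Real.sin (l * t) =
      (Real.cos ((k - l : ℤ) * t) - Real.cos ((k + l : ℤ) * t)) / 2 := by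
    intro t; push_cast; rw [sub_mul, add_mul, Real.cos_sub, Real.cos_add]; ring
  simp_rw [h]
  rw [intervalIntegral.integral_div, intervalIntegral.integral_sub
    ((by fun_prop : Continuous _).intervalIntegrable _ _)
    ((by fun_prop : Continuous _).intervalIntegrable _ _),
    integral_cos_int_mul h1, integral_cos_int_mul h2]
  simp

lemma integral_sin_mul_cos (k l : ℤ) :
    ∫ t in (-Real.pi)..Real.pi, Real.sin (k * t) * Real.cos (l * t) = 0 := by
  have h : ∀ t : ℝ, Real.sin (k * t) * Real.cos (l * t) =
      (Real.sin ((k - l : ℤ) * t) + Real.sin ((k + l : ℤ) * t)) / 2 := by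
    intro t; push_cast; rw [sub_mul, add_mul, Real.sin_sub, Real.sin_add]; ring
  simp_rw [h]
  rw [intervalIntegral.integral_div, intervalIntegral.integral_add
    ((by fun_prop : Continuous _).intervalIntegrable _ _)
    ((by fun_prop : Continuous _).intervalIntegrable _ _),
    integral_sin_int_mul, integral_sin_int_mul]
  simp

lemma integral_two_mul_cos_sq {k : ℤ} (hk : k ≠ 0) (p q : ℤ) :
    ∫ t in (p * Real.pi)..(q * Real.pi), 2 * Real.cos (k * t) ^ 2 = q * Real.pi - p * Real.pi := by
  have h : ∀ t : ℝ, 2 * Real.cos (k * t) ^ 2 = 1 + Real.cos ((2 * k : ℤ) * t) := by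
    intro t; push_cast; rw [mul_assoc, Real.cos_two_mul]; ring
  simp_rw [h]
  rw [intervalIntegral.integral_add ((by fun_prop : Continuous _).intervalIntegrable _ _)
    ((by fun_prop : Continuous _).intervalIntegrable _ _), integral_cos_int_mul (by omega)]
  simp

lemma integral_two_mul_sin_sq {k : ℤ} (hk : k ≠ 0) (p q : ℤ) :
    ∫ t in (p * Real.pi)..(q * Real.pi), 2 * Real.sin (k * t) ^ 2 = q * Real.pi - p * Real.pi := by
  have h : ∀ t : ℝ, 2 * Real.sin (k * t) ^ 2 = 1 - Real.cos ((2 * k : ℤ) * t) := by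
    intro t; push_cast; rw [mul_assoc, Real.cos_two_mul, Real.cos_sq']; ring
  simp_rw [h]
  rw [intervalIntegral.integral_sub ((by fun_prop : Continuous _).intervalIntegrable _ _)
    ((by fun_prop : Continuous _).intervalIntegrable _ _), integral_cos_int_mul (by omega)]
  simp

lemma abs_cos_sub_cos_le (x y : ℝ) : |Real.cos x - Real.cos y| ≤ |x - y| := by
  rw [Real.cos_sub_cos, abs_mul, abs_mul]
  have h1 := Real.abs_sin_le_one ((x + y) / 2)
  have h2 : |Real.sin ((x - y) / 2)| ≤ |(x - y) / 2| := Real.abs_sin_le_abs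
  rw [abs_div, abs_two] at h2
  have h3 : |(-2 : ℝ)| = 2 := by norm_num
  rw [h3]
  nlinarith [abs_nonneg (Real.sin ((x - y) / 2)), abs_nonneg (Real.sin ((x + y) / 2))]

lemma abs_sin_sub_sin_le (x y : ℝ) : |Real.sin x - Real.sin y| ≤ |x - y| := by
  have := abs_cos_sub_cos_le (x - Real.pi / 2) (y - Real.pi / 2)
  rwa [Real.cos_sub_pi_div_two, Real.cos_sub_pi_div_two, sub_sub_sub_cancel_right] at this


/-! ### Systems with a strip of nearly equal values. -/

/-- Orthonormal systems, bounded in the mean square, whose values at close points are close. -/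
structure IsStripSystem {Ω ι : Type*} [MeasurableSpace Ω] [Fintype ι] (P : Measure Ω)
    (X : ι → Ω → ℝ) (B C c : ℝ) : Prop where
  measurable : ∀ k, Measurable (X k)
  sum_sq_le : ∀ w, ∑ k, X k w ^ 2 ≤ B ^ 2 * Fintype.card ι
  integral_sq : ∀ k, ∫ w, X k w ^ 2 ∂P = 1
  integral_mul : ∀ k l, k ≠ l → ∫ w, X k w * X l w ∂P = 0
  variance_le : ∫ w, (∑ k, X k w ^ 2 - Fintype.card ι) ^ 2 ∂P ≤ C * Fintype.card ι
  exists_strip : ∃ (S : Set (Ω × Ω)) (p : ℝ), MeasurableSet S ∧ c / Fintype.card ι ≤ p ∧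
    (∀ᵐ w ∂P, p ≤ P.real (Prod.mk w ⁻¹' S)) ∧ (∀ w, P.real (Prod.mk w ⁻¹' S) ≤ 4 * p) ∧
    ∀ w w', (w, w') ∈ S → ∑ k, (X k w - X k w') ^ 2 ≤ Fintype.card ι / 8

theorem exists_twoSidedBounds_of_isStripSystem {B C c : ℝ} (hB0 : 0 ≤ B) (hC : 0 ≤ C)
    (hc : 0 < c) : ∃ c₀ c₁ : ℝ, 0 < c₀ ∧ 0 < c₁ ∧ ∀ {Ω ι : Type*} [MeasurableSpace Ω]
      [Fintype ι] {P : Measure Ω} {X : ι → Ω → ℝ}, Nontrivial ι → IsProbabilityMeasure P →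
      IsStripSystem P X B C c → TwoSidedBounds P X c₀ c₁ := by
  obtain ⟨c₀, c₁, h0, h1, h⟩ := exists_twoSidedBounds_of_strip hB0 hC hc
  refine ⟨c₀, c₁, h0, h1, ?_⟩
  intro Ω ι _ _ P X _ _ hX
  obtain ⟨S, p, hS, hp, hlow, hup, hclose⟩ := hX.exists_strip
  exact h hX.measurable hX.sum_sq_le hX.integral_sq hX.integral_mul hX.variance_le hS hp hlow hup
    hclose

/-- A system on an interval whose `k`-th function is Lipschitz with constant `√2 n`. -/
lemma exists_strip_of_interval {a b : ℝ} (hab : a < b) (h1 : 1 ≤ b - a) (h2 : b - a ≤ 8) {n : ℕ}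
    (hn : 1 ≤ n) {X : Fin n → ℝ → ℝ}
    (hX : ∀ k t t', (X k t - X k t') ^ 2 ≤ 2 * (n * |t - t'|) ^ 2) :
    ∃ (S : Set (ℝ × ℝ)) (p : ℝ), MeasurableSet S ∧ (1 / 100) / Fintype.card (Fin n) ≤ p ∧
    (∀ᵐ w ∂(cond (volume : Measure ℝ) (Ioo a b)),
      p ≤ (cond (volume : Measure ℝ) (Ioo a b)).real (Prod.mk w ⁻¹' S)) ∧
    (∀ w, (cond (volume : Measure ℝ) (Ioo a b)).real (Prod.mk w ⁻¹' S) ≤ 4 * p) ∧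
    ∀ w w', (w, w') ∈ S → ∑ k, (X k w - X k w') ^ 2 ≤ Fintype.card (Fin n) / 8 := by
  have hn1 : (1 : ℝ) ≤ n := Nat.one_le_cast.2 hn
  have h0 : 0 < b - a := by linarith
  -- At this width n|t-t'| ≤ 1/4, so each summand is at most 2/16 = 1/8.
  refine ⟨{q | |q.1 - q.2| ≤ 1 / (4 * n)}, 1 / (4 * n) / (b - a),
    measurableSet_le (by fun_prop) (by fun_prop), ?_, ?_, ?_, ?_⟩
  · rw [Fintype.card_fin, div_div, div_div, div_le_div_iff₀ (by positivity) (by positivity)]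
    nlinarith
  · filter_upwards [ae_cond_mem (μ := (volume : Measure ℝ)) (s := Ioo a b) measurableSet_Ioo]
      with t ht
    refine le_cond_Ioo_strip hab (by positivity) ?_ ht
    rw [div_le_div_iff₀ (by positivity) (by norm_num)]
    nlinarith
  · intro t
    refine (cond_Ioo_strip_le hab (by positivity) t).trans ?_
    gcongr
    norm_num
  · intro t t' ht
    have ht : |t - t'| ≤ 1 / (4 * n) := ht
    rw [Fintype.card_fin]
    have h3 : n * |t - t'| ≤ 1 / 4 := by
      calc n * |t - t'| ≤ n * (1 / (4 * n)) := by gcongr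
        _ = 1 / 4 := by field_simp
    calc _ ≤ ∑ _k : Fin n, (1 : ℝ) / 8 := Finset.sum_le_sum fun k _ => by
          refine (hX k t t').trans ?_
          have : 0 ≤ n * |t - t'| := by positivity
          nlinarith
      _ = _ := by simp; ring

lemma sqrt_two_mul_sub_sq_le {n k : ℕ} (hk : k ≤ n) {x y t t' : ℝ}
    (h : |x - y| ≤ |k * t - k * t'|) :
    (Real.sqrt 2 * x - Real.sqrt 2 * y) ^ 2 ≤ 2 * (n * |t - t'|) ^ 2 := by
  rw [← mul_sub, mul_pow, Real.sq_sqrt (by norm_num), ← sq_abs (x - y)]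
  have h1 : |x - y| ≤ n * |t - t'| := by
    refine h.trans ?_
    rw [← mul_sub, abs_mul, Nat.abs_cast]
    gcongr
  gcongr

/-! ### The cosine and trigonometric systems. -/

lemma measurable_cosSystem (n : ℕ) (j : Fin n) : Measurable (cosSystem n j) := by
  unfold cosSystem; fun_prop

lemma integral_cosSystem_mul (n : ℕ) (j k : Fin n) (hjk : j ≠ k) :
    ∫ t, cosSystem n j t * cosSystem n k t ∂cosMeasure = 0 := by
  have hjk' : (j : ℕ) ≠ k := fun h => hjk (Fin.ext h)
  have := integral_cos_mul_cos (((j : ℕ) + 1 : ℕ) : ℤ) (((k : ℕ) + 1 : ℕ) : ℤ) 0 1 (by omega)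
    (by omega)
  rw [cosMeasure, integral_cond_Ioo Real.pi_pos]
  have h : ∀ t, cosSystem n j t * cosSystem n k t = 2 * (Real.cos ((((j : ℕ) + 1 : ℕ) : ℤ) * t) *
      Real.cos ((((k : ℕ) + 1 : ℕ) : ℤ) * t)) := by
    intro t
    simp only [cosSystem, Int.cast_natCast]
    linear_combination Real.cos ((((j : ℕ) + 1 : ℕ) : ℝ) * t) *
      Real.cos ((((k : ℕ) + 1 : ℕ) : ℝ) * t) * Real.mul_self_sqrt (by norm_num : (0 : ℝ) ≤ 2)
  simp_rw [h]
  simp only [Int.cast_zero, zero_mul, Int.cast_one, one_mul] at this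
  rw [intervalIntegral.integral_const_mul, this]
  simp

lemma integral_cosSystem_sq (n : ℕ) (j : Fin n) : ∫ t, cosSystem n j t ^ 2 ∂cosMeasure = 1 := by
  have := integral_two_mul_cos_sq (k := (((j : ℕ) + 1 : ℕ) : ℤ)) (by omega) 0 1
  rw [cosMeasure, integral_cond_Ioo Real.pi_pos]
  simp only [Int.cast_zero, zero_mul, Int.cast_one, one_mul, Int.cast_natCast] at this
  simp only [cosSystem, mul_pow, Real.sq_sqrt (by norm_num : (0 : ℝ) ≤ 2)]
  rw [this, sub_zero, inv_mul_cancel₀ Real.pi_ne_zero]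

/-- The double angle formula: X_k² - 1 is a multiple of X_{2k}, so the centered squares are
orthogonal as well. The zero-based index 2j + 1 stands for the frequency 2(j + 1). -/
lemma cosSystem_sq (n : ℕ) (j : Fin n) (t : ℝ) : cosSystem n j t ^ 2 =
    1 + (Real.sqrt 2)⁻¹ * cosSystem (2 * n) ⟨2 * j + 1, by omega⟩ t := by
  simp only [cosSystem]
  rw [mul_pow, Real.sq_sqrt (by norm_num), inv_mul_cancel_left₀ (by positivity)]
  have : ((2 * (j : ℕ) + 1 + 1 : ℕ) : ℝ) * t = 2 * ((((j : ℕ) + 1 : ℕ) : ℝ) * t) := by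
    push_cast; ring
  rw [this, Real.cos_two_mul]
  ring

lemma isProbabilityMeasure_cosMeasure : IsProbabilityMeasure cosMeasure :=
  isProbabilityMeasure_cond_Ioo Real.pi_pos

lemma isStripSystem_cosSystem {n : ℕ} (hn : 1 ≤ n) :
    IsStripSystem cosMeasure (cosSystem n) 2 1 (1 / 100) where
  measurable := measurable_cosSystem n
  sum_sq_le t := by
    rw [Fintype.card_fin]
    calc ∑ k, cosSystem n k t ^ 2 ≤ ∑ _k : Fin n, (2 : ℝ) := Finset.sum_le_sum fun k _ => by
          rw [cosSystem, mul_pow, Real.sq_sqrt (by norm_num)]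
          linarith [Real.cos_sq_le_one ((((k : ℕ) + 1 : ℕ) : ℝ) * t)]
      _ ≤ _ := by simp; linarith [(Nat.cast_nonneg n : (0 : ℝ) ≤ n)]
  integral_sq := integral_cosSystem_sq n
  integral_mul := integral_cosSystem_mul n
  variance_le := by
    have := isProbabilityMeasure_cosMeasure
    have hs2 : Real.sqrt 2 ≠ 0 := by positivity
    have h : ∀ t, ∑ k, cosSystem n k t ^ 2 - Fintype.card (Fin n) =
        ∑ k : Fin n, (Real.sqrt 2)⁻¹ * cosSystem (2 * n) ⟨2 * k + 1, by omega⟩ t := by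
      intro t
      simp only [cosSystem_sq, Finset.sum_add_distrib]
      simp
    have hb : ∀ (m : ℕ) (j : Fin m) t, |cosSystem m j t| ≤ Real.sqrt 2 := by
      intro m j t
      rw [cosSystem, abs_mul, abs_of_nonneg (Real.sqrt_nonneg _)]
      exact mul_le_of_le_one_right (Real.sqrt_nonneg _) (Real.abs_cos_le_one _)
    simp_rw [h]
    rw [integral_sq_sum_of_orthogonal]
    · simp_rw [mul_pow, integral_const_mul, integral_cosSystem_sq, inv_pow,
        Real.sq_sqrt (by norm_num : (0 : ℝ) ≤ 2)]
      simp only [Finset.sum_const, Finset.card_univ, nsmul_eq_mul]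
      linarith [(Nat.cast_nonneg (Fintype.card (Fin n)) : (0 : ℝ) ≤ _)]
    · intro k l
      refine Integrable.of_bound (C := 1) ?_ (Filter.Eventually.of_forall fun t => ?_)
      · exact (((measurable_cosSystem _ _).const_mul _).mul
          ((measurable_cosSystem _ _).const_mul _)).aestronglyMeasurable
      · have h1 : ∀ k : Fin n, |(Real.sqrt 2)⁻¹ * cosSystem (2 * n) ⟨2 * k + 1, by omega⟩ t| ≤ 1 := by
          intro k
          rw [abs_mul, abs_of_nonneg (by positivity), inv_mul_le_iff₀ (by positivity), mul_one]
          exact hb _ _ _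
        rw [Real.norm_eq_abs, abs_mul]
        exact mul_le_one₀ (h1 k) (abs_nonneg _) (h1 l)
    · intro k l hkl
      simp_rw [mul_mul_mul_comm, integral_const_mul]
      rw [integral_cosSystem_mul, mul_zero]
      intro h
      simp only [Fin.mk.injEq, Nat.add_right_cancel_iff] at h
      exact hkl (Fin.ext (by omega))
  exists_strip := by
    refine exists_strip_of_interval Real.pi_pos (by linarith [Real.pi_gt_three])
      (by linarith [Real.pi_lt_four]) hn fun k t t' => ?_
    exact sqrt_two_mul_sub_sq_le (k := (k : ℕ) + 1) k.2 (abs_cos_sub_cos_le _ _)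

lemma isProbabilityMeasure_trigMeasure : IsProbabilityMeasure trigMeasure :=
  isProbabilityMeasure_cond_Ioo (by linarith [Real.pi_pos])

/-- Cosine and sine of the same frequency come in pairs because n is even; the norm of the vector is
then constant. -/
lemma sum_trigSystem_sq {n : ℕ} (hn : Even n) (t : ℝ) : ∑ j, trigSystem n j t ^ 2 = n := by
  obtain ⟨m, rfl⟩ := hn
  let g : ℕ → ℝ := fun j => if Even j then Real.sqrt 2 * Real.cos (((j / 2 + 1 : ℕ) : ℝ) * t)
    else Real.sqrt 2 * Real.sin (((j / 2 + 1 : ℕ) : ℝ) * t)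
  have h : ∀ m : ℕ, ∑ j ∈ Finset.range (m + m), g j ^ 2 = (m + m : ℕ) := by
    intro m
    induction m with
    | zero => simp
    | succ m ih =>
      rw [show m + 1 + (m + 1) = m + m + 1 + 1 by ring, Finset.sum_range_succ,
        Finset.sum_range_succ, ih]
      have h1 : Even (m + m) := ⟨m, rfl⟩
      have h2 : ¬ Even (m + m + 1) := by simp
      have h3 : (m + m + 1) / 2 = (m + m) / 2 := by omega
      simp only [g, if_pos h1, if_neg h2, h3, mul_pow, Real.sq_sqrt (by norm_num : (0 : ℝ) ≤ 2)]
      have h4 := Real.sin_sq_add_cos_sq ((((m + m) / 2 + 1 : ℕ) : ℝ) * t)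
      push_cast at h4 ⊢
      linarith
  rw [← h m]
  exact Fin.sum_univ_eq_sum_range (fun j => g j ^ 2) (m + m)

lemma integral_trigMeasure (f : ℝ → ℝ) : ∫ t, f t ∂trigMeasure =
    (2 * Real.pi)⁻¹ * ∫ t in (-Real.pi)..Real.pi, f t := by
  rw [trigMeasure, integral_cond_Ioo (by linarith [Real.pi_pos])]
  ring_nf

lemma isStripSystem_trigSystem {n : ℕ} (hn : 1 ≤ n) (hn2 : Even n) :
    IsStripSystem trigMeasure (trigSystem n) 2 1 (1 / 100) where
  measurable j := by unfold trigSystem; split_ifs <;> fun_prop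
  sum_sq_le t := by
    rw [sum_trigSystem_sq hn2, Fintype.card_fin]
    linarith [(Nat.cast_nonneg n : (0 : ℝ) ≤ n)]
  integral_sq j := by
    rw [integral_trigMeasure]
    have hpi : (2 * Real.pi) ≠ 0 := by positivity
    unfold trigSystem
    split_ifs
    · have := integral_two_mul_cos_sq (k := (((j : ℕ) / 2 + 1 : ℕ) : ℤ)) (by omega) (-1) 1
      simp only [Int.cast_neg, neg_mul, Int.cast_one, one_mul, Int.cast_natCast] at this
      simp only [mul_pow, Real.sq_sqrt (by norm_num : (0 : ℝ) ≤ 2)]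
      rw [this, sub_neg_eq_add, ← two_mul, inv_mul_cancel₀ hpi]
    · have := integral_two_mul_sin_sq (k := (((j : ℕ) / 2 + 1 : ℕ) : ℤ)) (by omega) (-1) 1
      simp only [Int.cast_neg, neg_mul, Int.cast_one, one_mul, Int.cast_natCast] at this
      simp only [mul_pow, Real.sq_sqrt (by norm_num : (0 : ℝ) ≤ 2)]
      rw [this, sub_neg_eq_add, ← two_mul, inv_mul_cancel₀ hpi]
  integral_mul j k hjk := by
    have hjk' : (j : ℕ) ≠ k := fun h => hjk (Fin.ext h)
    rw [integral_trigMeasure]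
    have h2 := Real.mul_self_sqrt (by norm_num : (0 : ℝ) ≤ 2)
    have hmul : ∀ x y, Real.sqrt 2 * x * (Real.sqrt 2 * y) = 2 * (x * y) := by
      intro x y; linear_combination (x * y) * h2
    unfold trigSystem
    split_ifs with hj hk hk
    · have := integral_cos_mul_cos (((j : ℕ) / 2 + 1 : ℕ) : ℤ) (((k : ℕ) / 2 + 1 : ℕ) : ℤ) (-1) 1
        (by grind) (by omega)
      simp only [Int.cast_neg, neg_mul, Int.cast_one, one_mul, Int.cast_natCast] at this
      simp_rw [hmul]
      rw [intervalIntegral.integral_const_mul, this, mul_zero, mul_zero]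
    · have := integral_sin_mul_cos (((k : ℕ) / 2 + 1 : ℕ) : ℤ) (((j : ℕ) / 2 + 1 : ℕ) : ℤ)
      simp only [Int.cast_natCast] at this
      simp_rw [hmul, mul_comm (Real.cos _)]
      rw [intervalIntegral.integral_const_mul, this, mul_zero, mul_zero]
    · have := integral_sin_mul_cos (((j : ℕ) / 2 + 1 : ℕ) : ℤ) (((k : ℕ) / 2 + 1 : ℕ) : ℤ)
      simp only [Int.cast_natCast] at this
      simp_rw [hmul]
      rw [intervalIntegral.integral_const_mul, this, mul_zero, mul_zero]
    · have := integral_sin_mul_sin (((j : ℕ) / 2 + 1 : ℕ) : ℤ) (((k : ℕ) / 2 + 1 : ℕ) : ℤ) (-1) 1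
        (by grind) (by omega)
      simp only [Int.cast_neg, neg_mul, Int.cast_one, one_mul, Int.cast_natCast] at this
      simp_rw [hmul]
      rw [intervalIntegral.integral_const_mul, this, mul_zero, mul_zero]
  variance_le := by
    simp_rw [sum_trigSystem_sq hn2, Fintype.card_fin]
    simp
  exists_strip := by
    refine exists_strip_of_interval (by linarith [Real.pi_pos]) (by linarith [Real.pi_gt_three])
      (by linarith [Real.pi_lt_four]) hn fun j t t' => ?_
    have hj : (j : ℕ) / 2 + 1 ≤ n := by omega
    unfold trigSystem
    split_ifs
    · exact sqrt_two_mul_sub_sq_le hj (abs_cos_sub_cos_le _ _)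
    · exact sqrt_two_mul_sub_sq_le hj (abs_sin_sub_sin_le _ _)


/-! ### Chebyshev polynomials as the cosine system in the variable cos t. -/

lemma chebMeasure_eq_map : chebMeasure = cosMeasure.map Real.cos := by
  ext A hA
  have himg : Real.cos '' Ioo 0 Real.pi = Ioo (-1) 1 := by
    ext y
    constructor
    · rintro ⟨t, ht, rfl⟩
      have h1 := Real.cos_lt_cos_of_nonneg_of_le_pi le_rfl ht.2.le ht.1
      have h2 := Real.cos_lt_cos_of_nonneg_of_le_pi ht.1.le le_rfl ht.2
      rw [Real.cos_zero] at h1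
      rw [Real.cos_pi] at h2
      exact ⟨h2, h1⟩
    · rintro ⟨h1, h2⟩
      exact ⟨Real.arccos y, ⟨Real.arccos_pos.2 h2, Real.arccos_lt_pi.2 h1⟩,
        Real.cos_arccos h1.le h2.le⟩
  have hinj : InjOn Real.cos (Ioo 0 Real.pi) := Real.injOn_cos.mono Ioo_subset_Icc_self
  rw [Measure.map_apply Real.measurable_cos hA, chebMeasure, withDensity_apply _ hA,
    Measure.restrict_restrict hA, ← setLIntegral_indicator hA, ← himg,
    lintegral_image_eq_lintegral_abs_deriv_mul measurableSet_Ioo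
      (fun x _ => (Real.hasDerivAt_cos x).hasDerivWithinAt) hinj,
    cosMeasure, cond_apply measurableSet_Ioo, Real.volume_Ioo, sub_zero]
  have hB : MeasurableSet (Real.cos ⁻¹' A) := Real.measurable_cos hA
  -- The Jacobian sin t cancels √(1 - cos² t), leaving the constant density 1/π.
  have h : ∀ t ∈ Ioo 0 Real.pi, ENNReal.ofReal |-Real.sin t| *
      A.indicator (fun t => ENNReal.ofReal (1 / (Real.pi * Real.sqrt (1 - t ^ 2)))) (Real.cos t) =
      (Real.cos ⁻¹' A).indicator (fun _ => (ENNReal.ofReal Real.pi)⁻¹) t := by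
    intro t ht
    by_cases hA' : Real.cos t ∈ A
    · rw [indicator_of_mem hA', indicator_of_mem (by exact hA')]
      have hs := Real.sin_pos_of_mem_Ioo ht
      rw [abs_neg, abs_of_pos hs, ← Real.abs_sin_eq_sqrt_one_sub_cos_sq, abs_of_pos hs,
        ← ENNReal.ofReal_mul hs.le, ← ENNReal.ofReal_inv_of_pos Real.pi_pos]
      congr 1
      field_simp
    · rw [indicator_of_notMem hA', indicator_of_notMem (by exact hA'), mul_zero]
  rw [setLIntegral_congr_fun measurableSet_Ioo h, lintegral_indicator_const hB,
    Measure.restrict_apply hB, inter_comm]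

lemma distFun_chebSystem (n : ℕ) (θ : EuclideanSpace ℝ (Fin n)) (x : ℝ) :
    distFun cosMeasure (cosSystem n) θ x = distFun chebMeasure (chebSystem n) θ x := by
  have hm : MeasurableSet {t | weightedSum (chebSystem n) θ t ≤ x} := by
    refine measurableSet_le ?_ measurable_const
    unfold weightedSum chebSystem
    exact Finset.measurable_fun_sum _ fun k _ => ((Real.measurable_cos.comp
      (Real.measurable_arccos.const_mul _)).const_mul _).const_mul _
  rw [distFun, distFun, chebMeasure_eq_map, map_measureReal_apply Real.measurable_cos hm]
  refine measureReal_congr ?_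
  filter_upwards [ae_cond_mem (μ := (volume : Measure ℝ)) (s := Ioo 0 Real.pi) measurableSet_Ioo]
    with t ht
  refine propext (iff_of_eq ?_)
  change (weightedSum (cosSystem n) θ t ≤ x) = (weightedSum (chebSystem n) θ (Real.cos t) ≤ x)
  simp only [weightedSum, cosSystem, chebSystem, Real.arccos_cos ht.1.le ht.2.le]

/-! ### Uniform distributions on finite sets -/

lemma uniformOn_univ_real_singleton {Ω : Type*} [MeasurableSpace Ω] [MeasurableSingletonClass Ω]
    [Fintype Ω] (w : Ω) : (uniformOn (univ : Set Ω)).real {w} = (Fintype.card Ω : ℝ)⁻¹ := by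
  rw [measureReal_def, uniformOn_univ, Measure.count_singleton]
  simp

lemma integral_uniformOn_univ {Ω : Type*} [MeasurableSpace Ω] [MeasurableSingletonClass Ω]
    [Fintype Ω] [Nonempty Ω] (f : Ω → ℝ) :
    ∫ w, f w ∂(uniformOn (univ : Set Ω)) = (Fintype.card Ω : ℝ)⁻¹ * ∑ w, f w := by
  have : IsProbabilityMeasure (uniformOn (univ : Set Ω)) :=
    isProbabilityMeasure_uniformOn finite_univ univ_nonempty
  rw [integral_fintype Integrable.of_finite]
  simp_rw [uniformOn_univ_real_singleton, smul_eq_mul, Finset.mul_sum]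

/-- On a finite space the diagonal itself is the strip: its sections are atoms, and the vectors on
it coincide. -/
lemma exists_strip_uniformOn_univ {Ω ι : Type*} [MeasurableSpace Ω] [MeasurableSingletonClass Ω]
    [Fintype Ω] [Nonempty Ω] [Fintype ι] {X : ι → Ω → ℝ} {c : ℝ}
    (hc : c / Fintype.card ι ≤ (Fintype.card Ω : ℝ)⁻¹) :
    ∃ (S : Set (Ω × Ω)) (p : ℝ), MeasurableSet S ∧ c / Fintype.card ι ≤ p ∧
    (∀ᵐ w ∂(uniformOn (univ : Set Ω)), p ≤ (uniformOn (univ : Set Ω)).real (Prod.mk w ⁻¹' S)) ∧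
    (∀ w, (uniformOn (univ : Set Ω)).real (Prod.mk w ⁻¹' S) ≤ 4 * p) ∧
    ∀ w w', (w, w') ∈ S → ∑ k, (X k w - X k w') ^ 2 ≤ Fintype.card ι / 8 := by
  have h : ∀ w : Ω, Prod.mk w ⁻¹' {q : Ω × Ω | q.1 = q.2} = {w} := by
    intro w; ext w'; simp [eq_comm]
  refine ⟨{q | q.1 = q.2}, (Fintype.card Ω : ℝ)⁻¹, (Set.toFinite _).measurableSet, hc, ?_, ?_, ?_⟩
  · refine Filter.Eventually.of_forall fun w => ?_
    rw [h, uniformOn_univ_real_singleton]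
  · intro w
    rw [h, uniformOn_univ_real_singleton]
    have : (0 : ℝ) ≤ (Fintype.card Ω : ℝ)⁻¹ := by positivity
    linarith
  · intro w w' hw
    obtain rfl : w = w' := hw
    simp only [sub_self, ne_eq, OfNat.ofNat_ne_zero, not_false_eq_true, zero_pow,
      Finset.sum_const_zero]
    positivity

lemma sum_empiricalSystem_sq (n : ℕ) (i : Fin n) : ∑ k, empiricalSystem n k i ^ 2 = n := by
  simp [empiricalSystem]

lemma isProbabilityMeasure_indexMeasure {n : ℕ} (hn : 1 ≤ n) :
    IsProbabilityMeasure (indexMeasure n) := by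
  have : Nonempty (Fin n) := ⟨⟨0, hn⟩⟩
  exact isProbabilityMeasure_uniformOn finite_univ univ_nonempty

lemma isStripSystem_empiricalSystem {n : ℕ} (hn : 1 ≤ n) :
    IsStripSystem (indexMeasure n) (empiricalSystem n) 2 1 (1 / 100) := by
  have : Nonempty (Fin n) := ⟨⟨0, hn⟩⟩
  have hn0 : (n : ℝ) ≠ 0 := Nat.cast_ne_zero.2 (by omega)
  refine ⟨fun k => measurable_of_countable _, fun w => ?_, fun k => ?_, fun k l hkl => ?_, ?_,
    exists_strip_uniformOn_univ ?_⟩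
  · rw [sum_empiricalSystem_sq, Fintype.card_fin]
    linarith [(Nat.cast_nonneg n : (0 : ℝ) ≤ n)]
  · rw [indexMeasure, integral_uniformOn_univ]
    simp [empiricalSystem, hn0]
  · rw [indexMeasure, integral_uniformOn_univ]
    have : ∀ i, empiricalSystem n k i * empiricalSystem n l i = 0 := by
      intro i
      unfold empiricalSystem
      split_ifs with h1 h2 <;> simp
      exact absurd (h1.trans h2.symm) hkl
    simp [this]
  · simp [sum_empiricalSystem_sq]
  · rw [Fintype.card_fin, ← one_div]
    gcongr
    norm_num

instance : MeasurableSingletonClass ℤˣ :=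
  ⟨fun u => ⟨{(u : ℤ)}, MeasurableSet.of_discrete, by ext v; simp [Units.ext_iff]⟩⟩

lemma walshSystem_sq (d : ℕ) (τ : {τ : Finset (Fin d) // τ ≠ ∅}) (t : Fin d → ℤˣ) :
    walshSystem d τ t ^ 2 = 1 := by
  rw [walshSystem, ← Finset.prod_pow]
  refine Finset.prod_eq_one fun k _ => ?_
  rcases Int.units_eq_one_or (t k) with h | h <;> simp [h]

lemma sum_walshSystem_mul {d : ℕ} {τ σ : {τ : Finset (Fin d) // τ ≠ ∅}} (h : τ ≠ σ) :
    ∑ t, walshSystem d τ t * walshSystem d σ t = 0 := by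
  have h1 : ∀ t, walshSystem d τ t * walshSystem d σ t = ∏ k, ((if k ∈ τ.1 then
      (((t k : ℤˣ) : ℤ) : ℝ) else 1) * (if k ∈ σ.1 then (((t k : ℤˣ) : ℤ) : ℝ) else 1)) := by
    intro t
    rw [Finset.prod_mul_distrib, Finset.prod_ite_mem, Finset.prod_ite_mem, Finset.univ_inter,
      Finset.univ_inter]
    rfl
  simp_rw [h1]
  have h2 := Finset.prod_univ_sum (fun _ : Fin d => (Finset.univ : Finset ℤˣ))
    (fun k u => ((if k ∈ τ.1 then ((u : ℤ) : ℝ) else 1) * (if k ∈ σ.1 then ((u : ℤ) : ℝ) else 1)))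
  rw [Fintype.piFinset_univ] at h2
  rw [← h2]
  have h3 : τ.1 ≠ σ.1 := fun h' => h (Subtype.ext h')
  -- The sum factors over the coordinates, and a coordinate in exactly one of the two sets
  -- contributes 1 + (-1) = 0.
  obtain ⟨k, hk⟩ : ∃ k, ¬ (k ∈ τ.1 ↔ k ∈ σ.1) := by
    by_contra! h'
    exact h3 (Finset.ext h')
  refine Finset.prod_eq_zero (Finset.mem_univ k) ?_
  have h4 : (Finset.univ : Finset ℤˣ) = {1, -1} := by decide
  rw [h4, Finset.sum_pair (by decide)]
  by_cases hτ : k ∈ τ.1 <;> by_cases hσ : k ∈ σ.1 <;> simp_all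

lemma isProbabilityMeasure_cubeMeasure (d : ℕ) : IsProbabilityMeasure (cubeMeasure d) :=
  isProbabilityMeasure_uniformOn finite_univ univ_nonempty

lemma card_nonempty_finset (d : ℕ) : Fintype.card {τ : Finset (Fin d) // τ ≠ ∅} = 2 ^ d - 1 := by
  rw [Fintype.card_subtype_compl, Fintype.card_finset, Fintype.card_fin, Fintype.card_subtype_eq]

lemma isStripSystem_walshSystem {d : ℕ} (hd : 2 ≤ d) :
    IsStripSystem (cubeMeasure d) (walshSystem d) 2 1 (1 / 100) := by
  refine ⟨fun k => measurable_of_countable _, fun w => ?_, fun k => ?_, fun k l hkl => ?_, ?_,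
    exists_strip_uniformOn_univ ?_⟩
  · simp only [walshSystem_sq, Finset.sum_const, Finset.card_univ, nsmul_eq_mul, mul_one]
    linarith [(Nat.cast_nonneg (Fintype.card {τ : Finset (Fin d) // τ ≠ ∅}) : (0 : ℝ) ≤ _)]
  · rw [cubeMeasure, integral_uniformOn_univ]
    simp [walshSystem_sq]
  · rw [cubeMeasure, integral_uniformOn_univ, sum_walshSystem_mul hkl, mul_zero]
  · simp only [walshSystem_sq, Finset.sum_const, Finset.card_univ, nsmul_eq_mul, mul_one, sub_self]
    simp only [ne_eq, OfNat.ofNat_ne_zero, not_false_eq_true, zero_pow, integral_zero]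
    positivity
  · have h1 : 2 ^ 2 ≤ 2 ^ d := Nat.pow_le_pow_right (by norm_num) hd
    have h2 : (4 : ℝ) ≤ 2 ^ d := by exact_mod_cast h1
    have h3 : Fintype.card (Fin d → ℤˣ) = 2 ^ d := by simp
    rw [card_nonempty_finset, h3, Nat.cast_sub Nat.one_le_two_pow, ← one_div]
    push_cast
    rw [div_div, div_le_div_iff₀ (by linarith) (by linarith)]
    linarith


/-! ### The system Ψ(kt + s). -/

lemma cond_Ioo_zero_one : cond (volume : Measure ℝ) (Ioo 0 1) = volume.restrict (Ioo 0 1) := by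
  rw [ProbabilityTheory.cond, Real.volume_Ioo]; simp

lemma squareMeasure_eq : squareMeasure =
    (cond (volume : Measure ℝ) (Ioo 0 1)).prod (cond (volume : Measure ℝ) (Ioo 0 1)) := by
  rw [cond_Ioo_zero_one, Measure.prod_restrict, squareMeasure, Measure.volume_eq_prod]

lemma isProbabilityMeasure_squareMeasure : IsProbabilityMeasure squareMeasure := by
  have := isProbabilityMeasure_cond_Ioo (zero_lt_one' ℝ)
  rw [squareMeasure_eq]
  infer_instance

lemma integral_cond_Ioo_zero_one (f : ℝ → ℝ) :
    ∫ t, f t ∂(cond (volume : Measure ℝ) (Ioo 0 1)) = ∫ t in (0 : ℝ)..1, f t := by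
  rw [integral_cond_Ioo zero_lt_one]; simp

lemma integrable_cond_Ioo_zero_one_iff (f : ℝ → ℝ) :
    Integrable f (cond (volume : Measure ℝ) (Ioo 0 1)) ↔ IntervalIntegrable f volume 0 1 := by
  rw [cond_Ioo_zero_one, intervalIntegrable_iff_integrableOn_Ioo_of_le zero_le_one, IntegrableOn]

/-- For a periodic function, the integral over a period does not depend on the shift. -/
lemma integral_periodic_add_left {φ : ℝ → ℝ} (hφ : Function.Periodic φ 1) (a : ℝ) :
    ∫ s in (0 : ℝ)..1, φ (a + s) = ∫ s in (0 : ℝ)..1, φ s := by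
  rw [intervalIntegral.integral_comp_add_left, add_zero]
  simpa using hφ.intervalIntegral_add_eq a 0

lemma intervalIntegrable_periodic_add_left {φ : ℝ → ℝ} (hφ : Function.Periodic φ 1)
    (hi : IntervalIntegrable φ volume 0 1) (a : ℝ) :
    IntervalIntegrable (fun s => φ (a + s)) volume 0 1 := by
  have h := hφ.intervalIntegrable₀ one_ne_zero (by simpa using hi) a (a + 1)
  have := h.comp_add_left a
  simpa using this

/-- For fixed t the integral in s runs over a full period, so the shift by at does not matter, and
one period decides integrability on the square. -/
lemma integrable_periodic_square {φ : ℝ → ℝ} (hφ : Function.Periodic φ 1) (hm : Measurable φ)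
    (hi : IntervalIntegrable φ volume 0 1) (a : ℝ) :
    Integrable (fun p : ℝ × ℝ => φ (a * p.1 + p.2)) squareMeasure := by
  have := isProbabilityMeasure_cond_Ioo (zero_lt_one' ℝ)
  have hme : Measurable fun p : ℝ × ℝ => φ (a * p.1 + p.2) := hm.comp (by fun_prop)
  rw [squareMeasure_eq, integrable_prod_iff hme.aestronglyMeasurable]
  constructor
  · refine Filter.Eventually.of_forall fun t => ?_
    rw [integrable_cond_Ioo_zero_one_iff]
    exact intervalIntegrable_periodic_add_left hφ hi (a * t)
  · have h : ∀ t, ∫ s, ‖φ (a * t + s)‖ ∂(cond (volume : Measure ℝ) (Ioo 0 1)) =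
        ∫ s in (0 : ℝ)..1, ‖φ s‖ := fun t => by
      rw [integral_cond_Ioo_zero_one]
      exact integral_periodic_add_left (φ := fun s => ‖φ s‖) (hφ.comp norm) (a * t)
    simp only [h]
    exact integrable_const _

lemma integral_periodic_square {φ : ℝ → ℝ} (hφ : Function.Periodic φ 1) (hm : Measurable φ)
    (hi : IntervalIntegrable φ volume 0 1) (a : ℝ) :
    ∫ p, φ (a * p.1 + p.2) ∂squareMeasure = ∫ s in (0 : ℝ)..1, φ s := by
  have := isProbabilityMeasure_cond_Ioo (zero_lt_one' ℝ)
  have h := integrable_periodic_square hφ hm hi a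
  rw [squareMeasure_eq] at h ⊢
  rw [integral_prod _ h]
  simp_rw [integral_cond_Ioo_zero_one, integral_periodic_add_left hφ]
  simp

lemma memLp_two_periodic_square {φ : ℝ → ℝ} (hφ : Function.Periodic φ 1) (hm : Measurable φ)
    (hi : IntervalIntegrable (fun x => φ x ^ 2) volume 0 1) (a : ℝ) :
    MemLp (fun p : ℝ × ℝ => φ (a * p.1 + p.2)) 2 squareMeasure := by
  have hme : Measurable fun p : ℝ × ℝ => φ (a * p.1 + p.2) := hm.comp (by fun_prop)
  rw [memLp_two_iff_integrable_sq hme.aestronglyMeasurable]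
  exact integrable_periodic_square (φ := fun x => φ x ^ 2) (hφ.comp (· ^ 2)) (hm.pow_const 2) hi a

lemma intervalIntegrable_of_sq {φ : ℝ → ℝ} (hm : Measurable φ)
    (hi : IntervalIntegrable (fun x => φ x ^ 2) volume 0 1) : IntervalIntegrable φ volume 0 1 := by
  have := isProbabilityMeasure_cond_Ioo (zero_lt_one' ℝ)
  rw [← integrable_cond_Ioo_zero_one_iff] at hi ⊢
  exact ((memLp_two_iff_integrable_sq hm.aestronglyMeasurable).2 hi).integrable one_le_two

/-- Pairwise independence of the variables `φ(at + s)` and `ψ(bt + s)`. -/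
lemma integral_periodic_square_mul {φ ψ : ℝ → ℝ} (hφ : Function.Periodic φ 1)
    (hφm : Measurable φ) (hφi : IntervalIntegrable (fun x => φ x ^ 2) volume 0 1)
    (hψ : Function.Periodic ψ 1) (hψm : Measurable ψ)
    (hψi : IntervalIntegrable (fun x => ψ x ^ 2) volume 0 1) {a b : ℝ} {m : ℤ} (hm : m ≠ 0)
    (hab : a - b = m) :
    ∫ p, φ (a * p.1 + p.2) * ψ (b * p.1 + p.2) ∂squareMeasure =
      (∫ s in (0 : ℝ)..1, φ s) * ∫ s in (0 : ℝ)..1, ψ s := by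
  have := isProbabilityMeasure_cond_Ioo (zero_lt_one' ℝ)
  have h1 : Integrable (fun p : ℝ × ℝ => φ (a * p.1 + p.2) * ψ (b * p.1 + p.2)) squareMeasure :=
    (memLp_two_periodic_square hφ hφm hφi a).integrable_mul
    (memLp_two_periodic_square hψ hψm hψi b)
  have h2 : Integrable (fun p : ℝ × ℝ => φ (m * p.1 + p.2) * ψ (0 * p.1 + p.2)) squareMeasure :=
    (memLp_two_periodic_square hφ hφm hφi m).integrable_mul
    (memLp_two_periodic_square hψ hψm hψi 0)
  have hm0 : (m : ℝ) ≠ 0 := Int.cast_ne_zero.2 hm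
  -- As t runs over the unit interval, mt + s covers |m| full periods; this is where m must be a
  -- nonzero integer.
  have key : ∀ s, ∫ t in (0 : ℝ)..1, φ (m * t + s) = ∫ t in (0 : ℝ)..1, φ t := by
    intro s
    rw [intervalIntegral.integral_comp_mul_add (fun x => φ x) hm0]
    have h3 := hφ.intervalIntegral_add_zsmul_eq m s (fun t₁ t₂ =>
      hφ.intervalIntegrable₀ one_ne_zero (by simpa using intervalIntegrable_of_sq hφm hφi) t₁ t₂)
    have h4 := hφ.intervalIntegral_add_eq s 0
    rw [h4] at h3
    simp only [zsmul_eq_mul, mul_one, zero_add, mul_zero] at h3 ⊢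
    rw [add_comm, h3, smul_eq_mul, inv_mul_cancel_left₀ hm0]
  calc ∫ p, φ (a * p.1 + p.2) * ψ (b * p.1 + p.2) ∂squareMeasure
      = ∫ t in (0 : ℝ)..1, ∫ s in (0 : ℝ)..1, φ (a * t + s) * ψ (b * t + s) := by
        rw [squareMeasure_eq] at h1 ⊢
        rw [integral_prod _ h1]
        simp_rw [integral_cond_Ioo_zero_one]
    -- Shifting s by -bt frees ψ from t and leaves the integer frequency a - b in φ. The integral
    -- over t can then be taken first.
    _ = ∫ t in (0 : ℝ)..1, ∫ s in (0 : ℝ)..1, φ (m * t + s) * ψ (0 * t + s) := by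
        congr 1
        ext t
        rw [← integral_periodic_add_left (φ := fun s => φ (m * t + s) * ψ (0 * t + s)) _ (b * t)]
        · refine intervalIntegral.integral_congr fun s _ => ?_
          rw [← hab]
          ring_nf
        · intro s
          change φ _ * ψ _ = φ _ * ψ _
          rw [← add_assoc, ← add_assoc, hφ, hψ]
    _ = ∫ s in (0 : ℝ)..1, ∫ t in (0 : ℝ)..1, φ (m * t + s) * ψ (0 * t + s) := by
        simp_rw [← integral_cond_Ioo_zero_one]
        rw [squareMeasure_eq] at h2
        exact integral_integral_swap h2
    _ = _ := by
        simp_rw [zero_mul, zero_add, intervalIntegral.integral_mul_const, key]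
        rw [intervalIntegral.integral_const_mul]

lemma intervalIntegrable_sq_of_pow_four {Ψ : ℝ → ℝ} (hm : Measurable Ψ)
    (hi : IntervalIntegrable (fun x => Ψ x ^ 4) volume 0 1) :
    IntervalIntegrable (fun x => Ψ x ^ 2) volume 0 1 := by
  refine intervalIntegrable_of_sq (φ := fun x => Ψ x ^ 2) (hm.pow_const 2) ?_
  simpa only [← pow_mul] using hi

lemma measurable_psiSystem {Ψ : ℝ → ℝ} (hm : Measurable Ψ) {n : ℕ} (k : Fin n) :
    Measurable (psiSystem Ψ n k) :=
  hm.comp (by fun_prop)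

lemma integrable_psiSystem_pow_four {Ψ : ℝ → ℝ} (hΨ : Function.Periodic Ψ 1) (hm : Measurable Ψ)
    (hi : IntervalIntegrable (fun x => Ψ x ^ 4) volume 0 1) {n : ℕ} (k : Fin n) :
    Integrable (fun w => psiSystem Ψ n k w ^ 4) squareMeasure :=
  integrable_periodic_square (φ := fun x => Ψ x ^ 4) (hΨ.comp (· ^ 4)) (hm.pow_const 4) hi _

lemma integral_psiSystem_sq {Ψ : ℝ → ℝ} (hΨ : Function.Periodic Ψ 1) (hm : Measurable Ψ)
    (hi : IntervalIntegrable (fun x => Ψ x ^ 4) volume 0 1)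
    (h2 : ∫ x in (0 : ℝ)..1, Ψ x ^ 2 = 1) {n : ℕ} (k : Fin n) :
    ∫ w, psiSystem Ψ n k w ^ 2 ∂squareMeasure = 1 := by
  rw [← h2]
  exact integral_periodic_square (φ := fun x => Ψ x ^ 2) (hΨ.comp (· ^ 2)) (hm.pow_const 2)
    (intervalIntegrable_sq_of_pow_four hm hi) _

lemma exists_int_sub_eq {n : ℕ} {k l : Fin n} (hkl : k ≠ l) : ∃ m : ℤ, m ≠ 0 ∧
    (((k : ℕ) + 1 : ℕ) : ℝ) - (((l : ℕ) + 1 : ℕ) : ℝ) = m := by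
  refine ⟨(k : ℤ) - l, fun h => hkl (Fin.ext (by omega)), by push_cast; ring⟩

lemma integral_psiSystem_mul {Ψ : ℝ → ℝ} (hΨ : Function.Periodic Ψ 1) (hm : Measurable Ψ)
    (hi : IntervalIntegrable (fun x => Ψ x ^ 4) volume 0 1)
    (h1 : ∫ x in (0 : ℝ)..1, Ψ x = 0) {n : ℕ} (k l : Fin n) (hkl : k ≠ l) :
    ∫ w, psiSystem Ψ n k w * psiSystem Ψ n l w ∂squareMeasure = 0 := by
  obtain ⟨m, hm0, hm1⟩ := exists_int_sub_eq hkl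
  have hi2 := intervalIntegrable_sq_of_pow_four hm hi
  have := integral_periodic_square_mul hΨ hm hi2 hΨ hm hi2 hm0 hm1
  rwa [h1, zero_mul] at this

/-- Pairwise independence makes the variables Ψ² - 1 uncorrelated, so the variance is n(∫Ψ⁴ - 1). -/
lemma integral_sum_psiSystem_sq_sub_le {Ψ : ℝ → ℝ} (hΨ : Function.Periodic Ψ 1)
    (hm : Measurable Ψ) (hi : IntervalIntegrable (fun x => Ψ x ^ 4) volume 0 1)
    (h2 : ∫ x in (0 : ℝ)..1, Ψ x ^ 2 = 1) (n : ℕ) :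
    ∫ w, (∑ k, psiSystem Ψ n k w ^ 2 - Fintype.card (Fin n)) ^ 2 ∂squareMeasure ≤
      (∫ x in (0 : ℝ)..1, Ψ x ^ 4) * Fintype.card (Fin n) := by
  have hi2 := intervalIntegrable_sq_of_pow_four hm hi
  have hφ : Function.Periodic (fun x => Ψ x ^ 2 - 1) 1 := hΨ.comp (fun x => x ^ 2 - 1)
  have hφm : Measurable (fun x => Ψ x ^ 2 - 1) := (hm.pow_const 2).sub_const 1
  have hexp : (fun x => (Ψ x ^ 2 - 1) ^ 2) = fun x => (Ψ x ^ 4 - 2 * Ψ x ^ 2) + 1 := by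
    ext x; ring
  have hi3 : IntervalIntegrable (fun x => Ψ x ^ 4 - 2 * Ψ x ^ 2) volume 0 1 :=
    hi.sub (hi2.const_mul 2)
  have hφi : IntervalIntegrable (fun x => (Ψ x ^ 2 - 1) ^ 2) volume 0 1 := by
    rw [hexp]; exact hi3.add (by simp)
  have hφ0 : ∫ x in (0 : ℝ)..1, (Ψ x ^ 2 - 1) = 0 := by
    rw [intervalIntegral.integral_sub hi2 (by simp), h2]; simp
  have hφ2 : ∫ x in (0 : ℝ)..1, (Ψ x ^ 2 - 1) ^ 2 = (∫ x in (0 : ℝ)..1, Ψ x ^ 4) - 1 := by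
    rw [hexp, intervalIntegral.integral_add hi3 (by simp),
      intervalIntegral.integral_sub hi (hi2.const_mul 2), intervalIntegral.integral_const_mul, h2]
    simp
    ring
  have hsum : ∀ w, ∑ k, psiSystem Ψ n k w ^ 2 - Fintype.card (Fin n) =
      ∑ k : Fin n, (Ψ ((((k : ℕ) + 1 : ℕ) : ℝ) * w.1 + w.2) ^ 2 - 1) := by
    intro w; simp [psiSystem]
  simp_rw [hsum]
  rw [integral_sq_sum_of_orthogonal]
  · calc _ = ∑ _k : Fin n, ((∫ x in (0 : ℝ)..1, Ψ x ^ 4) - 1) :=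
          Finset.sum_congr rfl fun k _ => by
            rw [← hφ2]
            exact integral_periodic_square (φ := fun x => (Ψ x ^ 2 - 1) ^ 2)
              (hφ.comp (· ^ 2)) (hφm.pow_const 2) hφi _
      _ ≤ _ := by
        simp only [Finset.sum_const, Finset.card_univ, nsmul_eq_mul]
        linarith [(Nat.cast_nonneg (Fintype.card (Fin n)) : (0 : ℝ) ≤ _)]
  · intro k l
    exact (memLp_two_periodic_square hφ hφm hφi _).integrable_mul
      (memLp_two_periodic_square hφ hφm hφi _)
  · intro k l hkl
    obtain ⟨m, hm0, hm1⟩ := exists_int_sub_eq hkl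
    have := integral_periodic_square_mul hφ hφm hφi hφ hφm hφi hm0 hm1
    rwa [hφ0, zero_mul] at this

theorem exists_upperBounds_psiSystem (M : ℝ) : ∃ c₁ : ℝ, 0 < c₁ ∧
    ∀ Ψ : ℝ → ℝ, Function.Periodic Ψ 1 → Measurable Ψ →
      IntervalIntegrable (fun x => Ψ x ^ 4) volume 0 1 →
      (∫ x in (0 : ℝ)..1, Ψ x) = 0 → (∫ x in (0 : ℝ)..1, Ψ x ^ 2) = 1 →
      (∫ x in (0 : ℝ)..1, Ψ x ^ 4) ≤ M →
      ∀ n : ℕ, 2 ≤ n → WellDefined squareMeasure (psiSystem Ψ n) ∧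
        UpperBounds squareMeasure (psiSystem Ψ n) c₁ := by
  -- M is an arbitrary real number, and the constant must be positive also when no Ψ satisfies the
  -- bound.
  refine ⟨5408 * max M 0 + 6000, by positivity, ?_⟩
  intro Ψ hΨ hm hi h1 h2 hM n hn
  have := isProbabilityMeasure_squareMeasure
  have : Nontrivial (Fin n) := Fin.nontrivial_iff_two_le.2 hn
  have hX := fun k : Fin n => measurable_psiSystem (Ψ := Ψ) hm k
  have h := isoLaw_scaledLaw (C := max M 0) hX (integrable_psiSystem_pow_four hΨ hm hi)
    (integral_psiSystem_sq hΨ hm hi h2) (integral_psiSystem_mul hΨ hm hi h1)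
    ((integral_sum_psiSystem_sq_sub_le hΨ hm hi h2 n).trans (by
      gcongr
      exact hM.trans (le_max_left _ _)))
  exact ⟨wellDefined_of_isoLaw hX h, upperBounds_of_isoLaw hX h (le_max_right _ _)⟩

lemma abs_le_of_lipschitzWith_periodic {Ψ : ℝ → ℝ} (hΨ : Function.Periodic Ψ 1) {K : NNReal}
    (hK : LipschitzWith K Ψ) (x : ℝ) : |Ψ x| ≤ |Ψ 0| + K := by
  have h1 : Ψ x = Ψ (Int.fract x) := by
    rw [Int.fract]
    simpa using (hΨ.sub_zsmul_eq ⌊x⌋ (x := x)).symm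
  have h2 := hK.dist_le_mul (Int.fract x) 0
  rw [Real.dist_eq, Real.dist_eq, sub_zero, abs_of_nonneg (Int.fract_nonneg x), ← h1] at h2
  have h3 : (K : ℝ) * Int.fract x ≤ K :=
    mul_le_of_le_one_right K.2 (Int.fract_lt_one x).le
  have h4 := abs_sub_abs_le_abs_sub (Ψ x) (Ψ 0)
  linarith

/-- Frequencies reach n in t but s enters with frequency 1. The strip therefore has width r/n in t
and a fixed width r in s, and its sections have mass of order r²/n. -/
lemma isStripSystem_psiSystem {Ψ : ℝ → ℝ} (hΨ : Function.Periodic Ψ 1) {K : NNReal}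
    (hK : LipschitzWith K Ψ) (h1 : ∫ x in (0 : ℝ)..1, Ψ x = 0)
    (h2 : ∫ x in (0 : ℝ)..1, Ψ x ^ 2 = 1) {n : ℕ} (hn : 2 ≤ n) :
    IsStripSystem squareMeasure (psiSystem Ψ n) (|Ψ 0| + K) (∫ x in (0 : ℝ)..1, Ψ x ^ 4)
      ((1 / (6 * (K + 1))) ^ 2) := by
  have hm := hK.continuous.measurable
  have hi : IntervalIntegrable (fun x => Ψ x ^ 4) volume 0 1 :=
    (hK.continuous.pow 4).intervalIntegrable _ _
  have hn1 : (1 : ℝ) ≤ n := Nat.one_le_cast.2 (by omega)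
  have hK0 : (0 : ℝ) ≤ K := K.2
  refine ⟨measurable_psiSystem hm, fun w => ?_, integral_psiSystem_sq hΨ hm hi h2,
    integral_psiSystem_mul hΨ hm hi h1, integral_sum_psiSystem_sq_sub_le hΨ hm hi h2 n, ?_⟩
  · calc ∑ k, psiSystem Ψ n k w ^ 2 ≤ ∑ _k : Fin n, (|Ψ 0| + K) ^ 2 :=
        Finset.sum_le_sum fun k _ => by
          rw [← sq_abs (psiSystem Ψ n k w)]
          gcongr
          exact abs_le_of_lipschitzWith_periodic hΨ hK _
      _ = _ := by simp [mul_comm]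
  -- The arguments of Ψ differ by at most 2r on the strip, so the values differ by at most 2rK ≤
  -- 1/3, and (1/3)² ≤ 1/8.
  · set r : ℝ := 1 / (6 * (K + 1)) with hr
    have hr0 : 0 < r := by positivity
    have hKr : K * (2 * r) ≤ 1 / 3 := by
      rw [hr]; field_simp; linarith
    have hr1 : r ≤ 1 / 2 := by
      rw [hr, div_le_div_iff₀ (by positivity) (by norm_num)]; linarith
    have hrn0 : 0 ≤ r / n := by positivity
    have hrn : r / n ≤ 1 / 2 := (div_le_self hr0.le hn1).trans hr1
    have hpre : ∀ w : ℝ × ℝ, Prod.mk w ⁻¹' ({q : (ℝ × ℝ) × (ℝ × ℝ) | |q.1.1 - q.2.1| ≤ r / n} ∩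
        {q | |q.1.2 - q.2.2| ≤ r}) = {t' | |w.1 - t'| ≤ r / n} ×ˢ {s' | |w.2 - s'| ≤ r} := by
      intro w; ext w'; simp
    refine ⟨{q | |q.1.1 - q.2.1| ≤ r / n} ∩ {q | |q.1.2 - q.2.2| ≤ r}, r / n * r,
      (measurableSet_le (by fun_prop) (by fun_prop)).inter
        (measurableSet_le (by fun_prop) (by fun_prop)), ?_, ?_, ?_, ?_⟩
    · rw [Fintype.card_fin]; apply le_of_eq; ring
    · have hae : ∀ᵐ w ∂squareMeasure, w ∈ Ioo (0 : ℝ) 1 ×ˢ Ioo (0 : ℝ) 1 :=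
        ae_restrict_mem (measurableSet_Ioo.prod measurableSet_Ioo)
      filter_upwards [hae] with w hw
      rw [hpre, squareMeasure_eq, measureReal_prod_prod]
      have a1 := le_cond_Ioo_strip (zero_lt_one' ℝ) hrn0 (by linarith) hw.1
      have a2 := le_cond_Ioo_strip (zero_lt_one' ℝ) hr0.le (by linarith) hw.2
      rw [sub_zero, div_one] at a1 a2
      exact mul_le_mul a1 a2 hr0.le measureReal_nonneg
    · intro w
      rw [hpre, squareMeasure_eq, measureReal_prod_prod]
      have a1 := cond_Ioo_strip_le (zero_lt_one' ℝ) hrn0 w.1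
      have a2 := cond_Ioo_strip_le (zero_lt_one' ℝ) hr0.le w.2
      rw [sub_zero, div_one] at a1 a2
      refine (mul_le_mul a1 a2 measureReal_nonneg (by positivity)).trans (le_of_eq (by ring))
    · rintro w w' ⟨hw1, hw2⟩
      have hw1 : |w.1 - w'.1| ≤ r / n := hw1
      have hw2 : |w.2 - w'.2| ≤ r := hw2
      calc ∑ k, (psiSystem Ψ n k w - psiSystem Ψ n k w') ^ 2 ≤ ∑ _k : Fin n, (1 : ℝ) / 8 :=
            Finset.sum_le_sum fun k _ => by
              have a1 : |psiSystem Ψ n k w - psiSystem Ψ n k w'| ≤ 1 / 3 := by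
                have a2 := hK.dist_le_mul ((((k : ℕ) + 1 : ℕ) : ℝ) * w.1 + w.2)
                  ((((k : ℕ) + 1 : ℕ) : ℝ) * w'.1 + w'.2)
                rw [Real.dist_eq, Real.dist_eq] at a2
                have a3 : |(((k : ℕ) + 1 : ℕ) : ℝ) * w.1 + w.2 -
                    ((((k : ℕ) + 1 : ℕ) : ℝ) * w'.1 + w'.2)| ≤ 2 * r := by
                  have a4 : (((k : ℕ) + 1 : ℕ) : ℝ) * |w.1 - w'.1| ≤ r := by
                    calc _ ≤ (n : ℝ) * (r / n) := by gcongr; exact k.2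
                      _ = r := by field_simp
                  calc _ = |(((k : ℕ) + 1 : ℕ) : ℝ) * (w.1 - w'.1) + (w.2 - w'.2)| := by ring_nf
                    _ ≤ (((k : ℕ) + 1 : ℕ) : ℝ) * |w.1 - w'.1| + |w.2 - w'.2| := by
                      refine (abs_add_le _ _).trans ?_
                      rw [abs_mul, Nat.abs_cast]
                    _ ≤ _ := by linarith
                exact a2.trans ((mul_le_mul_of_nonneg_left a3 hK0).trans hKr)
              rw [← sq_abs]
              have := abs_nonneg (psiSystem Ψ n k w - psiSystem Ψ n k w')
              nlinarith
        _ = _ := by simp; ring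

theorem exists_twoSidedBounds_psiSystem {Ψ : ℝ → ℝ} (hΨ : Function.Periodic Ψ 1)
    (hK : ∃ K : NNReal, LipschitzWith K Ψ) (h1 : ∫ x in (0 : ℝ)..1, Ψ x = 0)
    (h2 : ∫ x in (0 : ℝ)..1, Ψ x ^ 2 = 1) : ∃ c₀ c₁ : ℝ, 0 < c₀ ∧ 0 < c₁ ∧
      ∀ n : ℕ, 2 ≤ n → TwoSidedBounds squareMeasure (psiSystem Ψ n) c₀ c₁ := by
  obtain ⟨K, hK⟩ := hK
  obtain ⟨c₀, c₁, h0, h0', h⟩ := exists_twoSidedBounds_of_isStripSystem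
    (B := |Ψ 0| + K) (C := ∫ x in (0 : ℝ)..1, Ψ x ^ 4) (c := (1 / (6 * (K + 1))) ^ 2)
    (by positivity) (intervalIntegral.integral_nonneg zero_le_one fun x _ => by positivity)
    (by have : (0 : ℝ) ≤ K := K.2
        positivity)
  exact ⟨c₀, c₁, h0, h0', fun n hn => h (Fin.nontrivial_iff_two_le.2 hn)
    isProbabilityMeasure_squareMeasure (isStripSystem_psiSystem hΨ hK h1 h2 hn)⟩

/-- The systems share the parameters B = 2, C = 1, c = 1/100, except the Chebyshev one, which
inherits the bounds of the cosines; hence common constants. -/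
theorem exists_twoSidedBounds_systems : ∃ c₀ c₁ : ℝ, 0 < c₀ ∧ 0 < c₁ ∧
    (∀ n : ℕ, 2 ≤ n → Even n → TwoSidedBounds trigMeasure (trigSystem n) c₀ c₁) ∧
    (∀ n : ℕ, 2 ≤ n → TwoSidedBounds cosMeasure (cosSystem n) c₀ c₁) ∧
    (∀ n : ℕ, 2 ≤ n → TwoSidedBounds chebMeasure (chebSystem n) c₀ c₁) ∧
    (∀ d : ℕ, 2 ≤ d → TwoSidedBounds (cubeMeasure d) (walshSystem d) c₀ c₁) ∧
    (∀ n : ℕ, 2 ≤ n → TwoSidedBounds (indexMeasure n) (empiricalSystem n) c₀ c₁) := by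
  obtain ⟨c₀, c₁, h0, h1, h⟩ := exists_twoSidedBounds_of_isStripSystem (B := 2) (C := 1)
    (c := 1 / 100) (by norm_num) (by norm_num) (by norm_num)
  have hcos : ∀ n : ℕ, 2 ≤ n → TwoSidedBounds cosMeasure (cosSystem n) c₀ c₁ := fun n hn =>
    h (Fin.nontrivial_iff_two_le.2 hn) isProbabilityMeasure_cosMeasure
      (isStripSystem_cosSystem (by omega))
  refine ⟨c₀, c₁, h0, h1, fun n hn hn2 => ?_, hcos, fun n hn => ?_, fun d hd => ?_, fun n hn => ?_⟩
  · exact h (Fin.nontrivial_iff_two_le.2 hn) isProbabilityMeasure_trigMeasure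
      (isStripSystem_trigSystem (by omega) hn2)
  · exact distFun_congr_bounds (distFun_chebSystem n) (hcos n hn)
  · refine h ?_ (isProbabilityMeasure_cubeMeasure d) (isStripSystem_walshSystem hd)
    rw [← Fintype.one_lt_card_iff_nontrivial, card_nonempty_finset]
    have h1 : 2 ^ 2 ≤ 2 ^ d := Nat.pow_le_pow_right (by norm_num) hd
    omega
  · exact h (Fin.nontrivial_iff_two_le.2 hn) (isProbabilityMeasure_indexMeasure (by omega))
      (isStripSystem_empiricalSystem (by omega))


/-! ### The mean distance to a normal variable -/

/-- By the symmetry of Z one may average |a - z| and |a + z|, and this average is max(|a|,|z|). -/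
lemma integral_abs_sub_gaussian_eq_max (a : ℝ) :
    ∫ z, |a - z| ∂(gaussianReal 0 1) = ∫ z, max |a| |z| ∂(gaussianReal 0 1) := by
  have h1 : Integrable (fun z => |a - z|) (gaussianReal 0 1) :=
    ((integrable_const a).sub (integrable_id_gaussianReal 0 1)).abs
  have h2 : Integrable (fun z => |a + z|) (gaussianReal 0 1) :=
    ((integrable_const a).add (integrable_id_gaussianReal 0 1)).abs
  have h3 : ∫ z, |a + z| ∂(gaussianReal 0 1) = ∫ z, |a - z| ∂(gaussianReal 0 1) := by
    have h := gaussianReal_map_neg (μ := 0) (v := 1)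
    rw [neg_zero] at h
    nth_rw 2 [← h]
    rw [integral_map (by fun_prop) (Continuous.aestronglyMeasurable (by fun_prop))]
    simp
  have h4 : ∀ z, max |a| |z| = (|a - z| + |a + z|) / 2 := by
    intro z
    rcases le_total |a| |z| with h | h
    · rw [max_eq_right h]
      rcases abs_cases a with h5 | h5 <;> rcases abs_cases z with h6 | h6 <;>
        rcases abs_cases (a - z) with h7 | h7 <;> rcases abs_cases (a + z) with h8 | h8 <;> linarith
    · rw [max_eq_left h]
      rcases abs_cases a with h5 | h5 <;> rcases abs_cases z with h6 | h6 <;>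
        rcases abs_cases (a - z) with h7 | h7 <;> rcases abs_cases (a + z) with h8 | h8 <;> linarith
  simp_rw [h4]
  rw [integral_div, integral_add h1 h2, h3]
  ring

lemma integral_Ioi_mul_exp_neg_sq_half (b : ℝ) :
    IntegrableOn (fun z => z * Real.exp (-z ^ 2 / 2)) (Ioi b) ∧
    ∫ z in Ioi b, z * Real.exp (-z ^ 2 / 2) = Real.exp (-b ^ 2 / 2) := by
  have e : ∀ z : ℝ, -z ^ 2 / 2 = -(1 / 2) * z ^ 2 := fun z => by ring
  have h1 : Integrable (fun z => z * Real.exp (-z ^ 2 / 2)) := by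
    simp_rw [e]; exact integrable_mul_exp_neg_mul_sq (by norm_num)
  refine ⟨h1.integrableOn, ?_⟩
  have h2 : ∀ z ∈ Ici b, HasDerivAt (fun z => -Real.exp (-z ^ 2 / 2))
      (z * Real.exp (-z ^ 2 / 2)) z := by
    intro z _
    have h3 : HasDerivAt (fun z : ℝ => -z ^ 2 / 2) (-z) z :=
      (((hasDerivAt_pow 2 z).neg).div_const 2).congr_deriv (by push_cast; ring)
    exact h3.exp.neg.congr_deriv (by ring)
  have h3 : Filter.Tendsto (fun z : ℝ => -Real.exp (-z ^ 2 / 2)) Filter.atTop (nhds 0) := by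
    rw [← neg_zero]
    refine (Real.tendsto_exp_atBot.comp ?_).neg
    have h4 := (Filter.tendsto_pow_atTop (α := ℝ) two_ne_zero).const_mul_atTop_of_neg
      (r := -(1 / 2)) (by norm_num)
    simpa only [← e] using h4
  rw [integral_Ioi_of_hasDerivAt_of_tendsto' h2 h1.integrableOn h3]
  ring

lemma integral_Ioi_max_mul_exp {b : ℝ} (hb : 0 ≤ b) :
    ∫ z in Ioi (0 : ℝ), max b z * Real.exp (-z ^ 2 / 2) =
      b ^ 2 * (∫ s in (0 : ℝ)..1, Real.exp (-(s ^ 2 * b ^ 2) / 2)) + Real.exp (-b ^ 2 / 2) := by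
  obtain ⟨i1, h1⟩ := integral_Ioi_mul_exp_neg_sq_half b
  have e1 : ∀ z ∈ Ioc 0 b, max b z * Real.exp (-z ^ 2 / 2) = b * Real.exp (-z ^ 2 / 2) :=
    fun z hz => by rw [max_eq_left hz.2]
  have e2 : ∀ z ∈ Ioi b, max b z * Real.exp (-z ^ 2 / 2) = z * Real.exp (-z ^ 2 / 2) :=
    fun z hz => by rw [max_eq_right (mem_Ioi.1 hz).le]
  have hc : Continuous fun z : ℝ => b * Real.exp (-z ^ 2 / 2) := by fun_prop
  rw [← Ioc_union_Ioi_eq_Ioi hb, setIntegral_union (Ioc_disjoint_Ioi le_rfl) measurableSet_Ioi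
    ((hc.integrableOn_Ioc).congr_fun (fun z hz => (e1 z hz).symm) measurableSet_Ioc)
    (i1.congr_fun (fun z hz => (e2 z hz).symm) measurableSet_Ioi),
    setIntegral_congr_fun measurableSet_Ioc e1, setIntegral_congr_fun measurableSet_Ioi e2, h1,
    ← intervalIntegral.integral_of_le hb, intervalIntegral.integral_const_mul]
  have h2 := intervalIntegral.smul_integral_comp_mul_left (a := 0) (b := 1)
    (fun z => Real.exp (-z ^ 2 / 2)) b
  rw [mul_zero, mul_one, smul_eq_mul] at h2
  rw [← h2]
  have e3 : ∀ s : ℝ, -(s ^ 2 * b ^ 2) / 2 = -(b * s) ^ 2 / 2 := fun s => by ring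
  simp_rw [e3]
  ring

lemma one_sub_exp_div_sq_mem {s : ℝ} (b : ℝ) :
    (1 - Real.exp (-(s ^ 2 * b ^ 2) / 2)) / s ^ 2 ∈ Icc 0 (b ^ 2 / 2) := by
  have h1 : Real.exp (-(s ^ 2 * b ^ 2) / 2) ≤ 1 := Real.exp_le_one_iff.2 (by
    have : 0 ≤ s ^ 2 * b ^ 2 := by positivity
    linarith)
  have h2 := Real.add_one_le_exp (-(s ^ 2 * b ^ 2) / 2)
  refine ⟨div_nonneg (by linarith) (sq_nonneg s), ?_⟩
  refine div_le_of_le_mul₀ (sq_nonneg s) (by positivity) ?_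
  linarith

lemma intervalIntegrable_one_sub_exp_div_sq (b : ℝ) :
    IntervalIntegrable (fun s => (1 - Real.exp (-(s ^ 2 * b ^ 2) / 2)) / s ^ 2) volume 0 1 := by
  rw [intervalIntegrable_iff]
  refine Measure.integrableOn_of_bounded (M := b ^ 2 / 2) (by simp) (Measurable.aestronglyMeasurable
    (by fun_prop)) (Filter.Eventually.of_forall fun s => ?_)
  have := one_sub_exp_div_sq_mem (s := s) b
  rw [Real.norm_of_nonneg this.1]
  exact this.2

/-- Integration by parts against the primitive -1/s of 1/s². -/
lemma integral_one_sub_exp_div_sq (b : ℝ) :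
    ∫ s in (0 : ℝ)..1, (1 - Real.exp (-(s ^ 2 * b ^ 2) / 2)) / s ^ 2 =
      b ^ 2 * (∫ s in (0 : ℝ)..1, Real.exp (-(s ^ 2 * b ^ 2) / 2)) + Real.exp (-b ^ 2 / 2) - 1 := by
  set G : ℝ → ℝ := fun s => -((1 - Real.exp (-(s ^ 2 * b ^ 2) / 2)) / s) with hG
  have hd : ∀ s ∈ Ioo (0 : ℝ) 1, HasDerivAt G ((1 - Real.exp (-(s ^ 2 * b ^ 2) / 2)) / s ^ 2 -
      b ^ 2 * Real.exp (-(s ^ 2 * b ^ 2) / 2)) s := by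
    intro s hs
    have hs0 : s ≠ 0 := hs.1.ne'
    have h1 : HasDerivAt (fun s : ℝ => -(s ^ 2 * b ^ 2) / 2) (-(s * b ^ 2)) s :=
      (((hasDerivAt_pow 2 s).mul_const (b ^ 2)).neg.div_const 2).congr_deriv (by push_cast; ring)
    exact (((h1.exp.const_sub 1).div (hasDerivAt_id s) hs0).neg).congr_deriv (by
      simp only [id]; field_simp; ring)
  have hc : ContinuousOn G (Icc 0 1) := by
    intro s hs
    rcases hs.1.eq_or_lt with rfl | h0
    · have hG0 : G 0 = 0 := by simp [hG]
      rw [ContinuousWithinAt, hG0]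
      refine squeeze_zero_norm (a := fun s => |s| * (b ^ 2 / 2)) (fun s => ?_) ?_
      · rcases eq_or_ne s 0 with rfl | hs0
        · simp [hG]
        have h2 := one_sub_exp_div_sq_mem (s := s) b
        have e : G s = -(s * ((1 - Real.exp (-(s ^ 2 * b ^ 2) / 2)) / s ^ 2)) := by
          simp only [hG]; field_simp
        rw [e, norm_neg, norm_mul, Real.norm_eq_abs, Real.norm_of_nonneg h2.1]
        exact mul_le_mul_of_nonneg_left h2.2 (abs_nonneg s)
      · have : Continuous fun s : ℝ => |s| * (b ^ 2 / 2) := by fun_prop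
        have h3 := this.tendsto 0
        simp only [abs_zero, zero_mul] at h3
        exact h3.mono_left nhdsWithin_le_nhds
    · refine ContinuousAt.continuousWithinAt ?_
      have : s ≠ 0 := h0.ne'
      exact ((by fun_prop : ContinuousAt (fun s => 1 - Real.exp (-(s ^ 2 * b ^ 2) / 2)) s).div
        continuousAt_id this).neg
  have i1 := intervalIntegrable_one_sub_exp_div_sq b
  have i2 : IntervalIntegrable (fun s : ℝ => b ^ 2 * Real.exp (-(s ^ 2 * b ^ 2) / 2)) volume 0 1 :=
    (by fun_prop : Continuous _).intervalIntegrable _ _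
  have h := intervalIntegral.integral_eq_sub_of_hasDerivAt_of_le zero_le_one hc hd (i1.sub i2)
  rw [intervalIntegral.integral_sub i1 i2, intervalIntegral.integral_const_mul] at h
  have e1 : G 1 - G 0 = Real.exp (-b ^ 2 / 2) - 1 := by simp [hG]
  linarith

/-- In this form a enters only through e^(-s²a²/2), so for random a the Laplace transform of a² is
all that is needed. -/
theorem integral_abs_sub_gaussian (a : ℝ) :
    ∫ z, |a - z| ∂(gaussianReal 0 1) = Real.sqrt (2 / Real.pi) *
      (1 + ∫ s in (0 : ℝ)..1, (1 - Real.exp (-(s ^ 2 * a ^ 2) / 2)) / s ^ 2) := by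
  rw [integral_abs_sub_gaussian_eq_max, integral_gaussianReal_eq_integral_smul one_ne_zero]
  have e : ∀ z : ℝ, gaussianPDFReal 0 1 z • max |a| |z| = (fun y => (Real.sqrt (2 * Real.pi))⁻¹ *
      (max |a| y * Real.exp (-y ^ 2 / 2))) |z| := by
    intro z
    beta_reduce
    rw [gaussianPDFReal_std, smul_eq_mul, sq_abs]
    ring
  simp_rw [e]
  rw [integral_comp_abs (f := fun y => (Real.sqrt (2 * Real.pi))⁻¹ *
      (max |a| y * Real.exp (-y ^ 2 / 2))), integral_const_mul,
    integral_Ioi_max_mul_exp (abs_nonneg a), integral_one_sub_exp_div_sq, sq_abs]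
  have h2 : Real.sqrt 2 * Real.sqrt 2 = 2 := Real.mul_self_sqrt (by norm_num)
  have hp : Real.sqrt Real.pi ≠ 0 := (Real.sqrt_pos.2 Real.pi_pos).ne'
  set I : ℝ := ∫ s in (0 : ℝ)..1, Real.exp (-(s ^ 2 * a ^ 2) / 2)
  rw [Real.sqrt_mul (by norm_num), Real.sqrt_div (by norm_num)]
  field_simp
  linear_combination -(a ^ 2 * I + Real.exp (-(a ^ 2 / 2))) * h2

/-! ### Gaussian moments -/

lemma integral_mul_exp_sq_gaussian {a : ℝ} (ha : 0 ≤ a) (f : ℝ → ℝ) :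
    ∫ x, f x * Real.exp (-a * x ^ 2 / 2) ∂(gaussianReal 0 1) =
      (Real.sqrt (1 + a))⁻¹ * ∫ x, f ((Real.sqrt (1 + a))⁻¹ * x) ∂(gaussianReal 0 1) := by
  have hs : 0 < Real.sqrt (1 + a) := Real.sqrt_pos.2 (by linarith)
  have h1 := integral_gaussianReal_comp_affine f 0 (inv_pos.2 hs)
  have h2 := integral_gaussianReal_comp_affine (fun x => f x * Real.exp (-a * x ^ 2 / 2)) 0 one_pos
  simp only [zero_add, sub_zero, one_mul, one_pow, mul_one] at h1 h2
  rw [h1, h2, mul_inv, inv_inv, ← mul_assoc, inv_mul_cancel_left₀ hs.ne']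
  congr 1
  refine integral_congr_ae (Filter.Eventually.of_forall fun x => ?_)
  beta_reduce
  rw [mul_assoc, ← Real.exp_add, inv_pow, Real.sq_sqrt (by linarith)]
  congr 2
  field_simp
  ring

lemma stdGaussian_real : stdGaussian ℝ = gaussianReal 0 1 := by
  have h := stdGaussian_map_inner (1 : ℝ)
  simp only [RCLike.inner_apply, conj_trivial, mul_one, nnnorm_one, one_pow] at h
  rwa [Measure.map_id'] at h

lemma gaussian_moments : ∫ x, x ^ 4 ∂(gaussianReal 0 1) = 3 ∧
    ∫ x, x ^ 8 ∂(gaussianReal 0 1) = 105 := by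
  have s := integral_norm_pow_succ_stdGaussian (E := ℝ)
  have s0 := s 0
  have s1 := s 1
  have s2 := s 2
  have s3 := s 3
  rw [stdGaussian_real] at s0 s1 s2 s3
  simp only [pow_mul, Real.norm_eq_abs, sq_abs] at s0 s1 s2 s3
  simp only [← pow_mul] at s0 s1 s2 s3
  norm_num at s0 s1 s2 s3
  rw [s3, s2, s1, s0]
  norm_num

lemma integrable_pow_gaussian (k : ℕ) : Integrable (fun x : ℝ => x ^ k) (gaussianReal 0 1) := by
  rw [← stdGaussian_real]
  refine (integrable_norm_pow_stdGaussian (E := ℝ) k).mono' (by fun_prop)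
    (Filter.Eventually.of_forall fun x => ?_)
  rw [norm_pow]

lemma integral_pow_four_mul_exp_gaussian {a : ℝ} (ha : 0 ≤ a) :
    ∫ x, x ^ 4 * Real.exp (-a * x ^ 2 / 2) ∂(gaussianReal 0 1) =
      3 * (Real.sqrt (1 + a))⁻¹ ^ 5 := by
  rw [integral_mul_exp_sq_gaussian ha (fun x => x ^ 4)]
  simp_rw [mul_pow]
  rw [integral_const_mul, gaussian_moments.1]
  ring

/-! ### Taylor expansions -/

lemma abs_exp_sub_cubic_le (x : ℝ) :
    |Real.exp x - (1 + x + x ^ 2 / 2 + x ^ 3 / 6)| ≤ 4 * x ^ 4 * max 1 (Real.exp x) := by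
  have h := Complex.norm_exp_sub_sum_le_norm_mul_exp (x : ℂ) 4
  have e : Complex.exp x - ∑ m ∈ Finset.range 4, (x : ℂ) ^ m / (Nat.factorial m : ℂ) =
      ((Real.exp x - (1 + x + x ^ 2 / 2 + x ^ 3 / 6) : ℝ) : ℂ) := by
    simp [Finset.sum_range_succ, Nat.factorial]
  rw [e, Complex.norm_real, Complex.norm_real, Real.norm_eq_abs, Real.norm_eq_abs,
    (by norm_num : Even 4).pow_abs] at h
  have hx : 0 ≤ x ^ 4 := by positivity
  rcases le_total 0 x with h0 | h0
  · rw [abs_of_nonneg h0] at h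
    refine h.trans ?_
    have := le_max_right 1 (Real.exp x)
    have := Real.exp_pos x
    nlinarith
  · rw [max_eq_left (Real.exp_le_one_iff.2 h0), mul_one]
    rcases le_total (-1) x with h1 | h1
    · refine h.trans ?_
      have h2 : Real.exp |x| ≤ 4 := by
        have : Real.exp |x| ≤ Real.exp 1 := Real.exp_le_exp.2 (abs_le.2 ⟨h1, by linarith⟩)
        linarith [Real.exp_one_lt_d9]
      nlinarith
    · have h2 := Real.exp_pos x
      have h3 := Real.exp_le_one_iff.2 h0
      have h4 : 1 ≤ x ^ 2 := by nlinarith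
      have h5 : x ^ 2 ≤ x ^ 4 := by nlinarith
      have h6 : -x ^ 3 ≤ x ^ 4 := by nlinarith
      have h7 : x ^ 3 ≤ 0 := by nlinarith
      rw [abs_le]
      constructor <;> nlinarith

/-- Since e^(-w) max(1, e^(-(u-w))) = max(e^(-w), e^(-u)) ≤ 1, the remainder is a pure fourth power
with no exponential growth. -/
lemma abs_exp_neg_expansion_le {w u : ℝ} (hw : 0 ≤ w) (hu : 0 ≤ u) :
    |Real.exp (-u) - Real.exp (-w) * (1 - (u - w) + (u - w) ^ 2 / 2 - (u - w) ^ 3 / 6)| ≤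
      4 * (u - w) ^ 4 := by
  have h := abs_exp_sub_cubic_le (-(u - w))
  have e : Real.exp (-u) - Real.exp (-w) * (1 - (u - w) + (u - w) ^ 2 / 2 - (u - w) ^ 3 / 6) =
      Real.exp (-w) * (Real.exp (-(u - w)) -
        (1 + -(u - w) + (-(u - w)) ^ 2 / 2 + (-(u - w)) ^ 3 / 6)) := by
    have h0 : Real.exp (-u) = Real.exp (-w) * Real.exp (-(u - w)) := by
      rw [← Real.exp_add]; ring_nf
    rw [h0]; ring
  rw [e, abs_mul, abs_of_pos (Real.exp_pos _)]
  have h2 : Real.exp (-w) * max 1 (Real.exp (-(u - w))) ≤ 1 := by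
    rw [mul_max_of_nonneg _ _ (Real.exp_pos _).le, mul_one, ← Real.exp_add]
    refine max_le (Real.exp_le_one_iff.2 (by linarith)) (Real.exp_le_one_iff.2 (by linarith))
  calc _ ≤ Real.exp (-w) * (4 * (-(u - w)) ^ 4 * max 1 (Real.exp (-(u - w)))) := by gcongr
    _ = 4 * (u - w) ^ 4 * (Real.exp (-w) * max 1 (Real.exp (-(u - w)))) := by ring
    _ ≤ _ := mul_le_of_le_one_right (by positivity) h2

lemma abs_sq_mul_exp_neg_expansion_le {w u : ℝ} (hw : 0 ≤ w) (hu : 0 ≤ u) :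
    |u ^ 2 * Real.exp (-u) - (w ^ 2 * Real.exp (-w) +
      (2 * w - w ^ 2) * Real.exp (-w) * (u - w))| ≤ 2 * (1 + w ^ 2) * (u - w) ^ 2 := by
  obtain ⟨d, rfl⟩ : ∃ d, u = w + d := ⟨u - w, by ring⟩
  have e : (w + d) ^ 2 * Real.exp (-(w + d)) - (w ^ 2 * Real.exp (-w) +
      (2 * w - w ^ 2) * Real.exp (-w) * (w + d - w)) = Real.exp (-w) *
      (w ^ 2 * (Real.exp (-d) - 1 + d) + 2 * w * d * (Real.exp (-d) - 1) +
        d ^ 2 * Real.exp (-d)) := by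
    rw [neg_add, Real.exp_add]; ring
  set m := max 1 (Real.exp (-d)) with hm
  have hm1 : 1 ≤ m := le_max_left _ _
  have hm2 : Real.exp (-d) ≤ m := le_max_right _ _
  have h1 := exp_neg_sub_le d
  have h2 : 0 ≤ Real.exp (-d) - 1 + d := by linarith [Real.add_one_le_exp (-d)]
  have h3 : |Real.exp (-d) - 1| ≤ |d| * m := by
    rcases le_total 0 d with h0 | h0
    · rw [abs_of_nonneg h0, abs_of_nonpos (by linarith [Real.exp_le_one_iff.2 (neg_nonpos.2 h0)])]
      nlinarith
    · rw [abs_of_nonpos h0, abs_of_nonneg (by linarith [Real.one_le_exp (neg_nonneg.2 h0)])]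
      have h4 := Real.add_one_le_exp d
      have h5 : Real.exp (-d) * Real.exp d = 1 := by rw [← Real.exp_add]; simp
      have h6 := Real.exp_pos (-d)
      nlinarith
  have h4 : |2 * w * d * (Real.exp (-d) - 1)| ≤ 2 * w * (d ^ 2 * m) := by
    rw [abs_mul, abs_mul, abs_of_nonneg (by positivity : 0 ≤ 2 * w)]
    calc 2 * w * |d| * |Real.exp (-d) - 1| ≤ 2 * w * |d| * (|d| * m) := by gcongr
      _ = 2 * w * (|d| ^ 2 * m) := by ring
      _ = _ := by rw [sq_abs]
  have h5 : Real.exp (-w) * m ≤ 1 := by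
    rw [hm, mul_max_of_nonneg _ _ (Real.exp_pos _).le, mul_one, ← Real.exp_add]
    refine max_le (Real.exp_le_one_iff.2 (by linarith)) (Real.exp_le_one_iff.2 (by linarith))
  rw [e, abs_mul, abs_of_pos (Real.exp_pos _), add_sub_cancel_left]
  have h6 : |w ^ 2 * (Real.exp (-d) - 1 + d) + 2 * w * d * (Real.exp (-d) - 1) +
      d ^ 2 * Real.exp (-d)| ≤ (1 + w) ^ 2 * d ^ 2 * m := by
    refine (abs_add_le _ _).trans ((add_le_add_left (abs_add_le _ _) _).trans ?_)
    rw [abs_of_nonneg (mul_nonneg (sq_nonneg w) h2), abs_of_nonneg (by positivity :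
      0 ≤ d ^ 2 * Real.exp (-d))]
    have h7 : w ^ 2 * (Real.exp (-d) - 1 + d) ≤ w ^ 2 * (d ^ 2 * m) := by gcongr
    have h8 : d ^ 2 * Real.exp (-d) ≤ d ^ 2 * m := by gcongr
    nlinarith
  calc _ ≤ Real.exp (-w) * ((1 + w) ^ 2 * d ^ 2 * m) := by gcongr
    _ = (1 + w) ^ 2 * d ^ 2 * (Real.exp (-w) * m) := by ring
    _ ≤ (1 + w) ^ 2 * d ^ 2 := mul_le_of_le_one_right (by positivity) h5
    _ ≤ _ := by gcongr; nlinarith [sq_nonneg (1 - w)]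

/-- With t = √(1+y) the remainder factors as -(t-1)⁴(t²+4t+5)/16, against y⁴ = (t-1)⁴(t+1)⁴; thus it
holds down to y = -1. -/
lemma abs_sqrt_one_add_expansion_le {y : ℝ} (hy : -1 ≤ y) :
    |Real.sqrt (1 + y) - (1 + y / 2 - y ^ 2 / 8 + y ^ 3 / 16)| ≤ y ^ 4 := by
  set t := Real.sqrt (1 + y) with ht
  have h0 : 0 ≤ t := Real.sqrt_nonneg _
  have h1 : y = t ^ 2 - 1 := by rw [ht, Real.sq_sqrt (by linarith)]; ring
  rw [h1]
  have e : t - (1 + (t ^ 2 - 1) / 2 - (t ^ 2 - 1) ^ 2 / 8 + (t ^ 2 - 1) ^ 3 / 16) =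
      -((t - 1) ^ 4 * ((t ^ 2 + 4 * t + 5) / 16)) := by ring
  rw [e, abs_neg, abs_of_nonneg (by positivity), show (t ^ 2 - 1) ^ 4 = (t - 1) ^ 4 * (t + 1) ^ 4
    by ring]
  gcongr
  nlinarith [mul_nonneg h0 h0, pow_nonneg h0 3, pow_nonneg h0 4]


/-! ### Expansions of spherical means in the radial deviation. -/

section SphereExpansion

variable {ι : Type*} [Fintype ι] [Nonempty ι]

lemma continuous_sphere_coord (i : ι) :
    Continuous fun θ : Metric.sphere (0 : EuclideanSpace ℝ ι) 1 => θ.1 i :=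
  (EuclideanSpace.proj (𝕜 := ℝ) i).continuous.comp continuous_subtype_val

lemma integrable_of_continuous_sphere {u : Metric.sphere (0 : EuclideanSpace ℝ ι) 1 → ℝ}
    (hu : Continuous u) : Integrable u (sphereMeasure ι) :=
  hu.integrable_of_hasCompactSupport (HasCompactSupport.of_compactSpace u)

lemma integrable_polar_coord_iff (i : ι) {f : ℝ → ℝ} (hf : Measurable f) :
    Integrable (fun p : Metric.sphere (0 : EuclideanSpace ℝ ι) 1 × ℝ => f (p.2 * p.1.1 i))
      ((sphereMeasure ι).prod (radialLaw ι)) ↔ Integrable f (gaussianReal 0 1) := by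
  classical
  have h1 := integrable_stdGaussian_polar ι (fun g => f (inner ℝ (EuclideanSpace.single i 1) g))
    (hf.comp (by fun_prop))
  have h2 := integrable_inner_stdGaussian_iff (EuclideanSpace.single i (1 : ℝ)) f hf
  simp only [nnnorm_one, one_pow, PiLp.nnnorm_single] at h2
  rw [← h2, ← h1]
  simp [EuclideanSpace.inner_single_left]

/-- The product of the radius and a coordinate of θ is a coordinate of a standard Gaussian vector,
hence standard normal. -/
lemma integral_polar_coord (i : ι) {f : ℝ → ℝ} (hf : Measurable f) :
    ∫ p : Metric.sphere (0 : EuclideanSpace ℝ ι) 1 × ℝ, f (p.2 * p.1.1 i)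
      ∂((sphereMeasure ι).prod (radialLaw ι)) = ∫ x, f x ∂(gaussianReal 0 1) := by
  classical
  have h1 := integral_stdGaussian_polar ι (fun g => f (inner ℝ (EuclideanSpace.single i 1) g))
    (hf.comp (by fun_prop))
  have h2 := integral_inner_stdGaussian (EuclideanSpace.single i (1 : ℝ)) f hf
  simp only [norm_one, one_mul, PiLp.norm_single] at h2
  rw [← h2, ← h1]
  simp [EuclideanSpace.inner_single_left]

lemma integrable_sphere_mul_radDev_pow {u : Metric.sphere (0 : EuclideanSpace ℝ ι) 1 → ℝ}
    (hu : Continuous u) (k : ℕ) :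
    Integrable (fun p : Metric.sphere (0 : EuclideanSpace ℝ ι) 1 × ℝ => u p.1 * radDev ι p.2 ^ k)
      ((sphereMeasure ι).prod (radialLaw ι)) :=
  (integrable_of_continuous_sphere hu).mul_prod (integrable_radDev_pow ι k)

lemma integral_sphere_mul_radDev_pow (u : Metric.sphere (0 : EuclideanSpace ℝ ι) 1 → ℝ) (k : ℕ) :
    ∫ p : Metric.sphere (0 : EuclideanSpace ℝ ι) 1 × ℝ, u p.1 * radDev ι p.2 ^ k
      ∂((sphereMeasure ι).prod (radialLaw ι)) =
      (∫ θ, u θ ∂(sphereMeasure ι)) * ∫ r, radDev ι r ^ k ∂(radialLaw ι) :=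
  integral_prod_mul u fun r => radDev ι r ^ k

/-- Averages of functions that are close to a cubic polynomial in the radial deviation. -/
lemma abs_integral_sub_cubic_le {u₀ u₁ u₂ u₃ v : Metric.sphere (0 : EuclideanSpace ℝ ι) 1 → ℝ}
    (h0 : Continuous u₀) (h1 : Continuous u₁) (h2 : Continuous u₂) (h3 : Continuous u₃)
    (hv : Continuous v) {F : Metric.sphere (0 : EuclideanSpace ℝ ι) 1 × ℝ → ℝ}
    (hF : Integrable F ((sphereMeasure ι).prod (radialLaw ι))) (k : ℕ)
    (h : ∀ p, |F p - (u₀ p.1 + u₁ p.1 * radDev ι p.2 + u₂ p.1 * radDev ι p.2 ^ 2 +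
      u₃ p.1 * radDev ι p.2 ^ 3)| ≤ v p.1 * radDev ι p.2 ^ k) :
    |∫ p, F p ∂((sphereMeasure ι).prod (radialLaw ι)) - (∫ θ, u₀ θ ∂(sphereMeasure ι) +
      (∫ θ, u₂ θ ∂(sphereMeasure ι)) * (2 / Fintype.card ι) +
      (∫ θ, u₃ θ ∂(sphereMeasure ι)) * (8 / (Fintype.card ι : ℝ) ^ 2))| ≤
      (∫ θ, v θ ∂(sphereMeasure ι)) * ∫ r, radDev ι r ^ k ∂(radialLaw ι) := by
  have i0 := integrable_sphere_mul_radDev_pow h0 0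
  have i1 := integrable_sphere_mul_radDev_pow h1 1
  have i2 := integrable_sphere_mul_radDev_pow h2 2
  have i3 := integrable_sphere_mul_radDev_pow h3 3
  have e0 := integral_sphere_mul_radDev_pow (ι := ι) u₀ 0
  have e1 := integral_sphere_mul_radDev_pow (ι := ι) u₁ 1
  have e2 := integral_sphere_mul_radDev_pow (ι := ι) u₂ 2
  have e3 := integral_sphere_mul_radDev_pow (ι := ι) u₃ 3
  simp only [pow_zero, mul_one, pow_one, integral_radDev, mul_zero, integral_const,
    probReal_univ, smul_eq_mul] at i0 i1 e0 e1
  rw [integral_radDev_sq] at e2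
  rw [integral_radDev_cube] at e3
  have i01 : Integrable (fun p : Metric.sphere (0 : EuclideanSpace ℝ ι) 1 × ℝ =>
      u₀ p.1 + u₁ p.1 * radDev ι p.2) ((sphereMeasure ι).prod (radialLaw ι)) := i0.add i1
  have i012 : Integrable (fun p : Metric.sphere (0 : EuclideanSpace ℝ ι) 1 × ℝ =>
      u₀ p.1 + u₁ p.1 * radDev ι p.2 + u₂ p.1 * radDev ι p.2 ^ 2)
      ((sphereMeasure ι).prod (radialLaw ι)) := i01.add i2
  have i0123 : Integrable (fun p : Metric.sphere (0 : EuclideanSpace ℝ ι) 1 × ℝ =>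
      u₀ p.1 + u₁ p.1 * radDev ι p.2 + u₂ p.1 * radDev ι p.2 ^ 2 + u₃ p.1 * radDev ι p.2 ^ 3)
      ((sphereMeasure ι).prod (radialLaw ι)) := i012.add i3
  have e : ∫ p : Metric.sphere (0 : EuclideanSpace ℝ ι) 1 × ℝ,
      (u₀ p.1 + u₁ p.1 * radDev ι p.2 + u₂ p.1 * radDev ι p.2 ^ 2 + u₃ p.1 * radDev ι p.2 ^ 3)
      ∂((sphereMeasure ι).prod (radialLaw ι)) = ∫ θ, u₀ θ ∂(sphereMeasure ι) +
      (∫ θ, u₂ θ ∂(sphereMeasure ι)) * (2 / Fintype.card ι) +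
      (∫ θ, u₃ θ ∂(sphereMeasure ι)) * (8 / (Fintype.card ι : ℝ) ^ 2) := by
    rw [integral_add i012 i3, integral_add i01 i2, integral_add i0 i1, e0, e1, e2, e3, add_zero]
  rw [← e, ← integral_sub hF i0123, ← integral_sphere_mul_radDev_pow, ← Real.norm_eq_abs]
  exact norm_integral_le_of_norm_le (integrable_sphere_mul_radDev_pow hv k)
    (Filter.Eventually.of_forall h)

/-- The normalized square of a coordinate on the sphere. -/
noncomputable def coordSq (i : ι) (θ : Metric.sphere (0 : EuclideanSpace ℝ ι) 1) : ℝ :=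
  Fintype.card ι * θ.1 i ^ 2

lemma continuous_coordSq (i : ι) : Continuous (coordSq i) := by
  have := continuous_sphere_coord i
  unfold coordSq
  fun_prop

lemma coordSq_nonneg (i : ι) (θ : Metric.sphere (0 : EuclideanSpace ℝ ι) 1) : 0 ≤ coordSq i θ := by
  unfold coordSq; positivity

lemma sq_mul_coord (i : ι) (θ : Metric.sphere (0 : EuclideanSpace ℝ ι) 1) (r : ℝ) :
    (r * θ.1 i) ^ 2 = coordSq i θ * (1 + radDev ι r) := by
  have hn : (Fintype.card ι : ℝ) ≠ 0 := by simp
  unfold coordSq radDev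
  field_simp
  ring

/-- Bernoulli's inequality (1+ε)^k ≥ 1 + kε for the radial deviation ε, which is centered and
independent of θ: multiplying by the radius can only increase even moments. -/
lemma integral_coordSq_pow_le (i : ι) (k : ℕ) :
    ∫ θ, coordSq i θ ^ k ∂(sphereMeasure ι) ≤ ∫ x, x ^ (2 * k) ∂(gaussianReal 0 1) := by
  have hc : Continuous fun θ => coordSq i θ ^ k := (continuous_coordSq i).pow k
  have hi := (integrable_polar_coord_iff (ι := ι) i (f := fun x => x ^ (2 * k)) (by fun_prop)).2
    (integrable_pow_gaussian (2 * k))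
  rw [← integral_polar_coord (ι := ι) i (f := fun x => x ^ (2 * k)) (by fun_prop)]
  have i0 := integrable_sphere_mul_radDev_pow hc 0
  have i1 := integrable_sphere_mul_radDev_pow (hc.const_mul (k : ℝ)) 1
  have e0 := integral_sphere_mul_radDev_pow (ι := ι) (fun θ => coordSq i θ ^ k) 0
  have e1 := integral_sphere_mul_radDev_pow (ι := ι) (fun θ => k * coordSq i θ ^ k) 1
  simp only [pow_zero, mul_one, pow_one, integral_radDev, mul_zero, integral_const,
    probReal_univ, smul_eq_mul] at i0 i1 e0 e1
  have := integral_mono (i0.add i1) hi (fun p => ?_)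
  · rw [integral_add' i0 i1, e0, e1, add_zero] at this
    exact this
  · have hb := one_add_mul_le_pow (show (-2 : ℝ) ≤ radDev ι p.2 by
      linarith [neg_one_le_radDev ι p.2]) k
    have h0 : 0 ≤ coordSq i p.1 ^ k := pow_nonneg (coordSq_nonneg i p.1) k
    simp only [Pi.add_apply]
    rw [pow_mul, sq_mul_coord, mul_pow]
    nlinarith

/-- The Laplace transform of the squared coordinates up to the second order. -/
lemma abs_integral_exp_coordSq_sub_le (i : ι) {c : ℝ} (hc : 0 ≤ c) (hc' : c ≤ 1 / 2) :
    |∫ θ, Real.exp (-(c * coordSq i θ)) ∂(sphereMeasure ι) - ((Real.sqrt (1 + 2 * c))⁻¹ -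
      3 * c ^ 2 * (Real.sqrt (1 + 2 * c))⁻¹ ^ 5 / Fintype.card ι)| ≤
      7000 * c ^ 2 / (Fintype.card ι : ℝ) ^ 2 := by
  have hn : (0 : ℝ) < Fintype.card ι := Nat.cast_pos.2 Fintype.card_pos
  set n : ℝ := (Fintype.card ι : ℝ)
  have hcc := continuous_coordSq i
  set w : Metric.sphere (0 : EuclideanSpace ℝ ι) 1 → ℝ := fun θ => c * coordSq i θ with hw
  have hw0 : ∀ θ, 0 ≤ w θ := fun θ => mul_nonneg hc (coordSq_nonneg i θ)
  have hwc : Continuous w := by fun_prop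
  have hu : ∀ p : Metric.sphere (0 : EuclideanSpace ℝ ι) 1 × ℝ,
      c * (p.2 * p.1.1 i) ^ 2 - w p.1 = w p.1 * radDev ι p.2 := by
    intro p; rw [sq_mul_coord]; ring
  have hu0 : ∀ p : Metric.sphere (0 : EuclideanSpace ℝ ι) 1 × ℝ, 0 ≤ c * (p.2 * p.1.1 i) ^ 2 :=
    fun p => by positivity
  have m2 : ∫ θ, w θ ^ 2 ∂(sphereMeasure ι) ≤ 3 * c ^ 2 := by
    have := integral_coordSq_pow_le i 2
    norm_num [gaussian_moments.1] at this
    simp only [hw, mul_pow]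
    rw [integral_const_mul]
    nlinarith [sq_nonneg c]
  have m4 : ∫ θ, w θ ^ 4 ∂(sphereMeasure ι) ≤ 105 / 4 * c ^ 2 := by
    have := integral_coordSq_pow_le i 4
    norm_num [gaussian_moments.2] at this
    simp only [hw, mul_pow]
    rw [integral_const_mul]
    have h0 : c ^ 2 ≤ 1 / 4 := by nlinarith
    have h1 : c ^ 4 ≤ c ^ 2 / 4 := by nlinarith [sq_nonneg c]
    calc c ^ 4 * _ ≤ c ^ 4 * 105 := by gcongr
      _ ≤ _ := by linarith
  -- For the Gaussian coordinate x one has c x² = w(1 + ε). Expanding in ε expresses the known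
  -- Gaussian transform as E e^(-w) plus E(w² e^(-w))/n plus O(c²/n²).
  have f1 := abs_integral_sub_cubic_le (ι := ι) (u₀ := fun θ => Real.exp (-w θ))
    (u₁ := fun θ => -(Real.exp (-w θ) * w θ)) (u₂ := fun θ => Real.exp (-w θ) * w θ ^ 2 / 2)
    (u₃ := fun θ => -(Real.exp (-w θ) * w θ ^ 3 / 6)) (v := fun θ => 4 * w θ ^ 4)
    (F := fun p => Real.exp (-(c * (p.2 * p.1.1 i) ^ 2)))
    (by fun_prop) (by fun_prop) (by fun_prop) (by fun_prop) (by fun_prop)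
    ((integrable_polar_coord_iff (ι := ι) i (f := fun x => Real.exp (-(c * x ^ 2)))
      (by fun_prop)).2 (integrable_exp_neg_nonneg (by fun_prop) fun x => by positivity)) 4
    (fun p => by
      have := abs_exp_neg_expansion_le (hw0 p.1) (hu0 p)
      rw [hu] at this
      refine le_trans (le_of_eq ?_) (this.trans (le_of_eq (by ring)))
      congr 1
      ring)
  -- The mean of w² e^(-w) is needed up to O(1/n) only, so it may be replaced by its Gaussian
  -- counterpart.
  have f2 := abs_integral_sub_cubic_le (ι := ι) (u₀ := fun θ => w θ ^ 2 * Real.exp (-w θ))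
    (u₁ := fun θ => (2 * w θ - w θ ^ 2) * Real.exp (-w θ) * w θ) (u₂ := fun _ => 0)
    (u₃ := fun _ => 0) (v := fun θ => 2 * (w θ ^ 2 + w θ ^ 4))
    (F := fun p => (c * (p.2 * p.1.1 i) ^ 2) ^ 2 * Real.exp (-(c * (p.2 * p.1.1 i) ^ 2)))
    (by fun_prop) (by fun_prop) (by fun_prop) (by fun_prop) (by fun_prop)
    ((integrable_polar_coord_iff (ι := ι) i
      (f := fun x => (c * x ^ 2) ^ 2 * Real.exp (-(c * x ^ 2))) (by fun_prop)).2 (by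
        refine ((integrable_pow_gaussian 4).const_mul (c ^ 2)).mono' (by fun_prop)
          (Filter.Eventually.of_forall fun x => ?_)
        rw [Real.norm_of_nonneg (by positivity)]
        calc (c * x ^ 2) ^ 2 * Real.exp (-(c * x ^ 2)) ≤ (c * x ^ 2) ^ 2 * 1 := by
              gcongr
              exact Real.exp_le_one_iff.2 (neg_nonpos.2 (by positivity))
          _ = _ := by ring)) 2
    (fun p => by
      have := abs_sq_mul_exp_neg_expansion_le (hw0 p.1) (hu0 p)
      rw [hu] at this
      refine le_trans (le_of_eq ?_) (this.trans (le_of_eq (by ring)))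
      congr 1
      ring)
  have e1 : ∫ x, Real.exp (-(c * x ^ 2)) ∂(gaussianReal 0 1) = (Real.sqrt (1 + 2 * c))⁻¹ := by
    rw [← integral_exp_sq_gaussian (by positivity)]
    congr 1; ext x; ring_nf
  have e2 : ∫ x, (c * x ^ 2) ^ 2 * Real.exp (-(c * x ^ 2)) ∂(gaussianReal 0 1) =
      3 * c ^ 2 * (Real.sqrt (1 + 2 * c))⁻¹ ^ 5 := by
    have := integral_pow_four_mul_exp_gaussian (a := 2 * c) (by positivity)
    rw [mul_right_comm, ← this, mul_comm, ← integral_const_mul]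
    congr 1; ext x; ring_nf
  rw [integral_polar_coord (ι := ι) i (f := fun x => Real.exp (-(c * x ^ 2))) (by fun_prop),
    e1] at f1
  rw [integral_polar_coord (ι := ι) i
    (f := fun x => (c * x ^ 2) ^ 2 * Real.exp (-(c * x ^ 2))) (by fun_prop), e2] at f2
  have r4 := integral_radDev_four_le ι
  have iw2 : Integrable (fun θ => w θ ^ 2) (sphereMeasure ι) :=
    integrable_of_continuous_sphere (hwc.pow 2)
  have iw4 : Integrable (fun θ => w θ ^ 4) (sphereMeasure ι) :=
    integrable_of_continuous_sphere (hwc.pow 4)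
  simp only [integral_zero, zero_mul, add_zero] at f2
  rw [integral_const_mul, integral_add iw2 iw4, integral_radDev_sq] at f2
  rw [integral_const_mul, integral_neg, integral_div, integral_div] at f1
  set a := ∫ θ, Real.exp (-w θ) ∂(sphereMeasure ι)
  have hb : ∫ θ, Real.exp (-w θ) * w θ ^ 2 ∂(sphereMeasure ι) =
      ∫ θ, w θ ^ 2 * Real.exp (-w θ) ∂(sphereMeasure ι) := by simp_rw [mul_comm]
  rw [hb] at f1
  set b := ∫ θ, w θ ^ 2 * Real.exp (-w θ) ∂(sphereMeasure ι)
  set g₁ := (Real.sqrt (1 + 2 * c))⁻¹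
  set d := ∫ θ, Real.exp (-w θ) * w θ ^ 3 ∂(sphereMeasure ι) with hd
  have hd0 : 0 ≤ d := integral_nonneg fun θ => mul_nonneg (Real.exp_pos _).le (pow_nonneg (hw0 θ) 3)
  have hd1 : d ≤ 3 * c ^ 2 := by
    refine le_trans (integral_mono (integrable_of_continuous_sphere (by fun_prop)) iw2 fun θ => ?_)
      m2
    have h1 : Real.exp (-w θ) * w θ ≤ 1 := by
      have h2 := Real.add_one_le_exp (w θ)
      have h3 : Real.exp (-w θ) * Real.exp (w θ) = 1 := by rw [← Real.exp_add]; simp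
      nlinarith [Real.exp_pos (-w θ)]
    calc Real.exp (-w θ) * w θ ^ 3 = Real.exp (-w θ) * w θ * w θ ^ 2 := by ring
      _ ≤ 1 * w θ ^ 2 := by gcongr
      _ = _ := one_mul _
  have hw4 : 0 ≤ ∫ θ, w θ ^ 4 ∂(sphereMeasure ι) := integral_nonneg fun θ => by positivity
  have f1' : |g₁ - (a + b / 2 * (2 / n) + -(d / 6) * (8 / n ^ 2))| ≤ 6300 * c ^ 2 / n ^ 2 := by
    refine f1.trans ?_
    calc _ ≤ 4 * (105 / 4 * c ^ 2) * (60 / n ^ 2) := by gcongr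
      _ = _ := by ring
  have f2' : |3 * c ^ 2 * g₁ ^ 5 - b| ≤ 117 * c ^ 2 / n := by
    refine f2.trans ?_
    calc _ ≤ 2 * (3 * c ^ 2 + 105 / 4 * c ^ 2) * (2 / n) := by gcongr
      _ = 117 * c ^ 2 / n := by ring
  -- The first expansion solved for E e^(-w), with the second inserted. Every error keeps a factor
  -- c², which will absorb a division by s².
  have key : a - (g₁ - 3 * c ^ 2 * g₁ ^ 5 / n) =
      -(g₁ - (a + b / 2 * (2 / n) + -(d / 6) * (8 / n ^ 2))) + (3 * c ^ 2 * g₁ ^ 5 - b) / n +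
        4 / 3 * d / n ^ 2 := by
    field_simp
    ring
  rw [key]
  have h3 : |(3 * c ^ 2 * g₁ ^ 5 - b) / n| ≤ 117 * c ^ 2 / n ^ 2 := by
    rw [abs_div, abs_of_pos hn, div_le_iff₀ hn]
    refine f2'.trans (le_of_eq ?_)
    field_simp
  have h4 : |4 / 3 * d / n ^ 2| ≤ 4 * c ^ 2 / n ^ 2 := by
    rw [abs_of_nonneg (by positivity)]
    calc 4 / 3 * d / n ^ 2 ≤ 4 / 3 * (3 * c ^ 2) / n ^ 2 := by gcongr
      _ = _ := by ring
  calc _ ≤ 6300 * c ^ 2 / n ^ 2 + 117 * c ^ 2 / n ^ 2 + 4 * c ^ 2 / n ^ 2 := by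
        refine (abs_add_le _ _).trans (add_le_add ((abs_add_le _ _).trans (add_le_add ?_ h3)) h4)
        rwa [abs_neg]
    _ = 6421 * c ^ 2 / n ^ 2 := by ring
    _ ≤ _ := by gcongr; norm_num

end SphereExpansion


/-! ### The mean distance of a spherical coordinate to a normal variable. -/

section EmpiricalExpansion

variable {ι : Type*} [Fintype ι] [Nonempty ι]

lemma sq_sqrt_card_mul (i : ι) (θ : Metric.sphere (0 : EuclideanSpace ℝ ι) 1) :
    (Real.sqrt (Fintype.card ι) * θ.1 i) ^ 2 = coordSq i θ := by
  rw [mul_pow, Real.sq_sqrt (Nat.cast_nonneg _), coordSq]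

lemma integrable_one_sub_exp_coordSq (i : ι) :
    Integrable (fun p : Metric.sphere (0 : EuclideanSpace ℝ ι) 1 × ℝ =>
      (1 - Real.exp (-(p.2 ^ 2 * coordSq i p.1) / 2)) / p.2 ^ 2)
      ((sphereMeasure ι).prod (volume.restrict (Ioc 0 1))) := by
  have hc := continuous_coordSq i
  have hi : Integrable (fun p : Metric.sphere (0 : EuclideanSpace ℝ ι) 1 × ℝ => coordSq i p.1 / 2)
      ((sphereMeasure ι).prod (volume.restrict (Ioc 0 1))) :=
    ((integrable_of_continuous_sphere hc).div_const 2).comp_fst _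
  have hm : Measurable fun p : Metric.sphere (0 : EuclideanSpace ℝ ι) 1 × ℝ =>
      (1 - Real.exp (-(p.2 ^ 2 * coordSq i p.1) / 2)) / p.2 ^ 2 :=
    (Continuous.measurable (by fun_prop)).div (Continuous.measurable (by fun_prop))
  refine hi.mono' hm.aestronglyMeasurable (Filter.Eventually.of_forall fun p => ?_)
  have h := one_sub_exp_div_sq_mem (s := p.2) (Real.sqrt (coordSq i p.1))
  rw [Real.sq_sqrt (coordSq_nonneg i p.1)] at h
  rw [Real.norm_of_nonneg h.1]
  exact h.2

lemma integral_abs_sub_gaussian_coord (i : ι) (θ : Metric.sphere (0 : EuclideanSpace ℝ ι) 1) :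
    ∫ z, |Real.sqrt (Fintype.card ι) * θ.1 i - z| ∂(gaussianReal 0 1) = Real.sqrt (2 / Real.pi) *
      (1 + ∫ s in Ioc (0 : ℝ) 1, (1 - Real.exp (-(s ^ 2 * coordSq i θ) / 2)) / s ^ 2) := by
  rw [integral_abs_sub_gaussian, sq_sqrt_card_mul, intervalIntegral.integral_of_le zero_le_one]

lemma integrable_integral_abs_sub_gaussian_coord (i : ι) :
    Integrable (fun θ : Metric.sphere (0 : EuclideanSpace ℝ ι) 1 =>
      ∫ z, |Real.sqrt (Fintype.card ι) * θ.1 i - z| ∂(gaussianReal 0 1)) (sphereMeasure ι) := by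
  simp_rw [integral_abs_sub_gaussian_coord]
  exact ((integrable_const 1).add (integrable_one_sub_exp_coordSq i).integral_prod_left).const_mul _

/-- With t = √(1+s²) the quotient (1 - 1/t)/s² equals 1/(t(t+1)), free of the singularity at 0. A
primitive is s/(t+1) + (s/t)³/(4n). -/
lemma integral_laplace_main_term (n : ℝ) :
    ∫ s in (0 : ℝ)..1, ((Real.sqrt (1 + s ^ 2) * (Real.sqrt (1 + s ^ 2) + 1))⁻¹ +
      3 / 4 * s ^ 2 / Real.sqrt (1 + s ^ 2) ^ 5 / n) =
      Real.sqrt 2 - 1 + (8 * Real.sqrt 2)⁻¹ / n := by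
  have hpos : ∀ s : ℝ, 0 < Real.sqrt (1 + s ^ 2) := fun s => Real.sqrt_pos.2 (by positivity)
  have hd : ∀ s ∈ uIcc (0 : ℝ) 1, HasDerivAt (fun s => s / (Real.sqrt (1 + s ^ 2) + 1) +
      (s / Real.sqrt (1 + s ^ 2)) ^ 3 / 4 / n)
      ((Real.sqrt (1 + s ^ 2) * (Real.sqrt (1 + s ^ 2) + 1))⁻¹ +
      3 / 4 * s ^ 2 / Real.sqrt (1 + s ^ 2) ^ 5 / n) s := by
    intro s _
    have ht := hpos s
    have ht2 : Real.sqrt (1 + s ^ 2) ^ 2 = 1 + s ^ 2 := Real.sq_sqrt (by positivity)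
    have h1 : HasDerivAt (fun s : ℝ => Real.sqrt (1 + s ^ 2)) (s / Real.sqrt (1 + s ^ 2)) s := by
      have h2 : HasDerivAt (fun s : ℝ => 1 + s ^ 2) (2 * s) s :=
        ((hasDerivAt_pow 2 s).const_add 1).congr_deriv (by push_cast; ring)
      exact (h2.sqrt (by positivity)).congr_deriv (by field_simp)
    have h2 := (hasDerivAt_id s).div (h1.add_const 1) (by positivity)
    have h3 := ((((hasDerivAt_id s).div h1 ht.ne').pow 3).div_const 4).div_const n
    refine (h2.add h3).congr_deriv ?_
    simp only [id, Pi.div_apply]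
    set t := Real.sqrt (1 + s ^ 2)
    have hs : s ^ 2 = t ^ 2 - 1 := by linarith
    congr 1
    · field_simp
      rw [hs]
      ring
    · congr 1
      have e : (1 * t - s * (s / t)) / t ^ 2 = 1 / t ^ 3 := by
        field_simp
        rw [hs]
        ring
      rw [e]
      push_cast
      field_simp
  rw [intervalIntegral.integral_eq_sub_of_hasDerivAt hd]
  · have h2 : Real.sqrt 2 * Real.sqrt 2 = 2 := Real.mul_self_sqrt (by norm_num)
    have h3 : 0 < Real.sqrt 2 := by positivity
    norm_num
    have e1 : (Real.sqrt 2 + 1)⁻¹ = Real.sqrt 2 - 1 :=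
      inv_eq_of_mul_eq_one_right (by linarith)
    have e2 : Real.sqrt 2 ^ 3 = 2 * Real.sqrt 2 := by rw [pow_succ, sq, h2]
    rw [e1, e2]
    ring
  · refine Continuous.intervalIntegrable ?_ _ _
    refine Continuous.add (Continuous.inv₀ (by fun_prop) fun s => ?_) ((Continuous.div (by fun_prop)
      (by fun_prop) fun s => ?_).div_const n)
    · have := hpos s; positivity
    · have := hpos s; positivity

lemma abs_integral_abs_sub_gaussian_coord_sub_le (i : ι) :
    |∫ θ : Metric.sphere (0 : EuclideanSpace ℝ ι) 1,
      (∫ z, |Real.sqrt (Fintype.card ι) * θ.1 i - z| ∂(gaussianReal 0 1)) ∂(sphereMeasure ι) -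
      (2 + 1 / (8 * Fintype.card ι)) / Real.sqrt Real.pi| ≤ 1750 / (Fintype.card ι : ℝ) ^ 2 := by
  have hn : (0 : ℝ) < Fintype.card ι := Nat.cast_pos.2 Fintype.card_pos
  have hi := integrable_one_sub_exp_coordSq i
  have hmain := integral_laplace_main_term (Fintype.card ι : ℝ)
  have hco := integral_abs_sub_gaussian_coord i
  set n : ℝ := (Fintype.card ι : ℝ)
  set A : ℝ → ℝ := fun s => ∫ θ, (1 - Real.exp (-(s ^ 2 * coordSq i θ) / 2)) / s ^ 2
    ∂(sphereMeasure ι) with hA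
  set M : ℝ → ℝ := fun s => (Real.sqrt (1 + s ^ 2) * (Real.sqrt (1 + s ^ 2) + 1))⁻¹ +
      3 / 4 * s ^ 2 / Real.sqrt (1 + s ^ 2) ^ 5 / n with hM
  have hAi : IntegrableOn A (Ioc 0 1) := hi.integral_prod_right
  have hMi : IntegrableOn M (Ioc 0 1) := by
    refine Continuous.integrableOn_Ioc ?_
    have hpos : ∀ s : ℝ, 0 < Real.sqrt (1 + s ^ 2) := fun s => Real.sqrt_pos.2 (by positivity)
    refine Continuous.add (Continuous.inv₀ (by fun_prop) fun s => ?_) ((Continuous.div (by fun_prop)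
      (by fun_prop) fun s => ?_).div_const n)
    · have := hpos s; positivity
    · have := hpos s; positivity
  -- The Laplace expansion at c = s²/2 has error 1750 s⁴/n², which survives the division by s² on
  -- the unit interval.
  have hAM : ∀ s ∈ Ioc (0 : ℝ) 1, ‖A s - M s‖ ≤ 1750 / n ^ 2 := by
    intro s hs
    have hs0 : 0 < s := hs.1
    have hs2 : s ^ 2 ≤ 1 := pow_le_one₀ hs0.le hs.2
    have h := abs_integral_exp_coordSq_sub_le i (c := s ^ 2 / 2) (by positivity) (by linarith)
    rw [show 1 + 2 * (s ^ 2 / 2) = 1 + s ^ 2 by ring] at h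
    have ht : 0 < Real.sqrt (1 + s ^ 2) := Real.sqrt_pos.2 (by positivity)
    have ht2 : Real.sqrt (1 + s ^ 2) ^ 2 = 1 + s ^ 2 := Real.sq_sqrt (by positivity)
    set t := Real.sqrt (1 + s ^ 2)
    set a := ∫ θ, Real.exp (-(s ^ 2 / 2 * coordSq i θ)) ∂(sphereMeasure ι) with ha
    have e1 : A s = (1 - a) / s ^ 2 := by
      have hc := continuous_coordSq i
      have e : ∀ θ, -(s ^ 2 * coordSq i θ) / 2 = -(s ^ 2 / 2 * coordSq i θ) := fun θ => by ring
      simp only [hA, e]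
      rw [integral_div, integral_sub (integrable_const _)
        (integrable_of_continuous_sphere (by fun_prop))]
      simp [ha]
    have e2 : M s = (1 - (t⁻¹ - 3 * (s ^ 2 / 2) ^ 2 * t⁻¹ ^ 5 / n)) / s ^ 2 := by
      have e3 : (t * (t + 1))⁻¹ = (1 - t⁻¹) / s ^ 2 := by
        rw [show s ^ 2 = (t - 1) * (t + 1) by linarith]
        have : t - 1 ≠ 0 := by
          intro h0
          have : t = 1 := by linarith
          rw [this] at ht2
          nlinarith
        field_simp
      simp only [hM]
      rw [e3]
      field_simp
      ring
    rw [e1, e2, ← sub_div, Real.norm_eq_abs, abs_div, abs_of_pos (by positivity : 0 < s ^ 2),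
      div_le_iff₀ (by positivity), sub_sub_sub_cancel_left, abs_sub_comm]
    refine h.trans ?_
    calc 7000 * (s ^ 2 / 2) ^ 2 / n ^ 2 = 1750 / n ^ 2 * (s ^ 2 * s ^ 2) := by ring
      _ ≤ 1750 / n ^ 2 * (1 * s ^ 2) := by gcongr
      _ = _ := by ring
  have hint : |(∫ s in Ioc (0 : ℝ) 1, A s) - ∫ s in Ioc (0 : ℝ) 1, M s| ≤ 1750 / n ^ 2 := by
    have := norm_setIntegral_le_of_norm_le_const (μ := volume) (s := Ioc (0 : ℝ) 1) (by simp) hAM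
    rw [← integral_sub hAi hMi]
    simpa using this
  rw [← intervalIntegral.integral_of_le zero_le_one (f := M), hmain] at hint
  simp_rw [hco]
  have i1 : Integrable (fun θ => ∫ s in Ioc (0 : ℝ) 1,
      (1 - Real.exp (-(s ^ 2 * coordSq i θ) / 2)) / s ^ 2) (sphereMeasure ι) :=
    hi.integral_prod_left
  rw [integral_const_mul, integral_add (integrable_const _) i1, integral_integral_swap hi]
  change |Real.sqrt (2 / Real.pi) * (_ + ∫ s in Ioc (0 : ℝ) 1, A s) - _| ≤ _
  set I := ∫ s in Ioc (0 : ℝ) 1, A s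
  have h2 : Real.sqrt 2 * Real.sqrt 2 = 2 := Real.mul_self_sqrt (by norm_num)
  have h3 : 0 < Real.sqrt 2 := by positivity
  have hp : Real.sqrt Real.pi ≠ 0 := (Real.sqrt_pos.2 Real.pi_pos).ne'
  have e : Real.sqrt (2 / Real.pi) * (∫ _θ, (1 : ℝ) ∂(sphereMeasure ι) + I) -
      (2 + 1 / (8 * n)) / Real.sqrt Real.pi =
      Real.sqrt (2 / Real.pi) * (I - (Real.sqrt 2 - 1 + (8 * Real.sqrt 2)⁻¹ / n)) := by
    rw [Real.sqrt_div (by norm_num)]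
    simp only [integral_const, probReal_univ, smul_eq_mul, mul_one]
    field_simp
    linear_combination (8 * n) * h2
  rw [e, abs_mul, abs_of_nonneg (Real.sqrt_nonneg _)]
  exact (mul_le_of_le_one_left (abs_nonneg _) sqrt_two_div_pi_le_one).trans hint

end EmpiricalExpansion


/-! ### The mean radius and the expansion for the empirical measure. -/

section EmpiricalExpansion

variable {ι : Type*} [Fintype ι] [Nonempty ι]

/-- The quadratic term of √(1+ε) with E ε² = 2/n gives -1/(4n). The cubic and quartic terms are both
O(n⁻²). -/
lemma abs_integral_radius_sub_le :
    |∫ r, r / Real.sqrt (Fintype.card ι) ∂(radialLaw ι) - (1 - 1 / (4 * (Fintype.card ι : ℝ)))| ≤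
      61 / (Fintype.card ι : ℝ) ^ 2 := by
  have hn : (0 : ℝ) < Fintype.card ι := Nat.cast_pos.2 Fintype.card_pos
  have hae : ∀ᵐ r ∂(radialLaw ι), r / Real.sqrt (Fintype.card ι) =
      Real.sqrt (1 + radDev ι r) := by
    filter_upwards [radialLaw_nonneg ι] with r hr
    rw [← sq_div_sqrt_sub_one, add_sub_cancel, Real.sqrt_sq (by positivity)]
  have i0 : Integrable (fun r => r / Real.sqrt (Fintype.card ι)) (radialLaw ι) := by
    simpa using (integrable_pow_radialLaw ι 1).div_const (Real.sqrt (Fintype.card ι))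
  have i1 := i0.congr hae
  have h := abs_integral_sub_cubic_le (ι := ι) (u₀ := fun _ => 1) (u₁ := fun _ => 1 / 2)
    (u₂ := fun _ => -(1 / 8)) (u₃ := fun _ => 1 / 16) (v := fun _ => 1)
    (F := fun p => Real.sqrt (1 + radDev ι p.2)) (by fun_prop) (by fun_prop) (by fun_prop)
    (by fun_prop) (by fun_prop) (i1.comp_snd _) 4 (fun p => by
      refine le_trans (le_of_eq ?_) ((abs_sqrt_one_add_expansion_le
        (neg_one_le_radDev ι p.2)).trans (le_of_eq (by ring)))
      congr 1
      ring)
  have e := integral_prod_mul (μ := sphereMeasure ι) (ν := radialLaw ι) (fun _ => (1 : ℝ))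
    (fun r => Real.sqrt (1 + radDev ι r))
  simp only [one_mul, integral_const, probReal_univ, smul_eq_mul, mul_one] at e h
  rw [e, ← integral_congr_ae hae] at h
  have r4 := integral_radDev_four_le ι
  set n : ℝ := (Fintype.card ι : ℝ)
  set β := ∫ r, r / Real.sqrt n ∂(radialLaw ι)
  have key : β - (1 - 1 / (4 * n)) = (β - (1 + -(1 / 8) * (2 / n) + 1 / 16 * (8 / n ^ 2))) +
      1 / 2 / n ^ 2 := by
    field_simp
    ring
  rw [key]
  refine (abs_add_le _ _).trans ?_
  rw [abs_of_pos (by positivity : 0 < 1 / 2 / n ^ 2)]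
  calc _ ≤ 60 / n ^ 2 + 1 / 2 / n ^ 2 := by gcongr; exact h.trans r4
    _ = (60 + 1 / 2) / n ^ 2 := by ring
    _ ≤ _ := by gcongr; norm_num

lemma abs_inv_integral_radius_sub_le [Nontrivial ι] :
    |(∫ r, r / Real.sqrt (Fintype.card ι) ∂(radialLaw ι))⁻¹ -
      (1 + 1 / (4 * (Fintype.card ι : ℝ)))| ≤ 200 / (Fintype.card ι : ℝ) ^ 2 := by
  have hn : (0 : ℝ) < Fintype.card ι := Nat.cast_pos.2 Fintype.card_pos
  have hn1 : (1 : ℝ) ≤ Fintype.card ι := Nat.one_le_cast.2 Fintype.card_pos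
  have h1 := abs_integral_radius_sub_le (ι := ι)
  have h2 := integral_radius_ge (ι := ι)
  set n : ℝ := (Fintype.card ι : ℝ)
  set β := ∫ r, r / Real.sqrt n ∂(radialLaw ι)
  have hβ : 0 < β := by linarith
  have e : β⁻¹ - (1 + 1 / (4 * n)) =
      -((β - (1 - 1 / (4 * n))) * (1 + 1 / (4 * n)) - 1 / 16 / n ^ 2) * β⁻¹ := by
    field_simp
    ring
  have h3 : β⁻¹ ≤ 2 := by
    rw [inv_le_comm₀ hβ (by norm_num)]; linarith
  have h4 : 1 + 1 / (4 * n) ≤ 5 / 4 := by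
    have : 1 / (4 * n) ≤ 1 / (4 * 1) := by gcongr
    linarith
  rw [e, abs_mul, abs_neg, abs_of_pos (inv_pos.2 hβ)]
  calc _ ≤ (61 / n ^ 2 * (5 / 4) + 1 / 16 / n ^ 2) * 2 := by
        refine mul_le_mul ((abs_sub _ _).trans (add_le_add ?_ ?_)) h3 (by positivity) (by positivity)
        · rw [abs_mul, abs_of_pos (by positivity : 0 < 1 + 1 / (4 * n))]
          gcongr
        · rw [abs_of_pos (by positivity)]
    _ = (61 * (5 / 4) + 1 / 16) * 2 / n ^ 2 := by ring
    _ ≤ _ := by gcongr; norm_num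

/-- An exact identity: |⟨g,v⟩| is the product of the radius and |⟨θ,v⟩|, which are independent, and
its Gaussian mean is known. -/
lemma integral_sphere_abs_inner (v : EuclideanSpace ℝ ι) :
    (∫ r, r / Real.sqrt (Fintype.card ι) ∂(radialLaw ι)) *
      (∫ θ : Metric.sphere (0 : EuclideanSpace ℝ ι) 1,
        Real.sqrt (Fintype.card ι) * |inner ℝ θ.1 v| ∂(sphereMeasure ι)) =
      Real.sqrt (2 / Real.pi) * ‖v‖ := by
  have hn : 0 < Real.sqrt (Fintype.card ι) := Real.sqrt_pos.2 (Nat.cast_pos.2 Fintype.card_pos)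
  have h := integral_stdGaussian_polar ι (fun g => |inner ℝ g v|) (by fun_prop)
  rw [integral_abs_inner_stdGaussian] at h
  simp_rw [inner_smul_left, abs_mul] at h
  have e := integral_prod_mul (μ := sphereMeasure ι) (ν := radialLaw ι)
    (fun θ => |inner ℝ θ.1 v|) (fun r => |r|)
  simp_rw [mul_comm |inner ℝ _ v|] at e
  simp only [conj_trivial] at h
  rw [h] at e
  have e2 : ∫ r, |r| ∂(radialLaw ι) = ∫ r, r ∂(radialLaw ι) := by
    refine integral_congr_ae ?_
    filter_upwards [radialLaw_nonneg ι] with r hr using abs_of_nonneg hr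
  rw [e, e2, integral_div, integral_const_mul]
  field_simp

lemma integral_sphere_abs_coord_sub [Nontrivial ι] {i j : ι} (hij : i ≠ j) :
    ∫ θ : Metric.sphere (0 : EuclideanSpace ℝ ι) 1, |Real.sqrt (Fintype.card ι) * θ.1 i -
      Real.sqrt (Fintype.card ι) * θ.1 j| ∂(sphereMeasure ι) =
      2 / Real.sqrt Real.pi * (∫ r, r / Real.sqrt (Fintype.card ι) ∂(radialLaw ι))⁻¹ := by
  classical
  have h := integral_sphere_abs_inner (EuclideanSpace.single i (1 : ℝ) - EuclideanSpace.single j 1)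
  have hβ := integral_radius_ge (ι := ι)
  have e : ∀ θ : Metric.sphere (0 : EuclideanSpace ℝ ι) 1, Real.sqrt (Fintype.card ι) *
      |inner ℝ θ.1 (EuclideanSpace.single i (1 : ℝ) - EuclideanSpace.single j 1)| =
      |Real.sqrt (Fintype.card ι) * θ.1 i - Real.sqrt (Fintype.card ι) * θ.1 j| := by
    intro θ
    rw [← mul_sub, abs_mul, abs_of_nonneg (Real.sqrt_nonneg _), inner_sub_right,
      EuclideanSpace.inner_single_right, EuclideanSpace.inner_single_right]
    simp
  have hv : ‖EuclideanSpace.single i (1 : ℝ) - EuclideanSpace.single j (1 : ℝ)‖ =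
      Real.sqrt 2 := by
    rw [eq_comm, Real.sqrt_eq_iff_eq_sq (by norm_num) (norm_nonneg _), norm_sub_sq_real,
      EuclideanSpace.inner_single_left]
    simp [hij]
    norm_num
  simp_rw [e] at h
  rw [hv] at h
  have h2 : Real.sqrt 2 * Real.sqrt 2 = 2 := Real.mul_self_sqrt (by norm_num)
  rw [eq_mul_inv_iff_mul_eq₀ (by linarith), mul_comm, h, Real.sqrt_div (by norm_num),
    div_mul_eq_mul_div, h2]

/-- The empirical measure of the normalized coordinates. -/
noncomputable def empLaw (n : ℕ) (θ : Metric.sphere (0 : EuclideanSpace ℝ (Fin n)) 1) : Measure ℝ :=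
  (indexMeasure n).map fun i => Real.sqrt n * θ.1 i

lemma omega_sq_empiricalSystem {n : ℕ} (hn : 1 ≤ n)
    (θ : Metric.sphere (0 : EuclideanSpace ℝ (Fin n)) 1) :
    omega (indexMeasure n) (empiricalSystem n) θ ^ 2 = l2Dist (empLaw n θ) := by
  have := isProbabilityMeasure_indexMeasure hn
  have hp : IsProbabilityMeasure (empLaw n θ) :=
    Measure.isProbabilityMeasure_map (measurable_of_countable _).aemeasurable
  rw [omega, Real.sq_sqrt (integral_nonneg fun _ => sq_nonneg _), l2Dist]
  congr 1
  ext x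
  have h : ∀ i, weightedSum (empiricalSystem n) θ i = Real.sqrt n * θ.1 i := by
    intro i
    simp [weightedSum, empiricalSystem, mul_comm]
  rw [cdf_eq_real, empLaw, map_measureReal_apply (measurable_of_countable _) measurableSet_Iic,
    distFun]
  simp_rw [h]
  rfl

lemma integral_indexMeasure {n : ℕ} (hn : 1 ≤ n) (f : Fin n → ℝ) :
    ∫ i, f i ∂(indexMeasure n) = (n : ℝ)⁻¹ * ∑ i, f i := by
  have : Nonempty (Fin n) := ⟨⟨0, hn⟩⟩
  rw [indexMeasure, integral_uniformOn_univ, Fintype.card_fin]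

/-- The energy identity for a measure with n equal atoms: a mean over atoms against the normal law,
and a mean over pairs of atoms. -/
lemma l2Dist_empLaw {n : ℕ} (hn : 1 ≤ n) (θ : Metric.sphere (0 : EuclideanSpace ℝ (Fin n)) 1) :
    l2Dist (empLaw n θ) =
      (n : ℝ)⁻¹ * ∑ i, ∫ z, |Real.sqrt n * θ.1 i - z| ∂(gaussianReal 0 1) -
      (n : ℝ)⁻¹ * ((n : ℝ)⁻¹ * ∑ i, ∑ j, |Real.sqrt n * θ.1 i - Real.sqrt n * θ.1 j|) / 2 -
      1 / Real.sqrt Real.pi := by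
  have := isProbabilityMeasure_indexMeasure hn
  have : Nonempty (Fin n) := ⟨⟨0, hn⟩⟩
  have hm : Measurable fun i : Fin n => Real.sqrt n * θ.1 i := measurable_of_countable _
  have hp : IsProbabilityMeasure (empLaw n θ) := Measure.isProbabilityMeasure_map hm.aemeasurable
  have hid : Integrable id (empLaw n θ) := by
    rw [empLaw, integrable_map_measure (by fun_prop) hm.aemeasurable]
    exact Integrable.of_finite
  have e1 := meanDist_eq_integral_map (μ := indexMeasure n) (ν := gaussianReal 0 1) hm measurable_id
  rw [Measure.map_id] at e1
  have e2 := meanDist_eq_integral_map (μ := indexMeasure n) (ν := indexMeasure n) hm hm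
  have i1 : Integrable (fun p : Fin n × ℝ => |Real.sqrt n * θ.1 p.1 - id p.2|)
      ((indexMeasure n).prod (gaussianReal 0 1)) :=
    ((Integrable.of_finite (f := fun i : Fin n => Real.sqrt n * θ.1 i)).comp_fst _ |>.sub
      ((integrable_id_gaussianReal 0 1).comp_snd _)).abs
  rw [integral_prod _ i1, integral_indexMeasure hn] at e1
  rw [integral_prod _ Integrable.of_finite] at e2
  simp_rw [integral_indexMeasure hn] at e2
  rw [l2Dist_eq _ hid, empLaw, e1, e2, ← Finset.mul_sum]
  simp only [id]

theorem exists_empirical_expansion : ∃ C : ℝ, ∀ n : ℕ, 2 ≤ n →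
    |sphereMean (ι := Fin n) (fun θ => omega (indexMeasure n) (empiricalSystem n) θ ^ 2) -
      (7 / 8) / ((n : ℝ) * Real.sqrt Real.pi)| ≤ C / (n : ℝ) ^ 2 := by
  refine ⟨2000, fun n hn => ?_⟩
  have : Nontrivial (Fin n) := Fin.nontrivial_iff_two_le.2 hn
  have hn0 : (0 : ℝ) < n := Nat.cast_pos.2 (by omega)
  have hn1 : (1 : ℝ) ≤ n := Nat.one_le_cast.2 (by omega)
  simp_rw [sphereMean, omega_sq_empiricalSystem (show 1 ≤ n by omega),
    l2Dist_empLaw (show 1 ≤ n by omega)]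
  have a1 := fun i : Fin n => integrable_integral_abs_sub_gaussian_coord i
  have a2 := fun i : Fin n => abs_integral_abs_sub_gaussian_coord_sub_le i
  have a3 := fun (i j : Fin n) (hij : i ≠ j) => integral_sphere_abs_coord_sub hij
  have a4 := abs_inv_integral_radius_sub_le (ι := Fin n)
  simp only [Fintype.card_fin] at a1 a2 a3 a4
  set β := (∫ r, r / Real.sqrt n ∂(radialLaw (Fin n)))⁻¹
  have a5 : ∀ i j : Fin n, Integrable (fun θ : Metric.sphere (0 : EuclideanSpace ℝ (Fin n)) 1 =>
      |Real.sqrt n * θ.1 i - Real.sqrt n * θ.1 j|) (sphereMeasure (Fin n)) := by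
    intro i j
    have h1 := continuous_sphere_coord i
    have h2 := continuous_sphere_coord j
    exact integrable_of_continuous_sphere (by fun_prop)
  have j1 : Integrable (fun θ : Metric.sphere (0 : EuclideanSpace ℝ (Fin n)) 1 => (n : ℝ)⁻¹ *
      ∑ i, ∫ z, |Real.sqrt n * θ.1 i - z| ∂(gaussianReal 0 1)) (sphereMeasure (Fin n)) :=
    (integrable_finsetSum _ fun i _ => a1 i).const_mul _
  have j2' : ∀ i, Integrable (fun θ : Metric.sphere (0 : EuclideanSpace ℝ (Fin n)) 1 =>
      ∑ j, |Real.sqrt n * θ.1 i - Real.sqrt n * θ.1 j|) (sphereMeasure (Fin n)) :=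
    fun i => integrable_finsetSum _ fun j _ => a5 i j
  have j2 : Integrable (fun θ : Metric.sphere (0 : EuclideanSpace ℝ (Fin n)) 1 => (n : ℝ)⁻¹ *
      ((n : ℝ)⁻¹ * ∑ i, ∑ j, |Real.sqrt n * θ.1 i - Real.sqrt n * θ.1 j|) / 2)
      (sphereMeasure (Fin n)) :=
    (((integrable_finsetSum _ fun i _ => j2' i).const_mul _).const_mul _).div_const _
  have j12 : Integrable (fun θ : Metric.sphere (0 : EuclideanSpace ℝ (Fin n)) 1 => (n : ℝ)⁻¹ *
      (∑ i, ∫ z, |Real.sqrt n * θ.1 i - z| ∂(gaussianReal 0 1)) - (n : ℝ)⁻¹ *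
      ((n : ℝ)⁻¹ * ∑ i, ∑ j, |Real.sqrt n * θ.1 i - Real.sqrt n * θ.1 j|) / 2)
      (sphereMeasure (Fin n)) := j1.sub j2
  rw [integral_sub j12 (integrable_const _), integral_sub j1 j2, integral_const_mul,
    integral_finsetSum _ fun i _ => a1 i, integral_div, integral_const_mul, integral_const_mul,
    integral_finsetSum _ fun i _ => j2' i]
  simp_rw [integral_finsetSum _ fun j _ => a5 _ j]
  -- Diagonal pairs contribute nothing; hence n - 1 in place of n, which matters at order 1/n.
  have b2 : ∑ i : Fin n, ∑ j : Fin n, ∫ θ : Metric.sphere (0 : EuclideanSpace ℝ (Fin n)) 1,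
      |Real.sqrt n * θ.1 i - Real.sqrt n * θ.1 j| ∂(sphereMeasure (Fin n)) =
      n * ((n - 1) * (2 / Real.sqrt Real.pi * β)) := by
    have : ∀ i : Fin n, ∑ j : Fin n, ∫ θ : Metric.sphere (0 : EuclideanSpace ℝ (Fin n)) 1,
        |Real.sqrt n * θ.1 i - Real.sqrt n * θ.1 j| ∂(sphereMeasure (Fin n)) =
        (n - 1) * (2 / Real.sqrt Real.pi * β) := by
      intro i
      rw [← Finset.add_sum_erase _ _ (Finset.mem_univ i), Finset.sum_congr rfl fun j hj =>
        a3 i j (Finset.ne_of_mem_erase hj).symm]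
      simp [Finset.card_erase_of_mem, Nat.cast_sub (show 1 ≤ n by omega)]
    simp_rw [this]
    simp
  rw [b2]
  set H : ℝ := (n : ℝ)⁻¹ * ∑ i : Fin n, ∫ θ : Metric.sphere (0 : EuclideanSpace ℝ (Fin n)) 1,
    (∫ z, |Real.sqrt n * θ.1 i - z| ∂(gaussianReal 0 1)) ∂(sphereMeasure (Fin n)) with hH
  have b1 : |H - (2 + 1 / (8 * (n : ℝ))) / Real.sqrt Real.pi| ≤ 1750 / (n : ℝ) ^ 2 := by
    have e : H - (2 + 1 / (8 * (n : ℝ))) / Real.sqrt Real.pi = (n : ℝ)⁻¹ * ∑ i : Fin n,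
        (∫ θ : Metric.sphere (0 : EuclideanSpace ℝ (Fin n)) 1,
        (∫ z, |Real.sqrt n * θ.1 i - z| ∂(gaussianReal 0 1)) ∂(sphereMeasure (Fin n)) -
        (2 + 1 / (8 * (n : ℝ))) / Real.sqrt Real.pi) := by
      rw [Finset.sum_sub_distrib, mul_sub, ← hH]
      congr 1
      simp
      field_simp
    rw [e, abs_mul, abs_of_pos (inv_pos.2 hn0), inv_mul_le_iff₀ hn0]
    refine (Finset.abs_sum_le_sum_abs _ _).trans ((Finset.sum_le_sum fun i _ => a2 i).trans ?_)
    simp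
  have hp1 : 1 ≤ Real.sqrt Real.pi := Real.one_le_sqrt.2 (by linarith [Real.pi_gt_three])
  have hp0 : 0 < Real.sqrt Real.pi := by linarith
  simp only [integral_const, probReal_univ, smul_eq_mul, one_mul]
  -- Up to the factor 1/√π, (2 + 1/(8n)) - (1 - 1/n)(1 + 1/(4n)) - 1 = (1/8 + 1 - 1/4)/n + 1/(4n²),
  -- which is where 7/8 comes from.
  have key : H - (n : ℝ)⁻¹ * ((n : ℝ)⁻¹ * (n * ((n - 1) * (2 / Real.sqrt Real.pi * β)))) / 2 -
      1 / Real.sqrt Real.pi - 7 / 8 / (n * Real.sqrt Real.pi) =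
      (H - (2 + 1 / (8 * (n : ℝ))) / Real.sqrt Real.pi) -
      (1 - (n : ℝ)⁻¹) * (β - (1 + 1 / (4 * n))) / Real.sqrt Real.pi +
      1 / 4 / n ^ 2 / Real.sqrt Real.pi := by
    field_simp
    ring
  rw [key]
  have hinv : (n : ℝ)⁻¹ ≤ 1 := inv_le_one_of_one_le₀ hn1
  have hinv0 : 0 < (n : ℝ)⁻¹ := inv_pos.2 hn0
  have c2 : |(1 - (n : ℝ)⁻¹) * (β - (1 + 1 / (4 * n))) / Real.sqrt Real.pi| ≤ 200 / (n : ℝ) ^ 2 := by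
    rw [abs_div, abs_mul, abs_of_pos hp0, abs_of_nonneg (by linarith)]
    refine (div_le_self (by positivity) hp1).trans ?_
    exact (mul_le_of_le_one_left (abs_nonneg _) (by linarith)).trans a4
  have c3 : |1 / 4 / (n : ℝ) ^ 2 / Real.sqrt Real.pi| ≤ 1 / 4 / (n : ℝ) ^ 2 := by
    rw [abs_of_pos (by positivity)]
    exact div_le_self (by positivity) hp1
  calc _ ≤ 1750 / (n : ℝ) ^ 2 + 200 / (n : ℝ) ^ 2 + 1 / 4 / (n : ℝ) ^ 2 :=
        (abs_add_le _ _).trans (add_le_add ((abs_sub _ _).trans (add_le_add b1 c2)) c3)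
    _ = (1750 + 200 + 1 / 4) / (n : ℝ) ^ 2 := by ring
    _ ≤ _ := by gcongr; norm_num

end EmpiricalExpansion

end RandCLT

open RandCLT in
theorem mainTheorem4 :
    (∃ c₀ c₁ : ℝ, 0 < c₀ ∧ 0 < c₁ ∧
      (∀ n : ℕ, 2 ≤ n → Even n → TwoSidedBounds trigMeasure (trigSystem n) c₀ c₁) ∧
      (∀ n : ℕ, 2 ≤ n → TwoSidedBounds cosMeasure (cosSystem n) c₀ c₁) ∧
      (∀ n : ℕ, 2 ≤ n → TwoSidedBounds chebMeasure (chebSystem n) c₀ c₁) ∧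
      (∀ d : ℕ, 2 ≤ d → TwoSidedBounds (cubeMeasure d) (walshSystem d) c₀ c₁) ∧
      (∀ n : ℕ, 2 ≤ n → TwoSidedBounds (indexMeasure n) (empiricalSystem n) c₀ c₁)) ∧
    (∀ Ψ : ℝ → ℝ, Function.Periodic Ψ 1 → (∃ K : NNReal, LipschitzWith K Ψ) →
      (∫ x in (0 : ℝ)..1, Ψ x) = 0 → (∫ x in (0 : ℝ)..1, Ψ x ^ 2) = 1 →
      ∃ c₀ c₁ : ℝ, 0 < c₀ ∧ 0 < c₁ ∧
        ∀ n : ℕ, 2 ≤ n → TwoSidedBounds squareMeasure (psiSystem Ψ n) c₀ c₁) ∧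
    (∀ M : ℝ, ∃ c₁ : ℝ, 0 < c₁ ∧
      ∀ Ψ : ℝ → ℝ, Function.Periodic Ψ 1 → Measurable Ψ →
        IntervalIntegrable (fun x => Ψ x ^ 4) volume 0 1 →
        (∫ x in (0 : ℝ)..1, Ψ x) = 0 → (∫ x in (0 : ℝ)..1, Ψ x ^ 2) = 1 →
        (∫ x in (0 : ℝ)..1, Ψ x ^ 4) ≤ M →
        ∀ n : ℕ, 2 ≤ n → WellDefined squareMeasure (psiSystem Ψ n) ∧
          UpperBounds squareMeasure (psiSystem Ψ n) c₁) ∧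
    (∃ C : ℝ, ∀ n : ℕ, 2 ≤ n →
      |sphereMean (ι := Fin n) (fun θ => omega (indexMeasure n) (empiricalSystem n) θ ^ 2) -
        (7 / 8) / ((n : ℝ) * Real.sqrt Real.pi)| ≤ C / (n : ℝ) ^ 2) :=
  ⟨exists_twoSidedBounds_systems, fun _ hΨ hK h1 h2 => exists_twoSidedBounds_psiSystem hΨ hK h1 h2,
    exists_upperBounds_psiSystem, exists_empirical_expansion⟩
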